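/- There are an absolute constant $C$, a preprocessing algorithm and a query algorithm for the random access machine with words of $O(\log n)$ bits and real cells (on which only additions, subtractions and comparisons are performed), every elementary operation taking one step, such that the following holds. Let $G=(V,E)$ be a finite simple undirected graph, not necessarily connected, with $V=\{0,\dots,n-1\}$, $n\ge 1$, $m=|E|$, and edge weights $\omega:E\to\mathbb{R}_{>0}$; the length of a path is the sum of the weights of its edges. Let $r\in V$, let $T_r$ be a shortest-path tree of $G$ rooted at $r$ (a subtree of $G$ that spans the vertices reachable from $r$ and whose path from $r$ to each of them is a shortest path in $G$), and let $P$ be a path in $T_r$ that starts at $r$. Given the list of the weighted edges of $G$ (in any order), $r$, and the vertex sequence of $P$, the preprocessing algorithm takes at most $C\,(m+n\log(n+1))$ steps and leaves a data structure of at most $C\,n$ words. Given only this data structure and any $x\in P$ and $v\in V$, the query algorithm reports a simple path from $r$ to $v$ in $G$ that avoids $x$ and whose length is at most $3$ times the length of every path from $r$ to $v$ in $G$ that avoids $x$, or reports that $G$ has no path from $r$ to $v$ avoiding $x$. It takes at most $C\,(\ell+1)$ steps, where $\ell$ is the number of vertices of the reported path ($\ell=0$ if there is none). -/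

import Mathlib

/-! The machine model: a random access machine for structured programs, with integer word cells and
real cells. Words must stay below a bound `W` (polynomial in the input size, hence `O(log n)` bits);
on reals only addition, subtraction and comparison are available, and there are no real constants
but `0`. Every constant, variable access, array access, arithmetic operation, comparison, Boolean
connective, assignment and test costs one step. A program is finite and mentions only finitely many
variables and arrays. -/

namespace RealRAM

/-- A machine state: word variables, word arrays (array name, index), real variables, real arrays. -/
structure State where
  wv : ℕ → ℕ
  wa : ℕ → ℕ → ℕ
  rv : ℕ → ℝ
  ra : ℕ → ℕ → ℝ

/-- Word expressions. `arr a e` is the cell with index `e` of the word array `a`. -/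
inductive WExp where
  | const (c : ℕ)
  | var (x : ℕ)
  | arr (a : ℕ) (e : WExp)
  | add (e₁ e₂ : WExp)
  | sub (e₁ e₂ : WExp)
  | mul (e₁ e₂ : WExp)
  | div (e₁ e₂ : WExp)

/-- The number of elementary steps in the evaluation of a word expression. -/
def WExp.size : WExp → ℕ
  | const _ => 1
  | var _ => 1
  | arr _ e => e.size + 1
  | add e₁ e₂ => e₁.size + e₂.size + 1
  | sub e₁ e₂ => e₁.size + e₂.size + 1
  | mul e₁ e₂ => e₁.size + e₂.size + 1
  | div e₁ e₂ => e₁.size + e₂.size + 1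

/-- The value of a word expression. Subtraction is truncated, division is rounded down. -/
def WExp.eval (s : State) : WExp → ℕ
  | const c => c
  | var x => s.wv x
  | arr a e => s.wa a (e.eval s)
  | add e₁ e₂ => e₁.eval s + e₂.eval s
  | sub e₁ e₂ => e₁.eval s - e₂.eval s
  | mul e₁ e₂ => e₁.eval s * e₂.eval s
  | div e₁ e₂ => e₁.eval s / e₂.eval s

/-- All values that occur in the evaluation, intermediate ones included, are at most `W`. -/
def WExp.Fits (W : ℕ) (s : State) : WExp → Prop
  | const c => c ≤ W
  | var x => s.wv x ≤ W
  | arr a e => e.Fits W s ∧ s.wa a (e.eval s) ≤ W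
  | add e₁ e₂ => e₁.Fits W s ∧ e₂.Fits W s ∧ e₁.eval s + e₂.eval s ≤ W
  | sub e₁ e₂ => e₁.Fits W s ∧ e₂.Fits W s
  | mul e₁ e₂ => e₁.Fits W s ∧ e₂.Fits W s ∧ e₁.eval s * e₂.eval s ≤ W
  | div e₁ e₂ => e₁.Fits W s ∧ e₂.Fits W s

/-- Real expressions. `arr a e` is the cell with index `e` of the real array `a`. -/
inductive RExp where
  | zero
  | var (x : ℕ)
  | arr (a : ℕ) (e : WExp)
  | add (e₁ e₂ : RExp)
  | sub (e₁ e₂ : RExp)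

/-- The number of elementary steps in the evaluation of a real expression. -/
def RExp.size : RExp → ℕ
  | zero => 1
  | var _ => 1
  | arr _ e => e.size + 1
  | add e₁ e₂ => e₁.size + e₂.size + 1
  | sub e₁ e₂ => e₁.size + e₂.size + 1

/-- The value of a real expression. -/
noncomputable def RExp.eval (s : State) : RExp → ℝ
  | zero => 0
  | var x => s.rv x
  | arr a e => s.ra a (e.eval s)
  | add e₁ e₂ => e₁.eval s + e₂.eval s
  | sub e₁ e₂ => e₁.eval s - e₂.eval s

/-- All indices that occur in the evaluation are admissible words. -/
def RExp.Fits (W : ℕ) (s : State) : RExp → Prop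
  | zero => True
  | var _ => True
  | arr _ e => e.Fits W s
  | add e₁ e₂ => e₁.Fits W s ∧ e₂.Fits W s
  | sub e₁ e₂ => e₁.Fits W s ∧ e₂.Fits W s

/-- Tests: comparisons of words, comparisons of reals, Boolean connectives. -/
inductive Test where
  | weq (e₁ e₂ : WExp)
  | wlt (e₁ e₂ : WExp)
  | rlt (e₁ e₂ : RExp)
  | neg (b : Test)
  | and (b₁ b₂ : Test)
  | or (b₁ b₂ : Test)

/-- The number of elementary steps in the evaluation of a test. -/
def Test.size : Test → ℕ
  | weq e₁ e₂ => e₁.size + e₂.size + 1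
  | wlt e₁ e₂ => e₁.size + e₂.size + 1
  | rlt e₁ e₂ => e₁.size + e₂.size + 1
  | neg b => b.size + 1
  | and b₁ b₂ => b₁.size + b₂.size + 1
  | or b₁ b₂ => b₁.size + b₂.size + 1

/-- The outcome of a test. -/
def Test.Holds (s : State) : Test → Prop
  | weq e₁ e₂ => e₁.eval s = e₂.eval s
  | wlt e₁ e₂ => e₁.eval s < e₂.eval s
  | rlt e₁ e₂ => e₁.eval s < e₂.eval s
  | neg b => ¬ b.Holds s
  | and b₁ b₂ => b₁.Holds s ∧ b₂.Holds s
  | or b₁ b₂ => b₁.Holds s ∨ b₂.Holds s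

/-- All words that occur in the evaluation of the test are at most `W`. -/
def Test.Fits (W : ℕ) (s : State) : Test → Prop
  | weq e₁ e₂ => e₁.Fits W s ∧ e₂.Fits W s
  | wlt e₁ e₂ => e₁.Fits W s ∧ e₂.Fits W s
  | rlt e₁ e₂ => e₁.Fits W s ∧ e₂.Fits W s
  | neg b => b.Fits W s
  | and b₁ b₂ => b₁.Fits W s ∧ b₂.Fits W s
  | or b₁ b₂ => b₁.Fits W s ∧ b₂.Fits W s

/-- Programs. -/
inductive Program where
  | skip
  /-- word variable `x := e` -/
  | wset (x : ℕ) (e : WExp)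
  /-- word cell `a[i] := e` -/
  | wstore (a : ℕ) (i e : WExp)
  /-- real variable `x := e` -/
  | rset (x : ℕ) (e : RExp)
  /-- real cell `a[i] := e` -/
  | rstore (a : ℕ) (i : WExp) (e : RExp)
  | seq (c₁ c₂ : Program)
  | ite (b : Test) (c₁ c₂ : Program)
  /-- while `b` do `c` -/
  | loop (b : Test) (c : Program)

/-- `Exec W c s k s'`: on a machine whose words are bounded by `W`, the program `c`, started in the
state `s`, halts after exactly `k` steps in the state `s'`. A run in which a word exceeds `W` has no
outcome. -/
inductive Exec (W : ℕ) : Program → State → ℕ → State → Prop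
  | skip (s : State) : Exec W .skip s 1 s
  | wset (s : State) (x : ℕ) (e : WExp) (he : e.Fits W s) :
      Exec W (.wset x e) s (e.size + 1)
        { s with wv := Function.update s.wv x (e.eval s) }
  | wstore (s : State) (a : ℕ) (i e : WExp) (hi : i.Fits W s) (he : e.Fits W s) :
      Exec W (.wstore a i e) s (i.size + e.size + 1)
        { s with
          wa := Function.update s.wa a (Function.update (s.wa a) (i.eval s) (e.eval s)) }
  | rset (s : State) (x : ℕ) (e : RExp) (he : e.Fits W s) :
      Exec W (.rset x e) s (e.size + 1)
        { s with rv := Function.update s.rv x (e.eval s) }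
  | rstore (s : State) (a : ℕ) (i : WExp) (e : RExp) (hi : i.Fits W s) (he : e.Fits W s) :
      Exec W (.rstore a i e) s (i.size + e.size + 1)
        { s with
          ra := Function.update s.ra a (Function.update (s.ra a) (i.eval s) (e.eval s)) }
  | seq {c₁ c₂ : Program} {s s₁ s₂ : State} {k₁ k₂ : ℕ}
      (h₁ : Exec W c₁ s k₁ s₁) (h₂ : Exec W c₂ s₁ k₂ s₂) :
      Exec W (.seq c₁ c₂) s (k₁ + k₂) s₂
  | ite_true {b : Test} {c₁ c₂ : Program} {s s' : State} {k : ℕ} (hf : b.Fits W s)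
      (hb : b.Holds s) (h : Exec W c₁ s k s') :
      Exec W (.ite b c₁ c₂) s (b.size + 1 + k) s'
  | ite_false {b : Test} {c₁ c₂ : Program} {s s' : State} {k : ℕ} (hf : b.Fits W s)
      (hb : ¬ b.Holds s) (h : Exec W c₂ s k s') :
      Exec W (.ite b c₁ c₂) s (b.size + 1 + k) s'
  | loop_true {b : Test} {c : Program} {s s₁ s₂ : State} {k₁ k₂ : ℕ} (hf : b.Fits W s)
      (hb : b.Holds s) (h₁ : Exec W c s k₁ s₁) (h₂ : Exec W (.loop b c) s₁ k₂ s₂) :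
      Exec W (.loop b c) s (b.size + 1 + k₁ + k₂) s₂
  | loop_false {b : Test} {c : Program} {s : State} (hf : b.Fits W s) (hb : ¬ b.Holds s) :
      Exec W (.loop b c) s (b.size + 1) s

end RealRAM

/-- The length of a walk with respect to the edge weights `w`. -/
def walkWeight {V : Type*} {G : SimpleGraph V} (w : Sym2 V → ℝ) {u v : V} (p : G.Walk u v) : ℝ :=
  (p.edges.map w).sum

/-- `T` is a shortest-path tree of `G` rooted at `r`: a subtree of `G` that contains `r`, spans the
vertices of `G` reachable from `r`, and in which every path from `r` is a shortest path of `G`.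
(As a graph on all of `V`, the vertices not reachable from `r` are isolated in `T`.) -/
structure IsShortestPathTree {V : Type*} (G : SimpleGraph V) (w : Sym2 V → ℝ) (r : V)
    (T : SimpleGraph V) : Prop where
  le : T ≤ G
  acyclic : T.IsAcyclic
  connected : ∀ u v, T.Adj u v → T.Reachable r u
  spanning : ∀ v, G.Reachable r v → T.Reachable r v
  shortest : ∀ (v : V) (p : T.Walk r v), p.IsPath →
    ∀ q : G.Walk r v, walkWeight w p ≤ walkWeight w q

/-- `p` is an `α`-approximate shortest path from `r` to `v` avoiding the vertex `x`. -/
def IsApproxShortestAvoiding {V : Type*} (α : ℝ) (G : SimpleGraph V) (w : Sym2 V → ℝ)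
    {r v : V} (x : V) (p : G.Walk r v) : Prop :=
  p.IsPath ∧ x ∉ p.support ∧
    ∀ q : G.Walk r v, x ∉ q.support → walkWeight w p ≤ α * walkWeight w q

/-- `L` lists every edge of `G` exactly once, in any order and with any order of the endpoints. -/
def IsEdgeList {V : Type*} (G : SimpleGraph V) (L : List (V × V)) : Prop :=
  (L.map fun e => s(e.1, e.2)).Nodup ∧ ∀ e : Sym2 V, e ∈ L.map (fun e => s(e.1, e.2)) ↔ e ∈ G.edgeSet

namespace RealRAM

/-- The word array whose initial segment is `l`, with zeros after it. -/
def wordArray {n : ℕ} (l : List (Fin n)) : ℕ → ℕ :=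
  fun j => (l.map Fin.val).getD j 0

/-- The initial state of the preprocessing. The word variables 0, 1, 2, 3 hold the number of
vertices, the number of edges, the source and the number of vertices of the path; the word arrays 0
and 1 hold the two endpoints of the edges, the real array 0 their weights, and the word array 2 the
vertices of the path in order. Everything else is zero. -/
noncomputable def inputState {n : ℕ} (w : Sym2 (Fin n) → ℝ) (L : List (Fin n × Fin n))
    (r : Fin n) (P : List (Fin n)) : State where
  wv := fun x => [n, L.length, (r : ℕ), P.length].getD x 0
  wa := fun a => match a with
    | 0 => wordArray (L.map Prod.fst)
    | 1 => wordArray (L.map Prod.snd)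
    | 2 => wordArray P
    | _ => fun _ => 0
  rv := fun _ => 0
  ra := fun a => match a with
    | 0 => fun j => (L.map fun e => w s(e.1, e.2)).getD j 0
    | _ => fun _ => 0

/-- A data structure of `A * S` words: the contents of `A` word arrays of length `S`. -/
abbrev DataStructure (A S : ℕ) := Fin A → Fin S → ℕ

/-- The data structure that a preprocessing which halts in the state `s` leaves behind: the first
`S` cells of each of the first `A` word arrays. -/
def State.dataStructure (s : State) (A S : ℕ) : DataStructure A S := fun a i => s.wa a i

/-- The initial state of a query with the arguments `v` and `x` (in the word variables 0 and 1) on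
the data structure `D`. Nothing but `D`, `v` and `x` is available. -/
noncomputable def queryState {A S : ℕ} (D : DataStructure A S) (v x : ℕ) : State where
  wv := fun y => [v, x].getD y 0
  wa := fun a i => if h : a < A ∧ i < S then D ⟨a, h.1⟩ ⟨i, h.2⟩ else 0
  rv := fun _ => 0
  ra := fun _ _ => 0

/-- The list that a query reports in its final state: the word variable 0 holds its length, the
initial segment of the word array 0 its entries. -/
def State.report (s : State) : List ℕ := (List.range (s.wv 0)).map (s.wa 0)

/-- The reported list is correct: it is the vertex sequence, from `r` to `v`, of an `α`-approximate
shortest path avoiding `x`, or the empty list if no path from `r` to `v` avoids `x`. -/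
def IsCorrectReport {n : ℕ} (α : ℝ) (G : SimpleGraph (Fin n)) (w : Sym2 (Fin n) → ℝ)
    (r v x : Fin n) (out : List ℕ) : Prop :=
  (∃ p : G.Walk r v, IsApproxShortestAvoiding α G w x p ∧ out = p.support.map Fin.val) ∨
    ((∀ q : G.Walk r v, x ∈ q.support) ∧ out = [])

end RealRAM

/-! Call the number of vertices of P on the tree path from r to a reachable vertex v the level of v,
and let X I be the vertex of P on level I. Of the given tree only P matters: distances d are
computed by Dijkstra's algorithm, the vertices of P take their parents along P and all others their
Dijkstra predecessors. This is again a shortest-path tree containing P (`ShortestPaths.levelTree`).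

Removing x = X I leaves three kinds of reachable vertices. Those on smaller levels keep their
shortest paths. Those on larger levels stay connected to each other inside the subtree of X (I + 1).
Those on level I, except x, lie off the path and need a detour.

Let δ₁ be the length of a best detour to a vertex of level I that runs down the tree on smaller
levels, enters level I from there and stays on its off-path vertices. The cell of I stores an arc
(y, z) of length c into a larger level that minimises cv I = k + c + d z, where k is d y for y on a
smaller level and δ₁ y for y on level I. Along a walk of length W that avoids x and is now at v, the
sum W + d v never decreases, by the triangle inequality. So once the walk has been on a larger
level, cv I ≤ W + d v. Taking the cell and then the tree path from z to v costs at most cv I - 2 d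
(X (I + 1)) + d v ≤ W + 2 d v ≤ 3 W. A vertex of level I is entered for the last time either from
above or from below with the help of the cell; a second detour search gives labels δ₃ ≤ 3 W for
these. The estimates are `Avoids.bounds`, the paths `exists_answer`.

The reported path is simple. The only danger is that the final detour and the detour to y share a
vertex of level I; but if b is the length with which the final detour enters the level, then δ₃ > b
on the former, δ₁ < b on the latter, and δ₃ ≤ δ₁ everywhere (`Detours.le_of_empty`).

All levels are treated at once, since the label of a detour depends only on its endpoint: one detour
graph with an artificial source n serves every level, and one predecessor per vertex plus one arc
per level is O(n) space. An arc from level i to level j offers the same cost to all levels strictly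
between, a range update for minima; it enters two cells of a sparse table with O(log n) rows, which
are pushed down at the end (`wp_spanArc`, `wp_pushCells`). A query follows pointers only through
vertices that it reports, hence takes linear time in its output.

The time O(m + n log n) for three runs of Dijkstra's algorithm comes from hollow heaps. To decrease
a key, a node is made hollow, keeping its two children of largest rank, and a new node takes the
rest. Still a root of rank q forces 2 ^ (q / 2) nodes (`HollowHeap.two_pow_le`), and a potential
counting the roots and the children of hollow nodes pays for consolidation.

Machine programs are verified by weakest preconditions that also count steps; loops carry a
potential that pays for each iteration (`Program.wp_loop_ghost`). -/

namespace RealRAM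

/-! ### Weakest preconditions with cost -/

namespace State

def setW (s : State) (x v : ℕ) : State := { s with wv := Function.update s.wv x v }

def setWA (s : State) (a i v : ℕ) : State :=
  { s with wa := Function.update s.wa a (Function.update (s.wa a) i v) }

noncomputable def setR (s : State) (x : ℕ) (v : ℝ) : State :=
  { s with rv := Function.update s.rv x v }

noncomputable def setRA (s : State) (a i : ℕ) (v : ℝ) : State :=
  { s with ra := Function.update s.ra a (Function.update (s.ra a) i v) }

variable (s : State) (x y a b i v : ℕ) (z : ℝ)

@[simp] theorem setW_wv : (s.setW x v).wv y = if y = x then v else s.wv y := by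
  simp [setW, Function.update_apply]
@[simp] theorem setW_wa : (s.setW x v).wa = s.wa := rfl
@[simp] theorem setW_rv : (s.setW x v).rv = s.rv := rfl
@[simp] theorem setW_ra : (s.setW x v).ra = s.ra := rfl
@[simp] theorem setWA_wv : (s.setWA a i v).wv = s.wv := rfl
@[simp] theorem setWA_wa :
    (s.setWA a i v).wa b = if b = a then Function.update (s.wa a) i v else s.wa b := by
  simp [setWA, Function.update_apply]
@[simp] theorem setWA_rv : (s.setWA a i v).rv = s.rv := rfl
@[simp] theorem setWA_ra : (s.setWA a i v).ra = s.ra := rfl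
@[simp] theorem setR_wv : (s.setR x z).wv = s.wv := rfl
@[simp] theorem setR_wa : (s.setR x z).wa = s.wa := rfl
@[simp] theorem setR_rv : (s.setR x z).rv y = if y = x then z else s.rv y := by
  simp [setR, Function.update_apply]
@[simp] theorem setR_ra : (s.setR x z).ra = s.ra := rfl
@[simp] theorem setRA_wv : (s.setRA a i z).wv = s.wv := rfl
@[simp] theorem setRA_wa : (s.setRA a i z).wa = s.wa := rfl
@[simp] theorem setRA_rv : (s.setRA a i z).rv = s.rv := rfl
@[simp] theorem setRA_ra :
    (s.setRA a i z).ra b = if b = a then Function.update (s.ra a) i z else s.ra b := by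
  simp [setRA, Function.update_apply]

end State

/-- All words stored in the state are at most `W`. -/
structure Bounded (W : ℕ) (s : State) : Prop where
  wv : ∀ x, s.wv x ≤ W
  wa : ∀ a i, s.wa a i ≤ W

/-- What is left of `WExp.Fits` in a bounded state. -/
@[simp] def WExp.Ok (W : ℕ) (s : State) : WExp → Prop
  | const c => c ≤ W
  | var _ => True
  | arr _ e => e.Ok W s
  | add e₁ e₂ => e₁.Ok W s ∧ e₂.Ok W s ∧ e₁.eval s + e₂.eval s ≤ W
  | sub e₁ e₂ => e₁.Ok W s ∧ e₂.Ok W s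
  | mul e₁ e₂ => e₁.Ok W s ∧ e₂.Ok W s ∧ e₁.eval s * e₂.eval s ≤ W
  | div e₁ e₂ => e₁.Ok W s ∧ e₂.Ok W s

@[simp] def RExp.Ok (W : ℕ) (s : State) : RExp → Prop
  | zero => True
  | var _ => True
  | arr _ e => e.Ok W s
  | add e₁ e₂ => e₁.Ok W s ∧ e₂.Ok W s
  | sub e₁ e₂ => e₁.Ok W s ∧ e₂.Ok W s

@[simp] def Test.Ok (W : ℕ) (s : State) : Test → Prop
  | weq e₁ e₂ => e₁.Ok W s ∧ e₂.Ok W s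
  | wlt e₁ e₂ => e₁.Ok W s ∧ e₂.Ok W s
  | rlt e₁ e₂ => e₁.Ok W s ∧ e₂.Ok W s
  | neg b => b.Ok W s
  | and b₁ b₂ => b₁.Ok W s ∧ b₂.Ok W s
  | or b₁ b₂ => b₁.Ok W s ∧ b₂.Ok W s

attribute [simp] WExp.eval WExp.size RExp.eval RExp.size Test.Holds Test.size

theorem Bounded.fits {W : ℕ} {s : State} (h : Bounded W s) : ∀ e : WExp, e.Ok W s → e.Fits W s
  | .const _, he => he
  | .var x, _ => h.wv x
  | .arr a e, he => ⟨h.fits e he, h.wa a _⟩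
  | .add e₁ e₂, he => ⟨h.fits e₁ he.1, h.fits e₂ he.2.1, he.2.2⟩
  | .sub e₁ e₂, he => ⟨h.fits e₁ he.1, h.fits e₂ he.2⟩
  | .mul e₁ e₂, he => ⟨h.fits e₁ he.1, h.fits e₂ he.2.1, he.2.2⟩
  | .div e₁ e₂, he => ⟨h.fits e₁ he.1, h.fits e₂ he.2⟩

theorem Bounded.fitsR {W : ℕ} {s : State} (h : Bounded W s) : ∀ e : RExp, e.Ok W s → e.Fits W s
  | .zero, _ => trivial
  | .var _, _ => trivial
  | .arr _ e, he => h.fits e he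
  | .add e₁ e₂, he => ⟨h.fitsR e₁ he.1, h.fitsR e₂ he.2⟩
  | .sub e₁ e₂, he => ⟨h.fitsR e₁ he.1, h.fitsR e₂ he.2⟩

theorem Bounded.fitsT {W : ℕ} {s : State} (h : Bounded W s) : ∀ b : Test, b.Ok W s → b.Fits W s
  | .weq e₁ e₂, he => ⟨h.fits e₁ he.1, h.fits e₂ he.2⟩
  | .wlt e₁ e₂, he => ⟨h.fits e₁ he.1, h.fits e₂ he.2⟩
  | .rlt e₁ e₂, he => ⟨h.fitsR e₁ he.1, h.fitsR e₂ he.2⟩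
  | .neg b, he => h.fitsT b he
  | .and b₁ b₂, he => ⟨h.fitsT b₁ he.1, h.fitsT b₂ he.2⟩
  | .or b₁ b₂, he => ⟨h.fitsT b₁ he.1, h.fitsT b₂ he.2⟩

theorem WExp.Fits.eval_le {W : ℕ} {s : State} : ∀ {e : WExp}, e.Fits W s → e.eval s ≤ W
  | .const _, h => h
  | .var _, h => h
  | .arr _ _, h => h.2
  | .add _ _, h => h.2.2
  | .sub _ _, h => (Nat.sub_le _ _).trans h.1.eval_le
  | .mul _ _, h => h.2.2
  | .div _ _, h => (Nat.div_le_self _ _).trans h.1.eval_le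

theorem Bounded.setW {W : ℕ} {s : State} (h : Bounded W s) {x v : ℕ} (hv : v ≤ W) :
    Bounded W (s.setW x v) :=
  ⟨fun y => by rw [State.setW_wv]; split_ifs <;> [exact hv; exact h.wv y], h.wa⟩

theorem Bounded.setWA {W : ℕ} {s : State} (h : Bounded W s) {a i v : ℕ} (hv : v ≤ W) :
    Bounded W (s.setWA a i v) :=
  ⟨h.wv, fun b j => by
    rw [State.setWA_wa]
    split_ifs
    · rw [Function.update_apply]; split_ifs <;> [exact hv; exact h.wa _ _]
    · exact h.wa b j⟩

/-! ### Write sets, weakest preconditions and loop rules. -/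

namespace Program

def wordVars : Program → List ℕ
  | skip => []
  | wset x _ => [x]
  | wstore _ _ _ => []
  | rset _ _ => []
  | rstore _ _ _ => []
  | seq c₁ c₂ => c₁.wordVars ++ c₂.wordVars
  | ite _ c₁ c₂ => c₁.wordVars ++ c₂.wordVars
  | loop _ c => c.wordVars

def wordArrays : Program → List ℕ
  | skip => []
  | wset _ _ => []
  | wstore a _ _ => [a]
  | rset _ _ => []
  | rstore _ _ _ => []
  | seq c₁ c₂ => c₁.wordArrays ++ c₂.wordArrays
  | ite _ c₁ c₂ => c₁.wordArrays ++ c₂.wordArrays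
  | loop _ c => c.wordArrays

def realVars : Program → List ℕ
  | skip => []
  | wset _ _ => []
  | wstore _ _ _ => []
  | rset x _ => [x]
  | rstore _ _ _ => []
  | seq c₁ c₂ => c₁.realVars ++ c₂.realVars
  | ite _ c₁ c₂ => c₁.realVars ++ c₂.realVars
  | loop _ c => c.realVars

def realArrays : Program → List ℕ
  | skip => []
  | wset _ _ => []
  | wstore _ _ _ => []
  | rset _ _ => []
  | rstore a _ _ => [a]
  | seq c₁ c₂ => c₁.realArrays ++ c₂.realArrays
  | ite _ c₁ c₂ => c₁.realArrays ++ c₂.realArrays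
  | loop _ c => c.realArrays

/-- A weakest precondition: it implies that `c` halts after `k` steps in a state `s'` with
`Q k s'`, if the initial state is bounded. -/
def wp (W : ℕ) : Program → (ℕ → State → Prop) → State → Prop
  | skip, Q, s => Q 1 s
  | wset x e, Q, s => e.Ok W s ∧ Q (e.size + 1) (s.setW x (e.eval s))
  | wstore a i e, Q, s =>
      i.Ok W s ∧ e.Ok W s ∧ Q (i.size + e.size + 1) (s.setWA a (i.eval s) (e.eval s))
  | rset x e, Q, s => e.Ok W s ∧ Q (e.size + 1) (s.setR x (e.eval s))
  | rstore a i e, Q, s =>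
      i.Ok W s ∧ e.Ok W s ∧ Q (i.size + e.size + 1) (s.setRA a (i.eval s) (e.eval s))
  | seq c₁ c₂, Q, s => c₁.wp W (fun k₁ s₁ => c₂.wp W (fun k₂ s₂ => Q (k₁ + k₂) s₂) s₁) s
  | ite b c₁ c₂, Q, s => b.Ok W s ∧
      (b.Holds s → c₁.wp W (fun k s' => Q (b.size + 1 + k) s') s) ∧
      (¬ b.Holds s → c₂.wp W (fun k s' => Q (b.size + 1 + k) s') s)
  -- A loop stays opaque here, which keeps the definition structurally recursive; the loop rules
  -- below provide the run.
  | loop b c, Q, s => Bounded W s → ∃ k s', Exec W (loop b c) s k s' ∧ Q k s'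

end Program

/-- `s'` agrees with `s` on everything that `c` does not write. -/
structure Frame (c : Program) (s s' : State) : Prop where
  wv : ∀ x, x ∉ c.wordVars → s'.wv x = s.wv x
  wa : ∀ a, a ∉ c.wordArrays → s'.wa a = s.wa a
  rv : ∀ x, x ∉ c.realVars → s'.rv x = s.rv x
  ra : ∀ a, a ∉ c.realArrays → s'.ra a = s.ra a

theorem Frame.refl (c : Program) (s : State) : Frame c s s :=
  ⟨fun _ _ => rfl, fun _ _ => rfl, fun _ _ => rfl, fun _ _ => rfl⟩

theorem Frame.trans {c : Program} {s s' s'' : State} (h : Frame c s s') (h' : Frame c s' s'') :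
    Frame c s s'' :=
  ⟨fun x hx => (h'.wv x hx).trans (h.wv x hx), fun x hx => (h'.wa x hx).trans (h.wa x hx),
    fun x hx => (h'.rv x hx).trans (h.rv x hx), fun x hx => (h'.ra x hx).trans (h.ra x hx)⟩

theorem Frame.mono {c c' : Program} {s s' : State} (h : Frame c s s')
    (h₁ : c.wordVars ⊆ c'.wordVars) (h₂ : c.wordArrays ⊆ c'.wordArrays)
    (h₃ : c.realVars ⊆ c'.realVars) (h₄ : c.realArrays ⊆ c'.realArrays) : Frame c' s s' :=
  ⟨fun x hx => h.wv x fun h' => hx (h₁ h'), fun x hx => h.wa x fun h' => hx (h₂ h'),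
    fun x hx => h.rv x fun h' => hx (h₃ h'), fun x hx => h.ra x fun h' => hx (h₄ h')⟩

theorem Exec.frame {W : ℕ} {c : Program} {s s' : State} {k : ℕ} (h : Exec W c s k s') :
    Frame c s s' := by
  induction h with
  | skip s => exact Frame.refl _ _
  | wset s x e he =>
    refine ⟨fun y hy => ?_, fun _ _ => rfl, fun _ _ => rfl, fun _ _ => rfl⟩
    simp only [Program.wordVars, List.mem_singleton] at hy
    simp [hy]
  | wstore s a i e hi he =>
    refine ⟨fun _ _ => rfl, fun y hy => ?_, fun _ _ => rfl, fun _ _ => rfl⟩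
    simp only [Program.wordArrays, List.mem_singleton] at hy
    simp [hy]
  | rset s x e he =>
    refine ⟨fun _ _ => rfl, fun _ _ => rfl, fun y hy => ?_, fun _ _ => rfl⟩
    simp only [Program.realVars, List.mem_singleton] at hy
    simp [hy]
  | rstore s a i e hi he =>
    refine ⟨fun _ _ => rfl, fun _ _ => rfl, fun _ _ => rfl, fun y hy => ?_⟩
    simp only [Program.realArrays, List.mem_singleton] at hy
    simp [hy]
  | seq h₁ h₂ ih₁ ih₂ =>
    exact (ih₁.mono (by simp [Program.wordVars]) (by simp [Program.wordArrays])
      (by simp [Program.realVars]) (by simp [Program.realArrays])).trans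
      (ih₂.mono (by simp [Program.wordVars]) (by simp [Program.wordArrays])
      (by simp [Program.realVars]) (by simp [Program.realArrays]))
  | ite_true hf hb h ih =>
    exact ih.mono (by simp [Program.wordVars]) (by simp [Program.wordArrays])
      (by simp [Program.realVars]) (by simp [Program.realArrays])
  | ite_false hf hb h ih =>
    exact ih.mono (by simp [Program.wordVars]) (by simp [Program.wordArrays])
      (by simp [Program.realVars]) (by simp [Program.realArrays])
  | loop_true hf hb h₁ h₂ ih₁ ih₂ =>
    exact (ih₁.mono (by simp [Program.wordVars]) (by simp [Program.wordArrays])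
      (by simp [Program.realVars]) (by simp [Program.realArrays])).trans ih₂
  | loop_false hf hb => exact Frame.refl _ _

/-- A store is only executed if its expression fits, so no run breaks the word bound. Hence loads
need no check later, only constants, sums and products: this is what `Ok` retains of `Fits`. -/
theorem Exec.bounded {W : ℕ} {c : Program} {s s' : State} {k : ℕ} (h : Exec W c s k s') :
    Bounded W s → Bounded W s' := by
  induction h with
  | skip s => exact id
  | wset s x e he => exact fun h => h.setW he.eval_le
  | wstore s a i e hi he => exact fun h => h.setWA he.eval_le
  | rset s x e he => exact fun h => ⟨h.wv, h.wa⟩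
  | rstore s a i e hi he => exact fun h => ⟨h.wv, h.wa⟩
  | seq h₁ h₂ ih₁ ih₂ => exact fun h => ih₂ (ih₁ h)
  | ite_true hf hb h ih => exact ih
  | ite_false hf hb h ih => exact ih
  | loop_true hf hb h₁ h₂ ih₁ ih₂ => exact fun h => ih₂ (ih₁ h)
  | loop_false hf hb => exact id

theorem Program.wp_mono {W : ℕ} {c : Program} :
    ∀ {s : State} {Q Q' : ℕ → State → Prop}, c.wp W Q s → (∀ k s', Q k s' → Q' k s') →
      c.wp W Q' s := by
  induction c with
  | skip => exact fun h hQ => hQ _ _ h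
  | wset => exact fun h hQ => ⟨h.1, hQ _ _ h.2⟩
  | wstore => exact fun h hQ => ⟨h.1, h.2.1, hQ _ _ h.2.2⟩
  | rset => exact fun h hQ => ⟨h.1, hQ _ _ h.2⟩
  | rstore => exact fun h hQ => ⟨h.1, h.2.1, hQ _ _ h.2.2⟩
  | seq c₁ c₂ ih₁ ih₂ => exact fun h hQ => ih₁ h fun k₁ s₁ h₁ => ih₂ h₁ fun k₂ s₂ h₂ => hQ _ _ h₂
  | ite b c₁ c₂ ih₁ ih₂ =>
    exact fun h hQ => ⟨h.1, fun hb => ih₁ (h.2.1 hb) fun k s' => hQ _ _,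
      fun hb => ih₂ (h.2.2 hb) fun k s' => hQ _ _⟩
  | loop b c ih =>
    intro s Q Q' h hQ hB
    obtain ⟨k, s', hE, h'⟩ := h hB
    exact ⟨k, s', hE, hQ _ _ h'⟩

theorem Program.exists_exec_of_wp {W : ℕ} {c : Program} :
    ∀ {s : State} {Q : ℕ → State → Prop}, c.wp W Q s → Bounded W s →
      ∃ k s', Exec W c s k s' ∧ Q k s' := by
  induction c with
  | skip => exact fun h _ => ⟨_, _, .skip _, h⟩
  | wset x e => exact fun h hB => ⟨_, _, .wset _ x e (hB.fits e h.1), h.2⟩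
  | wstore a i e =>
    exact fun h hB => ⟨_, _, .wstore _ a i e (hB.fits i h.1) (hB.fits e h.2.1), h.2.2⟩
  | rset x e => exact fun h hB => ⟨_, _, .rset _ x e (hB.fitsR e h.1), h.2⟩
  | rstore a i e =>
    exact fun h hB => ⟨_, _, .rstore _ a i e (hB.fits i h.1) (hB.fitsR e h.2.1), h.2.2⟩
  | seq c₁ c₂ ih₁ ih₂ =>
    intro s Q h hB
    obtain ⟨k₁, s₁, hE₁, h₁⟩ := ih₁ h hB
    obtain ⟨k₂, s₂, hE₂, h₂⟩ := ih₂ h₁ (hE₁.bounded hB)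
    exact ⟨_, _, hE₁.seq hE₂, h₂⟩
  | ite b c₁ c₂ ih₁ ih₂ =>
    intro s Q h hB
    by_cases hb : b.Holds s
    · obtain ⟨k, s', hE, h'⟩ := ih₁ (h.2.1 hb) hB
      exact ⟨_, _, .ite_true (hB.fitsT b h.1) hb hE, h'⟩
    · obtain ⟨k, s', hE, h'⟩ := ih₂ (h.2.2 hb) hB
      exact ⟨_, _, .ite_false (hB.fitsT b h.1) hb hE, h'⟩
  | loop b c ih => exact fun h hB => h hB

theorem Program.wp_seq {W : ℕ} {c₁ c₂ : Program} {Q : ℕ → State → Prop} {s : State}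
    (h : c₁.wp W (fun k₁ s₁ => c₂.wp W (fun k₂ s₂ => Q (k₁ + k₂) s₂) s₁) s) :
    (c₁.seq c₂).wp W Q s := h

/-- The rule for loops. `I φ s` says that the invariant holds with the potential `φ`, which pays for
the steps. -/
theorem Program.wp_loop_ghost {W : ℕ} {b : Test} {c : Program} {s₀ : State}
    {Q : ℕ → State → Prop} (I : ℕ → State → Prop) (φ₀ : ℕ) (h₀ : I φ₀ s₀)
    (hok : ∀ φ s, Frame c s₀ s → Bounded W s → I φ s → b.Ok W s)
    (hbody : ∀ φ s, Frame c s₀ s → Bounded W s → I φ s → b.Holds s →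
      c.wp W (fun k s' => ∃ φ', I φ' s' ∧ b.size + 1 + k + φ' ≤ φ) s)
    (hQ : ∀ k φ s, Frame c s₀ s → Bounded W s → I φ s → ¬ b.Holds s →
      k + φ ≤ φ₀ + b.size + 1 → Q k s) :
    (Program.loop b c).wp W Q s₀ := by
  intro hB
  suffices H : ∀ (N φ : ℕ) (s : State), φ ≤ N → Frame c s₀ s → Bounded W s → I φ s →
      ∃ k φ' s', Exec W (.loop b c) s k s' ∧ Frame c s₀ s' ∧ Bounded W s' ∧ I φ' s' ∧ ¬ b.Holds s' ∧
        k + φ' ≤ φ + b.size + 1 by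
    obtain ⟨k, φ', s', hE, hF, hB', hI, hb, hk⟩ := H _ φ₀ s₀ le_rfl (Frame.refl _ _) hB h₀
    exact ⟨k, s', hE, hQ k φ' s' hF hB' hI hb hk⟩
  intro N
  induction N with
  | zero =>
    intro φ s hN hF hB hI
    by_cases hb : b.Holds s
    · obtain ⟨k, s', -, φ', -, h⟩ := Program.exists_exec_of_wp (hbody φ s hF hB hI hb) hB
      omega
    · exact ⟨_, _, _, .loop_false (hB.fitsT b (hok φ s hF hB hI)) hb, hF, hB, hI, hb, by omega⟩
  | succ N ih =>
    intro φ s hN hF hB hI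
    by_cases hb : b.Holds s
    · obtain ⟨k, s', hE, φ', hI', h⟩ := Program.exists_exec_of_wp (hbody φ s hF hB hI hb) hB
      obtain ⟨k₂, φ₂, s₂, hE₂, hF₂, hB₂, hI₂, hb₂, hk₂⟩ :=
        ih φ' s' (by omega) (hF.trans hE.frame) (hE.bounded hB) hI'
      exact ⟨_, _, _, .loop_true (hB.fitsT b (hok φ s hF hB hI)) hb hE hE₂, hF₂, hB₂, hI₂, hb₂,
        by omega⟩
    · exact ⟨_, _, _, .loop_false (hB.fitsT b (hok φ s hF hB hI)) hb, hF, hB, hI, hb, by omega⟩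

/-- The rule for loops, with an invariant `I` and a potential `Φ` that pays for the steps. -/
theorem Program.wp_loop {W : ℕ} {b : Test} {c : Program} {s₀ : State} {Q : ℕ → State → Prop}
    (I : State → Prop) (Φ : State → ℕ) (h₀ : I s₀)
    (hok : ∀ s, Frame c s₀ s → Bounded W s → I s → b.Ok W s)
    (hbody : ∀ s, Frame c s₀ s → Bounded W s → I s → b.Holds s →
      c.wp W (fun k s' => I s' ∧ b.size + 1 + k + Φ s' ≤ Φ s) s)
    (hQ : ∀ k s, Frame c s₀ s → Bounded W s → I s → ¬ b.Holds s →
      k + Φ s ≤ Φ s₀ + b.size + 1 → Q k s) :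
    (Program.loop b c).wp W Q s₀ := by
  refine Program.wp_loop_ghost (fun φ s => I s ∧ φ = Φ s) (Φ s₀) ⟨h₀, rfl⟩
    (fun φ s hF hB hI => hok s hF hB hI.1) ?_ ?_
  · rintro φ s hF hB ⟨hI, rfl⟩ hb
    exact Program.wp_mono (hbody s hF hB hI hb) fun k s' h => ⟨Φ s', ⟨h.1, rfl⟩, h.2⟩
  · rintro k φ s hF hB ⟨hI, rfl⟩ hb hk
    exact hQ k s hF hB hI hb hk

/-- Specifications need not mention what is left unchanged: this can be added to any postcondition,
and that a fixed name is not in the write lists is then settled by `decide`. -/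
theorem Program.wp_frame {W : ℕ} {c : Program} :
    ∀ {s : State} {Q : ℕ → State → Prop}, c.wp W Q s →
      c.wp W (fun k s' => Q k s' ∧ Frame c s s') s := by
  induction c with
  | skip => exact fun h => ⟨h, Frame.refl _ _⟩
  | wset x e =>
    refine fun h => ⟨h.1, h.2, fun y hy => ?_, fun _ _ => rfl, fun _ _ => rfl, fun _ _ => rfl⟩
    simp only [Program.wordVars, List.mem_singleton] at hy
    simp [hy]
  | wstore a i e =>
    refine fun h => ⟨h.1, h.2.1, h.2.2, fun _ _ => rfl, fun y hy => ?_, fun _ _ => rfl,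
      fun _ _ => rfl⟩
    simp only [Program.wordArrays, List.mem_singleton] at hy
    simp [hy]
  | rset x e =>
    refine fun h => ⟨h.1, h.2, fun _ _ => rfl, fun _ _ => rfl, fun y hy => ?_, fun _ _ => rfl⟩
    simp only [Program.realVars, List.mem_singleton] at hy
    simp [hy]
  | rstore a i e =>
    refine fun h => ⟨h.1, h.2.1, h.2.2, fun _ _ => rfl, fun _ _ => rfl, fun _ _ => rfl,
      fun y hy => ?_⟩
    simp only [Program.realArrays, List.mem_singleton] at hy
    simp [hy]
  | seq c₁ c₂ ih₁ ih₂ =>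
    intro s Q h
    change c₁.wp W (fun k₁ s₁ => c₂.wp W
      (fun k₂ s₂ => Q (k₁ + k₂) s₂ ∧ Frame (c₁.seq c₂) s s₂) s₁) s
    refine Program.wp_mono (ih₁ h) fun k₁ s₁ h₁ => Program.wp_mono (ih₂ h₁.1) fun k₂ s₂ h₂ =>
      ⟨h₂.1, ?_⟩
    exact (h₁.2.mono (by simp [Program.wordVars]) (by simp [Program.wordArrays])
      (by simp [Program.realVars]) (by simp [Program.realArrays])).trans
      (h₂.2.mono (by simp [Program.wordVars]) (by simp [Program.wordArrays])
      (by simp [Program.realVars]) (by simp [Program.realArrays]))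
  | ite b c₁ c₂ ih₁ ih₂ =>
    exact fun h => ⟨h.1, fun hb => Program.wp_mono (ih₁ (h.2.1 hb)) fun k s' h' => ⟨h'.1,
        h'.2.mono (by simp [Program.wordVars]) (by simp [Program.wordArrays])
        (by simp [Program.realVars]) (by simp [Program.realArrays])⟩,
      fun hb => Program.wp_mono (ih₂ (h.2.2 hb)) fun k s' h' => ⟨h'.1,
        h'.2.mono (by simp [Program.wordVars]) (by simp [Program.wordArrays])
        (by simp [Program.realVars]) (by simp [Program.realArrays])⟩⟩
  | loop b c ih =>
    intro s Q h hB
    obtain ⟨k, s', hE, h'⟩ := h hB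
    exact ⟨k, s', hE, h', hE.frame⟩

/-- Renames every variable and array by adding `o`. -/
def WExp.shift (o : ℕ) : WExp → WExp
  | const c => const c
  | var x => var (x + o)
  | arr a e => arr (a + o) (e.shift o)
  | add e₁ e₂ => add (e₁.shift o) (e₂.shift o)
  | sub e₁ e₂ => sub (e₁.shift o) (e₂.shift o)
  | mul e₁ e₂ => mul (e₁.shift o) (e₂.shift o)
  | div e₁ e₂ => div (e₁.shift o) (e₂.shift o)

def RExp.shift (o : ℕ) : RExp → RExp
  | zero => zero
  | var x => var (x + o)
  | arr a e => arr (a + o) (e.shift o)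
  | add e₁ e₂ => add (e₁.shift o) (e₂.shift o)
  | sub e₁ e₂ => sub (e₁.shift o) (e₂.shift o)

def Test.shift (o : ℕ) : Test → Test
  | weq e₁ e₂ => weq (e₁.shift o) (e₂.shift o)
  | wlt e₁ e₂ => wlt (e₁.shift o) (e₂.shift o)
  | rlt e₁ e₂ => rlt (e₁.shift o) (e₂.shift o)
  | neg b => neg (b.shift o)
  | and b₁ b₂ => and (b₁.shift o) (b₂.shift o)
  | or b₁ b₂ => or (b₁.shift o) (b₂.shift o)

def Program.shift (o : ℕ) : Program → Program
  | skip => skip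
  | wset x e => wset (x + o) (e.shift o)
  | wstore a i e => wstore (a + o) (i.shift o) (e.shift o)
  | rset x e => rset (x + o) (e.shift o)
  | rstore a i e => rstore (a + o) (i.shift o) (e.shift o)
  | seq c₁ c₂ => seq (c₁.shift o) (c₂.shift o)
  | ite b c₁ c₂ => ite (b.shift o) (c₁.shift o) (c₂.shift o)
  | loop b c => loop (b.shift o) (c.shift o)

/-- The part of the state that a program renamed by `Program.shift` sees. -/
def State.window (o : ℕ) (s : State) : State where
  wv := fun x => s.wv (x + o)
  wa := fun a => s.wa (a + o)
  rv := fun x => s.rv (x + o)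
  ra := fun a => s.ra (a + o)

theorem WExp.eval_shift (o : ℕ) (s : State) :
    ∀ e : WExp, (e.shift o).eval s = e.eval (s.window o)
  | const _ => rfl
  | var _ => rfl
  | arr a e => by simp [WExp.shift, State.window, WExp.eval_shift o s e]
  | add e₁ e₂ => by simp [WExp.shift, WExp.eval_shift o s e₁, WExp.eval_shift o s e₂]
  | sub e₁ e₂ => by simp [WExp.shift, WExp.eval_shift o s e₁, WExp.eval_shift o s e₂]
  | mul e₁ e₂ => by simp [WExp.shift, WExp.eval_shift o s e₁, WExp.eval_shift o s e₂]
  | div e₁ e₂ => by simp [WExp.shift, WExp.eval_shift o s e₁, WExp.eval_shift o s e₂]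

theorem WExp.size_shift (o : ℕ) : ∀ e : WExp, (e.shift o).size = e.size
  | const _ => rfl
  | var _ => rfl
  | arr a e => by simp [WExp.shift, WExp.size_shift o e]
  | add e₁ e₂ => by simp [WExp.shift, WExp.size_shift o e₁, WExp.size_shift o e₂]
  | sub e₁ e₂ => by simp [WExp.shift, WExp.size_shift o e₁, WExp.size_shift o e₂]
  | mul e₁ e₂ => by simp [WExp.shift, WExp.size_shift o e₁, WExp.size_shift o e₂]
  | div e₁ e₂ => by simp [WExp.shift, WExp.size_shift o e₁, WExp.size_shift o e₂]

theorem WExp.ok_shift {W : ℕ} (o : ℕ) (s : State) :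
    ∀ e : WExp, (e.shift o).Ok W s ↔ e.Ok W (s.window o)
  | const _ => Iff.rfl
  | var _ => Iff.rfl
  | arr a e => by simp [WExp.shift, WExp.ok_shift o s e]
  | add e₁ e₂ => by
    simp [WExp.shift, WExp.ok_shift o s e₁, WExp.ok_shift o s e₂, WExp.eval_shift]
  | sub e₁ e₂ => by simp [WExp.shift, WExp.ok_shift o s e₁, WExp.ok_shift o s e₂]
  | mul e₁ e₂ => by
    simp [WExp.shift, WExp.ok_shift o s e₁, WExp.ok_shift o s e₂, WExp.eval_shift]
  | div e₁ e₂ => by simp [WExp.shift, WExp.ok_shift o s e₁, WExp.ok_shift o s e₂]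

theorem WExp.fits_shift {W : ℕ} (o : ℕ) (s : State) :
    ∀ e : WExp, (e.shift o).Fits W s ↔ e.Fits W (s.window o)
  | const _ => Iff.rfl
  | var _ => Iff.rfl
  | arr a e => by simp [WExp.shift, WExp.Fits, WExp.fits_shift o s e, WExp.eval_shift, State.window]
  | add e₁ e₂ => by
    simp [WExp.shift, WExp.Fits, WExp.fits_shift o s e₁, WExp.fits_shift o s e₂, WExp.eval_shift]
  | sub e₁ e₂ => by simp [WExp.shift, WExp.Fits, WExp.fits_shift o s e₁, WExp.fits_shift o s e₂]
  | mul e₁ e₂ => by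
    simp [WExp.shift, WExp.Fits, WExp.fits_shift o s e₁, WExp.fits_shift o s e₂, WExp.eval_shift]
  | div e₁ e₂ => by simp [WExp.shift, WExp.Fits, WExp.fits_shift o s e₁, WExp.fits_shift o s e₂]

theorem RExp.eval_shift (o : ℕ) (s : State) :
    ∀ e : RExp, (e.shift o).eval s = e.eval (s.window o)
  | zero => rfl
  | var _ => rfl
  | arr a e => by simp [RExp.shift, State.window, WExp.eval_shift o s e]
  | add e₁ e₂ => by simp [RExp.shift, RExp.eval_shift o s e₁, RExp.eval_shift o s e₂]
  | sub e₁ e₂ => by simp [RExp.shift, RExp.eval_shift o s e₁, RExp.eval_shift o s e₂]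

theorem RExp.size_shift (o : ℕ) : ∀ e : RExp, (e.shift o).size = e.size
  | zero => rfl
  | var _ => rfl
  | arr a e => by simp [RExp.shift, WExp.size_shift o e]
  | add e₁ e₂ => by simp [RExp.shift, RExp.size_shift o e₁, RExp.size_shift o e₂]
  | sub e₁ e₂ => by simp [RExp.shift, RExp.size_shift o e₁, RExp.size_shift o e₂]

theorem RExp.fits_shift {W : ℕ} (o : ℕ) (s : State) :
    ∀ e : RExp, (e.shift o).Fits W s ↔ e.Fits W (s.window o)
  | zero => Iff.rfl
  | var _ => Iff.rfl
  | arr a e => by simp [RExp.shift, RExp.Fits, WExp.fits_shift o s e]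
  | add e₁ e₂ => by simp [RExp.shift, RExp.Fits, RExp.fits_shift o s e₁, RExp.fits_shift o s e₂]
  | sub e₁ e₂ => by simp [RExp.shift, RExp.Fits, RExp.fits_shift o s e₁, RExp.fits_shift o s e₂]

theorem Test.holds_shift (o : ℕ) (s : State) :
    ∀ b : Test, (b.shift o).Holds s ↔ b.Holds (s.window o)
  | weq e₁ e₂ => by simp [Test.shift, WExp.eval_shift]
  | wlt e₁ e₂ => by simp [Test.shift, WExp.eval_shift]
  | rlt e₁ e₂ => by simp [Test.shift, RExp.eval_shift]
  | neg b => by simp [Test.shift, Test.holds_shift o s b]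
  | and b₁ b₂ => by simp [Test.shift, Test.holds_shift o s b₁, Test.holds_shift o s b₂]
  | or b₁ b₂ => by simp [Test.shift, Test.holds_shift o s b₁, Test.holds_shift o s b₂]

theorem Test.size_shift (o : ℕ) : ∀ b : Test, (b.shift o).size = b.size
  | weq e₁ e₂ => by simp [Test.shift, WExp.size_shift]
  | wlt e₁ e₂ => by simp [Test.shift, WExp.size_shift]
  | rlt e₁ e₂ => by simp [Test.shift, RExp.size_shift]
  | neg b => by simp [Test.shift, Test.size_shift o b]
  | and b₁ b₂ => by simp [Test.shift, Test.size_shift o b₁, Test.size_shift o b₂]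
  | or b₁ b₂ => by simp [Test.shift, Test.size_shift o b₁, Test.size_shift o b₂]

theorem Test.fits_shift {W : ℕ} (o : ℕ) (s : State) :
    ∀ b : Test, (b.shift o).Fits W s ↔ b.Fits W (s.window o)
  | weq e₁ e₂ => by simp [Test.shift, Test.Fits, WExp.fits_shift]
  | wlt e₁ e₂ => by simp [Test.shift, Test.Fits, WExp.fits_shift]
  | rlt e₁ e₂ => by simp [Test.shift, Test.Fits, RExp.fits_shift]
  | neg b => by simp [Test.shift, Test.Fits, Test.fits_shift o s b]
  | and b₁ b₂ => by simp [Test.shift, Test.Fits, Test.fits_shift o s b₁, Test.fits_shift o s b₂]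
  | or b₁ b₂ => by simp [Test.shift, Test.Fits, Test.fits_shift o s b₁, Test.fits_shift o s b₂]

theorem Bounded.window {W : ℕ} {s : State} (h : Bounded W s) (o : ℕ) : Bounded W (s.window o) :=
  ⟨fun x => h.wv (x + o), fun a i => h.wa (a + o) i⟩

theorem Exec.shift {W : ℕ} (o : ℕ) {c : Program} {t t' : State} {k : ℕ} (h : Exec W c t k t') :
    ∀ s : State, s.window o = t → ∃ s', Exec W (c.shift o) s k s' ∧ s'.window o = t' := by
  induction h with
  | skip t => exact fun s hs => ⟨s, .skip s, hs⟩
  | wset t x e he =>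
    rintro s rfl
    refine ⟨_, by
      have := Exec.wset (W := W) s (x + o) (e.shift o) ((WExp.fits_shift o s e).2 he)
      rwa [WExp.size_shift] at this, ?_⟩
    simp [State.window, WExp.eval_shift, Function.update_apply, funext_iff]
  | wstore t a i e hi he =>
    rintro s rfl
    refine ⟨_, by
      have := Exec.wstore (W := W) s (a + o) (i.shift o) (e.shift o)
        ((WExp.fits_shift o s i).2 hi) ((WExp.fits_shift o s e).2 he)
      rwa [WExp.size_shift, WExp.size_shift] at this, ?_⟩
    simp [State.window, WExp.eval_shift, Function.update_apply, funext_iff]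
  | rset t x e he =>
    rintro s rfl
    refine ⟨_, by
      have := Exec.rset (W := W) s (x + o) (e.shift o) ((RExp.fits_shift o s e).2 he)
      rwa [RExp.size_shift] at this, ?_⟩
    simp [State.window, RExp.eval_shift, Function.update_apply, funext_iff]
  | rstore t a i e hi he =>
    rintro s rfl
    refine ⟨_, by
      have := Exec.rstore (W := W) s (a + o) (i.shift o) (e.shift o)
        ((WExp.fits_shift o s i).2 hi) ((RExp.fits_shift o s e).2 he)
      rwa [WExp.size_shift, RExp.size_shift] at this, ?_⟩
    simp [State.window, WExp.eval_shift, RExp.eval_shift, Function.update_apply, funext_iff]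
  | seq h₁ h₂ ih₁ ih₂ =>
    intro s hs
    obtain ⟨s₁, hE₁, hs₁⟩ := ih₁ s hs
    obtain ⟨s₂, hE₂, hs₂⟩ := ih₂ s₁ hs₁
    exact ⟨s₂, hE₁.seq hE₂, hs₂⟩
  | @ite_true b c₁ c₂ t t' k hf hb h ih =>
    rintro s rfl
    obtain ⟨s', hE, hs'⟩ := ih s rfl
    refine ⟨s', ?_, hs'⟩
    have := Exec.ite_true (c₂ := c₂.shift o) ((Test.fits_shift o s b).2 hf)
      ((Test.holds_shift o s b).2 hb) hE
    rwa [Test.size_shift] at this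
  | @ite_false b c₁ c₂ t t' k hf hb h ih =>
    rintro s rfl
    obtain ⟨s', hE, hs'⟩ := ih s rfl
    refine ⟨s', ?_, hs'⟩
    have := Exec.ite_false (c₁ := c₁.shift o) ((Test.fits_shift o s b).2 hf)
      (mt (Test.holds_shift o s b).1 hb) hE
    rwa [Test.size_shift] at this
  | @loop_true b c t t₁ t₂ k₁ k₂ hf hb h₁ h₂ ih₁ ih₂ =>
    rintro s rfl
    obtain ⟨s₁, hE₁, hs₁⟩ := ih₁ s rfl
    obtain ⟨s₂, hE₂, hs₂⟩ := ih₂ s₁ hs₁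
    refine ⟨s₂, ?_, hs₂⟩
    have := Exec.loop_true ((Test.fits_shift o s b).2 hf) ((Test.holds_shift o s b).2 hb) hE₁ hE₂
    rwa [Test.size_shift] at this
  | @loop_false b c t hf hb =>
    rintro s rfl
    refine ⟨s, ?_, rfl⟩
    have := Exec.loop_false (c := c.shift o) ((Test.fits_shift o s b).2 hf)
      (mt (Test.holds_shift o s b).1 hb)
    rwa [Test.size_shift] at this

theorem RExp.ok_shift {W : ℕ} (o : ℕ) (s : State) :
    ∀ e : RExp, (e.shift o).Ok W s ↔ e.Ok W (s.window o)
  | zero => Iff.rfl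
  | var _ => Iff.rfl
  | arr a e => by simp [RExp.shift, WExp.ok_shift o s e]
  | add e₁ e₂ => by simp [RExp.shift, RExp.ok_shift o s e₁, RExp.ok_shift o s e₂]
  | sub e₁ e₂ => by simp [RExp.shift, RExp.ok_shift o s e₁, RExp.ok_shift o s e₂]

theorem Test.ok_shift {W : ℕ} (o : ℕ) (s : State) :
    ∀ b : Test, (b.shift o).Ok W s ↔ b.Ok W (s.window o)
  | weq e₁ e₂ => by simp [Test.shift, WExp.ok_shift]
  | wlt e₁ e₂ => by simp [Test.shift, WExp.ok_shift]
  | rlt e₁ e₂ => by simp [Test.shift, RExp.ok_shift]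
  | neg b => by simp [Test.shift, Test.ok_shift o s b]
  | and b₁ b₂ => by simp [Test.shift, Test.ok_shift o s b₁, Test.ok_shift o s b₂]
  | or b₁ b₂ => by simp [Test.shift, Test.ok_shift o s b₁, Test.ok_shift o s b₂]

/-- The postcondition must hold for every state with the right window, since nothing is said here
about the rest of the state; that part is recovered from `Program.wp_frame`. Renaming allows the
same verified program to run several times on memory that is still zero. -/
theorem Program.wp_shift {W : ℕ} (o : ℕ) {c : Program} :
    ∀ {s : State} {Q : ℕ → State → Prop},
      c.wp W (fun k t => ∀ s', s'.window o = t → Q k s') (s.window o) → (c.shift o).wp W Q s := by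
  induction c with
  | skip => exact fun h => h _ rfl
  | wset x e =>
    refine fun h => ⟨(WExp.ok_shift o _ e).2 h.1, ?_⟩
    rw [WExp.size_shift]
    refine h.2 _ ?_
    simp [State.window, State.setW, WExp.eval_shift, Function.update_apply, funext_iff]
  | wstore a i e =>
    refine fun h => ⟨(WExp.ok_shift o _ i).2 h.1, (WExp.ok_shift o _ e).2 h.2.1, ?_⟩
    rw [WExp.size_shift, WExp.size_shift]
    refine h.2.2 _ ?_
    simp [State.window, State.setWA, WExp.eval_shift, Function.update_apply, funext_iff]
  | rset x e =>
    refine fun h => ⟨(RExp.ok_shift o _ e).2 h.1, ?_⟩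
    rw [RExp.size_shift]
    refine h.2 _ ?_
    simp [State.window, State.setR, RExp.eval_shift, Function.update_apply, funext_iff]
  | rstore a i e =>
    refine fun h => ⟨(WExp.ok_shift o _ i).2 h.1, (RExp.ok_shift o _ e).2 h.2.1, ?_⟩
    rw [WExp.size_shift, RExp.size_shift]
    refine h.2.2 _ ?_
    simp [State.window, State.setRA, WExp.eval_shift, RExp.eval_shift, Function.update_apply,
      funext_iff]
  | seq c₁ c₂ ih₁ ih₂ =>
    refine fun h => ih₁ (Program.wp_mono h ?_)
    rintro k _ h' s' rfl
    exact ih₂ h'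
  | ite b c₁ c₂ ih₁ ih₂ =>
    refine fun h => ⟨(Test.ok_shift o _ b).2 h.1, fun hb => ih₁ ?_, fun hb => ih₂ ?_⟩
    · rw [Test.size_shift]
      exact h.2.1 ((Test.holds_shift o _ b).1 hb)
    · rw [Test.size_shift]
      exact h.2.2 (mt (Test.holds_shift o _ b).2 hb)
  | loop b c ih =>
    intro s Q h hB
    obtain ⟨k, t, hE, ht⟩ := h (hB.window o)
    obtain ⟨s', hE', hs'⟩ := hE.shift o s rfl
    exact ⟨k, s', hE', ht s' hs'⟩

end RealRAM

/-! ### Hollow heaps -/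

/-- The list `l` is stored as a linked list that starts at `p`; `0` is the null pointer. -/
def Linked (next : ℕ → ℕ) : ℕ → List ℕ → Prop
  | p, [] => p = 0
  | p, c :: l => p = c ∧ c ≠ 0 ∧ Linked next (next c) l

theorem Linked.congr {next next' : ℕ → ℕ} : ∀ {p : ℕ} {l : List ℕ}, Linked next p l →
    (∀ c ∈ l, next' c = next c) → Linked next' p l
  | _, [], h, _ => h
  | _, c :: _, h, hc => ⟨h.1, h.2.1, by
      rw [hc c (by simp)]; exact h.2.2.congr fun d hd => hc d (by simp [hd])⟩

/-- A hollow heap. A node `u` holds the item `vert u` if `cur (vert u) = u`; otherwise it is hollow.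
`L` is the set of nodes, `ch u` the list of children of `u`, by decreasing rank. -/
structure HollowHeap (vert rank child next : ℕ → ℕ) (key : ℕ → ℝ) (cur : ℕ → ℕ)
    (ch : ℕ → List ℕ) (L : Finset ℕ) (roots : Multiset ℕ) : Prop where
  forest : roots + ∑ u ∈ L, (ch u : Multiset ℕ) = L.val
  pos : ∀ u ∈ L, u ≠ 0
  linked : ∀ u ∈ L, Linked next (child u) (ch u)
  rank_lt : ∀ u ∈ L, ∀ c ∈ ch u, rank c < rank u
  key_le : ∀ u ∈ L, ∀ c ∈ ch u, key u ≤ key c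
  weight : ∀ u ∈ L, 2 ^ (rank u / 2) ≤ 1 + ((ch u).map fun c => 2 ^ (rank c / 2)).sum
  ranks : ∀ u ∈ L, cur (vert u) = u → (ch u).map rank = (List.range (rank u)).reverse

/-- The number of children of hollow nodes. -/
def hollowChildren (vert cur : ℕ → ℕ) (ch : ℕ → List ℕ) (L : Finset ℕ) : ℕ :=
  ∑ u ∈ L with cur (vert u) ≠ u, (ch u).length

/-- The two largest ranks `r - 1` and `r - 2` suffice: `(r - 2) / 2 = r / 2 - 1`, and `(r - 1) / 2`
is at least that. -/
theorem two_pow_rank_le {rank : ℕ → ℕ} {l : List ℕ} {r : ℕ}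
    (h : l.map rank = (List.range r).reverse) :
    2 ^ (r / 2) ≤ 1 + (l.map fun c => 2 ^ (rank c / 2)).sum := by
  have h' : (l.map fun c => 2 ^ (rank c / 2)) = (l.map rank).map fun j => 2 ^ (j / 2) := by simp
  rw [h', h]
  rcases r with _ | _ | r
  · simp
  · simp
  · simp only [List.range_succ, List.reverse_append, List.reverse_cons, List.reverse_nil,
      List.nil_append, List.map_append, List.map_cons, List.map_nil, List.sum_append, List.sum_cons,
      List.sum_nil]
    have h₁ : (r + 1 + 1) / 2 = r / 2 + 1 := by omega
    have h₂ : 2 ^ (r / 2) ≤ 2 ^ ((r + 1) / 2) := Nat.pow_le_pow_right (by norm_num) (by omega)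
    rw [h₁, pow_succ]
    omega

/-! ### Forest structure, the rank bound and the heap operations. -/

namespace HollowHeap

variable {vert rank child next : ℕ → ℕ} {key : ℕ → ℝ} {cur : ℕ → ℕ}
    {ch : ℕ → List ℕ} {L : Finset ℕ} {roots : Multiset ℕ}

/-- All facts about roots and parents come from this count: a node occurs exactly once among the
roots and the child lists taken together. -/
theorem count_eq (h : HollowHeap vert rank child next key cur ch L roots) (x : ℕ) :
    roots.count x + ∑ u ∈ L, (ch u).count x = if x ∈ L then 1 else 0 := by
  have := congrArg (Multiset.count x) h.forest
  rw [Multiset.count_add, Multiset.count_sum'] at this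
  simp only [Multiset.coe_count] at this
  rw [this]
  split_ifs with hx
  · exact Multiset.count_eq_one_of_mem L.nodup hx
  · exact Multiset.count_eq_zero_of_notMem hx

theorem root_mem (h : HollowHeap vert rank child next key cur ch L roots) {x : ℕ}
    (hx : x ∈ roots) : x ∈ L := by
  by_contra hL
  have := h.count_eq x
  rw [if_neg hL] at this
  have := Multiset.count_pos.2 hx
  omega

theorem child_mem (h : HollowHeap vert rank child next key cur ch L roots) {u x : ℕ}
    (hu : u ∈ L) (hx : x ∈ ch u) : x ∈ L := by
  by_contra hL
  have := h.count_eq x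
  rw [if_neg hL] at this
  have h₁ := List.count_pos_iff.2 hx
  have h₂ := Finset.single_le_sum (f := fun u => (ch u).count x) (fun _ _ => Nat.zero_le _) hu
  omega

theorem root_not_child (h : HollowHeap vert rank child next key cur ch L roots) {u x : ℕ}
    (hu : u ∈ L) (hx : x ∈ roots) : x ∉ ch u := by
  intro hc
  have := h.count_eq x
  have h₁ := List.count_pos_iff.2 hc
  have h₂ := Finset.single_le_sum (f := fun u => (ch u).count x) (fun _ _ => Nat.zero_le _) hu
  have h₃ := Multiset.count_pos.2 hx
  split_ifs at this <;> omega

theorem parent_unique (h : HollowHeap vert rank child next key cur ch L roots) {u u' x : ℕ}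
    (hu : u ∈ L) (hu' : u' ∈ L) (hx : x ∈ ch u) (hx' : x ∈ ch u') : u = u' := by
  by_contra hne
  have := h.count_eq x
  have h₁ := List.count_pos_iff.2 hx
  have h₂ := List.count_pos_iff.2 hx'
  have h₃ := Finset.sum_le_sum_of_subset (f := fun u => (ch u).count x)
    (show ({u, u'} : Finset ℕ) ⊆ L by
      intro y; simp only [Finset.mem_insert, Finset.mem_singleton]; rintro (rfl | rfl) <;> assumption)
  rw [Finset.sum_pair hne] at h₃
  split_ifs at this <;> omega

theorem children_nodup (h : HollowHeap vert rank child next key cur ch L roots) {u : ℕ}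
    (hu : u ∈ L) : (ch u).Nodup := by
  rw [List.nodup_iff_count_le_one]
  intro x
  have := h.count_eq x
  have h₂ := Finset.single_le_sum (f := fun u => (ch u).count x) (fun _ _ => Nat.zero_le _) hu
  split_ifs at this <;> omega

theorem roots_nodup (h : HollowHeap vert rank child next key cur ch L roots) : roots.Nodup := by
  rw [Multiset.nodup_iff_count_le_one]
  intro x
  have := h.count_eq x
  split_ifs at this <;> omega

/-- Climb towards the root. Keys do not increase on the way, and ranks strictly increase while they
are bounded on `L`, so the climb ends. -/
theorem exists_root (h : HollowHeap vert rank child next key cur ch L roots) {u : ℕ}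
    (hu : u ∈ L) : ∃ a ∈ roots, key a ≤ key u := by
  suffices H : ∀ (k : ℕ) (u : ℕ), u ∈ L → L.sup rank - rank u ≤ k → ∃ a ∈ roots, key a ≤ key u from
    H _ u hu le_rfl
  intro k
  induction k with
  | zero =>
    intro u hu hk
    have hmem : u ∈ roots + ∑ u ∈ L, (ch u : Multiset ℕ) := by rw [h.forest]; exact hu
    rcases Multiset.mem_add.1 hmem with h' | h'
    · exact ⟨u, h', le_rfl⟩
    · obtain ⟨p, hp, hup⟩ := Multiset.mem_sum.1 h'
      have h₁ := h.rank_lt p hp u (by simpa using hup)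
      have h₂ := Finset.le_sup (f := rank) hp
      omega
  | succ k ih =>
    intro u hu hk
    have hmem : u ∈ roots + ∑ u ∈ L, (ch u : Multiset ℕ) := by rw [h.forest]; exact hu
    rcases Multiset.mem_add.1 hmem with h' | h'
    · exact ⟨u, h', le_rfl⟩
    · obtain ⟨p, hp, hup⟩ := Multiset.mem_sum.1 h'
      have h₁ := h.rank_lt p hp u (by simpa using hup)
      have h₂ := Finset.le_sup (f := rank) hp
      obtain ⟨a, ha, hak⟩ := ih p hp (by omega)
      exact ⟨a, ha, hak.trans (h.key_le p hp u (by simpa using hup))⟩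

/-- Sum `weight` over all nodes. By `forest` the nodes are the roots and the children, so the terms
of the children cancel and every node contributes 1 on the right. -/
theorem sum_two_pow_le (h : HollowHeap vert rank child next key cur ch L roots) :
    (roots.map fun a => 2 ^ (rank a / 2)).sum ≤ L.card := by
  have h₁ := congrArg (fun m : Multiset ℕ => (m.map fun a => 2 ^ (rank a / 2)).sum) h.forest
  have h₂ : ((∑ u ∈ L, (ch u : Multiset ℕ)).map fun a => 2 ^ (rank a / 2)).sum
      = ∑ u ∈ L, ((ch u).map fun c => 2 ^ (rank c / 2)).sum := by
    let f : Multiset ℕ →+ ℕ := (Multiset.sumAddMonoidHom).comp (Multiset.mapAddMonoidHom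
      fun a => 2 ^ (rank a / 2))
    change f (∑ u ∈ L, (ch u : Multiset ℕ)) = _
    rw [map_sum]
    refine Finset.sum_congr rfl fun u _ => ?_
    simp [f]
  simp only [Multiset.map_add, Multiset.sum_add] at h₁
  rw [h₂] at h₁
  have h₃ : (L.val.map fun a => 2 ^ (rank a / 2)).sum
      ≤ ∑ u ∈ L, (1 + ((ch u).map fun c => 2 ^ (rank c / 2)).sum) :=
    Finset.sum_le_sum fun u hu => h.weight u hu
  rw [Finset.sum_add_distrib] at h₃
  simp only [Finset.sum_const, smul_eq_mul, mul_one] at h₃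
  omega

theorem two_pow_le (h : HollowHeap vert rank child next key cur ch L roots) {a : ℕ}
    (ha : a ∈ roots) : 2 ^ (rank a / 2) ≤ L.card := by
  refine le_trans ?_ h.sum_two_pow_le
  exact Multiset.single_le_sum (fun _ _ => Nat.zero_le _) _ (Multiset.mem_map_of_mem _ ha)

theorem card_roots_le (h : HollowHeap vert rank child next key cur ch L roots) :
    Multiset.card roots ≤ L.card := by
  have := congrArg Multiset.card h.forest
  simp only [Multiset.card_add, Finset.card_val] at this
  omega

theorem length_children (h : HollowHeap vert rank child next key cur ch L roots) {u : ℕ}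
    (hu : u ∈ L) (hf : cur (vert u) = u) : (ch u).length = rank u := by
  simpa using congrArg List.length (h.ranks u hu hf)

theorem destroy {a : ℕ} (h : HollowHeap vert rank child next key cur ch L (a ::ₘ roots)) :
    HollowHeap vert rank child next key cur ch (L.erase a) (roots + (ch a : Multiset ℕ)) := by
  have ha := h.root_mem (Multiset.mem_cons_self a roots)
  refine ⟨?_, fun u hu => h.pos u (Finset.mem_of_mem_erase hu),
    fun u hu => h.linked u (Finset.mem_of_mem_erase hu),
    fun u hu => h.rank_lt u (Finset.mem_of_mem_erase hu),
    fun u hu => h.key_le u (Finset.mem_of_mem_erase hu),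
    fun u hu => h.weight u (Finset.mem_of_mem_erase hu),
    fun u hu => h.ranks u (Finset.mem_of_mem_erase hu)⟩
  have h₁ := h.forest
  rw [← Finset.add_sum_erase L _ ha, Multiset.cons_add] at h₁
  rw [Finset.erase_val, ← h₁, Multiset.erase_cons_head, add_assoc]

/-- This drop pays for moving the children of a destroyed root to the list of roots. -/
theorem hollowChildren_destroy {a : ℕ} (ha : a ∈ L) (hf : cur (vert a) ≠ a) :
    hollowChildren vert cur ch (L.erase a) + (ch a).length = hollowChildren vert cur ch L := by
  unfold hollowChildren
  rw [Finset.filter_erase, Finset.sum_erase_add]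
  simp [ha, hf]

/-- Equality of the ranks keeps the ranks of the children gapless: a child of rank `rank a` in front
of those of ranks `rank a - 1, …, 0` is what rank `rank a + 1` requires. Fullness is needed for `a`
only, whose list is extended. -/
theorem link {a b : ℕ} (h : HollowHeap vert rank child next key cur ch L (a ::ₘ b ::ₘ roots))
    (hr : rank a = rank b) (hk : key a ≤ key b) (hf : cur (vert a) = a) :
    HollowHeap vert (Function.update rank a (rank a + 1)) (Function.update child a b)
      (Function.update next b (child a)) key cur (Function.update ch a (b :: ch a)) L
      (a ::ₘ roots) := by
  have ha := h.root_mem (x := a) (by simp)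
  have hb := h.root_mem (x := b) (by simp)
  have hab : a ≠ b := by
    rintro rfl
    have := h.roots_nodup
    simp at this
  have hca : ∀ u ∈ L, a ∉ ch u := fun u hu => h.root_not_child hu (by simp)
  have hcb : ∀ u ∈ L, b ∉ ch u := fun u hu => h.root_not_child hu (by simp)
  have hrk : ∀ u ∈ L, ∀ c ∈ ch u, Function.update rank a (rank a + 1) c = rank c := by
    intro u hu c hc
    rw [Function.update_of_ne]
    rintro rfl
    exact hca u hu hc
  have hmap : ∀ u ∈ L, (ch u).map (Function.update rank a (rank a + 1)) = (ch u).map rank :=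
    fun u hu => List.map_congr_left (hrk u hu)
  have hra : (b :: ch a).map (Function.update rank a (rank a + 1))
      = (List.range (rank a + 1)).reverse := by
    rw [List.map_cons, hmap a ha, h.ranks a ha hf, Function.update_of_ne hab.symm, List.range_succ]
    simp [hr]
  refine ⟨?_, h.pos, fun u hu => ?_, fun u hu c hc => ?_, fun u hu c hc => ?_, fun u hu => ?_,
    fun u hu hfu => ?_⟩
  · rw [Finset.sum_congr rfl (g := fun u => (if u = a then {b} else 0) + (ch u : Multiset ℕ)),
      Finset.sum_add_distrib, Finset.sum_ite_eq' L a, if_pos ha, ← h.forest]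
    · simp only [← Multiset.singleton_add]
      abel
    · intro u _
      by_cases hu : u = a
      · subst hu
        rw [Function.update_self, if_pos rfl]
        rfl
      · simp [hu]
  · have hl := (h.linked u hu).congr (next' := Function.update next b (child a)) fun c hc => by
      rw [Function.update_of_ne]
      rintro rfl
      exact hcb u hu hc
    by_cases hua : u = a
    · subst hua
      rw [Function.update_self, Function.update_self]
      refine ⟨rfl, h.pos b hb, ?_⟩
      rwa [Function.update_self]
    · rwa [Function.update_of_ne hua, Function.update_of_ne hua]
  · by_cases hua : u = a
    · subst hua
      rw [Function.update_self] at hc ⊢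
      rcases List.mem_cons.1 hc with rfl | hc
      · rw [Function.update_of_ne hab.symm]; omega
      · rw [hrk u hu c hc]
        exact (h.rank_lt u hu c hc).trans (Nat.lt_succ_self _)
    · rw [Function.update_of_ne hua] at hc
      rw [Function.update_of_ne hua, hrk u hu c hc]
      exact h.rank_lt u hu c hc
  · by_cases hua : u = a
    · subst hua
      rw [Function.update_self] at hc
      rcases List.mem_cons.1 hc with rfl | hc
      · exact hk
      · exact h.key_le u hu c hc
    · rw [Function.update_of_ne hua] at hc
      exact h.key_le u hu c hc
  · by_cases hua : u = a
    · subst hua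
      rw [Function.update_self (f := ch)]
      exact two_pow_rank_le (by rw [hra, Function.update_self])
    · rw [Function.update_of_ne hua, Function.update_of_ne hua]
      have := h.weight u hu
      rwa [List.map_congr_left (g := fun c => 2 ^ (rank c / 2)) fun c hc => by rw [hrk u hu c hc]]
  · by_cases hua : u = a
    · subst hua
      rw [Function.update_self (f := ch), hra, Function.update_self]
    · rw [Function.update_of_ne hua, Function.update_of_ne hua, hmap u hu]
      exact h.ranks u hu hfu

theorem hollowChildren_update_of_full {a : ℕ} (hf : cur (vert a) = a) (l : List ℕ) :
    hollowChildren vert cur (Function.update ch a l) L = hollowChildren vert cur ch L := by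
  unfold hollowChildren
  refine Finset.sum_congr rfl fun u hu => ?_
  rw [Function.update_of_ne]
  rintro rfl
  exact (Finset.mem_filter.1 hu).2 hf

theorem insert (h : HollowHeap vert rank child next key cur ch L roots) {x v : ℕ} (k : ℝ)
    (hx : x ∉ L) (hx0 : x ≠ 0) :
    HollowHeap (Function.update vert x v) (Function.update rank x 0) (Function.update child x 0)
      next (Function.update key x k) (Function.update cur v x) (Function.update ch x [])
      (Insert.insert x L) (x ::ₘ roots) := by
  have hne : ∀ u ∈ L, u ≠ x := by rintro u hu rfl; exact hx hu
  have hnc : ∀ u ∈ L, ∀ c ∈ ch u, c ≠ x := fun u hu c hc => hne c (h.child_mem hu hc)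
  refine ⟨?_, fun u hu => ?_, fun u hu => ?_, fun u hu => ?_, fun u hu => ?_, fun u hu => ?_,
    fun u hu => ?_⟩
  · rw [Finset.sum_insert hx, Function.update_self, Finset.insert_val_of_notMem hx, ← h.forest,
      Finset.sum_congr rfl fun u hu => by rw [Function.update_of_ne (hne u hu)]]
    simp
  all_goals rcases Finset.mem_insert.1 hu with rfl | hu
  · exact hx0
  · exact h.pos u hu
  · rw [Function.update_self, Function.update_self]; rfl
  · rw [Function.update_of_ne (hne u hu), Function.update_of_ne (hne u hu)]
    exact h.linked u hu
  · simp
  · rw [Function.update_of_ne (hne u hu), Function.update_of_ne (hne u hu)]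
    intro c hc
    rw [Function.update_of_ne (hnc u hu c hc)]
    exact h.rank_lt u hu c hc
  · simp
  · rw [Function.update_of_ne (hne u hu), Function.update_of_ne (hne u hu)]
    intro c hc
    rw [Function.update_of_ne (hnc u hu c hc)]
    exact h.key_le u hu c hc
  · simp
  · rw [Function.update_of_ne (hne u hu), Function.update_of_ne (hne u hu)]
    rw [List.map_congr_left (g := fun c => 2 ^ (rank c / 2)) fun c hc => by
      rw [Function.update_of_ne (hnc u hu c hc)]]
    exact h.weight u hu
  · simp
  · intro hf
    rw [Function.update_of_ne (hne u hu)] at hf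
    -- An older node of the vertex `v` is no longer full, since the current node of `v` is now `x`.
    have : vert u ≠ v := by
      intro huv
      rw [huv, Function.update_self] at hf
      exact hne u hu hf.symm
    rw [Function.update_of_ne this] at hf
    rw [Function.update_of_ne (hne u hu), Function.update_of_ne (hne u hu),
      List.map_congr_left (g := rank) fun c hc => by rw [Function.update_of_ne (hnc u hu c hc)]]
    exact h.ranks u hu hf

theorem hollowChildren_insert (h : HollowHeap vert rank child next key cur ch L roots) {x v : ℕ}
    (hx : x ∉ L) (hv : cur v = 0) :
    hollowChildren (Function.update vert x v) (Function.update cur v x) (Function.update ch x [])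
      (Insert.insert x L) = hollowChildren vert cur ch L := by
  have hne : ∀ u ∈ L, u ≠ x := by rintro u hu rfl; exact hx hu
  unfold hollowChildren
  rw [Finset.filter_insert, if_neg (by simp)]
  rw [Finset.filter_congr (q := fun u => cur (vert u) ≠ u)]
  · refine Finset.sum_congr rfl fun u hu => ?_
    rw [Function.update_of_ne (hne u (Finset.mem_filter.1 hu).1)]
  · intro u hu
    rw [Function.update_of_ne (hne u hu)]
    by_cases huv : vert u = v
    · rw [huv, Function.update_self, hv]
      simp [(hne u hu).symm, (h.pos u hu).symm]
    · rw [Function.update_of_ne huv]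

/-- The key of the item in the node `u` decreases: `u` becomes hollow and keeps two children. -/
theorem decrease (h : HollowHeap vert rank child next key cur ch L roots) {x v u : ℕ} {k : ℝ}
    {child' next' : ℕ → ℕ}
    (hx : x ∉ L) (hx0 : x ≠ 0) (hu : u ∈ L) (hv : cur v = u) (huv : vert u = v) (hk : k ≤ key u)
    (hchild : ∀ y ∈ L, child' y = child y)
    (hnext : ∀ y ∈ L, y ∉ ch u → next' y = next y)
    (hlu : Linked next' (child u) ((ch u).take 2))
    (hlx : Linked next' (child' x) ((ch u).drop 2)) :
    HollowHeap (Function.update vert x v) (Function.update rank x (rank u - 2)) child'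
      next' (Function.update key x k) (Function.update cur v x)
      (Function.update (Function.update ch u ((ch u).take 2)) x ((ch u).drop 2))
      (Insert.insert x L) (x ::ₘ roots) := by
  have hne : ∀ u ∈ L, u ≠ x := by rintro u hu rfl; exact hx hu
  have hnc : ∀ u ∈ L, ∀ c ∈ ch u, c ≠ x := fun u hu c hc => hne c (h.child_mem hu hc)
  have hranks := h.ranks u hu (by rw [huv, hv])
  have hd : ((ch u).drop 2).map rank = (List.range (rank u - 2)).reverse := by
    rw [List.map_drop, hranks, List.drop_reverse, List.length_range, List.take_range]
    congr 2
    omega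
  have hsub : ∀ w ∈ L, ∀ c ∈ Function.update ch u ((ch u).take 2) w, c ∈ ch w := by
    intro w hw c hc
    by_cases hwu : w = u
    · subst hwu
      rw [Function.update_self] at hc
      exact List.mem_of_mem_take hc
    · rwa [Function.update_of_ne hwu] at hc
  have hdc : ∀ c ∈ (ch u).drop 2, c ∈ ch u := fun c hc => List.mem_of_mem_drop hc
  refine ⟨?_, fun w hw => ?_, fun w hw => ?_, fun w hw => ?_, fun w hw => ?_, fun w hw => ?_,
    fun w hw => ?_⟩
  · rw [Finset.sum_insert hx, Function.update_self, Finset.insert_val_of_notMem hx, ← h.forest,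
      Finset.sum_congr rfl fun w hw => by rw [Function.update_of_ne (hne w hw)],
      ← Finset.add_sum_erase L _ hu, ← Finset.add_sum_erase L _ hu, Function.update_self,
      Finset.sum_congr rfl fun w hw => by rw [Function.update_of_ne (Finset.ne_of_mem_erase hw)]]
    have : (ch u : Multiset ℕ) = ((ch u).take 2 : Multiset ℕ) + ((ch u).drop 2 : Multiset ℕ) := by
      rw [Multiset.coe_add, List.take_append_drop]
    rw [this]
    simp only [← Multiset.singleton_add]
    abel
  all_goals rcases Finset.mem_insert.1 hw with rfl | hw
  · exact hx0
  · exact h.pos w hw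
  · rw [Function.update_self]; exact hlx
  · rw [Function.update_of_ne (hne w hw), hchild w hw]
    by_cases hwu : w = u
    · subst hwu
      rwa [Function.update_self]
    · rw [Function.update_of_ne hwu]
      exact (h.linked w hw).congr fun c hc => hnext c (h.child_mem hw hc)
        fun hcu => hwu (h.parent_unique hw hu hc hcu)
  · rw [Function.update_self, Function.update_self]
    intro c hc
    rw [Function.update_of_ne (hnc u hu c (hdc c hc))]
    have : rank c ∈ ((ch u).drop 2).map rank := List.mem_map_of_mem hc
    rw [hd] at this
    simpa using this
  · rw [Function.update_of_ne (hne w hw), Function.update_of_ne (hne w hw)]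
    intro c hc
    rw [Function.update_of_ne (hnc w hw c (hsub w hw c hc))]
    exact h.rank_lt w hw c (hsub w hw c hc)
  · rw [Function.update_self, Function.update_self]
    intro c hc
    rw [Function.update_of_ne (hnc u hu c (hdc c hc))]
    exact hk.trans (h.key_le u hu c (hdc c hc))
  · rw [Function.update_of_ne (hne w hw), Function.update_of_ne (hne w hw)]
    intro c hc
    rw [Function.update_of_ne (hnc w hw c (hsub w hw c hc))]
    exact h.key_le w hw c (hsub w hw c hc)
  · rw [Function.update_self, Function.update_self,
      List.map_congr_left (g := fun c => 2 ^ (rank c / 2)) fun c hc => by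
      rw [Function.update_of_ne (hnc u hu c (hdc c hc))]]
    exact two_pow_rank_le hd
  · rw [Function.update_of_ne (hne w hw), Function.update_of_ne (hne w hw),
      List.map_congr_left (g := fun c => 2 ^ (rank c / 2)) fun c hc => by
      rw [Function.update_of_ne (hnc w hw c (hsub w hw c hc))]]
    by_cases hwu : w = u
    · subst hwu
      rw [Function.update_self]
      -- The hollow node keeps its rank `r`, so its remaining children, of ranks `r - 1` and `r -
      -- 2`, have to support the weight inequality alone. They do because each contributes at least
      -- `2 ^ (r / 2 - 1)`; this is why exactly two children stay.
      have ht : ((ch w).take 2).map (fun c => 2 ^ (rank c / 2))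
          = (((List.range (rank w)).reverse).take 2).map fun j => 2 ^ (j / 2) := by
        rw [← hranks, ← List.map_take, List.map_map]
        rfl
      rw [ht]
      rcases hr : rank w with _ | _ | r
      · simp
      · simp
      · simp only [List.range_succ, List.reverse_append, List.reverse_cons, List.reverse_nil,
          List.nil_append, List.cons_append, List.take_succ_cons, List.take_zero, List.map_cons,
          List.map_nil, List.sum_cons, List.sum_nil]
        have h₁ : (r + 1 + 1) / 2 = r / 2 + 1 := by omega
        have h₂ : 2 ^ (r / 2) ≤ 2 ^ ((r + 1) / 2) := Nat.pow_le_pow_right (by norm_num) (by omega)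
        rw [h₁, pow_succ]
        omega
    · rw [Function.update_of_ne hwu]
      exact h.weight w hw
  · intro _
    rw [Function.update_self, Function.update_self, ← hd]
    exact List.map_congr_left fun c hc => Function.update_of_ne (hnc u hu c (hdc c hc)) _ _
  · intro hf
    rw [Function.update_of_ne (hne w hw)] at hf
    have hwv : vert w ≠ v := by
      intro hwv
      rw [hwv, Function.update_self] at hf
      exact hne w hw hf.symm
    rw [Function.update_of_ne hwv] at hf
    have hwu : w ≠ u := by rintro rfl; exact hwv huv
    rw [Function.update_of_ne (hne w hw), Function.update_of_ne (hne w hw),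
      Function.update_of_ne hwu,
      List.map_congr_left (g := rank) fun c hc => by rw [Function.update_of_ne (hnc w hw c hc)]]
    exact h.ranks w hw hf

/-- Only `u` becomes hollow, and at most two children stay with it; the new node that receives the
others is full. -/
theorem hollowChildren_decrease {x v u : ℕ}
    (hx : x ∉ L) (hu : u ∈ L) (hv : cur v = u) (huv : vert u = v) :
    hollowChildren (Function.update vert x v) (Function.update cur v x)
      (Function.update (Function.update ch u ((ch u).take 2)) x ((ch u).drop 2))
      (Insert.insert x L) ≤ hollowChildren vert cur ch L + 2 := by
  have hne : ∀ u ∈ L, u ≠ x := by rintro u hu rfl; exact hx hu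
  unfold hollowChildren
  rw [Finset.filter_insert, if_neg (by simp)]
  have : (L.filter fun w => Function.update cur v x (Function.update vert x v w) ≠ w)
      ⊆ Insert.insert u (L.filter fun w => cur (vert w) ≠ w) := by
    intro w hw
    obtain ⟨hwL, hw⟩ := Finset.mem_filter.1 hw
    by_cases hwu : w = u
    · simp [hwu]
    · refine Finset.mem_insert_of_mem (Finset.mem_filter.2 ⟨hwL, ?_⟩)
      rw [Function.update_of_ne (hne w hwL)] at hw
      by_cases hwv : vert w = v
      · rw [hwv, hv]; exact fun h => hwu h.symm
      · rwa [Function.update_of_ne hwv] at hw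
  refine (Finset.sum_le_sum_of_subset this).trans ?_
  rw [Finset.sum_insert (by simp [hv, huv]), Function.update_of_ne (hne u hu), Function.update_self,
    add_comm]
  refine Nat.add_le_add (le_of_eq ?_) (by simp)
  refine Finset.sum_congr rfl fun w hw => ?_
  obtain ⟨hwL, hw⟩ := Finset.mem_filter.1 hw
  rw [Function.update_of_ne (hne w hwL), Function.update_of_ne]
  rintro rfl
  exact hw (by rw [huv, hv])

theorem extract (h : HollowHeap vert rank child next key cur ch L roots) {v : ℕ} :
    HollowHeap vert rank child next key (Function.update cur v 0) ch L roots := by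
  refine ⟨h.forest, h.pos, h.linked, h.rank_lt, h.key_le, h.weight, fun u hu hf => ?_⟩
  refine h.ranks u hu ?_
  by_cases huv : vert u = v
  · rw [huv, Function.update_self] at hf
    exact absurd hf.symm (h.pos u hu)
  · rwa [Function.update_of_ne huv] at hf

/-- The node of the extracted item turns hollow with all its children, which are as many as its
rank. This is the logarithmic cost of an extraction. -/
theorem hollowChildren_extract (h : HollowHeap vert rank child next key cur ch L roots) {v u : ℕ}
    (hu : u ∈ L) (hv : cur v = u) (huv : vert u = v) :
    hollowChildren vert (Function.update cur v 0) ch L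
      ≤ hollowChildren vert cur ch L + rank u := by
  unfold hollowChildren
  have : (L.filter fun w => Function.update cur v 0 (vert w) ≠ w)
      ⊆ Insert.insert u (L.filter fun w => cur (vert w) ≠ w) := by
    intro w hw
    obtain ⟨hwL, hw⟩ := Finset.mem_filter.1 hw
    by_cases hwu : w = u
    · simp [hwu]
    · refine Finset.mem_insert_of_mem (Finset.mem_filter.2 ⟨hwL, ?_⟩)
      by_cases hwv : vert w = v
      · rw [hwv, hv]; exact fun h => hwu h.symm
      · rwa [Function.update_of_ne hwv] at hw
  refine (Finset.sum_le_sum_of_subset this).trans ?_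
  rw [Finset.sum_insert (by simp [hv, huv]), h.length_children hu (by rw [huv, hv]), add_comm]

end HollowHeap

namespace RealRAM

/-! ### Adjacency lists -/

/-- `q - 1` is the last index below `p` at which `src` takes the value `u`; `q = 0` if there is
none. -/
structure IsLast (src : ℕ → ℕ) (q p u : ℕ) : Prop where
  le : q ≤ p
  ne : ∀ a, q ≤ a → a < p → src a ≠ u
  eq : q ≠ 0 → src (q - 1) = u

/-- Builds the lists of outgoing arcs: word array 2 holds the heads, word array 3 the links. -/
def buildAdjacency : Program :=
  .seq (.wset 3 (.const 0)) <|
  .loop (.wlt (.var 3) (.var 1)) <|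
    .seq (.wstore 3 (.var 3) (.arr 2 (.arr 0 (.var 3)))) <|
    .seq (.wstore 2 (.arr 0 (.var 3)) (.add (.var 3) (.const 1))) <|
    .wset 3 (.add (.var 3) (.const 1))

theorem wp_buildAdjacency {W : ℕ} {s : State} (hW : s.wv 1 < W) (h₀ : ∀ u, s.wa 2 u = 0) :
    buildAdjacency.wp W (fun k s' => k ≤ 20 * s.wv 1 + 20 ∧
      (∀ u, IsLast (s.wa 0) (s'.wa 2 u) (s.wv 1) u) ∧
      ∀ a < s.wv 1, IsLast (s.wa 0) (s'.wa 3 a) a (s.wa 0 a)) s := by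
  refine ⟨by simp, ?_⟩
  refine Program.wp_loop
    (fun t => t.wv 3 ≤ s.wv 1 ∧ (∀ u, IsLast (s.wa 0) (t.wa 2 u) (t.wv 3) u) ∧
      ∀ a < t.wv 3, IsLast (s.wa 0) (t.wa 3 a) a (s.wa 0 a))
    (fun t => 20 * (s.wv 1 - t.wv 3)) ?_ ?_ ?_ ?_
  · refine ⟨by simp, fun u => ?_, by simp⟩
    simp only [State.setW_wa, h₀]
    exact ⟨Nat.zero_le _, by simp, by simp⟩
  · intros; simp
  · rintro t hF hB ⟨h₁, h₂, h₃⟩ hb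
    have f1 : t.wv 1 = s.wv 1 := (hF.wv 1 (by decide)).trans (by simp)
    have f0 : t.wa 0 = s.wa 0 := (hF.wa 0 (by decide)).trans (by simp)
    simp only [Test.Holds, WExp.eval, f1] at hb
    simp [Program.wp, f0]
    refine ⟨by omega, ⟨by omega, fun u => ?_, fun a ha => ?_⟩, by omega⟩
    · rw [Function.update_apply]
      split_ifs with hu
      · subst hu
        exact ⟨le_rfl, fun a h h' => by omega, fun _ => rfl⟩
      · refine ⟨(h₂ u).le.trans (Nat.le_succ _), fun a h h' => ?_, (h₂ u).eq⟩
        rcases Nat.lt_succ_iff_lt_or_eq.1 h' with h' | rfl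
        · exact (h₂ u).ne a h h'
        · exact fun e => hu e.symm
    · rw [Function.update_apply]
      split_ifs with hu
      · subst hu
        exact h₂ _
      · exact h₃ a (by omega)
  · rintro k t hF hB ⟨h₁, h₂, h₃⟩ hb hk
    have f1 : t.wv 1 = s.wv 1 := (hF.wv 1 (by decide)).trans (by simp)
    simp only [Test.Holds, WExp.eval, f1] at hb
    have h4 : t.wv 3 = s.wv 1 := by omega
    rw [h4] at h₂ h₃
    simp at hk
    simp
    exact ⟨by omega, h₂, h₃⟩

/-! ### The consolidation of a hollow heap -/

/-- The nodes on the stack. -/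
def stackNodes (stk : ℕ → ℕ) (sp : ℕ) : Multiset ℕ := (Multiset.range sp).map stk

/-- The nodes in the slots. -/
def slotNodes (slot : ℕ → ℕ) (B : ℕ) : Multiset ℕ :=
  ∑ j ∈ Finset.range B, if slot j = 0 then 0 else {slot j}

theorem stackNodes_push (stk : ℕ → ℕ) (sp a : ℕ) :
    stackNodes (Function.update stk sp a) (sp + 1) = a ::ₘ stackNodes stk sp := by
  unfold stackNodes
  rw [Multiset.range_succ, Multiset.map_cons, Function.update_self]
  congr 1
  refine Multiset.map_congr rfl fun x hx => ?_
  rw [Multiset.mem_range] at hx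
  rw [Function.update_of_ne hx.ne]

theorem stackNodes_pop (stk : ℕ → ℕ) {sp : ℕ} (h : sp ≠ 0) :
    stackNodes stk sp = stk (sp - 1) ::ₘ stackNodes stk (sp - 1) := by
  obtain ⟨sp, rfl⟩ := Nat.exists_eq_succ_of_ne_zero h
  simp [stackNodes, Multiset.range_succ]

theorem card_stackNodes (stk : ℕ → ℕ) (sp : ℕ) : Multiset.card (stackNodes stk sp) = sp := by
  simp [stackNodes]

theorem slotNodes_fill {slot : ℕ → ℕ} {B j a : ℕ} (hj : j < B) (h : slot j = 0) (ha : a ≠ 0) :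
    slotNodes (Function.update slot j a) B = a ::ₘ slotNodes slot B := by
  unfold slotNodes
  rw [← Finset.add_sum_erase _ _ (Finset.mem_range.2 hj),
    ← Finset.add_sum_erase (Finset.range B) (fun j => if slot j = 0 then 0 else {slot j})
      (Finset.mem_range.2 hj)]
  rw [Function.update_self, if_neg ha, if_pos h, zero_add, Multiset.singleton_add]
  congr 1
  refine Finset.sum_congr rfl fun i hi => ?_
  rw [Function.update_of_ne (Finset.ne_of_mem_erase hi)]

theorem slotNodes_clear {slot : ℕ → ℕ} {B j : ℕ} (hj : j < B) (h : slot j ≠ 0) :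
    slotNodes slot B = slot j ::ₘ slotNodes (Function.update slot j 0) B := by
  have := slotNodes_fill (slot := Function.update slot j 0) hj (by simp) h
  rwa [Function.update_idem, Function.update_eq_self] at this

theorem mem_slotNodes {slot : ℕ → ℕ} {B a : ℕ} :
    a ∈ slotNodes slot B ↔ ∃ j < B, slot j = a ∧ a ≠ 0 := by
  simp only [slotNodes, Multiset.mem_sum, Finset.mem_range]
  refine exists_congr fun j => and_congr_right fun _ => ?_
  split_ifs with h
  · simp [h]; tauto
  · simp only [Multiset.mem_singleton]
    constructor
    · rintro rfl; exact ⟨rfl, h⟩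
    · rintro ⟨rfl, -⟩; rfl

theorem card_slotNodes_le (slot : ℕ → ℕ) (B : ℕ) : Multiset.card (slotNodes slot B) ≤ B := by
  unfold slotNodes
  rw [Multiset.card_sum]
  refine (Finset.sum_le_card_nsmul _ _ 1 fun j _ => ?_).trans (by simp)
  split_ifs <;> simp

theorem slotNodes_eq_zero {slot : ℕ → ℕ} {B : ℕ} (h : ∀ j, slot j = 0) : slotNodes slot B = 0 := by
  simp [slotNodes, h]

/-- Word variables: 4 number of nodes, 5 height of the stack, 6 bound of the ranks. Word arrays:
5 current node of a vertex, 8 vertex of a node, 9 rank, 10 first child, 11 next sibling, 12 slots,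
13 stack. Real array 2: keys. -/
structure HeapInv (B : ℕ) (s : State) (ch : ℕ → List ℕ) (L : Finset ℕ) : Prop where
  heap : HollowHeap (s.wa 8) (s.wa 9) (s.wa 10) (s.wa 11) (s.ra 2) (s.wa 5) ch L
    (stackNodes (s.wa 13) (s.wv 5) + slotNodes (s.wa 12) B)
  le_cnt : ∀ u ∈ L, u ≤ s.wv 4
  slot : ∀ j, s.wa 12 j ≠ 0 →
    j ≤ s.wv 6 ∧ s.wa 9 (s.wa 12 j) = j ∧ s.wa 5 (s.wa 8 (s.wa 12 j)) = s.wa 12 j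
  rank_le : ∀ u ∈ L, s.wa 9 u ≤ s.wv 6
  cur : ∀ v, s.wa 5 v ≠ 0 → s.wa 5 v ∈ L ∧ s.wa 8 (s.wa 5 v) = v
  lt : s.wv 6 < B

/-- The potential of a heap. -/
def heapPotential (B : ℕ) (s : State) (ch : ℕ → List ℕ) (L : Finset ℕ) : ℕ :=
  200 * s.wv 5 + 100 * Multiset.card (slotNodes (s.wa 12) B) +
    300 * hollowChildren (s.wa 8) (s.wa 5) ch L

theorem HeapInv.card_le {B : ℕ} {s : State} {ch : ℕ → List ℕ} {L : Finset ℕ}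
    (h : HeapInv B s ch L) : L.card ≤ s.wv 4 := by
  have : L ⊆ Finset.Icc 1 (s.wv 4) := fun u hu =>
    Finset.mem_Icc.2 ⟨Nat.one_le_iff_ne_zero.2 (h.heap.pos u hu), h.le_cnt u hu⟩
  simpa using Finset.card_le_card this

def pushChildren : Program :=
  .loop (.neg (.weq (.var 3) (.const 0))) <|
    .seq (.wstore 13 (.var 5) (.var 3)) <|
    .seq (.wset 5 (.add (.var 5) (.const 1))) <|
    .wset 3 (.arr 11 (.var 3))

/-- The part of the linked list that is still ahead is not a function of the state, so it is carried
as a ghost; its length is the potential. -/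
theorem wp_pushChildren {W : ℕ} {s : State} {l : List ℕ} (hl : Linked (s.wa 11) (s.wv 3) l)
    (hW : s.wv 5 + l.length ≤ W) (hW' : 1 ≤ W) :
    pushChildren.wp W (fun k s' => k ≤ 20 * l.length + 10 ∧
      stackNodes (s'.wa 13) (s'.wv 5) = stackNodes (s.wa 13) (s.wv 5) + l ∧
      s'.wv 5 = s.wv 5 + l.length) s := by
  refine Program.wp_loop_ghost
    (fun φ t => ∃ l' : List ℕ, φ = 20 * l'.length ∧ Linked (s.wa 11) (t.wv 3) l' ∧
      stackNodes (t.wa 13) (t.wv 5) + l' = stackNodes (s.wa 13) (s.wv 5) + l ∧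
      t.wv 5 + l'.length = s.wv 5 + l.length) (20 * l.length) ⟨l, rfl, hl, rfl, rfl⟩ ?_ ?_ ?_
  · intros; simp
  · rintro φ t hF hB ⟨l', rfl, h₁, h₂, h₃⟩ hb
    have f11 : t.wa 11 = s.wa 11 := hF.wa 11 (by decide)
    rcases l' with _ | ⟨c, l'⟩
    · exact absurd (show t.wv 3 = 0 from h₁) (by simpa using hb)
    · obtain ⟨rfl, hc0, h₁⟩ := h₁
      simp only [List.length_cons] at h₃
      simp [Program.wp, f11]
      refine ⟨by omega, l', ⟨h₁, ?_, by omega⟩, by omega⟩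
      rw [stackNodes_push, ← h₂, ← Multiset.cons_coe, Multiset.cons_add, Multiset.add_cons]
  · rintro k φ t hF hB ⟨l', rfl, h₁, h₂, h₃⟩ hb hk
    have h0 : t.wv 3 = 0 := by simpa using hb
    rcases l' with _ | ⟨c, l'⟩
    · simp at h₂ h₃ hk
      exact ⟨by omega, h₂, h₃⟩
    · exact absurd h₁.1.symm (by rw [h0]; exact h₁.2.1)

/-- Links the roots 9 and 10, where 9 has the smaller key, and puts the result on the stack. -/
def linkRoots : Program :=
  .seq (.wstore 11 (.var 10) (.arr 10 (.var 9))) <|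
  .seq (.wstore 10 (.var 9) (.var 10)) <|
  .seq (.wstore 9 (.var 9) (.add (.arr 9 (.var 9)) (.const 1))) <|
  .seq (.wstore 13 (.var 5) (.var 9)) <|
  .seq (.wset 5 (.add (.var 5) (.const 1))) <|
  .ite (.wlt (.var 6) (.arr 9 (.var 9))) (.wset 6 (.arr 9 (.var 9))) .skip

def consolidateStep : Program :=
  .seq (.wset 5 (.sub (.var 5) (.const 1))) <|
  .seq (.wset 9 (.arr 13 (.var 5))) <|
  .ite (.neg (.weq (.arr 5 (.arr 8 (.var 9))) (.var 9)))
    (.seq (.wset 3 (.arr 10 (.var 9))) pushChildren) <|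
  .seq (.wset 10 (.arr 12 (.arr 9 (.var 9)))) <|
  .ite (.weq (.var 10) (.const 0))
    (.wstore 12 (.arr 9 (.var 9)) (.var 9)) <|
  .seq (.wstore 12 (.arr 9 (.var 9)) (.const 0)) <|
  .ite (.rlt (.arr 2 (.var 10)) (.arr 2 (.var 9)))
    (.seq (.wset 3 (.var 9)) (.seq (.wset 9 (.var 10)) (.seq (.wset 10 (.var 3)) linkRoots)))
    linkRoots

def consolidate : Program :=
  .loop (.neg (.weq (.var 5) (.const 0))) consolidateStep

theorem wp_linkRoots {W B : ℕ} {s : State} {ch : ℕ → List ℕ} {L : Finset ℕ}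
    (hB : ∀ r, 2 ^ (r / 2) ≤ s.wv 4 → r < B) (hW : s.wv 4 < W) (hBW : B ≤ W)
    (heap : HollowHeap (s.wa 8) (s.wa 9) (s.wa 10) (s.wa 11) (s.ra 2) (s.wa 5) ch L
      (s.wv 9 ::ₘ s.wv 10 ::ₘ (stackNodes (s.wa 13) (s.wv 5) + slotNodes (s.wa 12) B)))
    (hr : s.wa 9 (s.wv 9) = s.wa 9 (s.wv 10)) (hk : s.ra 2 (s.wv 9) ≤ s.ra 2 (s.wv 10))
    (hf : s.wa 5 (s.wa 8 (s.wv 9)) = s.wv 9)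
    (le_cnt : ∀ u ∈ L, u ≤ s.wv 4)
    (slot : ∀ j, s.wa 12 j ≠ 0 →
      j ≤ s.wv 6 ∧ s.wa 9 (s.wa 12 j) = j ∧ s.wa 5 (s.wa 8 (s.wa 12 j)) = s.wa 12 j)
    (rank_le : ∀ u ∈ L, s.wa 9 u ≤ s.wv 6)
    (cur : ∀ v, s.wa 5 v ≠ 0 → s.wa 5 v ∈ L ∧ s.wa 8 (s.wa 5 v) = v)
    (lt : s.wv 6 < B) :
    linkRoots.wp W (fun k s' => k ≤ 40 ∧ ∃ ch', HeapInv B s' ch' L ∧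
      heapPotential B s' ch' L = 200 * s.wv 5 + 200 + 100 * Multiset.card (slotNodes (s.wa 12) B) +
        300 * hollowChildren (s.wa 8) (s.wa 5) ch L) s := by
  have hlink := heap.link hr hk hf
  have haL := heap.root_mem (x := s.wv 9) (by simp)
  have hcard : L.card ≤ s.wv 4 := by
    have : L ⊆ Finset.Icc 1 (s.wv 4) := fun u hu =>
      Finset.mem_Icc.2 ⟨Nat.one_le_iff_ne_zero.2 (heap.pos u hu), le_cnt u hu⟩
    simpa using Finset.card_le_card this
  have hsp := heap.card_roots_le
  simp only [Multiset.card_cons, Multiset.card_add, card_stackNodes] at hsp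
  have hra := rank_le _ haL
  -- The heap after the link obeys the rank bound as well, so the increased rank still is the index
  -- of a slot.
  have hnew : s.wa 9 (s.wv 9) + 1 < B := by
    have := hlink.two_pow_le (a := s.wv 9) (by simp)
    rw [Function.update_self] at this
    exact hB _ (this.trans hcard)
  -- The nodes in the slots are roots and roots are distinct, so the node whose rank changes is in
  -- no slot.
  have hns : ∀ j, s.wa 12 j ≠ 0 → s.wa 12 j ≠ s.wv 9 := by
    intro j hj he
    have hmem : s.wv 9 ∈ slotNodes (s.wa 12) B :=
      mem_slotNodes.2 ⟨j, (slot j hj).1.trans_lt lt, he, by rwa [← he]⟩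
    have hnd := heap.roots_nodup
    rw [Multiset.nodup_cons] at hnd
    exact hnd.1 (by simp [hmem])
  simp [linkRoots, Program.wp]
  refine ⟨by omega, by omega, fun hlt => ?_, fun hlt => ?_⟩
  · refine ⟨Function.update ch (s.wv 9) (s.wv 10 :: ch (s.wv 9)), ⟨?_, ?_, ?_, ?_, ?_, ?_⟩, ?_⟩
    · simp
      rw [stackNodes_push, Multiset.cons_add]
      exact hlink
    · simpa using le_cnt
    · intro j hj
      simp at hj ⊢
      rw [Function.update_of_ne (hns j hj)]
      obtain ⟨h₁, h₂, h₃⟩ := slot j hj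
      exact ⟨by omega, h₂, h₃⟩
    · intro u hu
      simp [Function.update_apply]
      have := rank_le u hu
      split_ifs <;> omega
    · simpa using cur
    · simpa using hnew
    · simp [heapPotential, HollowHeap.hollowChildren_update_of_full hf]
      ring
  · refine ⟨Function.update ch (s.wv 9) (s.wv 10 :: ch (s.wv 9)), ⟨?_, ?_, ?_, ?_, ?_, ?_⟩, ?_⟩
    · simp
      rw [stackNodes_push, Multiset.cons_add]
      exact hlink
    · simpa using le_cnt
    · intro j hj
      simp at hj ⊢
      rw [Function.update_of_ne (hns j hj)]
      exact slot j hj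
    · intro u hu
      simp [Function.update_apply]
      have := rank_le u hu
      split_ifs <;> omega
    · simpa using cur
    · simpa using lt
    · simp [heapPotential, HollowHeap.hollowChildren_update_of_full hf]
      ring

/-- In each case the potential drops by at least 100, more than the steps taken. A hollow root gives
back 200 for itself and 300 for each child, and each child needs 200 on the stack. A full root that
finds its slot free goes from 200 to 100. A link frees the 100 of the occupied slot, while the
winner returns to the stack. -/
theorem wp_consolidateStep {W B : ℕ} {s : State} {ch : ℕ → List ℕ} {L : Finset ℕ}
    (hB : ∀ r, 2 ^ (r / 2) ≤ s.wv 4 → r < B) (hW : s.wv 4 < W) (hBW : B ≤ W)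
    (h : HeapInv B s ch L) (hsp : s.wv 5 ≠ 0) :
    consolidateStep.wp W (fun k s' => ∃ ch' L', HeapInv B s' ch' L' ∧
      k + 10 + heapPotential B s' ch' L' ≤ heapPotential B s ch L) s := by
  have hpop := stackNodes_pop (s.wa 13) hsp
  have heap := h.heap
  rw [hpop, Multiset.cons_add] at heap
  set a := s.wa 13 (s.wv 5 - 1) with ha
  have haL : a ∈ L := heap.root_mem (by simp)
  have hcard := h.card_le
  have hroots := heap.card_roots_le
  simp only [Multiset.card_cons, Multiset.card_add, card_stackNodes] at hroots
  simp [consolidateStep, Program.wp, ← ha]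
  refine ⟨by omega, fun hb => ?_, fun hb => ⟨fun hz => ?_, fun hz => ?_⟩⟩
  · have hd := heap.destroy
    have hcr := hd.card_roots_le
    have hle := Finset.card_le_card (Finset.erase_subset a L)
    simp only [Multiset.card_add, card_stackNodes, Multiset.coe_card] at hcr
    refine Program.wp_mono (Program.wp_frame (wp_pushChildren (l := ch a) ?_ ?_ ?_)) ?_
    · simpa [← ha] using h.heap.linked a haL
    · simp; omega
    · omega
    · rintro k t ⟨⟨hk, h₁, h₂⟩, hF⟩
      simp at h₁ h₂
      have e4 : t.wv 4 = s.wv 4 := (hF.wv 4 (by decide)).trans (by simp)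
      have e6 : t.wv 6 = s.wv 6 := (hF.wv 6 (by decide)).trans (by simp)
      have e5 : t.wa 5 = s.wa 5 := (hF.wa 5 (by decide)).trans (by simp)
      have e8 : t.wa 8 = s.wa 8 := (hF.wa 8 (by decide)).trans (by simp)
      have e9 : t.wa 9 = s.wa 9 := (hF.wa 9 (by decide)).trans (by simp)
      have e10 : t.wa 10 = s.wa 10 := (hF.wa 10 (by decide)).trans (by simp)
      have e11 : t.wa 11 = s.wa 11 := (hF.wa 11 (by decide)).trans (by simp)
      have e12 : t.wa 12 = s.wa 12 := (hF.wa 12 (by decide)).trans (by simp)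
      have r2 : t.ra 2 = s.ra 2 := (hF.ra 2 (by decide)).trans (by simp)
      have hpot := HollowHeap.hollowChildren_destroy (ch := ch) haL hb
      refine ⟨ch, L.erase a, ⟨?_, ?_, ?_, ?_, ?_, ?_⟩, ?_⟩
      · rw [e5, e8, e9, e10, e11, e12, r2, h₁, add_right_comm]
        exact hd
      · rw [e4]; exact fun u hu => h.le_cnt u (Finset.mem_of_mem_erase hu)
      · rw [e12, e9, e5, e8, e6]; exact h.slot
      · rw [e9, e6]; exact fun u hu => h.rank_le u (Finset.mem_of_mem_erase hu)
      · rw [e5, e8]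
        intro v hv
        -- The destroyed node is nobody's current node, otherwise it would be full.
        refine ⟨Finset.mem_erase.2 ⟨?_, (h.cur v hv).1⟩, (h.cur v hv).2⟩
        intro he
        exact hb (by rw [← he, (h.cur v hv).2])
      · rw [e6]; exact h.lt
      · simp only [heapPotential, h₂, e12, e8, e5]
        omega
  · have hrB : s.wa 9 a < B := (h.rank_le a haL).trans_lt h.lt
    have ha0 := h.heap.pos a haL
    have hfill := slotNodes_fill hrB hz ha0
    refine ⟨ch, L, ⟨?_, ?_, ?_, ?_, ?_, ?_⟩, ?_⟩
    · simp
      rw [hfill, Multiset.add_cons]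
      exact heap
    · simpa using h.le_cnt
    · intro j hj
      simp at hj ⊢
      by_cases hja : j = s.wa 9 a
      · subst hja
        simp [hb, h.rank_le a haL]
      · rw [Function.update_of_ne hja] at hj ⊢
        exact h.slot j hj
    · simpa using h.rank_le
    · simpa using h.cur
    · simpa using h.lt
    · simp [heapPotential, hfill]
      omega
  · have hrB : s.wa 9 a < B := (h.rank_le a haL).trans_lt h.lt
    have hclear := slotNodes_clear hrB hz
    obtain ⟨hs₁, hs₂, hs₃⟩ := h.slot _ hz
    obtain ⟨b, hb'⟩ : ∃ b, s.wa 12 (s.wa 9 a) = b := ⟨_, rfl⟩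
    have hne : ∀ j, Function.update (s.wa 12) (s.wa 9 a) 0 j ≠ 0 → s.wa 12 j ≠ 0 := by
      intro j
      rw [Function.update_apply]
      split_ifs <;> simp
    have hupd : ∀ j, Function.update (s.wa 12) (s.wa 9 a) 0 j ≠ 0 →
        Function.update (s.wa 12) (s.wa 9 a) 0 j = s.wa 12 j := by
      intro j
      rw [Function.update_apply]
      split_ifs <;> simp
    have hcs : Multiset.card (slotNodes (s.wa 12) B)
        = Multiset.card (slotNodes (Function.update (s.wa 12) (s.wa 9 a) 0) B) + 1 := by
      rw [hclear, Multiset.card_cons]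
    have heap' : HollowHeap (s.wa 8) (s.wa 9) (s.wa 10) (s.wa 11) (s.ra 2) (s.wa 5) ch L
        (a ::ₘ b ::ₘ (stackNodes (s.wa 13) (s.wv 5 - 1) +
          slotNodes (Function.update (s.wa 12) (s.wa 9 a) 0) B)) := by
      rw [hclear, hb', Multiset.add_cons] at heap
      exact heap
    rw [hb'] at hs₂ hs₃ hz ⊢
    refine ⟨fun hlt => ?_, fun hlt => ?_⟩
    · refine Program.wp_mono (wp_linkRoots (B := B) (ch := ch) (L := L) ?_ ?_ hBW
        ?_ ?_ ?_ ?_ ?_ ?_ ?_ ?_ ?_) ?_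
      · simpa using hB
      · simpa using hW
      · simp
        rw [Multiset.cons_swap]
        exact heap'
      · simp [hs₂]
      · simp [hlt.le]
      · simp [hs₃]
      · simpa using h.le_cnt
      · intro j hj
        simp at hj ⊢
        have := h.slot j (hne j hj)
        rw [hupd j hj]
        exact this
      · simpa using h.rank_le
      · simpa using h.cur
      · simpa using h.lt
      · rintro k t ⟨hk, ch', hI, hp⟩
        refine ⟨ch', L, hI, ?_⟩
        rw [hp]
        simp [heapPotential, hcs]
        omega
    · refine Program.wp_mono (wp_linkRoots (B := B) (ch := ch) (L := L) ?_ ?_ hBW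
        ?_ ?_ ?_ ?_ ?_ ?_ ?_ ?_ ?_) ?_
      · simpa using hB
      · simpa using hW
      · simpa using heap'
      · simp [hs₂]
      · simp [hlt]
      · simp [hb]
      · simpa using h.le_cnt
      · intro j hj
        simp at hj ⊢
        have := h.slot j (hne j hj)
        rw [hupd j hj]
        exact this
      · simpa using h.rank_le
      · simpa using h.cur
      · simpa using h.lt
      · rintro k t ⟨hk, ch', hI, hp⟩
        refine ⟨ch', L, hI, ?_⟩
        rw [hp]
        simp [heapPotential, hcs]
        omega

theorem wp_consolidate {W B : ℕ} {s : State} {ch : ℕ → List ℕ} {L : Finset ℕ}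
    (hB : ∀ r, 2 ^ (r / 2) ≤ s.wv 4 → r < B) (hW : s.wv 4 < W) (hBW : B ≤ W)
    (h : HeapInv B s ch L) :
    consolidate.wp W (fun k s' => ∃ ch' L', HeapInv B s' ch' L' ∧ s'.wv 5 = 0 ∧
      k + heapPotential B s' ch' L' ≤ heapPotential B s ch L + 10) s := by
  refine Program.wp_loop_ghost
    (fun φ t => ∃ ch' L', HeapInv B t ch' L' ∧ φ = heapPotential B t ch' L')
    (heapPotential B s ch L) ⟨ch, L, h, rfl⟩ ?_ ?_ ?_
  · intros; simp
  · rintro φ t hF - ⟨ch', L', hI, rfl⟩ hb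
    have e4 : t.wv 4 = s.wv 4 := hF.wv 4 (by decide)
    refine Program.wp_mono (wp_consolidateStep (by rwa [e4]) (by rwa [e4]) hBW hI (by simpa using hb)) ?_
    rintro k t' ⟨ch'', L'', hI', hp⟩
    refine ⟨_, ⟨ch'', L'', hI', rfl⟩, ?_⟩
    simp
    omega
  · rintro k φ t hF - ⟨ch', L', hI, rfl⟩ hb hk
    refine ⟨ch', L', hI, by simpa using hb, ?_⟩
    simp at hk
    omega

end RealRAM

namespace RealRAM

/-! ### Finding the minimum -/

/-- Moves the nodes from the slots to the stack and sets the word variable 13 to one of minimum key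
(0 if there is none). -/
def findMin : Program :=
  .seq (.wset 12 (.const 0)) <|
  .seq (.wset 13 (.const 0)) <|
  .loop (.neg (.wlt (.var 6) (.var 12))) <|
    .seq (.wset 9 (.arr 12 (.var 12))) <|
    .seq
      (.ite (.weq (.var 9) (.const 0)) .skip <|
        .seq (.wstore 13 (.var 5) (.var 9)) <|
        .seq (.wset 5 (.add (.var 5) (.const 1))) <|
        .seq (.wstore 12 (.var 12) (.const 0)) <|
        .ite (.or (.weq (.var 13) (.const 0)) (.rlt (.arr 2 (.var 9)) (.arr 2 (.var 13))))
          (.wset 13 (.var 9)) .skip) <|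
    .wset 12 (.add (.var 12) (.const 1))

theorem HeapInv.congr {B : ℕ} {s t : State} {ch : ℕ → List ℕ} {L : Finset ℕ}
    (h : HeapInv B s ch L) (e4 : t.wv 4 = s.wv 4) (e5 : t.wv 5 = s.wv 5) (e6 : t.wv 6 = s.wv 6)
    (a5 : t.wa 5 = s.wa 5) (a8 : t.wa 8 = s.wa 8) (a9 : t.wa 9 = s.wa 9) (a10 : t.wa 10 = s.wa 10)
    (a11 : t.wa 11 = s.wa 11) (a12 : t.wa 12 = s.wa 12) (a13 : t.wa 13 = s.wa 13)
    (r2 : t.ra 2 = s.ra 2) : HeapInv B t ch L := by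
  obtain ⟨h₁, h₂, h₃, h₄, h₅, h₆⟩ := h
  rw [← e5, ← a5, ← a8, ← a9, ← a10, ← a11, ← a12, ← a13, ← r2] at h₁
  rw [← e4] at h₂
  rw [← e6, ← a5, ← a8, ← a9, ← a12] at h₃
  rw [← e6, ← a9] at h₄
  rw [← a5, ← a8] at h₅
  rw [← e6] at h₆
  exact ⟨h₁, h₂, h₃, h₄, h₅, h₆⟩

/-- After consolidation every root is full and sits in a slot, and every node is dominated by a root
(`HollowHeap.exists_root`), so the best root is a global minimum. Each of the at most `B` moves from
a slot to the stack raises the potential by 100. -/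
theorem wp_findMin {W B : ℕ} {s : State} {ch : ℕ → List ℕ} {L : Finset ℕ}
    (hW : s.wv 4 < W) (hBW : B ≤ W) (h : HeapInv B s ch L) (hsp : s.wv 5 = 0) :
    findMin.wp W (fun k s' => HeapInv B s' ch L ∧ (∀ j, s'.wa 12 j = 0) ∧
      (s'.wv 13 = 0 → L = ∅ ∧ s'.wv 5 = 0) ∧
      (s'.wv 13 ≠ 0 → s'.wv 13 ∈ L ∧ s.wa 5 (s.wa 8 (s'.wv 13)) = s'.wv 13 ∧
        ∀ u ∈ L, s.ra 2 (s'.wv 13) ≤ s.ra 2 u) ∧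
      k + heapPotential B s' ch L ≤ heapPotential B s ch L + 200 * B + 100) s := by
  refine ⟨by simp, by simp, ?_⟩
  have hc0 := card_slotNodes_le (s.wa 12) B
  have hlt := h.lt
  refine Program.wp_loop
    (fun t => HeapInv B t ch L ∧ (∀ j < t.wv 12, t.wa 12 j = 0) ∧ t.wv 12 ≤ s.wv 6 + 1 ∧
      t.wv 5 + Multiset.card (slotNodes (t.wa 12) B) = Multiset.card (slotNodes (s.wa 12) B) ∧
      (∀ a ∈ stackNodes (t.wa 13) (t.wv 5), s.wa 5 (s.wa 8 a) = a) ∧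
      (t.wv 13 = 0 → t.wv 5 = 0) ∧
      (t.wv 13 ≠ 0 → t.wv 13 ∈ stackNodes (t.wa 13) (t.wv 5) ∧
        ∀ a ∈ stackNodes (t.wa 13) (t.wv 5), s.ra 2 (t.wv 13) ≤ s.ra 2 a))
    (fun t => 60 * (s.wv 6 + 1 - t.wv 12)) ?_ ?_ ?_ ?_
  · refine ⟨h.congr ?_ ?_ ?_ ?_ ?_ ?_ ?_ ?_ ?_ ?_ ?_, by simp, by simp, by simp [hsp], ?_,
      by simp [hsp], by simp⟩
    any_goals simp
    · simp [hsp, stackNodes]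
  · intros; simp
  · rintro t hF hB ⟨hI, h₁, h₂, h₃, h₄, h₅, h₆⟩ hb
    have e4 : t.wv 4 = s.wv 4 := (hF.wv 4 (by decide)).trans (by simp)
    have e6 : t.wv 6 = s.wv 6 := (hF.wv 6 (by decide)).trans (by simp)
    have e5 : t.wa 5 = s.wa 5 := (hF.wa 5 (by decide)).trans (by simp)
    have e8 : t.wa 8 = s.wa 8 := (hF.wa 8 (by decide)).trans (by simp)
    have e9 : t.wa 9 = s.wa 9 := (hF.wa 9 (by decide)).trans (by simp)
    have e10 : t.wa 10 = s.wa 10 := (hF.wa 10 (by decide)).trans (by simp)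
    have e11 : t.wa 11 = s.wa 11 := (hF.wa 11 (by decide)).trans (by simp)
    have r2 : t.ra 2 = s.ra 2 := (hF.ra 2 (by decide)).trans (by simp)
    have hcl := hI.heap.card_roots_le
    simp only [Multiset.card_add, card_stackNodes] at hcl
    have hcl' := hI.card_le
    simp [e6] at hb
    simp [Program.wp, r2]
    refine ⟨fun hz => ⟨by omega, ⟨hI.congr ?_ ?_ ?_ ?_ ?_ ?_ ?_ ?_ ?_ ?_ ?_, ?_, by omega, h₃, h₄, h₅,
      h₆⟩, by omega⟩, fun hz => ?_⟩
    any_goals simp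
    · intro j hj
      rcases hj.lt_or_eq with hj | rfl
      · exact h₁ j hj
      · exact hz
    · obtain ⟨a, ha⟩ : ∃ a, t.wa 12 (t.wv 12) = a := ⟨_, rfl⟩
      rw [ha] at hz ⊢
      have hcl := slotNodes_clear (slot := t.wa 12) (B := B) (j := t.wv 12) (by omega) (by omega)
      have hcc := congrArg Multiset.card hcl
      rw [ha, Multiset.card_cons] at hcc
      obtain ⟨hs₁, hs₂, hs₃⟩ := hI.slot _ (show t.wa 12 (t.wv 12) ≠ 0 by omega)
      rw [ha] at hs₂ hs₃
      rw [e5, e8] at hs₃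
      have hroots : stackNodes (t.wa 13) (t.wv 5) + slotNodes (t.wa 12) B
          = stackNodes (Function.update (t.wa 13) (t.wv 5) a) (t.wv 5 + 1) +
            slotNodes (Function.update (t.wa 12) (t.wv 12) 0) B := by
        rw [hcl, ha, stackNodes_push, Multiset.cons_add, Multiset.add_cons]
      have key : HeapInv B ((((t.setWA 13 (t.wv 5) a).setW 5 (t.wv 5 + 1)).setWA 12 (t.wv 12) 0)) ch L := by
        refine ⟨?_, ?_, ?_, ?_, ?_, ?_⟩
        · simp
          rw [← hroots]
          exact hI.heap
        · simpa using hI.le_cnt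
        · intro j hj
          simp at hj ⊢
          by_cases hjt : j = t.wv 12
          · simp [hjt] at hj
          · rw [Function.update_of_ne hjt] at hj ⊢
            exact hI.slot j hj
        · simpa using hI.rank_le
        · simpa using hI.cur
        · simpa using hI.lt
      have hz' : ∀ j ≤ t.wv 12, Function.update (t.wa 12) (t.wv 12) 0 j = 0 := by
        intro j hj
        rcases hj.lt_or_eq with hj | rfl
        · rw [Function.update_of_ne hj.ne]
          exact h₁ j hj
        · simp
      have hfull : ∀ b ∈ stackNodes (Function.update (t.wa 13) (t.wv 5) a) (t.wv 5 + 1),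
          s.wa 5 (s.wa 8 b) = b := by
        rw [stackNodes_push]
        intro b hb
        rcases Multiset.mem_cons.1 hb with rfl | hb
        · exact hs₃
        · exact h₄ b hb
      refine ⟨by omega, fun hor => ⟨by omega, ⟨key.congr ?_ ?_ ?_ ?_ ?_ ?_ ?_ ?_ ?_ ?_ ?_, hz', hb,
        by omega, hfull, hz, fun _ => ⟨?_, ?_⟩⟩, by omega⟩, fun h0 hle => ⟨by omega,
        ⟨key.congr ?_ ?_ ?_ ?_ ?_ ?_ ?_ ?_ ?_ ?_ ?_, hz', hb,
        by omega, hfull, h0, fun _ => ⟨?_, ?_⟩⟩, by omega⟩⟩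
      any_goals simp
      all_goals rw [stackNodes_push]
      · simp
      · intro b hb
        rcases Multiset.mem_cons.1 hb with rfl | hb
        · exact le_rfl
        · rcases hor with h0 | hlt
          · rw [h₅ h0] at hb
            simp [stackNodes] at hb
          · by_cases h0 : t.wv 13 = 0
            · rw [h₅ h0] at hb
              simp [stackNodes] at hb
            · exact hlt.le.trans ((h₆ h0).2 b hb)
      · exact Multiset.mem_cons_of_mem (h₆ h0).1
      · intro b hb
        rcases Multiset.mem_cons.1 hb with rfl | hb
        · exact hle
        · exact (h₆ h0).2 b hb
  · rintro k t hF hB ⟨hI, h₁, h₂, h₃, h₄, h₅, h₆⟩ hb hk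
    have e6 : t.wv 6 = s.wv 6 := (hF.wv 6 (by decide)).trans (by simp)
    have e5 : t.wa 5 = s.wa 5 := (hF.wa 5 (by decide)).trans (by simp)
    have e8 : t.wa 8 = s.wa 8 := (hF.wa 8 (by decide)).trans (by simp)
    have r2 : t.ra 2 = s.ra 2 := (hF.ra 2 (by decide)).trans (by simp)
    simp [e6] at hb hk
    have hz : ∀ j, t.wa 12 j = 0 := by
      intro j
      by_contra hj
      have := (hI.slot j hj).1
      exact hj (h₁ j (by omega))
    have hs0 := slotNodes_eq_zero (B := B) hz
    have heap := hI.heap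
    rw [hs0, add_zero] at heap
    rw [hs0] at h₃
    refine ⟨hI, hz, fun h0 => ⟨?_, h₅ h0⟩, fun h0 => ?_, ?_⟩
    · by_contra hne
      obtain ⟨u, hu⟩ := Finset.nonempty_iff_ne_empty.2 hne
      obtain ⟨a, ha, -⟩ := heap.exists_root hu
      rw [h₅ h0] at ha
      simp [stackNodes] at ha
    · obtain ⟨h₇, h₈⟩ := h₆ h0
      refine ⟨heap.root_mem h₇, h₄ _ h₇, fun u hu => ?_⟩
      obtain ⟨a, ha, hau⟩ := heap.exists_root hu
      rw [r2] at hau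
      exact (h₈ a ha).trans hau
    · simp [heapPotential, hs0, e5, e8, hsp] at h₃ ⊢
      omega

/-! ### Insertion and decreasing of keys -/

/-- Stores the data of the node 4 for the vertex 15 and puts it on the stack. -/
def pushNode : Program :=
  .seq (.wstore 8 (.var 4) (.var 15)) <|
  .seq (.rstore 2 (.var 4) (.var 0)) <|
  .seq (.wstore 5 (.var 15) (.var 4)) <|
  .seq (.rstore 1 (.var 15) (.var 0)) <|
  .seq (.wstore 6 (.var 15) (.var 3)) <|
  .seq (.wstore 13 (.var 5) (.var 4)) <|
  .wset 5 (.add (.var 5) (.const 1))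

def insertNode : Program :=
  .seq (.wset 4 (.add (.var 4) (.const 1))) <|
  .seq (.wstore 9 (.var 4) (.const 0)) <|
  .seq (.wstore 10 (.var 4) (.const 0))
  pushNode

def decreaseNode : Program :=
  .seq (.wset 9 (.arr 5 (.var 15))) <|
  .seq (.wset 4 (.add (.var 4) (.const 1))) <|
  .seq (.wstore 9 (.var 4) (.sub (.arr 9 (.var 9)) (.const 2))) <|
  .ite (.wlt (.arr 9 (.var 9)) (.const 2))
    (.seq (.wstore 10 (.var 4) (.const 0)) pushNode) <|
    .seq (.wset 10 (.arr 11 (.arr 10 (.var 9)))) <|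
    .seq (.wstore 10 (.var 4) (.arr 11 (.var 10))) <|
    .seq (.wstore 11 (.var 10) (.const 0))
    pushNode

/-- The effect of adding a node for the vertex 15 to the heap, with the key in the real
variable 0. -/
structure NodeAdded (B : ℕ) (s s' : State) (ch : ℕ → List ℕ) (L : Finset ℕ)
    (ch' : ℕ → List ℕ) (L' : Finset ℕ) : Prop where
  inv : HeapInv B s' ch' L'
  cnt : s'.wv 4 = s.wv 4 + 1
  cur : s'.wa 5 = Function.update (s.wa 5) (s.wv 15) (s.wv 4 + 1)
  pred : s'.wa 6 = Function.update (s.wa 6) (s.wv 15) (s.wv 3)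
  dist : s'.ra 1 = Function.update (s.ra 1) (s.wv 15) (s.rv 0)
  key : s'.ra 2 = Function.update (s.ra 2) (s.wv 4 + 1) (s.rv 0)
  potential : heapPotential B s' ch' L' ≤ heapPotential B s ch L + 800

theorem wp_insertNode {W B : ℕ} {s : State} {ch : ℕ → List ℕ} {L : Finset ℕ}
    (hW : s.wv 4 < W) (h : HeapInv B s ch L) (hz : ∀ j, s.wa 12 j = 0)
    (hv : s.wa 5 (s.wv 15) = 0) :
    insertNode.wp W (fun k s' => k ≤ 60 ∧ ∃ ch' L', NodeAdded B s s' ch L ch' L') s := by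
  have hx : s.wv 4 + 1 ∉ L := fun hx => by have := h.le_cnt _ hx; omega
  have hins := h.heap.insert (v := s.wv 15) (s.rv 0) hx (Nat.succ_ne_zero _)
  have hcl := h.heap.card_roots_le
  simp only [Multiset.card_add, card_stackNodes] at hcl
  have hcl' := h.card_le
  simp [insertNode, pushNode, Program.wp]
  refine ⟨⟨by omega, by omega⟩, by omega, Function.update ch (s.wv 4 + 1) [],
    Insert.insert (s.wv 4 + 1) L, ⟨?_, ?_, ?_, ?_, ?_, ?_⟩, by simp, by simp, by simp, by simp,
    by simp, ?_⟩
  · simp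
    rw [stackNodes_push, Multiset.cons_add]
    exact hins
  · simp
    exact fun u hu => (h.le_cnt u hu).trans (Nat.le_succ _)
  · intro j hj
    simp [hz] at hj
  · simp
    intro u hu
    rw [Function.update_of_ne (by rintro rfl; exact hx hu)]
    exact h.rank_le u hu
  · intro v hv'
    simp at hv' ⊢
    by_cases hvv : v = s.wv 15
    · subst hvv
      simp
    · rw [Function.update_of_ne hvv] at hv' ⊢
      obtain ⟨h₁, h₂⟩ := h.cur v hv'
      refine ⟨Or.inr h₁, ?_⟩
      rw [Function.update_of_ne (by rintro he; exact hx (he ▸ h₁))]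
      exact h₂
  · simpa using h.lt
  · simp [heapPotential, HollowHeap.hollowChildren_insert h.heap hx hv]
    omega

theorem wp_decreaseNode {W B : ℕ} {s : State} {ch : ℕ → List ℕ} {L : Finset ℕ}
    (hW : s.wv 4 < W) (hW2 : 2 ≤ W) (h : HeapInv B s ch L) (hz : ∀ j, s.wa 12 j = 0)
    (hv : s.wa 5 (s.wv 15) ≠ 0) (hk : s.rv 0 ≤ s.ra 2 (s.wa 5 (s.wv 15))) :
    decreaseNode.wp W (fun k s' => k ≤ 80 ∧ ∃ ch' L', NodeAdded B s s' ch L ch' L') s := by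
  have hx : s.wv 4 + 1 ∉ L := fun hx => by have := h.le_cnt _ hx; omega
  obtain ⟨u, hu⟩ : ∃ u, s.wa 5 (s.wv 15) = u := ⟨_, rfl⟩
  obtain ⟨huL, huv⟩ := h.cur _ hv
  rw [hu] at huL huv hk hv
  have hux : u ≠ s.wv 4 + 1 := by rintro rfl; exact hx huL
  have hcl := h.heap.card_roots_le
  simp only [Multiset.card_add, card_stackNodes] at hcl
  have hcl' := h.card_le
  have hlen := h.heap.length_children huL (by rw [huv, hu])
  have hlink := h.heap.linked u huL
  have hnd := h.heap.children_nodup huL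
  have hpot := HollowHeap.hollowChildren_decrease (ch := ch) hx huL hu huv
  -- Both branches of the program end in a heap described by `HollowHeap.decrease`; only the links
  -- of the children differ.
  have post : ∀ (child' next' : ℕ → ℕ) (t : State), (∀ y ∈ L, child' y = s.wa 10 y) →
      (∀ y ∈ L, y ∉ ch u → next' y = s.wa 11 y) →
      Linked next' (s.wa 10 u) ((ch u).take 2) → Linked next' (child' (s.wv 4 + 1)) ((ch u).drop 2) →
      t.wa 8 = Function.update (s.wa 8) (s.wv 4 + 1) (s.wv 15) →
      t.wa 9 = Function.update (s.wa 9) (s.wv 4 + 1) (s.wa 9 u - 2) →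
      t.wa 10 = child' → t.wa 11 = next' →
      t.wa 12 = s.wa 12 → t.wa 13 = Function.update (s.wa 13) (s.wv 5) (s.wv 4 + 1) →
      t.wv 4 = s.wv 4 + 1 → t.wv 5 = s.wv 5 + 1 → t.wv 6 = s.wv 6 →
      t.wa 5 = Function.update (s.wa 5) (s.wv 15) (s.wv 4 + 1) →
      t.wa 6 = Function.update (s.wa 6) (s.wv 15) (s.wv 3) →
      t.ra 1 = Function.update (s.ra 1) (s.wv 15) (s.rv 0) →
      t.ra 2 = Function.update (s.ra 2) (s.wv 4 + 1) (s.rv 0) →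
      ∃ ch' L', NodeAdded B s t ch L ch' L' := by
    intro child' next' t hc hn hl₁ hl₂ a8 a9 a10 a11 a12 a13 e4 e5 e6 a5 a6 r1 r2
    have hdec := h.heap.decrease hx (Nat.succ_ne_zero _) huL hu huv hk hc hn hl₁ hl₂
    refine ⟨Function.update (Function.update ch u ((ch u).take 2)) (s.wv 4 + 1) ((ch u).drop 2),
      Insert.insert (s.wv 4 + 1) L, ⟨?_, ?_, ?_, ?_, ?_, ?_⟩, e4, a5, a6, r1, r2, ?_⟩
    rotate_left 6
    -- One more node on the stack costs 200, and at most two new children of a hollow node cost 300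
    -- each: this is the 800 in `NodeAdded`.
    · simp only [heapPotential, a8, a5, a12, e5]
      refine (Nat.add_le_add_left (Nat.mul_le_mul_left 300 hpot) _).trans ?_
      omega
    · rw [a5, a8, a9, a10, a11, a12, a13, e5, r2, stackNodes_push, Multiset.cons_add]
      exact hdec
    · rw [e4]
      intro y hy
      rcases Finset.mem_insert.1 hy with rfl | hy
      · exact le_rfl
      · exact (h.le_cnt y hy).trans (Nat.le_succ _)
    · intro j hj
      rw [a12] at hj
      exact absurd (hz j) hj
    · rw [a9, e6]
      intro y hy
      rcases Finset.mem_insert.1 hy with rfl | hy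
      · rw [Function.update_self]
        exact (Nat.sub_le _ _).trans (h.rank_le u huL)
      · rw [Function.update_of_ne (by rintro rfl; exact hx hy)]
        exact h.rank_le y hy
    · rw [a5, a8]
      intro w hw
      by_cases hwv : w = s.wv 15
      · subst hwv
        simp
      · rw [Function.update_of_ne hwv] at hw ⊢
        obtain ⟨h₁, h₂⟩ := h.cur w hw
        refine ⟨Finset.mem_insert_of_mem h₁, ?_⟩
        rw [Function.update_of_ne (by rintro he; exact hx (he ▸ h₁))]
        exact h₂
    · rw [e6]; exact h.lt
  simp [decreaseNode, pushNode, Program.wp, hu, Function.update_of_ne hux]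
  refine ⟨by omega, by omega, fun hr => ?_, fun hr => ?_⟩
  -- A full node of rank below 2 has fewer than two children; it keeps all of them and the new node
  -- gets none.
  · refine ⟨by omega, post
      (Function.update (s.wa 10) (s.wv 4 + 1) 0) (s.wa 11) _ ?_ ?_ ?_ ?_ ?_ ?_ ?_ ?_ ?_ ?_ ?_ ?_ ?_ ?_
      ?_ ?_ ?_⟩
    any_goals simp
    · intro y hy
      rw [Function.update_of_ne (by rintro rfl; exact hx hy)]
    · rwa [List.take_of_length_le (by omega)]
    · rw [List.drop_of_length_le (by omega)]
      rfl
  -- Otherwise the linked list is cut behind its second node, and what follows becomes the list of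
  -- the new node.
  · obtain ⟨c₁, c₂, l, hl⟩ : ∃ c₁ c₂ l, ch u = c₁ :: c₂ :: l := by
      rcases hl : ch u with _ | ⟨c₁, _ | ⟨c₂, l⟩⟩
      · rw [hl] at hlen; simp at hlen; omega
      · rw [hl] at hlen; simp at hlen; omega
      · exact ⟨_, _, _, rfl⟩
    rw [hl] at hlink hnd
    obtain ⟨hl₁, hl₂, hl₃, hl₄, hl₅⟩ := hlink
    simp at hnd
    rw [hl₁, hl₃]
    refine ⟨by omega, post
      (Function.update (s.wa 10) (s.wv 4 + 1) (s.wa 11 c₂)) (Function.update (s.wa 11) c₂ 0)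
      _ ?_ ?_ ?_ ?_ ?_ ?_ ?_ ?_ ?_ ?_ ?_ ?_ ?_ ?_ ?_ ?_ ?_⟩
    any_goals simp
    · intro y hy
      rw [Function.update_of_ne (by rintro rfl; exact hx hy)]
    · rw [hl]
      intro y hy hyc
      rw [Function.update_of_ne (by rintro rfl; simp at hyc)]
    · rw [hl]
      refine ⟨hl₁, hl₂, ?_, hl₄, ?_⟩
      · rw [Function.update_of_ne hnd.1.1]
        exact hl₃
      · simp [Linked]
    · rw [hl]
      refine hl₅.congr fun c hc => ?_
      rw [Function.update_of_ne (by rintro rfl; exact hnd.2.1 hc)]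

end RealRAM

/-! ### Dijkstra's algorithm -/

/-- The result of a single-source shortest path computation on the vertices below `N` with the arcs
`a < M` from `src a` to `dst a` of length `wt a`: the vertices `v` with `done v ≠ 0` are the reached
ones, `pred v - 1` is the last arc of a shortest path, and `ord` lists the `c` reached vertices by
increasing distance. -/
structure ShortestPaths (N M S : ℕ) (src dst : ℕ → ℕ) (wt : ℕ → ℝ) (done pred ord : ℕ → ℕ) (c : ℕ)
    (dist : ℕ → ℝ) : Prop where
  lt : ∀ v, done v ≠ 0 → v < N
  source : done S ≠ 0 ∧ dist S = 0
  relaxed : ∀ a < M, done (src a) ≠ 0 → done (dst a) ≠ 0 ∧ dist (dst a) ≤ dist (src a) + wt a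
  pred : ∀ v, done v ≠ 0 → v ≠ S →
    ∃ a < M, pred v = a + 1 ∧ dst a = v ∧ done (src a) ≠ 0 ∧ dist v = dist (src a) + wt a
  ord_done : ∀ i < c, done (ord i) ≠ 0
  ord_surj : ∀ v, done v ≠ 0 → ∃ i < c, ord i = v
  ord_mono : ∀ i j, i ≤ j → j < c → dist (ord i) ≤ dist (ord j)
  dist_nonneg : ∀ v, done v ≠ 0 → 0 ≤ dist v
  count_le : c ≤ N

/-- The invariant of Dijkstra's algorithm. The vertices `v` with `done v ≠ 0` are settled, those
with `cur v ≠ 0` are in the heap, and `P` is the set of arcs from settled vertices that have not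
been relaxed. -/
structure DijkstraInv (N M S : ℕ) (src dst : ℕ → ℕ) (wt : ℕ → ℝ) (done cur pred ord : ℕ → ℕ)
    (c : ℕ) (dist : ℕ → ℝ) (P : Finset ℕ) : Prop where
  done_lt : ∀ v, done v ≠ 0 → v < N
  cur_lt : ∀ v, cur v ≠ 0 → v < N ∧ done v = 0
  source : (done S ≠ 0 ∨ cur S ≠ 0) ∧ dist S = 0
  relaxed : ∀ a < M, done (src a) ≠ 0 → a ∉ P →
    (done (dst a) ≠ 0 ∨ cur (dst a) ≠ 0) ∧ dist (dst a) ≤ dist (src a) + wt a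
  pred : ∀ v, (done v ≠ 0 ∨ cur v ≠ 0) → v ≠ S →
    ∃ a < M, pred v = a + 1 ∧ dst a = v ∧ done (src a) ≠ 0 ∧ dist v = dist (src a) + wt a
  mono : ∀ u v, done u ≠ 0 → cur v ≠ 0 → dist u ≤ dist v
  ord_done : ∀ i < c, done (ord i) ≠ 0
  ord_surj : ∀ v, done v ≠ 0 → ∃ i < c, ord i = v
  ord_mono : ∀ i j, i ≤ j → j < c → dist (ord i) ≤ dist (ord j)
  count : c = (Finset.filter (fun v => done v ≠ 0) (Finset.range N)).card
  dist_nonneg : ∀ v, (done v ≠ 0 ∨ cur v ≠ 0) → 0 ≤ dist v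

/-! ### Preservation of the invariant of Dijkstra's algorithm. -/

namespace DijkstraInv

variable {N M S : ℕ} {src dst : ℕ → ℕ} {wt : ℕ → ℝ} {done cur pred ord : ℕ → ℕ} {c : ℕ}
  {dist : ℕ → ℝ} {P : Finset ℕ}

theorem count_le (h : DijkstraInv N M S src dst wt done cur pred ord c dist P) : c ≤ N := by
  rw [h.count]
  exact (Finset.card_filter_le _ _).trans (by simp)

theorem shortestPaths (h : DijkstraInv N M S src dst wt done cur pred ord c dist ∅)
    (hcur : ∀ v, cur v = 0) : ShortestPaths N M S src dst wt done pred ord c dist where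
  lt := h.done_lt
  source := ⟨h.source.1.resolve_right (by simp [hcur]), h.source.2⟩
  relaxed a ha hd := ⟨(h.relaxed a ha hd (by simp)).1.resolve_right (by simp [hcur]),
    (h.relaxed a ha hd (by simp)).2⟩
  pred v hv hS := h.pred v (Or.inl hv) hS
  ord_done := h.ord_done
  ord_surj := h.ord_surj
  ord_mono := h.ord_mono
  dist_nonneg v hv := h.dist_nonneg v (Or.inl hv)
  count_le := h.count_le

theorem count_lt (h : DijkstraInv N M S src dst wt done cur pred ord c dist P) {u : ℕ}
    (hu : cur u ≠ 0) : c < N := by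
  rw [h.count]
  refine lt_of_lt_of_eq (Finset.card_lt_card ?_) (Finset.card_range N)
  rw [Finset.filter_ssubset]
  exact ⟨u, Finset.mem_range.2 (h.cur_lt u hu).1, by simp [(h.cur_lt u hu).2]⟩

/-- By `mono` no settled vertex is farther than `u`, and by the choice of `u` no waiting one is
closer; so the order stays sorted. The set `P` takes up the arcs that leave `u`. -/
theorem settle (h : DijkstraInv N M S src dst wt done cur pred ord c dist ∅) {u : ℕ}
    (hu : cur u ≠ 0) (hmin : ∀ v, cur v ≠ 0 → dist u ≤ dist v) (hP : ∀ a < M, src a = u → a ∈ P) :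
    DijkstraInv N M S src dst wt (Function.update done u 1) (Function.update cur u 0) pred
      (Function.update ord c u) (c + 1) dist P := by
  obtain ⟨huN, hud⟩ := h.cur_lt u hu
  have hd : ∀ v, Function.update done u 1 v ≠ 0 ↔ (v = u ∨ done v ≠ 0) := by
    intro v
    rw [Function.update_apply]
    split_ifs with hv <;> simp [hv]
  have hc : ∀ v, Function.update cur u 0 v ≠ 0 ↔ (v ≠ u ∧ cur v ≠ 0) := by
    intro v
    rw [Function.update_apply]
    split_ifs with hv <;> simp [hv]
  have hdc : ∀ v, (Function.update done u 1 v ≠ 0 ∨ Function.update cur u 0 v ≠ 0) ↔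
      (done v ≠ 0 ∨ cur v ≠ 0) := by
    intro v
    rw [hd, hc]
    by_cases hv : v = u
    · subst hv; simp [hu]
    · simp [hv]
  refine ⟨fun v hv => ?_, fun v hv => ?_, ?_, fun a ha hs haP => ?_, fun v hv hS => ?_,
    fun x v hx hv => ?_, fun i hi => ?_, fun v hv => ?_, fun i j hij hj => ?_, ?_, fun v hv => ?_⟩
  · rcases (hd v).1 hv with rfl | hv
    · exact huN
    · exact h.done_lt v hv
  · obtain ⟨hvu, hv⟩ := (hc v).1 hv
    rw [Function.update_of_ne hvu]
    exact h.cur_lt v hv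
  · rw [hdc]; exact h.source
  · rw [hdc]
    rcases (hd _).1 hs with hs | hs
    · exact absurd (hP a ha hs) haP
    · exact h.relaxed a ha hs (by simp)
  · obtain ⟨a, h₁, h₂, h₃, h₄, h₅⟩ := h.pred v ((hdc v).1 hv) hS
    exact ⟨a, h₁, h₂, h₃, (hd _).2 (Or.inr h₄), h₅⟩
  · have hv' := ((hc v).1 hv).2
    rcases (hd x).1 hx with rfl | hx
    · exact hmin v hv'
    · exact h.mono x v hx hv'
  · rw [hd]
    rcases Nat.lt_succ_iff_lt_or_eq.1 hi with hi | rfl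
    · rw [Function.update_of_ne hi.ne]
      exact Or.inr (h.ord_done i hi)
    · simp
  · rcases (hd v).1 hv with rfl | hv
    · exact ⟨c, Nat.lt_succ_self c, by simp⟩
    · obtain ⟨i, hi, hiv⟩ := h.ord_surj v hv
      exact ⟨i, hi.trans (Nat.lt_succ_self c), by rwa [Function.update_of_ne hi.ne]⟩
  · rcases Nat.lt_succ_iff_lt_or_eq.1 hj with hj | rfl
    · rw [Function.update_of_ne hj.ne, Function.update_of_ne (hij.trans_lt hj).ne]
      exact h.ord_mono i j hij hj
    · rw [Function.update_self]
      rcases hij.lt_or_eq with hi | rfl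
      · rw [Function.update_of_ne hi.ne]
        exact h.mono _ u (h.ord_done i hi) hu
      · rw [Function.update_self]
  · rw [Finset.filter_congr (q := fun v => v = u ∨ done v ≠ 0) fun v _ => hd v, Finset.filter_or,
      Finset.filter_eq', if_pos (Finset.mem_range.2 huN), Finset.card_union_of_disjoint, ← h.count]
    · simp [add_comm]
    · simp [hud]
  · exact h.dist_nonneg v ((hdc v).1 hv)

theorem skip (h : DijkstraInv N M S src dst wt done cur pred ord c dist P) {a : ℕ}
    (h₁ : done (dst a) ≠ 0 ∨ cur (dst a) ≠ 0) (h₂ : dist (dst a) ≤ dist (src a) + wt a) :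
    DijkstraInv N M S src dst wt done cur pred ord c dist (P.erase a) := by
  refine { h with relaxed := fun b hb hs hbP => ?_ }
  by_cases hba : b = a
  · subst hba; exact ⟨h₁, h₂⟩
  · exact h.relaxed b hb hs fun h' => hbP (Finset.mem_erase.2 ⟨hba, h'⟩)

/-- By `htop` the tail of the arc is at least as far as every settled vertex. As lengths are
nonnegative, so is the new tentative distance, which preserves `mono`. -/
theorem improve (h : DijkstraInv N M S src dst wt done cur pred ord c dist P) {a x v : ℕ} {d : ℝ}
    (hx : x ≠ 0) (haM : a < M) (hv : dst a = v) (hd : d = dist (src a) + wt a) (hw : 0 ≤ wt a)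
    (hs : done (src a) ≠ 0) (hvN : v < N) (hvd : done v = 0)
    (hlt : cur v = 0 ∨ d < dist v) (htop : ∀ y, done y ≠ 0 → dist y ≤ dist (src a)) :
    DijkstraInv N M S src dst wt done (Function.update cur v x) (Function.update pred v (a + 1)) ord c
      (Function.update dist v d) (P.erase a) := by
  have hne : ∀ y, done y ≠ 0 → y ≠ v := by rintro y hy rfl; exact hy hvd
  have hdist : ∀ y, done y ≠ 0 → Function.update dist v d y = dist y :=
    fun y hy => Function.update_of_ne (hne y hy) _ _
  have hc : ∀ y, Function.update cur v x y ≠ 0 ↔ (y = v ∨ cur y ≠ 0) := by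
    intro y
    rw [Function.update_apply]
    split_ifs with hy <;> simp [hy, hx]
  have hd0 : 0 ≤ d := by
    rw [hd]; exact add_nonneg (h.dist_nonneg _ (Or.inl hs)) hw
  refine ⟨h.done_lt, fun y hy => ?_, ?_, fun b hb hbs hbP => ?_, fun y hy hS => ?_,
    fun y z hy hz => ?_, h.ord_done, h.ord_surj, fun i j hij hj => ?_, h.count, fun y hy => ?_⟩
  · rcases (hc y).1 hy with rfl | hy
    · exact ⟨hvN, hvd⟩
    · exact h.cur_lt y hy
  · refine ⟨h.source.1.imp id fun h' => (hc S).2 (Or.inr h'), ?_⟩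
    by_cases hSv : S = v
    -- The source is never improved: its distance is 0, and no tentative distance is negative.
    · exfalso
      subst hSv
      have h₁ := h.source.1.resolve_left (by simp [hvd])
      rw [h.source.2] at hlt
      rcases hlt with hlt | hlt
      · exact h₁ hlt
      · linarith
    · rw [Function.update_of_ne hSv]; exact h.source.2
  · rw [hdist _ hbs]
    by_cases hbv : dst b = v
    · rw [hbv]
      refine ⟨Or.inr ((hc v).2 (Or.inl rfl)), ?_⟩
      rw [Function.update_self]
      by_cases hba : b = a
      · subst hba; exact hd.le
      · obtain ⟨h₁, h₂⟩ := h.relaxed b hb hbs fun h' => hbP (Finset.mem_erase.2 ⟨hba, h'⟩)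
        rw [hbv] at h₁ h₂
        have h₃ := h₁.resolve_left (by simp [hvd])
        exact ((hlt.resolve_left h₃).trans_le h₂).le
    · rw [Function.update_of_ne (f := dist) hbv]
      have hba : b ≠ a := by rintro rfl; exact hbv hv
      obtain ⟨h₁, h₂⟩ := h.relaxed b hb hbs fun h' => hbP (Finset.mem_erase.2 ⟨hba, h'⟩)
      exact ⟨h₁.imp id fun h' => (hc _).2 (Or.inr h'), h₂⟩
  · by_cases hyv : y = v
    · subst hyv
      refine ⟨a, haM, by simp, hv, hs, ?_⟩
      rw [Function.update_self, hdist _ hs]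
      exact hd
    · have hy' : done y ≠ 0 ∨ cur y ≠ 0 := by
        rcases hy with hy | hy
        · exact Or.inl hy
        · exact Or.inr (((hc y).1 hy).resolve_left hyv)
      obtain ⟨b, h₁, h₂, h₃, h₄, h₅⟩ := h.pred y hy' hS
      refine ⟨b, h₁, ?_, h₃, h₄, ?_⟩
      · rwa [Function.update_of_ne hyv]
      · rwa [Function.update_of_ne hyv, hdist _ h₄]
  · rw [hdist y hy]
    by_cases hzv : z = v
    · subst hzv
      rw [Function.update_self, hd]
      have := htop y hy
      linarith
    · rw [Function.update_of_ne hzv]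
      exact h.mono y z hy (((hc z).1 hz).resolve_left hzv)
  · rw [hdist _ (h.ord_done i (hij.trans_lt hj)), hdist _ (h.ord_done j hj)]
    exact h.ord_mono i j hij hj
  · by_cases hyv : y = v
    · subst hyv
      rwa [Function.update_self]
    · rw [Function.update_of_ne hyv]
      exact h.dist_nonneg y (hy.imp id fun h' => ((hc y).1 h').resolve_left hyv)

theorem init (hS : S < N) {x : ℕ} (hx : x ≠ 0) (h0 : dist S = 0) (hd : ∀ v, done v = 0)
    (hc : ∀ v, cur v = 0) :
    DijkstraInv N M S src dst wt done (Function.update cur S x) pred ord 0 dist ∅ := by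
  have hc' : ∀ v, Function.update cur S x v ≠ 0 ↔ v = S := by
    intro v
    rw [Function.update_apply]
    split_ifs with hv <;> simp [hv, hx, hc]
  refine ⟨by simp [hd], fun v hv => ?_, ⟨Or.inr (by simpa using hx), h0⟩, by simp [hd],
    fun v hv hvS => ?_, by simp [hd], by simp, by simp [hd], by simp, by simp [hd], fun v hv => ?_⟩
  · rw [(hc' v).1 hv]; exact ⟨hS, hd S⟩
  · exact absurd ((hc' v).1 (hv.resolve_left (by simp [hd]))) hvS
  · rw [(hc' v).1 (hv.resolve_left (by simp [hd])), h0]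

end DijkstraInv

/-! ### The program for Dijkstra's algorithm. -/

namespace RealRAM

def relaxArc : Program :=
  .seq (.wset 15 (.arr 1 (.sub (.var 3) (.const 1)))) <|
  .seq (.rset 0 (.add (.arr 1 (.var 14)) (.arr 0 (.sub (.var 3) (.const 1))))) <|
  .seq
    (.ite (.weq (.arr 4 (.var 15)) (.const 0))
      (.ite (.weq (.arr 5 (.var 15)) (.const 0)) insertNode
        (.ite (.rlt (.var 0) (.arr 1 (.var 15))) decreaseNode .skip))
      .skip) <|
  .wset 3 (.arr 3 (.sub (.var 3) (.const 1)))

def relaxArcs : Program :=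
  .seq (.wset 3 (.arr 2 (.var 14))) <|
  .loop (.neg (.weq (.var 3) (.const 0))) relaxArc

def settleMin : Program :=
  .seq (.wset 14 (.arr 8 (.var 13))) <|
  .seq (.wstore 5 (.var 14) (.const 0)) <|
  .seq (.wstore 4 (.var 14) (.const 1)) <|
  .seq (.wstore 7 (.var 7) (.var 14)) <|
  .wset 7 (.add (.var 7) (.const 1))

/-- Dijkstra's algorithm. Input: word variables 0 (vertices), 1 (arcs), 2 (source), word arrays 0, 1
(ends of the arcs), real array 0 (lengths). Output: word arrays 4 (reached), 6 (predecessors),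
7 (order), word variable 7 (number of reached vertices), real array 1 (distances). -/
def dijkstra : Program :=
  .seq buildAdjacency <|
  .seq (.wset 15 (.var 2)) <|
  .seq (.rset 0 .zero) <|
  .seq (.wset 3 (.const 0)) <|
  .seq insertNode <|
  .loop (.neg (.weq (.var 5) (.const 0))) <|
    .seq consolidate <|
    .seq findMin <|
    .ite (.weq (.var 13) (.const 0)) .skip (.seq settleMin relaxArcs)

end RealRAM

namespace RealRAM

/-- The invariant outside of consolidation, when all roots are on the stack. The key of the current
node of a vertex is its tentative distance; nothing is required of the keys of hollow nodes beyond
the heap order. -/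
structure RunInv (B : ℕ) (s : State) (ch : ℕ → List ℕ) (L P : Finset ℕ) : Prop where
  heap : HeapInv B s ch L
  slots : ∀ j, s.wa 12 j = 0
  inv : DijkstraInv (s.wv 0) (s.wv 1) (s.wv 2) (s.wa 0) (s.wa 1) (s.ra 0) (s.wa 4) (s.wa 5) (s.wa 6)
    (s.wa 7) (s.wv 7) (s.ra 1) P
  key : ∀ v, s.wa 5 v ≠ 0 → s.ra 2 (s.wa 5 v) = s.ra 1 v

theorem wp_relaxArc {W B a : ℕ} {s : State} {ch : ℕ → List ℕ} {L P : Finset ℕ}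
    (h : RunInv B s ch L P) (hW : s.wv 4 < W) (hW2 : 2 ≤ W) (h3 : s.wv 3 = a + 1) (haM : a < s.wv 1)
    (hsrc : s.wa 0 a = s.wv 14) (hdst : s.wa 1 a < s.wv 0) (hwt : 0 ≤ s.ra 0 a)
    (hu : s.wa 4 (s.wv 14) ≠ 0) (htop : ∀ y, s.wa 4 y ≠ 0 → s.ra 1 y ≤ s.ra 1 (s.wv 14)) :
    relaxArc.wp W (fun k s' => k ≤ 130 ∧ s'.wv 3 = s.wa 3 a ∧ s'.wv 4 ≤ s.wv 4 + 1 ∧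
      (∀ y, s'.wa 4 y ≠ 0 → s'.ra 1 y ≤ s'.ra 1 (s.wv 14)) ∧
      ∃ ch' L', RunInv B s' ch' L' (P.erase a) ∧
        heapPotential B s' ch' L' ≤ heapPotential B s ch L + 800) s := by
  obtain ⟨heap, slots, inv, key⟩ := h
  obtain ⟨v, hv⟩ : ∃ v, s.wa 1 a = v := ⟨_, rfl⟩
  rw [hv] at hdst
  -- Insertion and decrease are both described by `NodeAdded`, so what follows from it is derived
  -- once for the two branches.
  have post : ∀ (t s₁ : State) (ch' : ℕ → List ℕ) (L' : Finset ℕ),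
      HeapInv B s₁ ch L → heapPotential B s₁ ch L = heapPotential B s ch L →
      NodeAdded B s₁ t ch L ch' L' →
      s₁.wv 0 = s.wv 0 → s₁.wv 1 = s.wv 1 → s₁.wv 2 = s.wv 2 → s₁.wv 4 = s.wv 4 →
      s₁.wv 7 = s.wv 7 → s₁.wv 3 = a + 1 → s₁.wv 15 = v → s₁.rv 0 = s.ra 1 (s.wv 14) + s.ra 0 a →
      s₁.wa = s.wa → s₁.ra = s.ra → (∀ x ∈ [0, 1, 2, 7, 14], t.wv x = s₁.wv x) →
      (∀ x ∈ [0, 1, 3, 4, 7, 12], t.wa x = s₁.wa x) → t.ra 0 = s₁.ra 0 →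
      s.wa 4 v = 0 → (s.wa 5 v = 0 ∨ s.ra 1 (s.wv 14) + s.ra 0 a < s.ra 1 v) →
      ∀ t' : State, t' = t.setW 3 (s.wa 3 a) →
      t'.wv 3 = s.wa 3 a ∧ t'.wv 4 ≤ s.wv 4 + 1 ∧
      (∀ y, t'.wa 4 y ≠ 0 → t'.ra 1 y ≤ t'.ra 1 (s.wv 14)) ∧
      ∃ ch' L', RunInv B t' ch' L' (P.erase a) ∧
        heapPotential B t' ch' L' ≤ heapPotential B s ch L + 800 := by
    intro t s₁ ch' L' hI₁ hp₁ hN e0 e1 e2 e4 e7 e3 e15 er ewa era hfv hfa hfr hvd hlt t' ht'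
    subst ht'
    have c5 := hN.cur
    have c6 := hN.pred
    have d1 := hN.dist
    have d2 := hN.key
    rw [e15, e4, ewa] at c5
    rw [e15, e3, ewa] at c6
    rw [e15, er, era] at d1
    rw [e4, er, era] at d2
    have w0 := (hfv 0 (by simp)).trans e0
    have w1 := (hfv 1 (by simp)).trans e1
    have w2 := (hfv 2 (by simp)).trans e2
    have w7 := (hfv 7 (by simp)).trans e7
    have a0 : t.wa 0 = s.wa 0 := by rw [hfa 0 (by simp), ewa]
    have a1 : t.wa 1 = s.wa 1 := by rw [hfa 1 (by simp), ewa]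
    have a4 : t.wa 4 = s.wa 4 := by rw [hfa 4 (by simp), ewa]
    have a7 : t.wa 7 = s.wa 7 := by rw [hfa 7 (by simp), ewa]
    have a12 : t.wa 12 = s.wa 12 := by rw [hfa 12 (by simp), ewa]
    have r0 : t.ra 0 = s.ra 0 := by rw [hfr, era]
    have himp := inv.improve (x := s.wv 4 + 1) (Nat.succ_ne_zero _) haM hv
      (show s.ra 1 (s.wv 14) + s.ra 0 a = _ by rw [hsrc]) hwt (by rwa [hsrc]) hdst hvd hlt
      (by rwa [hsrc])
    refine ⟨by simp, by simp [hN.cnt, e4], ?_, ch', L', ⟨?_, ?_, ?_, ?_⟩, ?_⟩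
    · simp only [State.setW_wa, State.setW_ra, a4, d1]
      intro y hy
      rw [Function.update_of_ne (by rintro rfl; exact hy hvd),
        Function.update_of_ne (by rintro he; rw [he] at hu; exact hu hvd)]
      exact htop y hy
    · exact hN.inv.congr rfl rfl rfl rfl rfl rfl rfl rfl rfl rfl rfl
    · simpa [a12] using slots
    · simp [w0, w1, w2, w7, a0, a1, a4, a7, r0, c5, c6, d1]
      exact himp
    · simp only [State.setW_wa, State.setW_ra, c5, d1, d2]
      intro y hy
      by_cases hyv : y = v
      · subst hyv; simp
      · rw [Function.update_of_ne hyv] at hy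
        rw [Function.update_of_ne hyv, Function.update_of_ne hyv, Function.update_of_ne]
        · exact key y hy
        · have := heap.le_cnt _ (heap.cur y hy).1
          omega
    · have := hN.potential
      rw [hp₁] at this
      exact this
  simp [relaxArc, Program.wp, h3, hv]
  refine ⟨by omega, fun hvd => ⟨fun hc => ?_, fun hc => ⟨fun hlt => ?_, fun hlt => ?_⟩⟩, fun hvd => ?_⟩
  · have hI₁ : HeapInv B ((s.setW 15 v).setR 0 (s.ra 1 (s.wv 14) + s.ra 0 a)) ch L :=
      heap.congr rfl rfl rfl rfl rfl rfl rfl rfl rfl rfl rfl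
    refine Program.wp_mono (Program.wp_frame (wp_insertNode (B := B) (ch := ch) (L := L) ?_ hI₁ ?_ ?_)) ?_
    · simpa using hW
    · simpa using slots
    · simpa using hc
    · rintro k t ⟨⟨hk, ch', L', hN⟩, hF⟩
      have e3 : t.wv 3 = a + 1 := (hF.wv 3 (by decide)).trans (by simpa using h3)
      have a3 : t.wa 3 = s.wa 3 := (hF.wa 3 (by decide)).trans (by simp)
      obtain ⟨p₁, p₂, p₃, p₄⟩ := post t _ ch' L' hI₁ rfl hN (by simp) (by simp) (by simp) (by simp)
        (by simp) (by simpa using h3) (by simp) (by simp) rfl rfl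
        (fun x hx => hF.wv x (by revert x; decide)) (fun x hx => hF.wa x (by revert x; decide))
        (hF.ra 0 (by decide)) hvd (Or.inl hc) _ rfl
      simp only [State.setW_wv, State.setW_wa, State.setW_ra] at p₂ p₃
      rw [e3, a3, Nat.add_sub_cancel]
      exact ⟨by omega, by omega, rfl, by simpa using p₂, p₃, p₄⟩
  · have hI₁ : HeapInv B ((s.setW 15 v).setR 0 (s.ra 1 (s.wv 14) + s.ra 0 a)) ch L :=
      heap.congr rfl rfl rfl rfl rfl rfl rfl rfl rfl rfl rfl
    refine Program.wp_mono (Program.wp_frame (wp_decreaseNode (B := B) (ch := ch) (L := L) ?_ hW2 hI₁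
      ?_ ?_ ?_)) ?_
    · simpa using hW
    · simpa using slots
    · simpa using hc
    · simp [key v hc, hlt.le]
    · rintro k t ⟨⟨hk, ch', L', hN⟩, hF⟩
      have e3 : t.wv 3 = a + 1 := (hF.wv 3 (by decide)).trans (by simpa using h3)
      have a3 : t.wa 3 = s.wa 3 := (hF.wa 3 (by decide)).trans (by simp)
      obtain ⟨p₁, p₂, p₃, p₄⟩ := post t _ ch' L' hI₁ rfl hN (by simp) (by simp) (by simp) (by simp)
        (by simp) (by simpa using h3) (by simp) (by simp) rfl rfl
        (fun x hx => hF.wv x (by revert x; decide)) (fun x hx => hF.wa x (by revert x; decide))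
        (hF.ra 0 (by decide)) hvd (Or.inr hlt) _ rfl
      simp only [State.setW_wv, State.setW_wa, State.setW_ra] at p₂ p₃
      rw [e3, a3, Nat.add_sub_cancel]
      exact ⟨by omega, by omega, rfl, by simpa using p₂, p₃, p₄⟩
  · refine ⟨by omega, by simpa using htop, ch, L, ⟨heap.congr ?_ ?_ ?_ ?_ ?_ ?_ ?_ ?_ ?_ ?_ ?_, ?_, ?_,
      ?_⟩, ?_⟩
    any_goals simp
    · exact slots
    · exact inv.skip (by rw [hv]; exact Or.inr hc) (by rw [hv, hsrc]; exact hlt)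
    · exact key
    · exact Nat.le_add_right _ _
  · refine ⟨by omega, by simpa using htop, ch, L, ⟨heap.congr ?_ ?_ ?_ ?_ ?_ ?_ ?_ ?_ ?_ ?_ ?_, ?_, ?_,
      ?_⟩, ?_⟩
    any_goals simp
    · exact slots
    · refine inv.skip (by rw [hv]; exact Or.inl hvd) ?_
      rw [hv, hsrc]
      exact (htop v hvd).trans (by linarith)
    · exact key
    · exact Nat.le_add_right _ _

end RealRAM

namespace RealRAM

/-- The arcs below `p` that leave `u`. -/
def arcsBelow (src : ℕ → ℕ) (u p : ℕ) : Finset ℕ := (Finset.range p).filter fun a => src a = u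

/-- A link skips only arcs of other vertices. So the arcs of `u` that are still to be relaxed are
determined by the current position in the list. -/
theorem arcsBelow_eq {src : ℕ → ℕ} {q p u : ℕ} (h : IsLast src q p u) :
    arcsBelow src u p = arcsBelow src u q := by
  ext a
  simp only [arcsBelow, Finset.mem_filter, Finset.mem_range]
  constructor
  · rintro ⟨h₁, h₂⟩
    refine ⟨?_, h₂⟩
    by_contra hq
    exact h.ne a (by omega) h₁ h₂
  · rintro ⟨h₁, h₂⟩
    exact ⟨h₁.trans_le h.le, h₂⟩

theorem arcsBelow_succ {src : ℕ → ℕ} {a u : ℕ} (h : src a = u) :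
    arcsBelow src u (a + 1) = insert a (arcsBelow src u a) := by
  rw [arcsBelow, Finset.range_add_one, Finset.filter_insert, if_pos h]
  rfl

theorem notMem_arcsBelow {src : ℕ → ℕ} {a u : ℕ} : a ∉ arcsBelow src u a := by
  simp [arcsBelow]

/-- The input of Dijkstra's algorithm. -/
structure ArcsOk (s : State) : Prop where
  dst_lt : ∀ a < s.wv 1, s.wa 1 a < s.wv 0
  nonneg : ∀ a < s.wv 1, 0 ≤ s.ra 0 a

structure AdjacencyOk (s : State) : Prop where
  head : ∀ u, IsLast (s.wa 0) (s.wa 2 u) (s.wv 1) u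
  next : ∀ a < s.wv 1, IsLast (s.wa 0) (s.wa 3 a) a (s.wa 0 a)

/-- An arc is paid with 1000: up to 800 of potential for a new node, up to 130 steps, and the test
of the loop. -/
theorem wp_relaxArcs {W B : ℕ} {s : State} {ch : ℕ → List ℕ} {L : Finset ℕ}
    (hA : ArcsOk s) (hadj : AdjacencyOk s)
    (h : RunInv B s ch L (arcsBelow (s.wa 0) (s.wv 14) (s.wv 1)))
    (hW : s.wv 4 + (arcsBelow (s.wa 0) (s.wv 14) (s.wv 1)).card ≤ W) (hW2 : 2 ≤ W)
    (hu : s.wa 4 (s.wv 14) ≠ 0) (htop : ∀ y, s.wa 4 y ≠ 0 → s.ra 1 y ≤ s.ra 1 (s.wv 14)) :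
    relaxArcs.wp W (fun k s' => ∃ ch' L', RunInv B s' ch' L' ∅ ∧
      s'.wv 4 ≤ s.wv 4 + (arcsBelow (s.wa 0) (s.wv 14) (s.wv 1)).card ∧
      k + heapPotential B s' ch' L' ≤ heapPotential B s ch L +
        1000 * (arcsBelow (s.wa 0) (s.wv 14) (s.wv 1)).card + 20) s := by
  obtain ⟨u, hu'⟩ : ∃ u, s.wv 14 = u := ⟨_, rfl⟩
  rw [hu'] at h hW hu htop ⊢
  have hhead := hadj.head u
  rw [arcsBelow_eq hhead] at h hW ⊢
  refine ⟨by simp, ?_⟩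
  refine Program.wp_loop_ghost
    (fun φ t => ∃ ch' L', RunInv B t ch' L' (arcsBelow (s.wa 0) u (t.wv 3)) ∧
      t.wv 3 ≤ s.wv 1 ∧ (t.wv 3 ≠ 0 → s.wa 0 (t.wv 3 - 1) = u) ∧
      (∀ y, t.wa 4 y ≠ 0 → t.ra 1 y ≤ t.ra 1 u) ∧
      t.wv 4 + (arcsBelow (s.wa 0) u (t.wv 3)).card
        ≤ s.wv 4 + (arcsBelow (s.wa 0) u (s.wa 2 u)).card ∧
      φ = 1000 * (arcsBelow (s.wa 0) u (t.wv 3)).card + heapPotential B t ch' L')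
    (1000 * (arcsBelow (s.wa 0) u (s.wa 2 u)).card + heapPotential B s ch L) ?_ ?_ ?_ ?_
  · refine ⟨ch, L, ⟨h.heap.congr ?_ ?_ ?_ ?_ ?_ ?_ ?_ ?_ ?_ ?_ ?_, ?_, ?_, ?_⟩, ?_, ?_, ?_, ?_, ?_⟩
    any_goals simp [hu']
    · exact h.slots
    · exact h.inv
    · exact h.key
    · exact hhead.le
    · exact hhead.eq
    · exact htop
    · rfl
  · intros; simp
  · rintro φ t hF hB ⟨ch', L', hI, hp, hpu, ht, hc, rfl⟩ hb
    have e0 : t.wv 0 = s.wv 0 := (hF.wv 0 (by decide)).trans (by simp)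
    have e1 : t.wv 1 = s.wv 1 := (hF.wv 1 (by decide)).trans (by simp)
    have e14 : t.wv 14 = u := (hF.wv 14 (by decide)).trans (by simp [hu'])
    have a0 : t.wa 0 = s.wa 0 := (hF.wa 0 (by decide)).trans (by simp)
    have a1 : t.wa 1 = s.wa 1 := (hF.wa 1 (by decide)).trans (by simp)
    have a3 : t.wa 3 = s.wa 3 := (hF.wa 3 (by decide)).trans (by simp)
    have a4 : t.wa 4 = s.wa 4 := (hF.wa 4 (by decide)).trans (by simp)
    have r0 : t.ra 0 = s.ra 0 := (hF.ra 0 (by decide)).trans (by simp)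
    obtain ⟨a, ha⟩ : ∃ a, t.wv 3 = a + 1 := Nat.exists_eq_succ_of_ne_zero (by simpa using hb)
    rw [ha] at hI hp hpu hc
    have hau : s.wa 0 a = u := by simpa using hpu
    have hnext := hadj.next a (by omega)
    rw [hau] at hnext
    rw [arcsBelow_succ hau] at hI hc
    rw [Finset.card_insert_of_notMem notMem_arcsBelow, arcsBelow_eq hnext] at hc
    refine Program.wp_mono (Program.wp_frame (wp_relaxArc (a := a) hI (by omega) hW2 ha (by omega) ?_ ?_ ?_ ?_ ?_)) ?_
    · rw [a0, e14, hau]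
    · rw [a1, e0]; exact hA.dst_lt a (by omega)
    · rw [r0]; exact hA.nonneg a (by omega)
    · rw [e14, a4]; exact hu
    · rw [e14]; exact ht
    · rintro k t' ⟨⟨hk, h3, h4, h5, ch'', L'', hI', hp'⟩, hF'⟩
      rw [Finset.erase_insert notMem_arcsBelow, arcsBelow_eq hnext] at hI'
      rw [a3] at h3
      refine ⟨_, ⟨ch'', L'', by rwa [h3], ?_, ?_, ?_, ?_, rfl⟩, ?_⟩
      · rw [h3]; exact hnext.le.trans (by omega)
      · rw [h3]; exact hnext.eq
      · rwa [e14] at h5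
      · rw [h3]; omega
      · rw [h3, ha, arcsBelow_succ hau, Finset.card_insert_of_notMem notMem_arcsBelow,
          arcsBelow_eq hnext]
        simp
        omega
  · rintro k φ t hF hB ⟨ch', L', hI, hp, hpu, ht, hc, rfl⟩ hb hk
    have h0 : t.wv 3 = 0 := by simpa using hb
    rw [h0] at hI hc hk
    have he : arcsBelow (s.wa 0) u 0 = ∅ := by simp [arcsBelow]
    rw [he] at hI hc hk
    simp at hk hc
    refine ⟨ch', L', hI, hc, ?_⟩
    simp
    omega

/-- Settling `u` moves its arcs from the account of the remaining arcs to the relaxation, so every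
arc is paid for once and creates at most one node. -/
theorem card_filter_update_add {M : ℕ} {src done : ℕ → ℕ} {u : ℕ} (hu : done u = 0) :
    ((Finset.range M).filter fun a => Function.update done u 1 (src a) = 0).card
      + (arcsBelow src u M).card = ((Finset.range M).filter fun a => done (src a) = 0).card := by
  rw [← Finset.card_union_of_disjoint]
  · congr 1
    ext a
    simp only [arcsBelow, Finset.mem_union, Finset.mem_filter, Finset.mem_range,
      Function.update_apply]
    by_cases ha : src a = u
    · simp [ha, hu]
    · simp [ha]
  · rw [Finset.disjoint_left]
    intro a ha hb
    simp only [arcsBelow, Finset.mem_filter] at ha hb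
    rw [hb.2, Function.update_self] at ha
    exact one_ne_zero ha.2

end RealRAM

namespace RealRAM

/-- The arcs from vertices that are not settled. -/
def remainingArcs (s : State) : ℕ :=
  ((Finset.range (s.wv 1)).filter fun a => s.wa 4 (s.wa 0 a) = 0).card

def dijkstraStep : Program :=
  .seq consolidate <|
  .seq findMin <|
  .ite (.weq (.var 13) (.const 0)) .skip (.seq settleMin relaxArcs)

/-- A settled vertex costs O(B): the scan of the slots and the children of the node that turns
hollow. The budget is `700 * (B + 1)` per unsettled vertex, and one more share as long as the stack
is nonempty, for the last round, in which only hollow nodes are left. Nodes and remaining arcs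
together never exceed `s.wv 1 + 1`; this keeps the ranks below `B`. -/
theorem wp_dijkstraStep {W B : ℕ} {s : State} {ch : ℕ → List ℕ} {L : Finset ℕ}
    (hA : ArcsOk s) (hadj : AdjacencyOk s) (h : RunInv B s ch L ∅)
    (hcnt : s.wv 4 + remainingArcs s ≤ s.wv 1 + 1)
    (hB : ∀ r, 2 ^ (r / 2) ≤ s.wv 1 + 1 → r < B) (hBW : B ≤ W) (hW : s.wv 1 + 1 < W)
    (hNW : s.wv 0 ≤ W) :
    dijkstraStep.wp W (fun k s' => ∃ ch' L', RunInv B s' ch' L' ∅ ∧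
      s'.wv 4 + remainingArcs s' ≤ s.wv 1 + 1 ∧
      k + 10 + (heapPotential B s' ch' L' + 1000 * remainingArcs s' +
        700 * (B + 1) * (s.wv 0 - s'.wv 7 + if s'.wv 5 = 0 then 0 else 1)) ≤
      heapPotential B s ch L + 1000 * remainingArcs s +
        700 * (B + 1) * (s.wv 0 - s.wv 7 + 1)) s := by
  unfold dijkstraStep
  have hcount := h.inv.count_le
  refine Program.wp_seq (Program.wp_mono (Program.wp_frame (wp_consolidate
    (fun r hr => hB r (by omega)) (by omega) hBW h.heap)) ?_)
  rintro k₁ s₁ ⟨⟨ch₁, L₁, hI₁, hsp₁, hk₁⟩, hF₁⟩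
  have e4 : s₁.wv 4 = s.wv 4 := hF₁.wv 4 (by decide)
  refine Program.wp_seq (Program.wp_mono (Program.wp_frame (wp_findMin (by omega) hBW hI₁ hsp₁)) ?_)
  rintro k₂ s₂ ⟨⟨hI₂, hz₂, hnone, hmin, hk₂⟩, hF₂⟩
  have w0 : s₂.wv 0 = s.wv 0 := (hF₂.wv 0 (by decide)).trans (hF₁.wv 0 (by decide))
  have w1 : s₂.wv 1 = s.wv 1 := (hF₂.wv 1 (by decide)).trans (hF₁.wv 1 (by decide))
  have w2 : s₂.wv 2 = s.wv 2 := (hF₂.wv 2 (by decide)).trans (hF₁.wv 2 (by decide))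
  have w4 : s₂.wv 4 = s.wv 4 := (hF₂.wv 4 (by decide)).trans e4
  have w7 : s₂.wv 7 = s.wv 7 := (hF₂.wv 7 (by decide)).trans (hF₁.wv 7 (by decide))
  have a0 : s₂.wa 0 = s.wa 0 := (hF₂.wa 0 (by decide)).trans (hF₁.wa 0 (by decide))
  have a1 : s₂.wa 1 = s.wa 1 := (hF₂.wa 1 (by decide)).trans (hF₁.wa 1 (by decide))
  have a2 : s₂.wa 2 = s.wa 2 := (hF₂.wa 2 (by decide)).trans (hF₁.wa 2 (by decide))
  have a3 : s₂.wa 3 = s.wa 3 := (hF₂.wa 3 (by decide)).trans (hF₁.wa 3 (by decide))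
  have a4 : s₂.wa 4 = s.wa 4 := (hF₂.wa 4 (by decide)).trans (hF₁.wa 4 (by decide))
  have a5 : s₂.wa 5 = s.wa 5 := (hF₂.wa 5 (by decide)).trans (hF₁.wa 5 (by decide))
  have a5' : s₂.wa 5 = s₁.wa 5 := hF₂.wa 5 (by decide)
  have a8' : s₂.wa 8 = s₁.wa 8 := hF₂.wa 8 (by decide)
  have a6 : s₂.wa 6 = s.wa 6 := (hF₂.wa 6 (by decide)).trans (hF₁.wa 6 (by decide))
  have a7 : s₂.wa 7 = s.wa 7 := (hF₂.wa 7 (by decide)).trans (hF₁.wa 7 (by decide))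
  have r0 : s₂.ra 0 = s.ra 0 := (hF₂.ra 0 (by decide)).trans (hF₁.ra 0 (by decide))
  have r1 : s₂.ra 1 = s.ra 1 := (hF₂.ra 1 (by decide)).trans (hF₁.ra 1 (by decide))
  have r2 : s₂.ra 2 = s.ra 2 := (hF₂.ra 2 (by decide)).trans (hF₁.ra 2 (by decide))
  have r2' : s₂.ra 2 = s₁.ra 2 := hF₂.ra 2 (by decide)
  have hRI : RunInv B s₂ ch₁ L₁ ∅ := by
    refine ⟨hI₂, hz₂, ?_, ?_⟩
    · rw [w0, w1, w2, w7, a0, a1, a4, a5, a6, a7, r0, r1]; exact h.inv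
    · rw [a5, r2, r1]; exact h.key
  have hrem : remainingArcs s₂ = remainingArcs s := by
    unfold remainingArcs
    rw [w1, a0, a4]
  refine ⟨by simp, fun hb => ?_, fun hb => ?_⟩
  · have hb' : s₂.wv 13 = 0 := by simpa using hb
    obtain ⟨-, h5⟩ := hnone hb'
    refine ⟨ch₁, L₁, hRI, by rw [hrem, w4]; exact hcnt, ?_⟩
    rw [hrem, w7, if_pos h5]
    simp
    have : 700 * (B + 1) * (s.wv 0 - s.wv 7 + 1)
      = 700 * (B + 1) * (s.wv 0 - s.wv 7) + 700 * B + 700 := by ring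
    omega
  · have hb' : s₂.wv 13 ≠ 0 := by simpa using hb
    obtain ⟨hbL, hbf, hbmin⟩ := hmin hb'
    obtain ⟨b, hbb⟩ : ∃ b, s₂.wv 13 = b := ⟨_, rfl⟩
    obtain ⟨u, huu⟩ : ∃ u, s₂.wa 8 b = u := ⟨_, rfl⟩
    rw [hbb] at hb' hbL hbf hbmin
    rw [← a5', ← a8', huu] at hbf
    have hu0 : s₂.wa 5 u ≠ 0 := by rw [hbf]; exact hb'
    obtain ⟨huN, hud⟩ := hRI.inv.cur_lt u hu0
    have hlt := hRI.inv.count_lt hu0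
    rw [w0, w7] at hlt
    have hminu : ∀ v, s₂.wa 5 v ≠ 0 → s₂.ra 1 u ≤ s₂.ra 1 v := by
      intro v hv
      rw [← hRI.key u hu0, ← hRI.key v hv, hbf, r2']
      exact hbmin _ (hI₂.cur v hv).1
    have hset := hRI.inv.settle (P := arcsBelow (s₂.wa 0) u (s₂.wv 1)) hu0 hminu
      (fun a ha hau => by simp [arcsBelow, ha, hau])
    have hrank := hI₂.rank_le b hbL
    have hltB := hI₂.lt
    have hpot := hI₂.heap.hollowChildren_extract hbL hbf huu
    have hcard := card_filter_update_add (M := s.wv 1) (src := s.wa 0) (done := s.wa 4) (u := u)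
      (by rw [← a4]; exact hud)
    have hremdef : remainingArcs s = ((Finset.range (s.wv 1)).filter
      fun a => s.wa 4 (s.wa 0 a) = 0).card := rfl
    rw [← hremdef] at hcard
    simp only [settleMin, Program.wp]
    simp [hbb, huu, w7]
    refine ⟨by omega, by omega, ?_⟩
    -- The extracted node stays on the stack as a hollow root; the next consolidation destroys it.
    have hI₃ : HeapInv B ((((((s₂.setW 14 u).setWA 5 u 0).setWA 4 u 1).setWA 7 (s.wv 7) u).setW 7
        (s.wv 7 + 1))) ch₁ L₁ := by
      refine ⟨?_, ?_, ?_, ?_, ?_, ?_⟩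
      · simpa using hI₂.heap.extract
      · simpa using hI₂.le_cnt
      · simp [hz₂]
      · simpa using hI₂.rank_le
      · simp
        intro v hv
        by_cases hvu : v = u
        · simp [hvu] at hv
        · rw [Function.update_of_ne hvu] at hv ⊢
          exact hI₂.cur v hv
      · simpa using hI₂.lt
    refine Program.wp_mono (Program.wp_frame (wp_relaxArcs (B := B) (ch := ch₁) (L := L₁) ⟨?_, ?_⟩ ⟨?_, ?_⟩
      ⟨hI₃, ?_, ?_, ?_⟩ ?_ ?_ ?_ ?_)) ?_
    · simpa [w0, w1, a1] using hA.dst_lt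
    · simpa [w1, r0] using hA.nonneg
    · simpa [w1, a0, a2] using hadj.head
    · simpa [w1, a0, a3] using hadj.next
    · simpa using hz₂
    · simpa [w7] using hset
    · simp
      intro v hv
      by_cases hvu : v = u
      · simp [hvu] at hv
      · rw [Function.update_of_ne hvu] at hv ⊢
        exact hRI.key v hv
    · simp [w1, w4, a0]
      omega
    · omega
    · simp
    · simp
      intro y hy
      by_cases hyu : y = u
      · rw [hyu]
      · rw [Function.update_of_ne hyu] at hy
        exact hRI.inv.mono y u hy hu0
    · rintro k₃ s₃ ⟨⟨ch₃, L₃, hI₃', hc₃, hk₃⟩, hF₃⟩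
      have f1 : s₃.wv 1 = s.wv 1 := (hF₃.wv 1 (by decide)).trans (by simp [w1])
      have f7 : s₃.wv 7 = s.wv 7 + 1 := (hF₃.wv 7 (by decide)).trans (by simp)
      have f0 : s₃.wa 0 = s.wa 0 := (hF₃.wa 0 (by decide)).trans (by simp [a0])
      have f4 : s₃.wa 4 = Function.update (s.wa 4) u 1 := (hF₃.wa 4 (by decide)).trans (by simp [a4])
      have hrem₃ : remainingArcs s₃ = ((Finset.range (s.wv 1)).filter
          fun a => Function.update (s.wa 4) u 1 (s.wa 0 a) = 0).card := by
        unfold remainingArcs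
        rw [f1, f0, f4]
      rw [← hrem₃] at hcard
      simp [w1, w4, a0] at hc₃ hk₃
      refine ⟨ch₃, L₃, hI₃', by omega, ?_⟩
      have hp₂ : heapPotential B ((((((s₂.setW 14 u).setWA 5 u 0).setWA 4 u 1).setWA 7 (s.wv 7) u).setW 7
        (s.wv 7 + 1))) ch₁ L₁ ≤ heapPotential B s₂ ch₁ L₁ + 300 * B := by
        simp [heapPotential]
        omega
      rw [f7]
      obtain ⟨d, hd⟩ : ∃ d, s.wv 0 = s.wv 7 + 1 + d := ⟨s.wv 0 - (s.wv 7 + 1), by omega⟩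
      have e1 : s.wv 0 - (s.wv 7 + 1) = d := by omega
      have e2 : s.wv 0 - s.wv 7 = d + 1 := by omega
      rw [e1, e2]
      have e3 : 700 * (B + 1) * (d + 1 + 1) = 700 * (B + 1) * (d + 1) + 700 * B + 700 := by ring
      have e5 : 700 * (B + 1) * (d + if s₃.wv 5 = 0 then 0 else 1) ≤ 700 * (B + 1) * (d + 1) :=
        Nat.mul_le_mul_left _ (by split_ifs <;> omega)
      omega

theorem wp_dijkstra {W B : ℕ} {s : State} (hA : ArcsOk s) (hS : s.wv 2 < s.wv 0)
    (hB : ∀ r, 2 ^ (r / 2) ≤ s.wv 1 + 1 → r < B) (hBW : B ≤ W) (hW : s.wv 1 + 1 < W)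
    (hNW : s.wv 0 ≤ W) (z4 : s.wv 4 = 0) (z5 : s.wv 5 = 0) (z6 : s.wv 6 = 0) (z7 : s.wv 7 = 0)
    (za2 : ∀ i, s.wa 2 i = 0) (za4 : ∀ i, s.wa 4 i = 0) (za5 : ∀ i, s.wa 5 i = 0)
    (za12 : ∀ i, s.wa 12 i = 0) :
    dijkstra.wp W (fun k s' => k ≤ 2000 * (s.wv 1 + (B + 1) * (s.wv 0 + 1)) ∧
      ShortestPaths (s.wv 0) (s.wv 1) (s.wv 2) (s.wa 0) (s.wa 1) (s.ra 0) (s'.wa 4) (s'.wa 6)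
        (s'.wa 7) (s'.wv 7) (s'.ra 1)) s := by
  refine Program.wp_seq (Program.wp_mono (Program.wp_frame (wp_buildAdjacency (by omega) za2)) ?_)
  rintro k₁ s₁ ⟨⟨hk₁, hadj₁, hadj₂⟩, hF₁⟩
  have w0 : s₁.wv 0 = s.wv 0 := hF₁.wv 0 (by decide)
  have w1 : s₁.wv 1 = s.wv 1 := hF₁.wv 1 (by decide)
  have w2 : s₁.wv 2 = s.wv 2 := hF₁.wv 2 (by decide)
  have w4 : s₁.wv 4 = s.wv 4 := hF₁.wv 4 (by decide)
  have w5 : s₁.wv 5 = s.wv 5 := hF₁.wv 5 (by decide)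
  have w6 : s₁.wv 6 = s.wv 6 := hF₁.wv 6 (by decide)
  have w7 : s₁.wv 7 = s.wv 7 := hF₁.wv 7 (by decide)
  have a0 : s₁.wa 0 = s.wa 0 := hF₁.wa 0 (by decide)
  have a1 : s₁.wa 1 = s.wa 1 := hF₁.wa 1 (by decide)
  have a4 : s₁.wa 4 = s.wa 4 := hF₁.wa 4 (by decide)
  have a5 : s₁.wa 5 = s.wa 5 := hF₁.wa 5 (by decide)
  have a12 : s₁.wa 12 = s.wa 12 := hF₁.wa 12 (by decide)
  have r0 : s₁.ra 0 = s.ra 0 := hF₁.ra 0 (by decide)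
  refine ⟨trivial, trivial, Nat.zero_le _, ?_⟩
  obtain ⟨s₂, hs₂⟩ : ∃ s₂, s₂ = ((s₁.setW 15 (s.wv 2)).setR 0 0).setW 3 0 := ⟨_, rfl⟩
  have hs₂' : ((s₁.setW 15 (WExp.eval s₁ (.var 2))).setR 0 (RExp.eval (s₁.setW 15
      (WExp.eval s₁ (.var 2))) .zero)).setW 3 (WExp.eval ((s₁.setW 15
      (WExp.eval s₁ (.var 2))).setR 0 (RExp.eval (s₁.setW 15
      (WExp.eval s₁ (.var 2))) .zero)) (.const 0)) = s₂ := by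
    rw [hs₂]
    simp [w2]
  rw [hs₂']
  have hI₂ : HeapInv B s₂ (fun _ => []) ∅ := by
    rw [hs₂]
    refine ⟨?_, by simp, ?_, by simp, ?_, ?_⟩
    · simp [w5, z5, a12, slotNodes_eq_zero za12, stackNodes]
      exact ⟨by simp, by simp, by simp, by simp, by simp, by simp, by simp⟩
    · simp [a12, za12]
    · simp [a5, za5]
    · simpa [w6, z6] using hB 0 (by simp)
  refine Program.wp_seq (Program.wp_mono (Program.wp_frame (wp_insertNode (B := B)
    (ch := fun _ => []) (L := ∅) ?_ hI₂ ?_ ?_)) ?_)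
  · rw [hs₂]; simp [w4]; omega
  · rw [hs₂]; simpa [a12] using za12
  · rw [hs₂]; simp [a5, za5]
  rintro k₃ s₃ ⟨⟨hk₃, ch₃, L₃, hN⟩, hF₃⟩
  have v0 : s₃.wv 0 = s.wv 0 := (hF₃.wv 0 (by decide)).trans (by simp [hs₂, w0])
  have v1 : s₃.wv 1 = s.wv 1 := (hF₃.wv 1 (by decide)).trans (by simp [hs₂, w1])
  have v2 : s₃.wv 2 = s.wv 2 := (hF₃.wv 2 (by decide)).trans (by simp [hs₂, w2])
  have v7 : s₃.wv 7 = 0 := (hF₃.wv 7 (by decide)).trans (by simp [hs₂, w7, z7])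
  have v4 : s₃.wv 4 = 1 := hN.cnt.trans (by simp [hs₂, w4, z4])
  have b0 : s₃.wa 0 = s.wa 0 := (hF₃.wa 0 (by decide)).trans (by simp [hs₂, a0])
  have b1 : s₃.wa 1 = s.wa 1 := (hF₃.wa 1 (by decide)).trans (by simp [hs₂, a1])
  have b2 : s₃.wa 2 = s₁.wa 2 := (hF₃.wa 2 (by decide)).trans (by simp [hs₂])
  have b3 : s₃.wa 3 = s₁.wa 3 := (hF₃.wa 3 (by decide)).trans (by simp [hs₂])
  have b4 : s₃.wa 4 = s.wa 4 := (hF₃.wa 4 (by decide)).trans (by simp [hs₂, a4])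
  have b12 : s₃.wa 12 = s.wa 12 := (hF₃.wa 12 (by decide)).trans (by simp [hs₂, a12])
  have q0 : s₃.ra 0 = s.ra 0 := (hF₃.ra 0 (by decide)).trans (by simp [hs₂, r0])
  have b5 : s₃.wa 5 = Function.update (s.wa 5) (s.wv 2) 1 :=
    hN.cur.trans (by simp [hs₂, a5, w4, z4])
  have q1 : s₃.ra 1 (s.wv 2) = 0 := by rw [hN.dist]; simp [hs₂]
  have q2 : s₃.ra 2 1 = 0 := by rw [hN.key]; simp [hs₂, w4, z4]
  have hp₃ : heapPotential B s₃ ch₃ L₃ ≤ 800 := by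
    refine hN.potential.trans ?_
    simp [hs₂, heapPotential, w5, z5, a12, slotNodes_eq_zero za12, hollowChildren]
  have hA₃ : ArcsOk s₃ := ⟨by rw [v0, v1, b1]; exact hA.dst_lt, by rw [v1, q0]; exact hA.nonneg⟩
  have hadj₃ : AdjacencyOk s₃ :=
    ⟨by rw [v1, b0, b2]; exact hadj₁, by rw [v1, b0, b3]; exact hadj₂⟩
  have hRI₃ : RunInv B s₃ ch₃ L₃ ∅ := by
    refine ⟨hN.inv, by rw [b12]; exact za12, ?_, ?_⟩
    · rw [v0, v1, v2, v7, b0, b1, b4, b5, q0]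
      exact DijkstraInv.init hS one_ne_zero q1 za4 za5
    · intro v hv
      have hvS : v = s.wv 2 := by
        by_contra hne
        rw [b5, Function.update_of_ne hne] at hv
        exact hv (za5 v)
      rw [hvS, b5, Function.update_self, q1, q2]
  have hrem₃ : remainingArcs s₃ ≤ s.wv 1 := by
    unfold remainingArcs
    rw [v1]
    exact (Finset.card_filter_le _ _).trans (by simp)
  refine Program.wp_loop_ghost
    (fun φ t => ∃ ch' L', RunInv B t ch' L' ∅ ∧ t.wv 4 + remainingArcs t ≤ s.wv 1 + 1 ∧
      φ = heapPotential B t ch' L' + 1000 * remainingArcs t +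
        700 * (B + 1) * (s.wv 0 - t.wv 7 + if t.wv 5 = 0 then 0 else 1))
    _ ⟨ch₃, L₃, hRI₃, by omega, rfl⟩ ?_ ?_ ?_
  · intros; simp
  · rintro φ t hF - ⟨ch', L', hI, hc, rfl⟩ hb
    have v0' : t.wv 0 = s₃.wv 0 := hF.wv 0 (by decide)
    have v1' : t.wv 1 = s₃.wv 1 := hF.wv 1 (by decide)
    have b0' : t.wa 0 = s₃.wa 0 := hF.wa 0 (by decide)
    have b1' : t.wa 1 = s₃.wa 1 := hF.wa 1 (by decide)
    have b2' : t.wa 2 = s₃.wa 2 := hF.wa 2 (by decide)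
    have b3' : t.wa 3 = s₃.wa 3 := hF.wa 3 (by decide)
    have q0' : t.ra 0 = s₃.ra 0 := hF.ra 0 (by decide)
    have hsp : t.wv 5 ≠ 0 := by simpa using hb
    refine Program.wp_mono (wp_dijkstraStep (B := B) (ch := ch') (L := L')
      ⟨by rw [v0', v1', b1']; exact hA₃.dst_lt, by rw [v1', q0']; exact hA₃.nonneg⟩
      ⟨by rw [v1', b0', b2']; exact hadj₃.head, by rw [v1', b0', b3']; exact hadj₃.next⟩ hI
      (by omega) (by rw [v1', v1]; exact hB) hBW (by omega) (by omega)) ?_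
    rintro k t' ⟨ch'', L'', hI', hc', hk⟩
    refine ⟨_, ⟨ch'', L'', hI', by omega, rfl⟩, ?_⟩
    rw [v0', v0] at hk
    rw [if_neg hsp]
    simp
    omega
  · rintro k φ t hF - ⟨ch', L', hI, hc, rfl⟩ hb hk
    have v0' : t.wv 0 = s₃.wv 0 := hF.wv 0 (by decide)
    have v1' : t.wv 1 = s₃.wv 1 := hF.wv 1 (by decide)
    have v2' : t.wv 2 = s₃.wv 2 := hF.wv 2 (by decide)
    have b0' : t.wa 0 = s₃.wa 0 := hF.wa 0 (by decide)
    have b1' : t.wa 1 = s₃.wa 1 := hF.wa 1 (by decide)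
    have q0' : t.ra 0 = s₃.ra 0 := hF.ra 0 (by decide)
    have hsp : t.wv 5 = 0 := by simpa using hb
    refine ⟨?_, ?_⟩
    · rw [v7] at hk
      simp at hk ⊢
      have h₁ : (s.wv 0 + if s₃.wv 5 = 0 then 0 else 1) ≤ s.wv 0 + 1 := by split_ifs <;> omega
      have h₂ := Nat.mul_le_mul_left (700 * (B + 1)) h₁
      have h₃ : 700 * (B + 1) * (s.wv 0 + 1) = 700 * ((B + 1) * (s.wv 0 + 1)) := by ring
      have h₄ : B + 1 ≤ (B + 1) * (s.wv 0 + 1) := Nat.le_mul_of_pos_right _ (by omega)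
      have h₅ : 1 * (s.wv 0 + 1) ≤ (B + 1) * (s.wv 0 + 1) := Nat.mul_le_mul_right _ (by omega)
      have h₆ : 0 < B := (Nat.zero_le _).trans_lt (hB 0 (by simp))
      omega
    · have hinv := hI.inv
      rw [v0', v1', v2', b0', b1', q0', v0, v1, v2, b0, b1, q0] at hinv
      refine hinv.shortestPaths fun v => ?_
      -- With an empty stack and empty slots there is no root, hence no node, so no vertex is still
      -- waiting.
      by_contra hv
      have hheap := hI.heap.heap
      rw [hsp, slotNodes_eq_zero hI.slots] at hheap
      obtain ⟨a, ha, -⟩ := hheap.exists_root (hI.heap.cur v hv).1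
      simp [stackNodes] at ha

end RealRAM

/-! ### Detours around a vertex of the path -/

section

variable (E : ℕ → ℕ → ℝ → Prop)

/-- `Route E a l b W`: `l` lists the vertices of a walk of length `W` from `a` to `b`. -/
inductive Route : ℕ → List ℕ → ℕ → ℝ → Prop
  | single (a : ℕ) : Route a [a] a 0
  | cons {a b t : ℕ} {l : List ℕ} {c W : ℝ} (h : E a b c) (hr : Route b l t W) :
      Route a (a :: l) t (c + W)

/-- `Avoids E x r v W`: a walk of length `W` from `r` to `v` avoids `x`. -/
inductive Avoids (x r : ℕ) : ℕ → ℝ → Prop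
  | base (h : r ≠ x) : Avoids x r r 0
  | step {u v : ℕ} {W c : ℝ} (hr : Avoids x r u W) (h : E u v c) (hv : v ≠ x) :
      Avoids x r v (W + c)

/-- `l` lists the vertices that satisfy `p` on the way from `a` along `nx` (shifted by one) to the
first vertex `b` that does not. -/
inductive Follows (nx : ℕ → ℕ) (p : ℕ → Prop) : ℕ → List ℕ → ℕ → Prop
  | nil {a : ℕ} (h : ¬ p a) : Follows nx p a [] a
  | cons {a b : ℕ} {l : List ℕ} (h : p a) (hl : Follows nx p (nx a - 1) l b) :
      Follows nx p a (a :: l) b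

/-- The two ways from `a` and `b` up to their lowest common ancestor `m`. -/
inductive Meets (par dep : ℕ → ℕ) : ℕ → ℕ → List ℕ → List ℕ → ℕ → Prop
  | refl (a : ℕ) : Meets par dep a a [] [] a
  | left {a b m : ℕ} {A B : List ℕ} (h : a ≠ b) (hd : dep b ≤ dep a)
      (hm : Meets par dep (par a - 1) b A B m) : Meets par dep a b (a :: A) B m
  | right {a b m : ℕ} {A B : List ℕ} (h : a ≠ b) (hd : dep a < dep b)
      (hm : Meets par dep a (par b - 1) A B m) : Meets par dep a b A (b :: B) m

structure IsArcs (n : ℕ) : Prop where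
  symm : ∀ u v c, E u v c → E v u c
  pos : ∀ u v c, E u v c → 0 < c
  lt : ∀ u v c, E u v c → u < n

/-- A shortest-path tree with parents `par` (shifted by one), distances `d` and depths `dep`, a path
in it marked by `onP`, and the levels of the vertices with respect to this path: `lv v` is the
number of vertices on the path above `v`, and `0` if `v` is not reachable. The vertex of the path on
level `I` is `X I`. -/
structure LevelTree (n r : ℕ) (d : ℕ → ℝ) (lv par dep onP X : ℕ → ℕ) : Prop where
  lv_root : lv r = 1
  onP_root : onP r ≠ 0
  par_root : par r = n + 1
  dist_root : d r = 0
  lv_top : lv n = 0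
  reach : ∀ u v c, E u v c → lv u ≠ 0 → lv v ≠ 0 ∧ d v ≤ d u + c
  parent : ∀ v, lv v ≠ 0 → v ≠ r → ∃ u c, par v = u + 1 ∧ E u v c ∧ d v = d u + c ∧
    dep v = dep u + 1 ∧ lv u ≠ 0 ∧
      ((onP v = 0 ∧ lv u = lv v) ∨ (onP v ≠ 0 ∧ onP u ≠ 0 ∧ lv v = lv u + 1))
  onP_eq : ∀ v, onP v ≠ 0 → X (lv v) = v
  lt : ∀ v, lv v ≠ 0 → v < n
  lv_le : ∀ v, lv v ≤ n
  dist_nonneg : ∀ v, lv v ≠ 0 → 0 ≤ d v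

/-- Predecessors `p` (shifted by one) and lengths `δ` of detours to the vertices off the path. A
detour enters the level of its endpoint from above, or from below with the help of the cell of the
level. -/
structure Detours (d : ℕ → ℝ) (lv onP X zz : ℕ → ℕ) (cv : ℕ → ℝ) (p : ℕ → ℕ) (δ : ℕ → ℝ) :
    Prop where
  up : ∀ u v c, E u v c → lv u ≠ 0 → onP v = 0 → lv u < lv v → p v ≠ 0 ∧ δ v ≤ d u + c
  eq : ∀ u v c, E u v c → lv u ≠ 0 → onP v = 0 → onP u = 0 → lv u = lv v → p u ≠ 0 →
    p v ≠ 0 ∧ δ v ≤ δ u + c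
  down : ∀ u v c, E u v c → lv v ≠ 0 → onP v = 0 → lv v < lv u → zz (lv v) ≠ 0 →
    p v ≠ 0 ∧ δ v ≤ cv (lv v) - 2 * d (X (lv v + 1)) + d u + c
  pred : ∀ v, p v ≠ 0 → onP v = 0 ∧ lv v ≠ 0 ∧ ∃ u c, E u v c ∧ p v = u + 1 ∧ lv u ≠ 0 ∧
    ((lv u < lv v ∧ δ v = d u + c) ∨ (lv u = lv v ∧ p u ≠ 0 ∧ δ v = δ u + c) ∨
      (lv v < lv u ∧ zz (lv v) ≠ 0 ∧ δ v = cv (lv v) - 2 * d (X (lv v + 1)) + d u + c))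
  nonneg : ∀ v, p v ≠ 0 → 0 ≤ δ v

/-- `y` is reached with length `k` without the vertex of the path on level `I`. -/
def Launch (d : ℕ → ℝ) (lv onP p : ℕ → ℕ) (δ : ℕ → ℝ) (I y : ℕ) (k : ℝ) : Prop :=
  lv y ≠ 0 ∧ ((lv y < I ∧ k = d y) ∨ (lv y = I ∧ onP y = 0 ∧ p y ≠ 0 ∧ k = δ y))

/-- The cheapest arcs `zy I - 1`, `zz I - 1` that cross the level `I`, and their costs `cv I`. -/
structure Cells (d : ℕ → ℝ) (lv onP p : ℕ → ℕ) (δ : ℕ → ℝ) (zy zz : ℕ → ℕ) (cv : ℕ → ℝ) :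
    Prop where
  sound : ∀ I, zz I ≠ 0 → ∃ y z c k, E y z c ∧ I < lv z ∧ Launch d lv onP p δ I y k ∧
    zy I = y + 1 ∧ zz I = z + 1 ∧ cv I = k + c + d z
  complete : ∀ I y z c k, E y z c → I < lv z → Launch d lv onP p δ I y k →
    zz I ≠ 0 ∧ cv I ≤ k + c + d z

end

/-! ### Routes in the tree and chains of detours. -/

section

variable {E : ℕ → ℕ → ℝ → Prop} {n r : ℕ} {d : ℕ → ℝ} {lv par dep onP X : ℕ → ℕ}

theorem Route.snoc {a b t : ℕ} {l : List ℕ} {c W : ℝ} (h : Route E a l b W) (hE : E b t c) :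
    Route E a (l ++ [t]) t (W + c) := by
  induction h with
  | single a =>
    have := Route.cons hE (Route.single t)
    simpa [add_comm] using this
  | cons h' hr ih =>
    rw [add_assoc]
    exact Route.cons h' (ih hE)

theorem Route.append {a b u t : ℕ} {l l' : List ℕ} {c W W' : ℝ} (h : Route E a l b W)
    (hE : E b u c) (h' : Route E u l' t W') : Route E a (l ++ l') t (W + c + W') := by
  induction h with
  | single a =>
    rw [zero_add]
    exact Route.cons hE h'
  | cons h₁ hr ih =>
    rw [add_assoc, add_assoc, ← add_assoc _ c]
    exact Route.cons h₁ (ih hE)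

theorem Route.reverse {a b : ℕ} {l : List ℕ} {W : ℝ} (hE : ∀ u v c, E u v c → E v u c)
    (h : Route E a l b W) : Route E b l.reverse a W := by
  induction h with
  | single a => exact Route.single a
  | cons h' hr ih =>
    rw [List.reverse_cons, add_comm]
    exact ih.snoc (hE _ _ _ h')

namespace LevelTree

/-- A step to the parent lowers the level only at a vertex of the path, and then by one. So from
level at least `J` it cannot leave these levels unless it starts at `X J`. -/
theorem parent' (h : LevelTree E n r d lv par dep onP X) {v J : ℕ} (hJ : J ≠ 0) (hv : J ≤ lv v)
    (hne : v ≠ X J) : ∃ u c, par v = u + 1 ∧ E u v c ∧ d v = d u + c ∧ dep v = dep u + 1 ∧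
      J ≤ lv u := by
  have hr : v ≠ r := by
    rintro rfl
    have : J = 1 := by have := h.lv_root; omega
    rw [this, ← h.lv_root] at hne
    exact hne (h.onP_eq v h.onP_root).symm
  obtain ⟨u, c, h₁, h₂, h₃, h₄, h₅, h₆⟩ := h.parent v (by omega) hr
  refine ⟨u, c, h₁, h₂, h₃, h₄, ?_⟩
  rcases h₆ with ⟨-, h₆⟩ | ⟨h₆, -, h₇⟩
  · omega
  · have : lv v ≠ J := by
      rintro rfl
      exact hne (h.onP_eq v h₆).symm
    omega

/-- Iterating `LevelTree.parent'` leads to `X J` with decreasing distance and depth: the vertices of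
level at least `J` form the subtree of `X J`. -/
theorem top_le (h : LevelTree E n r d lv par dep onP X) (hE : IsArcs E n) {J : ℕ} (hJ : J ≠ 0) :
    ∀ {v : ℕ}, J ≤ lv v → 0 ≤ d (X J) ∧ d (X J) ≤ d v ∧ dep (X J) ≤ dep v ∧ (dep (X J) = dep v → v = X J) := by
  suffices H : ∀ (k v : ℕ), dep v = k → J ≤ lv v →
      0 ≤ d (X J) ∧ d (X J) ≤ d v ∧ dep (X J) ≤ dep v ∧ (dep (X J) = dep v → v = X J) from
    fun {_} hv => H _ _ rfl hv
  intro k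
  induction k using Nat.strong_induction_on with
  | _ k ih =>
  intro v hk hv
  by_cases hne : v = X J
  · rw [← hne]; simpa using h.dist_nonneg v (by omega)
  obtain ⟨u, c, h₁, h₂, h₃, h₄, h₅⟩ := h.parent' hJ hv hne
  obtain ⟨i₀, i₁, i₂, i₃⟩ := ih (dep u) (by omega) u rfl h₅
  have := hE.pos _ _ _ h₂
  exact ⟨i₀, by linarith, by omega, by omega⟩

/-- The deeper end is always replaced by its parent, so the ends meet within the subtree of `X J`,
and the lengths telescope. The statements on depths are there for the induction: a new end is deeper
than all that follows on its side and cannot recur on the other. -/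
theorem exists_meets (h : LevelTree E n r d lv par dep onP X) (hE : IsArcs E n) {J : ℕ}
    (hJ : J ≠ 0) : ∀ {a b : ℕ}, J ≤ lv a → J ≤ lv b → ∃ A B m, Meets par dep a b A B m ∧
      J ≤ lv m ∧ Route E a (A ++ m :: B.reverse) b (d a + d b - 2 * d m) ∧
      (A ++ m :: B.reverse).Nodup ∧ (∀ y ∈ A ++ m :: B.reverse, J ≤ lv y) ∧
      (∀ y, y ∈ A ∨ y = m → dep y ≤ dep a ∧ (dep y = dep a → y = a)) ∧
      (∀ y, y ∈ B ∨ y = m → dep y ≤ dep b ∧ (dep y = dep b → y = b)) := by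
  suffices H : ∀ (k a b : ℕ), dep a + dep b = k → J ≤ lv a → J ≤ lv b →
      ∃ A B m, Meets par dep a b A B m ∧
      J ≤ lv m ∧ Route E a (A ++ m :: B.reverse) b (d a + d b - 2 * d m) ∧
      (A ++ m :: B.reverse).Nodup ∧ (∀ y ∈ A ++ m :: B.reverse, J ≤ lv y) ∧
      (∀ y, y ∈ A ∨ y = m → dep y ≤ dep a ∧ (dep y = dep a → y = a)) ∧
      (∀ y, y ∈ B ∨ y = m → dep y ≤ dep b ∧ (dep y = dep b → y = b)) from
    fun {_ _} ha hb => H _ _ _ rfl ha hb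
  intro k
  induction k using Nat.strong_induction_on with
  | _ k ih =>
  intro a b hk ha hb
  by_cases hab : a = b
  · subst hab
    refine ⟨[], [], a, .refl a, ha, ?_, by simp, by simpa using ha, by simp, by simp⟩
    have : d a + d a - 2 * d a = 0 := by ring
    rw [this]
    exact .single a
  by_cases hd : dep b ≤ dep a
  -- `X J` is the only vertex of least depth on these levels. If the end that has to move were `X
  -- J`, the two ends would coincide.
  · have hne : a ≠ X J := by
      intro hne
      obtain ⟨-, -, h₂, h₃⟩ := h.top_le hE hJ hb
      rw [← hne] at h₂ h₃
      exact hab (h₃ (by omega)).symm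
    obtain ⟨u, c, h₁, h₂, h₃, h₄, h₅⟩ := h.parent' hJ ha hne
    obtain ⟨A, B, m, i₁, i₂, i₃, i₄, i₅, i₆, i₇⟩ := ih _ (by omega) u b rfl h₅ hb
    refine ⟨a :: A, B, m, .left hab hd (by simpa [h₁] using i₁), i₂, ?_, ?_, ?_, ?_, i₇⟩
    · have e : d a + d b - 2 * d m = c + (d u + d b - 2 * d m) := by rw [h₃]; ring
      rw [e]
      exact .cons (hE.symm _ _ _ h₂) i₃
    · refine List.nodup_cons.2 ⟨fun hmem => ?_, i₄⟩
      have hmem' : (a ∈ A ∨ a = m) ∨ (a ∈ B ∨ a = m) := by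
        simp at hmem; tauto
      rcases hmem' with hmem' | hmem'
      · have := i₆ a hmem'; omega
      · have := i₇ a hmem'
        exact hab (this.2 (by omega))
    · intro y hy
      rcases List.mem_cons.1 hy with rfl | hy
      · exact ha
      · exact i₅ y hy
    · rintro y hy
      by_cases hya : y = a
      · simp [hya]
      · have hy' : y ∈ A ∨ y = m := by simp [hya] at hy; exact hy
        have := i₆ y hy'
        omega
  · have hne : b ≠ X J := by
      intro hne
      obtain ⟨-, -, h₂, h₃⟩ := h.top_le hE hJ ha
      rw [← hne] at h₂ h₃
      omega
    obtain ⟨u, c, h₁, h₂, h₃, h₄, h₅⟩ := h.parent' hJ hb hne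
    obtain ⟨A, B, m, i₁, i₂, i₃, i₄, i₅, i₆, i₇⟩ := ih _ (by omega) a u rfl ha h₅
    have hl : A ++ m :: (b :: B).reverse = (A ++ m :: B.reverse) ++ [b] := by simp
    refine ⟨A, b :: B, m, .right hab (by omega) (by simpa [h₁] using i₁), i₂, ?_, ?_, ?_, i₆, ?_⟩
    · have e : d a + d b - 2 * d m = (d a + d u - 2 * d m) + c := by rw [h₃]; ring
      rw [e, hl]
      exact i₃.snoc h₂
    · rw [hl, List.nodup_append]
      refine ⟨i₄, by simp, ?_⟩
      rintro y hy z hz rfl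
      rw [List.mem_singleton.1 hz] at hy
      have hmem' : (b ∈ A ∨ b = m) ∨ (b ∈ B ∨ b = m) := by
        simp at hy; tauto
      rcases hmem' with hmem' | hmem'
      · have := i₆ b hmem'; omega
      · have := i₇ b hmem'; omega
    · intro y hy
      rw [hl] at hy
      rcases List.mem_append.1 hy with hy | hy
      · exact i₅ y hy
      · rw [List.mem_singleton.1 hy]; exact hb
    · rintro y hy
      by_cases hya : y = b
      · simp [hya]
      · have hy' : y ∈ B ∨ y = m := by simp [hya] at hy; exact hy
        have := i₇ y hy'
        omega

/-- The climb stops at the artificial vertex `n`, to which the root points and whose level is 0; so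
the root itself is still listed. -/
theorem exists_root_route (h : LevelTree E n r d lv par dep onP X) (hE : IsArcs E n) :
    ∀ {v : ℕ}, lv v ≠ 0 → ∃ l, Follows par (fun y => lv y ≠ 0) v l n ∧ Route E v l r (d v) ∧
      l.Nodup ∧ ∀ y ∈ l, lv y ≠ 0 ∧ lv y ≤ lv v := by
  suffices H : ∀ (k v : ℕ), dep v = k → lv v ≠ 0 →
      ∃ l, Follows par (fun y => lv y ≠ 0) v l n ∧ Route E v l r (d v) ∧
      l.Nodup ∧ ∀ y ∈ l, dep y ≤ dep v ∧ lv y ≠ 0 ∧ lv y ≤ lv v by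
    intro v hv
    obtain ⟨l, h₁, h₂, h₃, h₄⟩ := H _ _ rfl hv
    exact ⟨l, h₁, h₂, h₃, fun y hy => (h₄ y hy).2⟩
  intro k
  induction k using Nat.strong_induction_on with
  | _ k ih =>
  intro v hk hv
  by_cases hr : v = r
  · subst hr
    refine ⟨[v], .cons hv ?_, ?_, by simp, by simpa using hv⟩
    · rw [h.par_root]
      exact .nil (by simp [h.lv_top])
    · rw [h.dist_root]
      exact .single v
  · obtain ⟨u, c, h₁, h₂, h₃, h₄, h₅, h₆⟩ := h.parent v hv hr
    obtain ⟨l, i₁, i₂, i₃, i₄⟩ := ih _ (by omega) u rfl h₅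
    refine ⟨v :: l, .cons hv (by simpa [h₁] using i₁), ?_, ?_, ?_⟩
    · rw [h₃, add_comm]
      exact .cons (hE.symm _ _ _ h₂) i₂
    · refine List.nodup_cons.2 ⟨fun hm => ?_, i₃⟩
      have := i₄ v hm
      omega
    · intro y hy
      rcases List.mem_cons.1 hy with rfl | hy
      · exact ⟨le_rfl, hv, le_rfl⟩
      · have := i₄ y hy
        omega

end LevelTree

/-- On finitely many vertices the strict order of real labels is well founded: count the vertices
with smaller label. -/
theorem induction_on_real {n : ℕ} (f : ℕ → ℝ) {p : ℕ → Prop}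
    (h : ∀ v < n, (∀ u < n, f u < f v → p u) → p v) : ∀ v < n, p v := by
  suffices H : ∀ (k v : ℕ), v < n → ((Finset.range n).filter fun u => f u < f v).card = k → p v from
    fun v hv => H _ v hv rfl
  intro k
  induction k using Nat.strong_induction_on with
  | _ k ih =>
  intro v hv hk
  refine h v hv fun u hu huv => ih _ ?_ u hu rfl
  rw [← hk]
  refine Finset.card_lt_card ⟨fun y hy => ?_, fun hs => ?_⟩
  · simp only [Finset.mem_filter] at hy ⊢
    exact ⟨hy.1, hy.2.trans huv⟩
  · have := hs (Finset.mem_filter.2 ⟨Finset.mem_range.2 hu, huv⟩)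
    simp at this

/-- The chain of predecessors of a detour up to the vertex `u` where it enters the level. -/
theorem Detours.exists_chain {zz : ℕ → ℕ} {cv : ℕ → ℝ} {p : ℕ → ℕ} {δ : ℕ → ℝ}
    (h : LevelTree E n r d lv par dep onP X) (hE : IsArcs E n)
    (hD : Detours E d lv onP X zz cv p δ) {v I : ℕ} (hv : p v ≠ 0) (hI : lv v = I) :
    ∃ l u W b, Follows p (fun y => lv y = I) v l u ∧ lv u ≠ 0 ∧
      (∀ t l' W', Route E u l' t W' → Route E v (l ++ l') t (W + W')) ∧ δ v = W + b ∧
      (∀ y ∈ l, lv y = I ∧ onP y = 0 ∧ p y ≠ 0 ∧ b < δ y ∧ δ y ≤ δ v) ∧ l.Nodup ∧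
      ((lv u < I ∧ b = d u) ∨
        (I < lv u ∧ zz I ≠ 0 ∧ b = cv I - 2 * d (X (I + 1)) + d u)) := by
  have hvn : v < n := h.lt v (hD.pred v hv).2.1
  revert hv hI
  refine induction_on_real (n := n) δ (p := fun v => p v ≠ 0 → lv v = I → ∃ l u W b, Follows p (fun y => lv y = I) v l u ∧ lv u ≠ 0 ∧
      (∀ t l' W', Route E u l' t W' → Route E v (l ++ l') t (W + W')) ∧ δ v = W + b ∧
      (∀ y ∈ l, lv y = I ∧ onP y = 0 ∧ p y ≠ 0 ∧ b < δ y ∧ δ y ≤ δ v) ∧ l.Nodup ∧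
      ((lv u < I ∧ b = d u) ∨
        (I < lv u ∧ zz I ≠ 0 ∧ b = cv I - 2 * d (X (I + 1)) + d u))) ?_ v hvn
  intro v hvn ih hv hI
  obtain ⟨h₁, h₂, u, c, h₃, h₄, h₅, h₆⟩ := hD.pred v hv
  have hc := hE.pos _ _ _ h₃
  have hvu := hE.symm _ _ _ h₃
  rw [hI] at h₆
  -- The chain ends when the predecessor is on another level. The length `b` of the detour up to
  -- there is below all labels on the chain, since arcs are positive.
  have hfin : lv u ≠ I → ∀ b, δ v = b + c → ((lv u < I ∧ b = d u) ∨
        (I < lv u ∧ zz I ≠ 0 ∧ b = cv I - 2 * d (X (I + 1)) + d u)) →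
      ∃ l u W b, Follows p (fun y => lv y = I) v l u ∧ lv u ≠ 0 ∧
      (∀ t l' W', Route E u l' t W' → Route E v (l ++ l') t (W + W')) ∧ δ v = W + b ∧
      (∀ y ∈ l, lv y = I ∧ onP y = 0 ∧ p y ≠ 0 ∧ b < δ y ∧ δ y ≤ δ v) ∧ l.Nodup ∧
      ((lv u < I ∧ b = d u) ∨
        (I < lv u ∧ zz I ≠ 0 ∧ b = cv I - 2 * d (X (I + 1)) + d u)) := by
    intro hu b hb hcase
    refine ⟨[v], u, c, b, .cons hI ?_, h₅, fun t l' W' hr => .cons hvu hr, by rw [hb, add_comm], ?_,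
      by simp, hcase⟩
    · rw [h₄]
      exact .nil hu
    · intro y hy
      rw [List.mem_singleton.1 hy]
      exact ⟨hI, h₁, hv, by linarith, le_rfl⟩
  rcases h₆ with ⟨h₆, h₇⟩ | ⟨h₆, h₇, h₈⟩ | ⟨h₆, h₇, h₈⟩
  · exact hfin h₆.ne _ h₇ (Or.inl ⟨h₆, rfl⟩)
  · obtain ⟨l, x, W, b, i₁, i₂, i₃, i₄, i₅, i₆, i₇⟩ := ih u (h.lt u h₅) (by linarith) h₇ h₆
    refine ⟨v :: l, x, c + W, b, .cons hI (by simpa [h₄] using i₁), i₂, fun t l' W' hr => ?_, ?_, ?_,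
      ?_, i₇⟩
    · rw [add_assoc]
      exact .cons hvu (i₃ t l' W' hr)
    · rw [h₈, i₄]; ring
    · have hb : b < δ u := by
        have : u ∈ l := by
          cases i₁ with
          | nil h' => exact absurd h₆ h'
          | cons h' hl => simp
        exact (i₅ u this).2.2.2.1
      intro y hy
      rcases List.mem_cons.1 hy with rfl | hy
      · exact ⟨hI, h₁, hv, by linarith, le_rfl⟩
      · obtain ⟨j₁, j₂, j₃, j₄, j₅⟩ := i₅ y hy
        exact ⟨j₁, j₂, j₃, j₄, by linarith⟩
    · refine List.nodup_cons.2 ⟨fun hm => ?_, i₆⟩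
      have := (i₅ v hm).2.2.2.2
      linarith
  · exact hfin h₆.ne' _ h₈ (Or.inr ⟨h₆, h₇, rfl⟩)

end

/-- The vertices `out`, in the order from `v` to the root, of the path that a query reports when the
vertex of the path on level `I` has to be avoided. -/
def Answer (n : ℕ) (lv par dep p₁ p₃ zy zz : ℕ → ℕ) (I v : ℕ) (out : List ℕ) : Prop :=
  ∃ l₃ u, Follows p₃ (fun y => lv y = I) v l₃ u ∧
    ((lv u < I ∧ ∃ l, Follows par (fun y => lv y ≠ 0) u l n ∧ out = l₃ ++ l) ∨
      (I < lv u ∧ ∃ A B m l₁ y l, Meets par dep u (zz I - 1) A B m ∧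
        Follows p₁ (fun y => lv y = I) (zy I - 1) l₁ y ∧
        Follows par (fun y => lv y ≠ 0) y l n ∧ out = l₃ ++ (A ++ m :: B.reverse ++ (l₁ ++ l))))

/-! ### The stretch, and the path that is reported. -/

section

variable {E : ℕ → ℕ → ℝ → Prop} {n r : ℕ} {d : ℕ → ℝ} {lv par dep onP X : ℕ → ℕ}
  {p₁ p₃ zy zz : ℕ → ℕ} {δ₁ δ₃ cv cv₁ : ℕ → ℝ}

/-- Induction along the walk. The fifth clause records how far it has come: it has been on a larger
level, and then `cv I ≤ W + d v` persists by the triangle inequality; or it is on a smaller level,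
where `d` is the right label; or it is on level `I` and `δ₁` bounds it. An arc into a larger level
turns the last two cases into the first by the minimality of the cell. The clause on level `I` also
shows that the detour exists. -/
theorem Avoids.bounds (h : LevelTree E n r d lv par dep onP X) (hE : IsArcs E n)
    (hD₁ : Detours E d lv onP X (fun _ => 0) cv₁ p₁ δ₁) (hC : Cells E d lv onP p₁ δ₁ zy zz cv)
    (hD₃ : Detours E d lv onP X zz cv p₃ δ₃) {x I v : ℕ} (hx : onP x ≠ 0) (hI : lv x = I)
    (hI0 : I ≠ 0) {W : ℝ} (hW : Avoids E x r v W) :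
    I ≠ 1 ∧ lv v ≠ 0 ∧ d v ≤ W ∧ 0 ≤ W ∧
      ((zz I ≠ 0 ∧ cv I ≤ W + d v) ∨ lv v < I ∨ (lv v = I ∧ p₁ v ≠ 0 ∧ δ₁ v ≤ W)) ∧
      (I < lv v → zz I ≠ 0 ∧ cv I ≤ W + d v) ∧
      (lv v = I → onP v = 0 ∧ p₃ v ≠ 0 ∧ δ₃ v ≤ 3 * W) := by
  induction hW with
  | base hr =>
    have h₁ : I ≠ 1 := by
      rintro rfl
      have e₁ := h.onP_eq x hx
      have e₂ := h.onP_eq r h.onP_root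
      rw [h.lv_root] at e₂
      rw [hI] at e₁
      exact hr (e₂.symm.trans e₁)
    have h₂ := h.lv_root
    refine ⟨h₁, by omega, h.dist_root.le, le_rfl, Or.inr (Or.inl (by omega)), by omega, by omega⟩
  | @step u v W c hr hc hv ih =>
    obtain ⟨i₁, i₂, i₃, i₄, i₅, i₆, i₇⟩ := ih
    obtain ⟨j₁, j₂⟩ := h.reach u v c hc i₂
    have hpos := hE.pos _ _ _ hc
    have hd' := (h.reach v u c (hE.symm _ _ _ hc) j₁).2
    have hP : lv v = I → onP v = 0 := by
      intro hvI
      by_contra hne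
      have e₁ := h.onP_eq x hx
      have e₂ := h.onP_eq v hne
      rw [hvI] at e₂
      rw [hI] at e₁
      exact hv (e₂.symm.trans e₁)
    have hcell : (zz I ≠ 0 ∧ cv I ≤ W + d u) → zz I ≠ 0 ∧ cv I ≤ W + c + d v :=
      fun h' => ⟨h'.1, by linarith⟩
    have hD : I < lv v → zz I ≠ 0 ∧ cv I ≤ W + c + d v := by
      intro hvI
      rcases i₅ with h' | h' | ⟨h', h'', h'''⟩
      · exact hcell h'
      · have := hC.complete I u v c _ hc hvI ⟨i₂, Or.inl ⟨h', rfl⟩⟩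
        exact ⟨this.1, by linarith⟩
      · have := hC.complete I u v c _ hc hvI ⟨i₂, Or.inr ⟨h', (i₇ h').1, h'', rfl⟩⟩
        exact ⟨this.1, by linarith⟩
    refine ⟨i₁, j₁, by linarith, by linarith, ?_, hD, fun hvI => ⟨hP hvI, ?_⟩⟩
    · rcases lt_trichotomy (lv v) I with hvI | hvI | hvI
      · exact Or.inr (Or.inl hvI)
      · rcases i₅ with h' | h' | ⟨h', h'', h'''⟩
        · exact Or.inl (hcell h')
        · have := hD₁.up u v c hc i₂ (hP hvI) (by omega)
          exact Or.inr (Or.inr ⟨hvI, this.1, by linarith⟩)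
        · have := hD₁.eq u v c hc i₂ (hP hvI) (i₇ h').1 (by omega) h''
          exact Or.inr (Or.inr ⟨hvI, this.1, by linarith⟩)
      · exact Or.inl (hD hvI)
    · rcases lt_trichotomy (lv u) I with huI | huI | huI
      · have := hD₃.up u v c hc i₂ (hP hvI) (by omega)
        exact ⟨this.1, by linarith⟩
      · have := hD₃.eq u v c hc i₂ (hP hvI) (i₇ huI).1 (by omega) (i₇ huI).2.1
        exact ⟨this.1, by linarith [(i₇ huI).2.2]⟩
      · obtain ⟨k₁, k₂⟩ := i₆ huI
        have := hD₃.down u v c hc j₁ (hP hvI) (by omega) (by rwa [hvI])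
        rw [hvI] at this
        refine ⟨this.1, ?_⟩
        have h₁ := (h.top_le hE (Nat.succ_ne_zero I) huI).1
        linarith

/-- With empty cells a detour can only enter its level from above. Such detours are admitted for
`p₃` too, so its labels are no larger. -/
theorem Detours.le_of_empty (h : LevelTree E n r d lv par dep onP X) (hE : IsArcs E n)
    (hD₁ : Detours E d lv onP X (fun _ => 0) cv₁ p₁ δ₁)
    (hD₃ : Detours E d lv onP X zz cv p₃ δ₃) {v : ℕ} (hv : p₁ v ≠ 0) : p₃ v ≠ 0 ∧ δ₃ v ≤ δ₁ v := by
  have hvn : v < n := h.lt v (hD₁.pred v hv).2.1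
  revert hv
  refine induction_on_real (n := n) δ₁ (p := fun v => p₁ v ≠ 0 → p₃ v ≠ 0 ∧ δ₃ v ≤ δ₁ v) ?_ v hvn
  intro v hvn ih hv
  obtain ⟨h₁, h₂, u, c, h₃, h₄, h₅, h₆⟩ := hD₁.pred v hv
  have hc := hE.pos _ _ _ h₃
  rcases h₆ with ⟨h₆, h₇⟩ | ⟨h₆, h₇, h₈⟩ | ⟨h₆, h₇, h₈⟩
  · rw [h₇]
    exact hD₃.up u v c h₃ h₅ h₁ h₆
  · obtain ⟨i₁, i₂⟩ := ih u (h.lt u h₅) (by linarith) h₇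
    have := hD₃.eq u v c h₃ h₅ h₁ (hD₁.pred u h₇).1 h₆ i₁
    exact ⟨this.1, by linarith⟩
  · exact absurd rfl h₇

/-- The way from a vertex below the level `I` up to the root over the cell of the level. -/
theorem Cells.exists_route (h : LevelTree E n r d lv par dep onP X) (hE : IsArcs E n)
    (hD₁ : Detours E d lv onP X (fun _ => 0) cv₁ p₁ δ₁) (hC : Cells E d lv onP p₁ δ₁ zy zz cv)
    {u I : ℕ} (hu : I < lv u) (hz : zz I ≠ 0) :
    ∃ A B m l₁ y l W, Meets par dep u (zz I - 1) A B m ∧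
      Follows p₁ (fun y => lv y = I) (zy I - 1) l₁ y ∧
      Follows par (fun y => lv y ≠ 0) y l n ∧
      Route E u (A ++ m :: B.reverse ++ (l₁ ++ l)) r W ∧ W ≤ cv I - 2 * d (X (I + 1)) + d u ∧
      (A ++ m :: B.reverse ++ (l₁ ++ l)).Nodup ∧
      ∀ q ∈ A ++ m :: B.reverse ++ (l₁ ++ l), lv q ≠ 0 ∧
        (lv q = I → onP q = 0 ∧ p₁ q ≠ 0 ∧ δ₁ q < cv I - 2 * d (X (I + 1)) + d u) := by
  obtain ⟨y₀, z, c, k, h₁, h₂, h₃, h₄, h₅, h₆⟩ := hC.sound I hz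
  have hpos := hE.pos _ _ _ h₁
  obtain ⟨A, B, m, i₁, i₂, i₃, i₄, i₅, -, -⟩ := h.exists_meets hE (Nat.succ_ne_zero I) hu h₂
  -- The meeting point lies in the subtree of `X (I + 1)`, hence is at least as far from the root;
  -- this justifies the summand `- 2 * d (X (I + 1))`.
  have hdm := (h.top_le hE (Nat.succ_ne_zero I) i₂).2.1
  have hdz := (h.top_le hE (Nat.succ_ne_zero I) h₂).2.1
  have hdu := (h.top_le hE (Nat.succ_ne_zero I) hu).2.1
  obtain ⟨l₁, y, l, j₁, j₂, j₃, j₄, j₅⟩ : ∃ l₁ y l,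
      Follows p₁ (fun y => lv y = I) y₀ l₁ y ∧ Follows par (fun y => lv y ≠ 0) y l n ∧
      Route E y₀ (l₁ ++ l) r k ∧ (l₁ ++ l).Nodup ∧ ∀ q ∈ l₁ ++ l, lv q ≠ 0 ∧ lv q ≤ I ∧
        (lv q = I → onP q = 0 ∧ p₁ q ≠ 0 ∧ δ₁ q ≤ k) := by
    obtain ⟨hy₀, ⟨hlt, rfl⟩ | ⟨heq, -, hp, rfl⟩⟩ := h₃
    · obtain ⟨l, e₁, e₂, e₃, e₄⟩ := h.exists_root_route hE hy₀
      refine ⟨[], y₀, l, .nil (by omega), e₁, e₂, e₃, fun q hq => ?_⟩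
      have := e₄ q hq
      exact ⟨this.1, by omega, by omega⟩
    · obtain ⟨l₁, y, W, b, e₁, e₂, e₃, e₄, e₅, e₆, e₇⟩ := hD₁.exists_chain h hE hp heq
      rcases e₇ with ⟨e₇, e₈⟩ | ⟨-, e₇, -⟩
      · obtain ⟨l, f₁, f₂, f₃, f₄⟩ := h.exists_root_route hE e₂
        refine ⟨l₁, y, l, e₁, f₁, ?_, ?_, ?_⟩
        · rw [e₄, e₈]
          exact e₃ _ _ _ f₂
        · refine List.nodup_append.2 ⟨e₆, f₃, ?_⟩
          rintro a ha b hb rfl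
          have := (e₅ a ha).1
          have := (f₄ a hb).2
          omega
        · intro q hq
          rcases List.mem_append.1 hq with hq | hq
          · obtain ⟨g₁, g₂, g₃, -, g₄⟩ := e₅ q hq
            exact ⟨by omega, by omega, fun _ => ⟨g₂, g₃, g₄⟩⟩
          · have := f₄ q hq
            exact ⟨this.1, by omega, by omega⟩
      · exact absurd rfl e₇
  refine ⟨A, B, m, l₁, y, l, _, by simpa [h₅] using i₁, by simpa [h₄] using j₁, j₂,
    i₃.append (hE.symm _ _ _ h₁) j₃, by linarith, ?_, ?_⟩
  · refine List.nodup_append.2 ⟨i₄, j₄, ?_⟩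
    rintro a ha b hb rfl
    have := i₅ a ha
    have := (j₅ a hb).2.1
    omega
  · intro q hq
    rcases List.mem_append.1 hq with hq | hq
    · have := i₅ q hq
      exact ⟨by omega, by omega⟩
    · obtain ⟨g₁, g₂, g₃⟩ := j₅ q hq
      refine ⟨g₁, fun hqI => ?_⟩
      obtain ⟨g₄, g₅, g₆⟩ := g₃ hqI
      exact ⟨g₄, g₅, by linarith⟩

/-- A smaller level uses the tree path, a larger one the cell. On level `I` a chain along `p₃` comes
first and one of these two ways continues it. -/
theorem exists_answer (h : LevelTree E n r d lv par dep onP X) (hE : IsArcs E n)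
    (hD₁ : Detours E d lv onP X (fun _ => 0) cv₁ p₁ δ₁) (hC : Cells E d lv onP p₁ δ₁ zy zz cv)
    (hD₃ : Detours E d lv onP X zz cv p₃ δ₃) {x I v : ℕ} (hx : onP x ≠ 0) (hI : lv x = I)
    (hI0 : I ≠ 0) (hv : lv v ≠ 0) (hv₁ : I < lv v → zz I ≠ 0) (hv₂ : lv v = I → p₃ v ≠ 0) :
    ∃ out W, Answer n lv par dep p₁ p₃ zy zz I v out ∧ Route E v out r W ∧ out.Nodup ∧ x ∉ out ∧
      (∀ q ∈ out, lv q ≠ 0) ∧ ∀ W', Avoids E x r v W' → W ≤ 3 * W' := by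
  have hbelow : ∀ u, I < lv u → zz I ≠ 0 → ∃ l W, (∃ A B m l₁ y l', Meets par dep u (zz I - 1) A B m ∧
      Follows p₁ (fun y => lv y = I) (zy I - 1) l₁ y ∧
      Follows par (fun y => lv y ≠ 0) y l' n ∧ l = A ++ m :: B.reverse ++ (l₁ ++ l')) ∧
      Route E u l r W ∧ W ≤ cv I - 2 * d (X (I + 1)) + d u ∧ l.Nodup ∧
      ∀ q ∈ l, lv q ≠ 0 ∧
        (lv q = I → onP q = 0 ∧ p₁ q ≠ 0 ∧ δ₁ q < cv I - 2 * d (X (I + 1)) + d u) := by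
    intro u hu hz
    obtain ⟨A, B, m, l₁, y, l, W, h₁, h₂, h₃, h₄, h₅, h₆, h₇⟩ :=
      hC.exists_route h hE hD₁ hu hz
    exact ⟨_, W, ⟨A, B, m, l₁, y, l, h₁, h₂, h₃, rfl⟩, h₄, h₅, h₆, h₇⟩
  rcases lt_trichotomy (lv v) I with hvI | hvI | hvI
  · obtain ⟨l, e₁, e₂, e₃, e₄⟩ := h.exists_root_route hE hv
    refine ⟨l, d v, ⟨[], v, .nil (by omega), Or.inl ⟨hvI, l, e₁, rfl⟩⟩, e₂, e₃, fun hxl => ?_,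
      fun q hq => (e₄ q hq).1, fun W' hW' => ?_⟩
    · have := e₄ x hxl
      omega
    · obtain ⟨-, -, b₁, b₂, -⟩ := hW'.bounds h hE hD₁ hC hD₃ hx hI hI0
      linarith
  · obtain ⟨l₃, u, W, b, e₁, e₂, e₃, e₄, e₅, e₆, e₇⟩ := hD₃.exists_chain h hE (hv₂ hvI) hvI
    have hbound : ∀ W', Avoids E x r v W' → W + b ≤ 3 * W' := by
      intro W' hW'
      have := ((hW'.bounds h hE hD₁ hC hD₃ hx hI hI0).2.2.2.2.2.2 hvI).2.2
      linarith
    have hxl₃ : x ∉ l₃ := fun hxl => hx (e₅ x hxl).2.1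
    rcases e₇ with ⟨e₇, e₈⟩ | ⟨e₇, e₈, e₉⟩
    · obtain ⟨l, f₁, f₂, f₃, f₄⟩ := h.exists_root_route hE e₂
      refine ⟨l₃ ++ l, _, ⟨l₃, u, e₁, Or.inl ⟨e₇, l, f₁, rfl⟩⟩, e₃ _ _ _ f₂, ?_, ?_, ?_, ?_⟩
      · refine List.nodup_append.2 ⟨e₆, f₃, ?_⟩
        rintro a ha b hb rfl
        have := (e₅ a ha).1
        have := (f₄ a hb).2
        omega
      · rw [List.mem_append, not_or]
        refine ⟨hxl₃, fun hxl => ?_⟩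
        have := f₄ x hxl
        omega
      · intro q hq
        rcases List.mem_append.1 hq with hq | hq
        · have := (e₅ q hq).1
          omega
        · exact (f₄ q hq).1
      · rw [← e₈]
        exact hbound
    · obtain ⟨l, W₂, ⟨A, B, m, l₁, y, l', g₁, g₂, g₃, rfl⟩, f₂, f₃, f₄, f₅⟩ := hbelow u e₇ e₈
      refine ⟨_, _, ⟨l₃, u, e₁, Or.inr ⟨e₇, A, B, m, l₁, y, l', g₁, g₂, g₃, rfl⟩⟩, e₃ _ _ _ f₂,
        ?_, ?_, ?_, ?_⟩
      · refine List.nodup_append.2 ⟨e₆, f₄, ?_⟩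
        rintro a ha b hb rfl
        -- A common vertex would be on level `I`, with `δ₃` above the length `b` at which the level
        -- is entered and `δ₁` below it. This contradicts `δ₃ ≤ δ₁`.
        obtain ⟨k₁, k₂, k₃, k₄, -⟩ := e₅ a ha
        obtain ⟨m₁, m₂, m₃⟩ := (f₅ a hb).2 k₁
        have := (hD₁.le_of_empty h hE hD₃ m₂).2
        linarith
      · rw [List.mem_append, not_or]
        exact ⟨hxl₃, fun hxl => hx ((f₅ x hxl).2 hI).1⟩
      · intro q hq
        rcases List.mem_append.1 hq with hq | hq
        · have := (e₅ q hq).1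
          omega
        · exact (f₅ q hq).1
      · intro W' hW'
        have := hbound W' hW'
        linarith
  · obtain ⟨l, W₂, ⟨A, B, m, l₁, y, l', g₁, g₂, g₃, rfl⟩, f₂, f₃, f₄, f₅⟩ := hbelow v hvI (hv₁ hvI)
    refine ⟨_, _, ⟨[], v, .nil (by omega), Or.inr ⟨hvI, A, B, m, l₁, y, l', g₁, g₂, g₃, rfl⟩⟩, f₂,
        f₄, fun hxl => hx ((f₅ x hxl).2 hI).1, fun q hq => (f₅ q hq).1, fun W' hW' => ?_⟩
    obtain ⟨-, -, b₁, b₂, -, b₃, -⟩ := hW'.bounds h hE hD₁ hC hD₃ hx hI hI0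
    have := (b₃ hvI).2
    have := (h.top_le hE (Nat.succ_ne_zero I) hvI).1
    linarith

end

/-! ### The query algorithm -/

namespace RealRAM

theorem map_range_succ {f : ℕ → ℕ} {k x : ℕ} :
    (List.range (k + 1)).map (Function.update f k x) = (List.range k).map f ++ [x] := by
  rw [List.range_succ, List.map_append, List.map_singleton, Function.update_self]
  congr 1
  refine List.map_congr_left fun i hi => Function.update_of_ne ?_ _ _
  exact (List.mem_range.1 hi).ne

/-- The list of vertices collected so far by a query. -/
def State.route (s : State) : List ℕ := (List.range (s.wv 4)).map (s.wa 20)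

/-- The second stack of a query. -/
def State.branch (s : State) : List ℕ := (List.range (s.wv 6)).map (s.wa 21)

theorem State.length_route (s : State) : s.route.length = s.wv 4 := by simp [State.route]

theorem State.length_branch (s : State) : s.branch.length = s.wv 6 := by simp [State.branch]

/-- Collects the vertices from the current one along the array `nx` as long as `b` holds. -/
def chain (b : Test) (nx : ℕ) : Program :=
  .loop b <|
    .seq (.wstore 20 (.var 4) (.var 2)) <|
    .seq (.wset 4 (.add (.var 4) (.const 1))) <|
    .wset 2 (.sub (.arr nx (.var 2)) (.const 1))

/-- One rule for the three pointer walks of a query. The predicate `p` is the meaning of the test,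
which has to be the same in all states that the loop can reach. -/
theorem wp_chain {W : ℕ} {b : Test} {nx : ℕ} {p : ℕ → Prop} {s : State} {l : List ℕ} {u : ℕ}
    (hb : ∀ t, Frame (chain b nx) s t → (b.Holds t ↔ p (t.wv 2))) (hok : ∀ t, b.Ok W t)
    (hnx : nx ≠ 20) (hl : Follows (s.wa nx) p (s.wv 2) l u) (hW : s.wv 4 + l.length < W) :
    (chain b nx).wp W (fun k s' => s'.wv 2 = u ∧ s'.route = s.route ++ l ∧
      k ≤ (b.size + 20) * (l.length + 1)) s := by
  refine Program.wp_loop_ghost (fun φ t => ∃ l', Follows (s.wa nx) p (t.wv 2) l' u ∧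
    t.route ++ l' = s.route ++ l ∧ φ = (b.size + 20) * l'.length) _ ⟨l, hl, rfl, rfl⟩ ?_ ?_ ?_
  · exact fun φ t _ _ _ => hok t
  · rintro φ t hF - ⟨l', h₁, h₂, rfl⟩ hbt
    have hF' : Frame (chain b nx) s t := ⟨hF.1, hF.2, hF.3, hF.4⟩
    have hlen := congrArg List.length h₂
    simp only [List.length_append, State.length_route] at hlen
    have hnxt : t.wa nx = s.wa nx := hF.wa nx (by simp [Program.wordArrays, hnx])
    rw [hb t hF'] at hbt
    cases h₁ with
    | nil h => exact absurd hbt h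
    | @cons _ _ l' _ h₁ =>
      simp only [List.length_cons] at hlen
      simp [Program.wp, hnx, hnxt]
      refine ⟨by omega, by omega, l', ⟨h₁, ?_⟩, by rw [Nat.mul_add]; omega⟩
      simp only [State.route] at h₂ ⊢
      simp [map_range_succ]
      simpa using h₂
  · rintro k φ t hF - ⟨l', h₁, h₂, rfl⟩ hbt hk
    have hF' : Frame (chain b nx) s t := ⟨hF.1, hF.2, hF.3, hF.4⟩
    rw [hb t hF'] at hbt
    cases h₁ with
    | nil h =>
      refine ⟨rfl, by simpa using h₂, ?_⟩
      simp at hk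
      ring_nf at hk ⊢
      omega
    | cons h => exact absurd h hbt

/-- Collects the vertices from the current one up to the lowest common ancestor with the vertex
in variable 5. -/
def climb : Program :=
  .loop (.neg (.weq (.var 2) (.var 5))) <|
    .ite (.wlt (.arr 5 (.var 2)) (.arr 5 (.var 5)))
      (.seq (.wstore 21 (.var 6) (.var 5)) <|
        .seq (.wset 6 (.add (.var 6) (.const 1))) <|
        .wset 5 (.sub (.arr 4 (.var 5)) (.const 1)))
      (.seq (.wstore 20 (.var 4) (.var 2)) <|
        .seq (.wset 4 (.add (.var 4) (.const 1))) <|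
        .wset 2 (.sub (.arr 4 (.var 2)) (.const 1)))

theorem wp_climb {W : ℕ} {s : State} {A B : List ℕ} {m : ℕ}
    (h : Meets (s.wa 4) (s.wa 5) (s.wv 2) (s.wv 5) A B m) (hW : s.wv 4 + A.length < W)
    (hW' : s.wv 6 + B.length < W) :
    climb.wp W (fun k s' => s'.wv 2 = m ∧ s'.route = s.route ++ A ∧ s'.branch = s.branch ++ B ∧
      k ≤ 40 * (A.length + B.length + 1)) s := by
  refine Program.wp_loop_ghost (fun φ t => ∃ A' B', Meets (s.wa 4) (s.wa 5) (t.wv 2) (t.wv 5) A' B' m ∧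
    t.route ++ A' = s.route ++ A ∧ t.branch ++ B' = s.branch ++ B ∧
      φ = 40 * (A'.length + B'.length)) _ ⟨A, B, h, rfl, rfl, rfl⟩ ?_ ?_ ?_
  · intros; simp
  · rintro φ t hF - ⟨A', B', h₁, h₂, h₃, rfl⟩ hbt
    have hlen := congrArg List.length h₂
    have hlen' := congrArg List.length h₃
    simp only [List.length_append, State.length_route, State.length_branch] at hlen hlen'
    have a4 : t.wa 4 = s.wa 4 := hF.wa 4 (by decide)
    have a5 : t.wa 5 = s.wa 5 := hF.wa 5 (by decide)
    have hne : t.wv 2 ≠ t.wv 5 := by simpa using hbt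
    obtain ⟨x, hx⟩ : ∃ x, t.wv 2 = x := ⟨_, rfl⟩
    obtain ⟨y, hy⟩ : ∃ y, t.wv 5 = y := ⟨_, rfl⟩
    rw [hx, hy] at h₁ hne
    cases h₁ with
    | refl => exact absurd rfl hne
    | @left _ _ _ A' _ _ hd h₁ =>
      simp only [List.length_cons] at hlen
      simp [Program.wp, a4, a5, hx, hy]
      refine ⟨fun h' => by omega, fun _ => ⟨by omega, by omega, A', B', ⟨h₁, ?_, ?_⟩, by omega⟩⟩
      · simp only [State.route] at h₂ ⊢
        simp [map_range_succ]
        simpa using h₂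
      · exact h₃
    | @right _ _ _ _ B' _ hd h₁ =>
      simp only [List.length_cons] at hlen'
      simp [Program.wp, a4, a5, hx, hy]
      refine ⟨fun _ => ⟨by omega, by omega, A', B', ⟨h₁, ?_, ?_⟩, by omega⟩, fun h' => by omega⟩
      · exact h₂
      · simp only [State.branch] at h₃ ⊢
        simp [map_range_succ]
        simpa using h₃
  · rintro k φ t hF - ⟨A', B', h₁, h₂, h₃, rfl⟩ hbt hk
    have heq : t.wv 2 = t.wv 5 := by simpa using hbt
    obtain ⟨x, hx⟩ : ∃ x, t.wv 2 = x := ⟨_, rfl⟩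
    rw [← heq, hx] at h₁
    cases h₁ with
    | refl =>
      simp at h₂ h₃ hk
      exact ⟨hx, h₂, h₃, by omega⟩
    | left h => exact absurd rfl h
    | right h => exact absurd rfl h

/-- Appends the second stack, from its top. -/
def descend : Program :=
  .loop (.neg (.weq (.var 6) (.const 0))) <|
    .seq (.wset 6 (.sub (.var 6) (.const 1))) <|
    .seq (.wstore 20 (.var 4) (.arr 21 (.var 6))) <|
    .wset 4 (.add (.var 4) (.const 1))

theorem wp_descend {W : ℕ} {s : State} (hW : s.wv 4 + s.wv 6 < W) :
    descend.wp W (fun k s' => s'.route = s.route ++ s.branch.reverse ∧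
      k ≤ 20 * (s.wv 6 + 1)) s := by
  refine Program.wp_loop (fun t => t.route ++ t.branch.reverse = s.route ++ s.branch.reverse)
    (fun t => 20 * t.wv 6) rfl ?_ ?_ ?_
  · intros; simp
  · rintro t hF - h hb
    have hlen := congrArg List.length h
    simp only [List.length_append, List.length_reverse, State.length_route,
      State.length_branch] at hlen
    obtain ⟨j, hj⟩ : ∃ j, t.wv 6 = j + 1 := Nat.exists_eq_succ_of_ne_zero (by simpa using hb)
    simp [Program.wp, hj]
    refine ⟨by omega, by omega, ?_, by omega⟩
    rw [← h]
    simp only [State.route, State.branch, hj]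
    simp [map_range_succ]
    simp [List.range_succ]
  · rintro k t hF - h hb hk
    have h0 : t.wv 6 = 0 := by simpa using hb
    simp [State.branch, h0] at h hk ⊢
    exact ⟨h, by omega⟩

/-- Reports the collected vertices in reverse order. -/
def reportRoute : Program :=
  .seq (.wset 7 (.const 0)) <|
  .seq
    (.loop (.wlt (.var 7) (.var 4)) <|
      .seq (.wstore 0 (.var 7) (.arr 20 (.sub (.sub (.var 4) (.var 7)) (.const 1)))) <|
      .wset 7 (.add (.var 7) (.const 1)))
  (.wset 0 (.var 4))

theorem wp_reportRoute {W : ℕ} {s : State} (hW : s.wv 4 < W) :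
    reportRoute.wp W (fun k s' => s'.report = s.route.reverse ∧ k ≤ 30 * (s.wv 4 + 1)) s := by
  refine ⟨Nat.zero_le _, Program.wp_seq ?_⟩
  refine Program.wp_loop (fun t => t.wv 7 ≤ s.wv 4 ∧
      ∀ j < t.wv 7, t.wa 0 j = s.wa 20 (s.wv 4 - j - 1))
    (fun t => 20 * (s.wv 4 - t.wv 7)) (by simp) ?_ ?_ ?_
  · intros; simp
  · rintro t hF - ⟨h, h'⟩ hb
    have e4 : t.wv 4 = s.wv 4 := (hF.wv 4 (by decide)).trans (by simp)
    have e20 : t.wa 20 = s.wa 20 := (hF.wa 20 (by decide)).trans (by simp)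
    simp [e4] at hb
    simp [Program.wp, e4, e20]
    refine ⟨by omega, by omega, ⟨by omega, fun j hj => ?_⟩, by omega⟩
    rw [Function.update_apply]
    split_ifs with hjt
    · rw [hjt]
    · exact h' j (by omega)
  · rintro k t hF - ⟨h, h'⟩ hb hk
    have e4 : t.wv 4 = s.wv 4 := (hF.wv 4 (by decide)).trans (by simp)
    simp [e4] at hb hk
    have e7 : t.wv 7 = s.wv 4 := by omega
    simp [Program.wp, State.report, e4]
    refine ⟨?_, by omega⟩
    refine List.ext_getElem (by simp [State.length_route]) fun i h₁ h₂ => ?_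
    simp at h₁
    simp [State.route, List.getElem_reverse]
    rw [h' i (by omega)]
    congr 1
    omega

/-- Level 1 means that `x` is the root. The target `v = x` falls under the third alternative,
because a vertex of the path never has a detour. -/
def queryFails : Test :=
  .or (.weq (.arr 3 (.var 0)) (.const 0)) <|
  .or (.weq (.var 3) (.const 1)) <|
  .or (.and (.weq (.arr 3 (.var 0)) (.var 3)) (.weq (.arr 7 (.var 0)) (.const 0)))
    (.and (.wlt (.var 3) (.arr 3 (.var 0))) (.weq (.arr 9 (.var 3)) (.const 0)))

/-- Crosses the level `I` from below. -/
def crossLevel : Program :=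
  .seq (.wset 5 (.sub (.arr 9 (.var 3)) (.const 1))) <|
  .seq climb <|
  .seq (.wstore 20 (.var 4) (.var 2)) <|
  .seq (.wset 4 (.add (.var 4) (.const 1))) <|
  .seq descend <|
  .seq (.wset 2 (.sub (.arr 8 (.var 3)) (.const 1))) <|
  chain (.weq (.arr 3 (.var 2)) (.var 3)) 6

def collectRoute : Program :=
  .seq (chain (.weq (.arr 3 (.var 2)) (.var 3)) 7) <|
  .seq (.ite (.wlt (.var 3) (.arr 3 (.var 2))) crossLevel .skip) <|
  chain (.neg (.weq (.arr 3 (.var 2)) (.const 0))) 4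

/-- The arrays 3 to 9 are only read. The arrays 20 and 21, outside the data structure, are scratch
stacks, and the vertices are collected from `v` to the root, then reported in reverse. -/
def query : Program :=
  .seq (.wset 3 (.arr 3 (.var 1))) <|
  .ite queryFails (.wset 0 (.const 0)) <|
  .seq (.wset 2 (.var 0)) <|
  .seq (.wset 4 (.const 0)) <|
  .seq (.wset 6 (.const 0)) <|
  .seq collectRoute reportRoute

theorem wp_crossLevel {W : ℕ} {s : State} {A B l₁ : List ℕ} {m y : ℕ}
    (h : Meets (s.wa 4) (s.wa 5) (s.wv 2) (s.wa 9 (s.wv 3) - 1) A B m) (h6 : s.wv 6 = 0)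
    (h₁ : Follows (s.wa 6) (fun y => s.wa 3 y = s.wv 3) (s.wa 8 (s.wv 3) - 1) l₁ y)
    (hW : s.wv 4 + (A ++ m :: B.reverse ++ l₁).length < W) :
    crossLevel.wp W (fun k s' => s'.wv 2 = y ∧ s'.route = s.route ++ (A ++ m :: B.reverse ++ l₁) ∧
      k ≤ 100 * ((A ++ m :: B.reverse ++ l₁).length + 1)) s := by
  simp at hW
  have hs6 : s.branch = [] := by simp [State.branch, h6]
  refine ⟨⟨trivial, by simp; omega⟩, Program.wp_seq (Program.wp_mono (Program.wp_frame (wp_climb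
    (A := A) (B := B) (m := m) (by simpa using h) (by simp; omega) (by simp; omega))) ?_)⟩
  rintro k₁ s₁ ⟨⟨i₁, i₂, i₃, i₄⟩, hF₁⟩
  have i₂' : s₁.route = s.route ++ A := i₂
  have i₃' : s₁.branch = B := by rw [i₃]; simpa [State.branch] using h6
  have l4 : s₁.wv 4 = s.wv 4 + A.length := by
    rw [← State.length_route, i₂', List.length_append, State.length_route]
  have l6 : s₁.wv 6 = B.length := by rw [← State.length_branch, i₃']
  have w3 : s₁.wv 3 = s.wv 3 := (hF₁.wv 3 (by decide)).trans (by simp)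
  have a8 : s₁.wa 8 = s.wa 8 := (hF₁.wa 8 (by decide)).trans (by simp)
  have a3 : s₁.wa 3 = s.wa 3 := (hF₁.wa 3 (by decide)).trans (by simp)
  have a6 : s₁.wa 6 = s.wa 6 := (hF₁.wa 6 (by decide)).trans (by simp)
  refine ⟨trivial, trivial, ⟨trivial, by simp; omega, by simp; omega⟩, ?_⟩
  refine Program.wp_seq (Program.wp_mono (Program.wp_frame (wp_descend (by simp; omega))) ?_)
  rintro k₂ s₂ ⟨⟨j₁, j₂⟩, hF₂⟩
  have v3 : s₂.wv 3 = s.wv 3 := (hF₂.wv 3 (by decide)).trans (by simp [w3])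
  have b8 : s₂.wa 8 = s.wa 8 := (hF₂.wa 8 (by decide)).trans (by simp [a8])
  have b3 : s₂.wa 3 = s.wa 3 := (hF₂.wa 3 (by decide)).trans (by simp [a3])
  have b6 : s₂.wa 6 = s.wa 6 := (hF₂.wa 6 (by decide)).trans (by simp [a6])
  have j₁' : s₂.route = s.route ++ (A ++ m :: B.reverse) := by
    rw [j₁]
    have e₁ : ∀ t : State, ((s₁.setWA 20 (WExp.eval s₁ (.var 4)) (WExp.eval s₁ (.var 2))).setW 4
        (WExp.eval (s₁.setWA 20 (WExp.eval s₁ (.var 4)) (WExp.eval s₁ (.var 2)))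
          ((WExp.var 4).add (.const 1)))) = t → t.route = s₁.route ++ [m] ∧ t.branch = s₁.branch := by
      rintro _ rfl
      simp [State.route, State.branch, map_range_succ, i₁]
    rw [(e₁ _ rfl).1, (e₁ _ rfl).2, i₃', i₂']
    simp
  have m4 : s₂.wv 4 = s.wv 4 + A.length + B.length + 1 := by
    rw [← State.length_route, j₁', List.length_append, State.length_route]
    simp
    omega
  refine ⟨⟨trivial, by simp; omega⟩, ?_⟩
  refine Program.wp_mono (wp_chain (p := fun y => s.wa 3 y = s.wv 3) (l := l₁) (u := y) ?_
    (by simp) (by decide) (by simpa [b8, v3, b6] using h₁) (by simp [m4]; omega)) ?_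
  · intro t hF
    have c3 : t.wa 3 = s.wa 3 := (hF.wa 3 (by decide)).trans (by simp [b3])
    have x3 : t.wv 3 = s.wv 3 := (hF.wv 3 (by decide)).trans (by simp [v3])
    simp [c3, x3]
  · rintro k₃ s₃ ⟨q₁, q₂, q₃⟩
    refine ⟨q₁, ?_, ?_⟩
    · have : s₃.route = s₂.route ++ l₁ := q₂
      rw [this, j₁']
      simp
    · simp [l6] at j₂ q₃ i₄ ⊢
      omega

/-- Each iteration of a loop handles one vertex of `out`, and those on the second stack are handled
twice; so the time is linear in the output. -/
theorem wp_collectRoute {W n : ℕ} {s : State} {out : List ℕ} (h4 : s.wv 4 = 0) (h6 : s.wv 6 = 0)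
    (h : Answer n (s.wa 3) (s.wa 4) (s.wa 5) (s.wa 6) (s.wa 7) (s.wa 8) (s.wa 9) (s.wv 3) (s.wv 2)
      out) (hW : out.length < W) :
    collectRoute.wp W (fun k s' => s'.route = out ∧ k ≤ 300 * (out.length + 1)) s := by
  obtain ⟨l₃, u, h₃, hout⟩ := h
  have hs4 : s.route = [] := by simp [State.route, h4]
  have hlen₃ : l₃.length ≤ out.length := by
    rcases hout with ⟨-, l, -, rfl⟩ | ⟨-, A, B, m, l₁, y, l, -, -, -, rfl⟩ <;> simp
  refine Program.wp_seq (Program.wp_mono (Program.wp_frame (wp_chain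
    (p := fun y => s.wa 3 y = s.wv 3) (l := l₃) (u := u) ?_ (by simp) (by decide) h₃ (by omega))) ?_)
  · intro t hF
    have c3 : t.wa 3 = s.wa 3 := hF.wa 3 (by decide)
    have x3 : t.wv 3 = s.wv 3 := hF.wv 3 (by decide)
    simp [c3, x3]
  rintro k₁ s₁ ⟨⟨i₁, i₂, i₃⟩, hF₁⟩
  rw [hs4, List.nil_append] at i₂
  have l4 : s₁.wv 4 = l₃.length := by rw [← State.length_route, i₂]
  have w3 : s₁.wv 3 = s.wv 3 := hF₁.wv 3 (by decide)
  have w6 : s₁.wv 6 = 0 := (hF₁.wv 6 (by decide)).trans h6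
  have a3 : s₁.wa 3 = s.wa 3 := hF₁.wa 3 (by decide)
  have a4 : s₁.wa 4 = s.wa 4 := hF₁.wa 4 (by decide)
  have a5 : s₁.wa 5 = s.wa 5 := hF₁.wa 5 (by decide)
  have a6 : s₁.wa 6 = s.wa 6 := hF₁.wa 6 (by decide)
  have a8 : s₁.wa 8 = s.wa 8 := hF₁.wa 8 (by decide)
  have a9 : s₁.wa 9 = s.wa 9 := hF₁.wa 9 (by decide)
  have hfin : ∀ (s₂ : State) (l₂ l : List ℕ), Frame crossLevel s₁ s₂ → s₂.route = l₂ →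
      Follows (s.wa 4) (fun y => s.wa 3 y ≠ 0) (s₂.wv 2) l n → out = l₂ ++ l →
      (chain (.neg (.weq (.arr 3 (.var 2)) (.const 0))) 4).wp W
        (fun k s' => s'.route = out ∧ k ≤ 25 * (out.length + 1)) s₂ := by
    intro s₂ l₂ l hF₂ hr hl ho
    have b3 : s₂.wa 3 = s.wa 3 := (hF₂.wa 3 (by decide)).trans a3
    have b4 : s₂.wa 4 = s.wa 4 := (hF₂.wa 4 (by decide)).trans a4
    have hlen : out.length = l₂.length + l.length := by rw [ho, List.length_append]
    have m4 : s₂.wv 4 = l₂.length := by rw [← State.length_route, hr]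
    refine Program.wp_mono (wp_chain (p := fun y => s.wa 3 y ≠ 0) (l := l) (u := n) ?_ (by simp)
      (by decide) (by rwa [b4]) (by omega)) ?_
    · intro t hF
      have c3 : t.wa 3 = s.wa 3 := (hF.wa 3 (by decide)).trans b3
      simp [c3]
    · rintro k s' ⟨-, q₁, q₂⟩
      refine ⟨by rw [q₁, hr, ho], ?_⟩
      simp at q₂
      omega
  refine Program.wp_seq ⟨by simp, fun hb => ?_, fun hb => ?_⟩
  · simp [w3, a3, i₁] at hb
    rcases hout with ⟨hlt, -⟩ | ⟨-, A, B, m, l₁, y, l, h₁, h₂, h₄, ho⟩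
    · omega
    have hlen := congrArg List.length ho
    simp at hlen
    refine Program.wp_mono (Program.wp_frame (wp_crossLevel (A := A) (B := B) (l₁ := l₁) (m := m)
      (y := y) (by rwa [a4, a5, a9, w3, i₁]) w6 (by rwa [a3, a6, a8, w3])
      (by simp; omega))) ?_
    rintro k₂ s₂ ⟨⟨j₁, j₂, j₃⟩, hF₂⟩
    refine Program.wp_mono (hfin s₂ _ l hF₂ j₂ (by rwa [j₁]) ?_) ?_
    · rw [i₂, ho]; simp
    · rintro k₃ s₃ ⟨q₁, q₂⟩
      refine ⟨q₁, ?_⟩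
      simp at j₃ i₃ q₂ ⊢
      omega
  · simp [w3, a3, i₁] at hb
    rcases hout with ⟨-, l, h₁, ho⟩ | ⟨hlt, -⟩
    · change (chain (.neg (.weq (.arr 3 (.var 2)) (.const 0))) 4).wp W _ s₁
      refine Program.wp_mono (hfin s₁ _ l (Frame.refl _ _) i₂ (by rwa [i₁]) ho) ?_
      rintro k₃ s₃ ⟨q₁, q₂⟩
      refine ⟨q₁, ?_⟩
      simp at i₃ q₂ ⊢
      omega
    · omega

/-- The query has to report that there is no path. -/
def QueryFails (lv p₃ zz : ℕ → ℕ) (I v : ℕ) : Prop :=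
  lv v = 0 ∨ I = 1 ∨ (lv v = I ∧ p₃ v = 0) ∨ (I < lv v ∧ zz I = 0)

theorem wp_query_of_fails {W : ℕ} {s : State}
    (h : QueryFails (s.wa 3) (s.wa 7) (s.wa 9) (s.wa 3 (s.wv 1)) (s.wv 0)) (hW : 1 ≤ W) :
    query.wp W (fun k s' => s'.report = [] ∧ k ≤ 100) s := by
  refine ⟨trivial, by simp [queryFails, hW], fun _ => ?_, fun hb => ?_⟩
  · refine ⟨Nat.zero_le _, ?_⟩
    simp [State.report, queryFails]
  · exact absurd (by simpa [queryFails, QueryFails] using h) hb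

theorem wp_query {W n : ℕ} {s : State} {out : List ℕ}
    (h : ¬ QueryFails (s.wa 3) (s.wa 7) (s.wa 9) (s.wa 3 (s.wv 1)) (s.wv 0))
    (hA : Answer n (s.wa 3) (s.wa 4) (s.wa 5) (s.wa 6) (s.wa 7) (s.wa 8) (s.wa 9)
      (s.wa 3 (s.wv 1)) (s.wv 0) out) (hW : out.length < W) :
    query.wp W (fun k s' => s'.report = out.reverse ∧ k ≤ 1000 * (out.length + 1)) s := by
  refine ⟨trivial, by simp [queryFails]; omega, fun hb => ?_, fun _ => ?_⟩
  · exact absurd (by simpa [queryFails, QueryFails] using hb) h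
  · refine ⟨trivial, Nat.zero_le _, Nat.zero_le _, ?_⟩
    refine Program.wp_seq (Program.wp_mono (wp_collectRoute (n := n) (out := out) ?_ ?_ ?_ hW) ?_)
    · simp
    · simp
    · simpa using hA
    · rintro k₁ s₁ ⟨i₁, i₂⟩
      have l4 : s₁.wv 4 = out.length := by rw [← State.length_route, i₁]
      refine Program.wp_mono (wp_reportRoute (by omega)) ?_
      rintro k₂ s₂ ⟨j₁, j₂⟩
      refine ⟨by rw [j₁, i₁], ?_⟩
      simp [queryFails]
      omega

end RealRAM

/-! ### Correctness of the preprocessing, in terms of the arrays it computes -/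

/-- The arcs that are listed in the arrays `src`, `dst`, `wt` below `M`. -/
def Arc (M : ℕ) (src dst : ℕ → ℕ) (wt : ℕ → ℝ) (u v : ℕ) (c : ℝ) : Prop :=
  ∃ a < M, src a = u ∧ dst a = v ∧ wt a = c

/-- An arc from `u` to `v` of length `c` contributes an arc from `S` of length `c'` to the detour
graph, whose source is `n`. -/
def DetourArc (n : ℕ) (d : ℕ → ℝ) (lv onP X zz : ℕ → ℕ) (cv : ℕ → ℝ) (u v : ℕ) (c : ℝ)
    (S : ℕ) (c' : ℝ) : Prop :=
  lv u ≠ 0 ∧ onP v = 0 ∧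
    ((lv u < lv v ∧ S = n ∧ c' = d u + c) ∨
      (lv u = lv v ∧ onP u = 0 ∧ S = u ∧ c' = c) ∨
      (lv v < lv u ∧ zz (lv v) ≠ 0 ∧ S = n ∧
        c' = cv (lv v) - d (X (lv v + 1)) - d (X (lv v + 1)) + (d u + c)))

/-- The arrays `src'`, `dst'`, `wt'` list below `k` the arcs that the arcs below `i` contribute, and
`frm` their origins. -/
structure Emitted (T : ℕ → ℕ → ℝ → Prop) (src dst : ℕ → ℕ) (i : ℕ) (src' dst' frm : ℕ → ℕ)
    (wt' : ℕ → ℝ) (k : ℕ) : Prop where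
  le : k ≤ i
  sound : ∀ b < k, ∃ a < i, T a (src' b) (wt' b) ∧ dst' b = dst a ∧ frm b = src a
  complete : ∀ a < i, ∀ S c, T a S c → ∃ b < k, src' b = S ∧ wt' b = c ∧ dst' b = dst a

namespace Emitted

variable {T : ℕ → ℕ → ℝ → Prop} {src dst src' dst' frm : ℕ → ℕ} {i k : ℕ} {wt' : ℕ → ℝ}

theorem skip (h : Emitted T src dst i src' dst' frm wt' k) (hT : ∀ S c, ¬ T i S c) :
    Emitted T src dst (i + 1) src' dst' frm wt' k := by
  refine ⟨h.le.trans (Nat.le_succ i), fun b hb => ?_, fun a ha S c hS => ?_⟩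
  · obtain ⟨a, ha, h'⟩ := h.sound b hb
    exact ⟨a, by omega, h'⟩
  · rcases Nat.lt_succ_iff_lt_or_eq.1 ha with ha | rfl
    · exact h.complete a ha S c hS
    · exact absurd hS (hT S c)

theorem push (h : Emitted T src dst i src' dst' frm wt' k) {S : ℕ} {c : ℝ} (hT : T i S c)
    (hT' : ∀ S' c', T i S' c' → S' = S ∧ c' = c) :
    Emitted T src dst (i + 1) (Function.update src' k S) (Function.update dst' k (dst i))
      (Function.update frm k (src i)) (Function.update wt' k c) (k + 1) := by
  refine ⟨Nat.succ_le_succ h.le, fun b hb => ?_, fun a ha S' c' hS => ?_⟩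
  · rcases Nat.lt_succ_iff_lt_or_eq.1 hb with hb | rfl
    · simp only [Function.update_of_ne hb.ne]
      obtain ⟨a, ha, h'⟩ := h.sound b hb
      exact ⟨a, by omega, h'⟩
    · simp only [Function.update_self]
      exact ⟨i, by omega, hT, rfl, rfl⟩
  · rcases Nat.lt_succ_iff_lt_or_eq.1 ha with ha | rfl
    · obtain ⟨b, hb, h'⟩ := h.complete a ha S' c' hS
      refine ⟨b, by omega, ?_⟩
      simpa only [Function.update_of_ne hb.ne] using h'
    · obtain ⟨rfl, rfl⟩ := hT' S' c' hS
      exact ⟨k, by omega, by simp⟩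

end Emitted

/-! ### The detour graph, and levels from the order of the distances. -/

section

variable {n r M : ℕ} {src dst : ℕ → ℕ} {wt : ℕ → ℝ} {d : ℕ → ℝ} {lv par dep onP X : ℕ → ℕ}

/-- An arc from the artificial source `n` stands for an entrance into a level, with the length of
the whole way up to its head; the other arcs stay on one level off the path. The true origin of the
last arc is recovered from `frm`. -/
theorem ShortestPaths.detours {zz : ℕ → ℕ} {cv : ℕ → ℝ} {k c : ℕ}
    {src' dst' frm done pred ord p : ℕ → ℕ} {wt' δ : ℕ → ℝ}
    (h : LevelTree (Arc M src dst wt) n r d lv par dep onP X)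
    (hE : Emitted (fun a => DetourArc n d lv onP X zz cv (src a) (dst a) (wt a)) src dst M src' dst'
      frm wt' k)
    (hS : ShortestPaths (n + 1) k n src' dst' wt' done pred ord c δ)
    (hp : ∀ v < n, p v = if done v = 0 then 0 else frm (pred v - 1) + 1)
    (hp' : ∀ v, n ≤ v → p v = 0) :
    Detours (Arc M src dst wt) d lv onP X zz cv p δ := by
  have hpd : ∀ v < n, p v ≠ 0 ↔ done v ≠ 0 := by
    intro v hv
    rw [hp v hv]
    split_ifs with h' <;> simp [h']
  have hrel : ∀ u v c, Arc M src dst wt u v c → ∀ S c', DetourArc n d lv onP X zz cv u v c S c' →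
      done S ≠ 0 → v < n → p v ≠ 0 ∧ δ v ≤ δ S + c' := by
    rintro u v c ⟨a, ha, rfl, rfl, rfl⟩ S c' hT hdone hv
    obtain ⟨b, hb, rfl, rfl, h₃⟩ := hE.complete a ha _ _ hT
    rw [hpd _ hv, ← h₃]
    exact hS.relaxed b hb hdone
  have hn0 := hS.source.2
  refine ⟨fun u v c ha hu hv hlt => ?_, fun u v c ha hu hv hu' hlt hpu => ?_,
    fun u v c ha hlv hv hlt hz => ?_, fun v hv => ?_, fun v hv => ?_⟩
  · have := hrel u v c ha n _ ⟨hu, hv, Or.inl ⟨hlt, rfl, rfl⟩⟩ hS.source.1 (h.lt v (by omega))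
    rwa [hn0, zero_add] at this
  · exact hrel u v c ha u _ ⟨hu, hv, Or.inr (Or.inl ⟨hlt, hu', rfl, rfl⟩)⟩
      ((hpd u (h.lt u hu)).1 hpu) (h.lt v (by omega))
  · have := hrel u v c ha n _ ⟨by omega, hv, Or.inr (Or.inr ⟨hlt, hz, rfl, rfl⟩)⟩ hS.source.1
      (h.lt v (by omega))
    rw [hn0] at this
    exact ⟨this.1, by linarith⟩
  · have hvn : v < n := by
      by_contra hvn
      exact hv (hp' v (by omega))
    have hdone := (hpd v hvn).1 hv
    obtain ⟨b, hb, h₁, h₂, h₃, h₄⟩ := hS.pred v hdone hvn.ne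
    obtain ⟨a, ha, ⟨h₅, h₆, h₇⟩, h₈, h₉⟩ := hE.sound b hb
    have hpv : p v = src a + 1 := by
      rw [hp v hvn, if_neg hdone, h₁]
      simp [h₉]
    have hav : dst a = v := by rw [← h₈, h₂]
    have hArc : Arc M src dst wt (src a) v (wt a) := ⟨a, ha, rfl, hav, rfl⟩
    rw [hav] at h₆ h₇
    refine ⟨h₆, (h.reach _ _ _ hArc h₅).1, src a, wt a, hArc, hpv, h₅, ?_⟩
    rcases h₇ with ⟨h₇, e₁, e₂⟩ | ⟨h₇, h₁₀, e₁, e₂⟩ | ⟨h₇, h₁₀, e₁, e₂⟩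
    · rw [e₁, hn0, e₂, zero_add] at h₄
      exact Or.inl ⟨h₇, h₄⟩
    · rw [e₁, e₂] at h₄
      rw [e₁] at h₃
      exact Or.inr (Or.inl ⟨h₇, (hpd _ (h.lt _ h₅)).2 h₃, h₄⟩)
    · rw [e₁, hn0, e₂] at h₄
      exact Or.inr (Or.inr ⟨h₇, h₁₀, by rw [h₄]; ring⟩)
  · have hvn : v < n := by
      by_contra hvn
      exact hv (hp' v (by omega))
    exact hS.dist_nonneg v ((hpd v hvn).1 hv)

/-- The state of the computation of parents, levels and depths after `i` vertices. -/
structure Levelled (π onP ord : ℕ → ℕ) (i : ℕ) (par₀ par lv dep : ℕ → ℕ) : Prop where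
  done : ∀ j < i, par (ord j) = π (ord j) ∧
    lv (ord j) = (if onP (ord j) = 0 then lv (π (ord j) - 1) else onP (ord j)) ∧
    dep (ord j) = dep (π (ord j) - 1) + 1
  rest : ∀ v, (∀ j < i, ord j ≠ v) → par v = par₀ v ∧ lv v = 0 ∧ dep v = 0

/-- The listed values refer to the level and depth of the parent, so these must not change later;
`hprev` ensures that parents are listed first or never. -/
theorem Levelled.step {π onP ord par₀ par lv dep : ℕ → ℕ} {i x : ℕ}
    (h : Levelled π onP ord i par₀ par lv dep) (hx : ord i = x)
    (hprev : ∀ j ≤ i, (∀ j' ≤ i, ord j' ≠ π (ord j) - 1) ∨ ∃ j' < j, ord j' = π (ord j) - 1) :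
    Levelled π onP ord (i + 1) par₀ (Function.update par x (π x))
      (Function.update lv x (if onP x = 0 then lv (π x - 1) else onP x))
      (Function.update dep x (dep (π x - 1) + 1)) := by
  -- The list is not known to be free of repetitions; a repeated vertex receives the values that it
  -- already has.
  by_cases hold : ∃ j < i, ord j = x
  · obtain ⟨j, hj, hjx⟩ := hold
    obtain ⟨h₁, h₂, h₃⟩ := h.done j hj
    rw [hjx] at h₁ h₂ h₃
    rw [← h₁, ← h₂] at *
    rw [← h₃, Function.update_eq_self, Function.update_eq_self, Function.update_eq_self]
    refine ⟨fun j' hj' => ?_, fun v hv => h.rest v fun j' hj' => hv j' (by omega)⟩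
    rcases Nat.lt_succ_iff_lt_or_eq.1 hj' with hj' | rfl
    · exact h.done j' hj'
    · rw [hx, ← hjx]; exact h.done j hj
  · push Not at hold
    -- The vertex written now is not the parent of one treated so far, nor of itself, so no value
    -- that was read is overwritten.
    have hne : ∀ j ≤ i, π (ord j) - 1 ≠ x := by
      intro j hj he
      rcases hprev j hj with h' | ⟨j', hj', h'⟩
      · exact h' i le_rfl (hx.trans he.symm)
      · exact hold j' (by omega) (h'.trans he)
    refine ⟨fun j hj => ?_, fun v hv => ?_⟩
    · rw [Function.update_of_ne (f := lv) (hne j (by omega)),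
        Function.update_of_ne (f := dep) (hne j (by omega))]
      rcases Nat.lt_succ_iff_lt_or_eq.1 hj with hj | rfl
      · simp only [Function.update_of_ne (hold j hj)]
        exact h.done j hj
      · simp [hx]
    · have hvx : v ≠ x := by
        rintro rfl
        exact hv i (by omega) hx
      simp only [Function.update_of_ne hvx]
      exact h.rest v fun j hj => hv j (by omega)

/-- `P` lists the `k` vertices of a path in a shortest-path tree, from the root `r`. -/
structure TightPath (E : ℕ → ℕ → ℝ → Prop) (n r : ℕ) (d : ℕ → ℝ) (P : ℕ → ℕ) (k : ℕ) : Prop where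
  zero : P 0 = r
  pos : 0 < k
  le : k ≤ n
  inj : ∀ i < k, ∀ j < k, P i = P j → i = j
  lt : ∀ i < k, P i < n
  tight : ∀ i, i + 1 < k → ∃ c, E (P i) (P (i + 1)) c ∧ d (P (i + 1)) = d (P i) + c

/-- The marks on the vertices of the path and their parents. -/
structure PathMarked (n : ℕ) (P : ℕ → ℕ) (i : ℕ) (onP par₀ : ℕ → ℕ) : Prop where
  mark : ∀ j < i, onP (P j) = j + 1 ∧ par₀ (P j) = if j = 0 then n + 1 else P (j - 1) + 1
  rest : ∀ v, (∀ j < i, P j ≠ v) → onP v = 0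

/-- The parent, shifted by one, of a vertex in the shortest-path tree that contains the path. -/
def treeParent (onP par₀ src pred : ℕ → ℕ) (v : ℕ) : ℕ :=
  if onP v = 0 then src (pred v - 1) + 1 else par₀ v

variable {done pred ord par₀ P : ℕ → ℕ} {k c : ℕ}

theorem TightPath.done_ne (hS : ShortestPaths n M r src dst wt done pred ord c d)
    (hP : TightPath (Arc M src dst wt) n r d P k) : ∀ j < k, done (P j) ≠ 0
  | 0, _ => by rw [hP.zero]; exact hS.source.1
  | j + 1, hj => by
    obtain ⟨c, ⟨a, ha, h₁, h₂, -⟩, -⟩ := hP.tight j hj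
    rw [← h₂]
    exact (hS.relaxed a ha (by rw [h₁]; exact TightPath.done_ne hS hP j (by omega))).1

theorem exists_mark (hm : PathMarked n P k onP par₀) {v : ℕ} (hv : onP v ≠ 0) :
    ∃ j < k, P j = v ∧ onP v = j + 1 ∧ par₀ v = if j = 0 then n + 1 else P (j - 1) + 1 := by
  by_contra hne
  push Not at hne
  refine hv (hm.rest v fun j hj hjv => ?_)
  have := hm.mark j hj
  rw [hjv] at this
  exact hne j hj hjv this.1 this.2

/-- The parent of a reached vertex. -/
theorem treeParent_spec (hA : IsArcs (Arc M src dst wt) n)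
    (hS : ShortestPaths n M r src dst wt done pred ord c d)
    (hP : TightPath (Arc M src dst wt) n r d P k) (hm : PathMarked n P k onP par₀) {v : ℕ}
    (hv : done v ≠ 0) :
    (v = r ∧ treeParent onP par₀ src pred v = n + 1 ∧ onP v = 1) ∨
      (v ≠ r ∧ ∃ u c, treeParent onP par₀ src pred v = u + 1 ∧ Arc M src dst wt u v c ∧
        d v = d u + c ∧ 0 < c ∧ done u ≠ 0 ∧
        (onP v = 0 ∨ (onP u ≠ 0 ∧ onP v = onP u + 1))) := by
  by_cases hvP : onP v = 0
  · have hvr : v ≠ r := by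
      rintro rfl
      have := (hm.mark 0 hP.pos).1
      rw [hP.zero] at this
      omega
    obtain ⟨a, ha, h₁, h₂, h₃, h₄⟩ := hS.pred v hv hvr
    have hArc : Arc M src dst wt (src a) v (wt a) := ⟨a, ha, rfl, h₂, rfl⟩
    refine Or.inr ⟨hvr, src a, wt a, ?_, hArc, h₄, hA.pos _ _ _ hArc, h₃, Or.inl hvP⟩
    simp [treeParent, hvP, h₁]
  · obtain ⟨j, hj, h₁, h₂, h₃⟩ := exists_mark hm hvP
    have hpar : treeParent onP par₀ src pred v = par₀ v := if_neg hvP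
    rw [hpar, h₃]
    rcases Nat.eq_zero_or_pos j with rfl | hpos
    · exact Or.inl ⟨h₁.symm.trans hP.zero, by simp, h₂⟩
    · refine Or.inr ⟨?_, ?_⟩
      · rintro rfl
        have := hP.inj j hj 0 hP.pos (h₁.trans hP.zero.symm)
        omega
      · obtain ⟨i, rfl⟩ : ∃ i, j = i + 1 := ⟨j - 1, by omega⟩
        obtain ⟨c, hc, hd⟩ := hP.tight i hj
        rw [h₁] at hc hd
        have := (hm.mark i (by omega)).1
        exact ⟨P i, c, by simp, hc, hd, hA.pos _ _ _ hc, hP.done_ne hS i (by omega),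
          Or.inr ⟨by omega, by omega⟩⟩

/-- As lengths are positive, a parent is strictly closer to the root and comes earlier in the order.
The parent of the root is the artificial vertex `n`, which is not listed. -/
theorem treeParent_earlier (hA : IsArcs (Arc M src dst wt) n)
    (hS : ShortestPaths n M r src dst wt done pred ord c d)
    (hP : TightPath (Arc M src dst wt) n r d P k) (hm : PathMarked n P k onP par₀) {i : ℕ}
    (hi : i < c) : (∀ j < c, ord j ≠ treeParent onP par₀ src pred (ord i) - 1) ∨
      ∃ j < i, ord j = treeParent onP par₀ src pred (ord i) - 1 := by
  rcases treeParent_spec hA hS hP hm (hS.ord_done i hi) with ⟨-, h, -⟩ | ⟨-, u, w, h₁, -, h₂, h₃, h₄, -⟩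
  · left
    intro j hj
    rw [h]
    simpa using (hS.lt _ (hS.ord_done j hj)).ne
  · right
    obtain ⟨j, hj, hju⟩ := hS.ord_surj u h₄
    refine ⟨j, ?_, by simp [h₁, hju]⟩
    by_contra hij
    have := hS.ord_mono i j (by omega) hj
    rw [hju] at this
    linarith

/-- The arcs of the path and those to the Dijkstra predecessors are all tight for `d`, so the mixed
parents again give a shortest-path tree. Off the path the level is inherited from the parent; on the
path it is the position. -/
theorem ShortestPaths.levelTree (hA : IsArcs (Arc M src dst wt) n)
    (hS : ShortestPaths n M r src dst wt done pred ord c d)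
    (hP : TightPath (Arc M src dst wt) n r d P k) (hm : PathMarked n P k onP par₀)
    (hL : Levelled (treeParent onP par₀ src pred) onP ord c par₀ par lv dep) :
    LevelTree (Arc M src dst wt) n r d lv par dep onP (fun I => P (I - 1)) := by
  have hdone : ∀ v, done v ≠ 0 → par v = treeParent onP par₀ src pred v ∧
      lv v = (if onP v = 0 then lv (treeParent onP par₀ src pred v - 1) else onP v) ∧
      dep v = dep (treeParent onP par₀ src pred v - 1) + 1 := by
    intro v hv
    obtain ⟨j, hj, rfl⟩ := hS.ord_surj v hv
    exact hL.done j hj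
  have hrest : ∀ v, done v = 0 → lv v = 0 ∧ dep v = 0 := by
    intro v hv
    refine (hL.rest v fun j hj hjv => ?_).2
    rw [← hjv] at hv
    exact hS.ord_done j hj hv
  have hlv : ∀ v < n, done v ≠ 0 → lv v ≠ 0 ∧ lv v ≤ n := by
    refine induction_on_real d fun v hvn ih hv => ?_
    obtain ⟨h₁, h₂, h₃⟩ := hdone v hv
    rcases treeParent_spec hA hS hP hm hv with ⟨-, h, h'⟩ | ⟨-, u, w, e₁, e₂, e₃, e₄, e₅, e₆⟩
    · rw [h', if_neg one_ne_zero] at h₂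
      omega
    · by_cases hvP : onP v = 0
      · rw [if_pos hvP, e₁] at h₂
        rw [h₂]
        exact ih u (hS.lt u e₅) (by linarith) e₅
      · rw [if_neg hvP] at h₂
        obtain ⟨j, hj, -, hj', -⟩ := exists_mark hm hvP
        have := hP.le
        omega
  have hiff : ∀ v, lv v ≠ 0 ↔ done v ≠ 0 :=
    fun v => ⟨fun h h' => h (hrest v h').1, fun h => (hlv v (hS.lt v h) h).1⟩
  have hlvP : ∀ v, onP v ≠ 0 → lv v = onP v := by
    intro v hv
    obtain ⟨j, hj, rfl, -⟩ := exists_mark hm hv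
    have := (hdone _ (hP.done_ne hS j hj)).2.1
    rwa [if_neg hv] at this
  have hrP : onP r = 1 := by
    have := (hm.mark 0 hP.pos).1
    rwa [hP.zero] at this
  refine ⟨?_, ?_, ?_, hS.source.2, ?_, ?_, ?_, ?_, ?_, ?_, ?_⟩
  · rw [hlvP r (by omega), hrP]
  · omega
  · rw [(hdone r hS.source.1).1]
    rcases treeParent_spec hA hS hP hm hS.source.1 with ⟨-, h, -⟩ | ⟨h, -⟩
    · exact h
    · exact absurd rfl h
  · by_contra hn
    exact (hS.lt n ((hiff n).1 hn)).false
  · rintro u v w ⟨a, ha, rfl, rfl, rfl⟩ hu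
    rw [hiff]
    exact hS.relaxed a ha ((hiff _).1 hu)
  · intro v hv hvr
    have hv' := (hiff v).1 hv
    obtain ⟨h₁, h₂, h₃⟩ := hdone v hv'
    rcases treeParent_spec hA hS hP hm hv' with ⟨h, -⟩ | ⟨-, u, w, e₁, e₂, e₃, e₄, e₅, e₆⟩
    · exact absurd h hvr
    · rw [e₁] at h₁ h₂ h₃
      refine ⟨u, w, h₁, e₂, e₃, h₃, (hiff u).2 e₅, ?_⟩
      by_cases hvP : onP v = 0
      · rw [if_pos hvP] at h₂
        exact Or.inl ⟨hvP, by simpa using h₂.symm⟩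
      · have e₇ := e₆.resolve_left hvP
        rw [if_neg hvP] at h₂
        have := hlvP u e₇.1
        exact Or.inr ⟨hvP, e₇.1, by omega⟩
  · intro v hv
    rw [hlvP v hv]
    obtain ⟨j, hj, h₁, h₂, -⟩ := exists_mark hm hv
    simpa [h₂] using h₁
  · exact fun v hv => hS.lt v ((hiff v).1 hv)
  · intro v
    by_cases hv : lv v = 0
    · omega
    · exact (hlv v (hS.lt v ((hiff v).1 hv)) ((hiff v).1 hv)).2
  · exact fun v hv => hS.dist_nonneg v ((hiff v).1 hv)

end

/-! The cheapest arcs across the levels, by a sparse table with rows of width `w`. -/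

/-- The cell `q` stands for the level `I`. -/
def Covers (w q I : ℕ) : Prop := q % w ≤ I ∧ I < q % w + 2 ^ (q / w)

/-- The cells name arcs that cross all the levels that the cell stands for, with their costs. -/
def CellsSound (T : ℕ → ℕ → ℝ → Prop) (M w : ℕ) (cell : ℕ → ℕ) (cv : ℕ → ℝ) : Prop :=
  ∀ q I, cell q ≠ 0 → Covers w q I → cell q - 1 < M ∧ T (cell q - 1) I (cv q)

/-- The cells below `Q` contain a cheapest arc among those below `i`. -/
def CellsComplete (T : ℕ → ℕ → ℝ → Prop) (w i Q : ℕ) (cell : ℕ → ℕ) (cv : ℕ → ℝ) : Prop :=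
  ∀ a < i, ∀ I κ, T a I κ → ∃ q < Q, Covers w q I ∧ cell q ≠ 0 ∧ cv q ≤ κ

/-- No cell has become worse. -/
def CellsImprove (cell : ℕ → ℕ) (cv : ℕ → ℝ) (cell' : ℕ → ℕ) (cv' : ℕ → ℝ) : Prop :=
  ∀ q, cell q ≠ 0 → cell' q ≠ 0 ∧ cv' q ≤ cv q

theorem CellsImprove.refl (cell : ℕ → ℕ) (cv : ℕ → ℝ) : CellsImprove cell cv cell cv :=
  fun _ h => ⟨h, le_rfl⟩

theorem CellsImprove.trans {cell cell' cell'' : ℕ → ℕ} {cv cv' cv'' : ℕ → ℝ}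
    (h : CellsImprove cell cv cell' cv') (h' : CellsImprove cell' cv' cell'' cv'') :
    CellsImprove cell cv cell'' cv'' := by
  intro q hq
  obtain ⟨h₁, h₂⟩ := h q hq
  obtain ⟨h₃, h₄⟩ := h' q h₁
  exact ⟨h₃, h₄.trans h₂⟩

theorem CellsComplete.improve {T : ℕ → ℕ → ℝ → Prop} {w i Q : ℕ} {cell cell' : ℕ → ℕ}
    {cv cv' : ℕ → ℝ} (h : CellsComplete T w i Q cell cv) (h' : CellsImprove cell cv cell' cv') :
    CellsComplete T w i Q cell' cv' := by
  intro a ha I κ hT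
  obtain ⟨q, hq, h₁, h₂, h₃⟩ := h a ha I κ hT
  obtain ⟨h₄, h₅⟩ := h' q h₂
  exact ⟨q, hq, h₁, h₄, h₅.trans h₃⟩

theorem covers_iff {w j p I : ℕ} (hp : p < w) :
    Covers w (j * w + p) I ↔ p ≤ I ∧ I < p + 2 ^ j := by
  have h₁ : (j * w + p) % w = p := by
    rw [add_comm, Nat.add_mul_mod_self_right, Nat.mod_eq_of_lt hp]
  have h₂ : (j * w + p) / w = j := by
    rw [add_comm, Nat.add_mul_div_right _ _ (by omega), Nat.div_eq_of_lt hp, zero_add]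
  rw [Covers, h₁, h₂]

theorem covers_of_lt {w p I : ℕ} (hp : p < w) : Covers w p I ↔ I = p := by
  have := covers_iff (j := 0) (I := I) hp
  rw [zero_mul, zero_add] at this
  rw [this]
  simp
  omega

/-- The arc `a` crosses the level `I`, and costs `κ` together with the ways to its ends. -/
def CrossArc (src dst : ℕ → ℕ) (wt d : ℕ → ℝ) (lv onP p : ℕ → ℕ) (δ : ℕ → ℝ) (a I : ℕ) (κ : ℝ) :
    Prop :=
  ∃ k, I < lv (dst a) ∧ Launch d lv onP p δ I (src a) k ∧ κ = k + wt a + d (dst a)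

/-! ### Filling the sparse table. -/

namespace RealRAM

/-- Enters the arc in variable 4 with the cost in the real variable 0 into the cell in variable 9. -/
def improveCell : Program :=
  .ite (.or (.weq (.arr 11 (.var 9)) (.const 0)) (.rlt (.var 0) (.arr 2 (.var 9))))
    (.seq (.wstore 11 (.var 9) (.add (.var 4) (.const 1))) (.rstore 2 (.var 9) (.var 0)))
    .skip

/-- Soundness demands that the arc has the same cost on every level of the cell, which is `hT`. -/
theorem wp_improveCell {W M w : ℕ} {T : ℕ → ℕ → ℝ → Prop} {s : State}
    (hs : CellsSound T M w (s.wa 11) (s.ra 2)) (ha : s.wv 4 < M)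
    (hT : ∀ I, Covers w (s.wv 9) I → T (s.wv 4) I (s.rv 0)) (hW : M ≤ W) :
    improveCell.wp W (fun k s' => k ≤ 20 ∧ CellsSound T M w (s'.wa 11) (s'.ra 2) ∧
      CellsImprove (s.wa 11) (s.ra 2) (s'.wa 11) (s'.ra 2) ∧
      s'.wa 11 (s.wv 9) ≠ 0 ∧ s'.ra 2 (s.wv 9) ≤ s.rv 0) s := by
  refine ⟨by simp, fun hb => ?_, fun hb => ?_⟩
  · have hb' : s.wa 11 (s.wv 9) = 0 ∨ s.rv 0 < s.ra 2 (s.wv 9) := by simpa using hb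
    simp [Program.wp]
    refine ⟨by omega, fun q I hq hc => ?_, fun q hq => ?_⟩
    · by_cases hqe : q = s.wv 9
      · subst hqe
        simpa using ⟨ha, hT I hc⟩
      · simp only [Function.update_of_ne hqe] at hq ⊢
        exact hs q I hq hc
    · by_cases hqe : q = s.wv 9
      · subst hqe
        simpa using (hb'.resolve_left hq).le
      · simp only [Function.update_of_ne hqe]
        exact ⟨hq, le_rfl⟩
  · have hb' : s.wa 11 (s.wv 9) ≠ 0 ∧ s.ra 2 (s.wv 9) ≤ s.rv 0 := by simpa using hb
    exact ⟨by simp, hs, CellsImprove.refl _ _, hb'⟩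

/-- Tables of logarithms and powers of two. -/
def buildLogs : Program :=
  .seq (.wset 4 (.const 2)) <|
  .seq (.wstore 13 (.const 0) (.const 1)) <|
  .loop (.wlt (.var 4) (.add (.var 0) (.const 1))) <|
    .seq (.wstore 12 (.var 4) (.add (.arr 12 (.div (.var 4) (.const 2))) (.const 1))) <|
    .seq (.wstore 13 (.arr 12 (.var 4))
      (.mul (.const 2) (.arr 13 (.sub (.arr 12 (.var 4)) (.const 1))))) <|
    .wset 4 (.add (.var 4) (.const 1))

/-- Both tables grow by `log k = log (k / 2) + 1`. A power of two is rewritten for every `k` with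
the same logarithm, always with the same value. -/
theorem wp_buildLogs {W : ℕ} {s : State} (h0 : s.wa 12 1 = 0) (hn : 1 ≤ s.wv 0)
    (hW : s.wv 0 + 2 ≤ W) :
    buildLogs.wp W (fun k s' => k ≤ 60 * (s.wv 0 + 1) ∧
      (∀ k, 1 ≤ k → k ≤ s.wv 0 → s'.wa 12 k = Nat.log 2 k) ∧
      (∀ j ≤ Nat.log 2 (s.wv 0), s'.wa 13 j = 2 ^ j)) s := by
  simp only [buildLogs, Program.wp]
  refine ⟨by simp; omega, by simp, by simp; omega, ?_⟩
  refine Program.wp_loop (fun t => 2 ≤ t.wv 4 ∧ t.wv 4 ≤ s.wv 0 + 2 ∧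
      ∀ k, 1 ≤ k → k < t.wv 4 → t.wa 12 k = Nat.log 2 k ∧ t.wa 13 (Nat.log 2 k) = 2 ^ Nat.log 2 k)
    (fun t => 40 * (s.wv 0 + 2 - t.wv 4)) ?_ ?_ ?_ ?_
  · simp
    intro k h₁ h₂
    have : k = 1 := by omega
    subst this
    simp [h0]
  · rintro t hF - h
    have e0 : t.wv 0 = s.wv 0 := (hF.wv 0 (by decide)).trans (by simp)
    simp [e0]
    omega
  · rintro t hF - ⟨h₁, h₂, h₃⟩ hb
    have e0 : t.wv 0 = s.wv 0 := (hF.wv 0 (by decide)).trans (by simp)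
    simp [e0] at hb
    have hlog : Nat.log 2 (t.wv 4) = Nat.log 2 (t.wv 4 / 2) + 1 :=
      Nat.log_of_one_lt_of_le (by norm_num) h₁
    obtain ⟨h₄, h₅⟩ := h₃ (t.wv 4 / 2) (by omega) (by omega)
    have hpow : 2 ^ Nat.log 2 (t.wv 4) ≤ t.wv 4 := Nat.pow_log_le_self 2 (by omega)
    have hpow' : 2 * 2 ^ Nat.log 2 (t.wv 4 / 2) = 2 ^ Nat.log 2 (t.wv 4) := by
      rw [hlog, pow_succ, mul_comm]
    have hlt : Nat.log 2 (t.wv 4) < t.wv 4 := Nat.log_lt_self 2 (by omega)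
    obtain ⟨g, hg⟩ : ∃ g, Nat.log 2 (t.wv 4 / 2) = g := ⟨_, rfl⟩
    rw [hg] at hlog h₄ h₅ hpow'
    simp [Program.wp, h₄, h₅, hpow']
    refine ⟨by omega, by omega, by omega, ⟨by omega, by omega, fun k hk hk' => ?_⟩, by omega⟩
    by_cases hkt : k = t.wv 4
    · subst hkt
      rw [← hlog]
      simp
    · obtain ⟨h₆, h₇⟩ := h₃ k hk (by omega)
      rw [Function.update_of_ne hkt, h₆, ← hlog]
      refine ⟨rfl, ?_⟩
      rw [Function.update_apply]
      split_ifs with he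
      · rw [he]
      · exact h₇
  · rintro k t hF - ⟨h₁, h₂, h₃⟩ hb hk
    have e0 : t.wv 0 = s.wv 0 := (hF.wv 0 (by decide)).trans (by simp)
    simp [e0] at hb hk
    refine ⟨by simp; omega, fun k hk hk' => (h₃ k hk (by omega)).1, fun j hj => ?_⟩
    have := (h₃ (2 ^ j) Nat.one_le_two_pow ?_).2
    · rwa [Nat.log_pow (by norm_num)] at this
    · have := Nat.pow_le_of_le_log (by omega) hj
      omega

/-- Enters the arc in variable 4 into the two cells that cover the levels between its ends. -/
def spanArc : Program :=
  .seq (.rset 0 (.add (.add (.arr 101 (.var 5)) (.arr 100 (.var 4))) (.arr 101 (.arr 101 (.var 4))))) <|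
  .seq (.wset 8 (.arr 12 (.sub (.sub (.var 7) (.var 6)) (.const 1)))) <|
  .seq (.wset 9 (.add (.mul (.var 8) (.add (.var 0) (.const 1))) (.add (.var 6) (.const 1)))) <|
  .seq improveCell <|
  .seq (.wset 9 (.add (.mul (.var 8) (.add (.var 0) (.const 1))) (.sub (.var 7) (.arr 13 (.var 8)))))
  improveCell

/-- Enters the arc in variable 4 into the cell of the level of its origin. -/
def touchArc : Program :=
  .seq (.rset 0 (.add (.add (.arr 201 (.var 5)) (.arr 100 (.var 4))) (.arr 101 (.arr 101 (.var 4))))) <|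
  .seq (.wset 9 (.var 6)) improveCell

def enterSpan : Program :=
  .ite (.wlt (.add (.var 6) (.const 1)) (.var 7)) spanArc .skip

def enterTouch : Program :=
  .ite (.and (.weq (.arr 10 (.var 5)) (.const 0)) (.neg (.weq (.arr 6 (.var 5)) (.const 0))))
    touchArc .skip

/-- Enters the arc in variable 4 into the table. -/
def enterArc : Program :=
  .seq (.wset 5 (.arr 100 (.var 4))) <|
  .seq (.wset 6 (.arr 3 (.arr 100 (.var 4)))) <|
  .seq (.wset 7 (.arr 3 (.arr 101 (.var 4)))) <|
  .ite (.and (.neg (.weq (.var 6) (.const 0))) (.wlt (.var 6) (.var 7)))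
    (.seq enterSpan enterTouch) .skip

/-- The input of the computation of the cells. -/
structure TableOk (n M : ℕ) (s : State) : Prop where
  n_eq : s.wv 0 = n
  log : ∀ k, 1 ≤ k → k ≤ n → s.wa 12 k = Nat.log 2 k
  pow : ∀ j ≤ Nat.log 2 n, s.wa 13 j = 2 ^ j
  lv_le : ∀ v, s.wa 3 v ≤ n

/-- The arcs that cross a level, in a state. -/
def State.crossArc (s : State) : ℕ → ℕ → ℝ → Prop :=
  CrossArc (s.wa 100) (s.wa 101) (s.ra 100) (s.ra 101) (s.wa 3) (s.wa 10) (s.wa 6) (s.ra 201)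

/-- Since `log n < n`, the table has at most `n` rows, so that `n * (n + 1)` bounds the indices as
words. -/
theorem row_le {n j : ℕ} (hn : 1 ≤ n) (hj : j ≤ Nat.log 2 n) :
    j * (n + 1) + n + 1 ≤ n * (n + 1) := by
  have h₁ : Nat.log 2 n < n := Nat.log_lt_self 2 (by omega)
  have h₂ : (j + 1) * (n + 1) ≤ n * (n + 1) := Nat.mul_le_mul_right _ (by omega)
  rw [add_mul, one_mul] at h₂
  omega

/-- If `L` levels lie strictly between the ends and `j = log L`, then `2 ^ j ≤ L < 2 * 2 ^ j`. So
the two intervals of length `2 ^ j` at either end cover them; their overlap is harmless for minima.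
-/
theorem wp_spanArc {W n M : ℕ} {T : ℕ → ℕ → ℝ → Prop} {s : State} (hok : TableOk n M s) (hn : 1 ≤ n)
    (hs : CellsSound T M (n + 1) (s.wa 11) (s.ra 2)) (ha : s.wv 4 < M) (hM : M ≤ W)
    (hW : n * (n + 1) ≤ W) (h5 : s.wv 5 = s.wa 100 (s.wv 4)) (h67 : s.wv 6 + 1 < s.wv 7)
    (h7 : s.wv 7 ≤ n)
    (hT : ∀ I, s.wv 6 < I → I < s.wv 7 →
      T (s.wv 4) I (s.ra 101 (s.wa 100 (s.wv 4)) + s.ra 100 (s.wv 4) + s.ra 101 (s.wa 101 (s.wv 4)))) :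
    spanArc.wp W (fun k s' => k ≤ 90 ∧ CellsSound T M (n + 1) (s'.wa 11) (s'.ra 2) ∧
      CellsImprove (s.wa 11) (s.ra 2) (s'.wa 11) (s'.ra 2) ∧
      ∀ I, s.wv 6 < I → I < s.wv 7 → ∃ q < (Nat.log 2 n + 1) * (n + 1), Covers (n + 1) q I ∧
        s'.wa 11 q ≠ 0 ∧ s'.ra 2 q ≤
          s.ra 101 (s.wa 100 (s.wv 4)) + s.ra 100 (s.wv 4) + s.ra 101 (s.wa 101 (s.wv 4))) s := by
  obtain ⟨κ, hκ⟩ : ∃ κ, s.ra 101 (s.wa 100 (s.wv 4)) + s.ra 100 (s.wv 4) +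
    s.ra 101 (s.wa 101 (s.wv 4)) = κ := ⟨_, rfl⟩
  obtain ⟨L, hL⟩ : ∃ L, s.wv 7 - s.wv 6 - 1 = L := ⟨_, rfl⟩
  obtain ⟨j, hj⟩ : ∃ j, Nat.log 2 L = j := ⟨_, rfl⟩
  have h12 : s.wa 12 L = j := by rw [hok.log L (by omega) (by omega), hj]
  have hjn : j ≤ Nat.log 2 n := by rw [← hj]; exact Nat.log_mono_right (by omega)
  have h13 := hok.pow j hjn
  have hp₁ : 2 ^ j ≤ L := by rw [← hj]; exact Nat.pow_log_le_self 2 (by omega)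
  have hp₂ : L < 2 ^ j + 2 ^ j := by
    have := Nat.lt_pow_succ_log_self (b := 2) (by norm_num) L
    rw [hj, pow_succ] at this
    omega
  have hpos : 0 < 2 ^ j := by positivity
  have hrow := row_le hn hjn
  have hrow' : j * (n + 1) + n + 1 ≤ (Nat.log 2 n + 1) * (n + 1) := by
    have := Nat.mul_le_mul_right (n + 1) (Nat.succ_le_succ hjn)
    rw [Nat.succ_mul] at this
    exact this
  have hc₁ : ∀ I, Covers (n + 1) (j * (n + 1) + (s.wv 6 + 1)) I ↔ s.wv 6 + 1 ≤ I ∧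
      I < s.wv 6 + 1 + 2 ^ j := fun I => covers_iff (by omega)
  have hc₂ : ∀ I, Covers (n + 1) (j * (n + 1) + (s.wv 7 - 2 ^ j)) I ↔ s.wv 7 - 2 ^ j ≤ I ∧
      I < s.wv 7 - 2 ^ j + 2 ^ j := fun I => covers_iff (by omega)
  obtain ⟨q₁, hq₁⟩ : ∃ q, j * (n + 1) + (s.wv 6 + 1) = q := ⟨_, rfl⟩
  obtain ⟨q₂, hq₂⟩ : ∃ q, j * (n + 1) + (s.wv 7 - 2 ^ j) = q := ⟨_, rfl⟩
  have hj1 : j * (n + 1) ≤ W := by omega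
  simp only [spanArc, Program.wp]
  simp [h5, hκ, hL, h12, hok.n_eq, hq₁]
  rw [hq₁] at hc₁
  rw [hq₂] at hc₂
  refine ⟨by omega, ⟨⟨by omega, by omega⟩, by omega, by omega⟩, ?_⟩
  refine Program.wp_mono (Program.wp_frame (wp_improveCell (T := T) (M := M) (w := n + 1) (by simpa using hs)
    (by simpa using ha) ?_ hM)) ?_
  · simp [hc₁]
    intro I h₁ h₂
    rw [← hκ]
    exact hT I (by omega) (by omega)
  rintro k₁ s₁ ⟨⟨i₁, i₂, i₃, i₄, i₅⟩, hF₁⟩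
  have w0 : s₁.wv 0 = n := (hF₁.wv 0 (by decide)).trans (by simp [hok.n_eq])
  have w4 : s₁.wv 4 = s.wv 4 := (hF₁.wv 4 (by decide)).trans (by simp)
  have w7 : s₁.wv 7 = s.wv 7 := (hF₁.wv 7 (by decide)).trans (by simp)
  have w8 : s₁.wv 8 = j := (hF₁.wv 8 (by decide)).trans (by simp)
  have a13 : s₁.wa 13 j = 2 ^ j := by rw [← h13]; exact congrFun ((hF₁.wa 13 (by decide)).trans (by simp)) j
  have r0 : s₁.rv 0 = κ := (hF₁.rv 0 (by decide)).trans (by simp)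
  simp at i₃ i₄ i₅
  simp only [w0, w7, w8, a13, hq₂]
  refine ⟨⟨⟨by omega, by omega⟩, by omega⟩, ?_⟩
  refine Program.wp_mono (wp_improveCell (T := T) (M := M) (w := n + 1) (by simpa using i₂)
    (by simpa [w4] using ha) ?_ hM) ?_
  · simp [hc₂, w4, r0]
    intro I h₁ h₂
    rw [← hκ]
    exact hT I (by omega) (by omega)
  rintro k₂ s₂ ⟨j₁, j₂, j₃, j₄, j₅⟩
  simp [r0] at j₃ j₄ j₅
  refine ⟨by omega, j₂, i₃.trans j₃, fun I h₁ h₂ => ?_⟩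
  by_cases hI : I < s.wv 6 + 1 + 2 ^ j
  · obtain ⟨k₃, k₄⟩ := j₃ q₁ i₄
    exact ⟨q₁, by omega, (hc₁ I).2 ⟨by omega, hI⟩, k₃, k₄.trans i₅⟩
  · exact ⟨q₂, by omega, (hc₂ I).2 ⟨by omega, by omega⟩, j₄, j₅⟩

end RealRAM

theorem CellsComplete.succ {T : ℕ → ℕ → ℝ → Prop} {w i Q : ℕ} {cell : ℕ → ℕ} {cv : ℕ → ℝ}
    (h : CellsComplete T w i Q cell cv)
    (h' : ∀ I κ, T i I κ → ∃ q < Q, Covers w q I ∧ cell q ≠ 0 ∧ cv q ≤ κ) :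
    CellsComplete T w (i + 1) Q cell cv := by
  intro a ha I κ hT
  rcases Nat.lt_succ_iff_lt_or_eq.1 ha with ha | rfl
  · exact h a ha I κ hT
  · exact h' I κ hT

namespace RealRAM

theorem wp_touchArc {W n M : ℕ} {T : ℕ → ℕ → ℝ → Prop} {s : State}
    (hs : CellsSound T M (n + 1) (s.wa 11) (s.ra 2)) (ha : s.wv 4 < M) (hM : M ≤ W)
    (h5 : s.wv 5 = s.wa 100 (s.wv 4)) (h6 : s.wv 6 ≤ n)
    (hT : T (s.wv 4) (s.wv 6)
      (s.ra 201 (s.wa 100 (s.wv 4)) + s.ra 100 (s.wv 4) + s.ra 101 (s.wa 101 (s.wv 4)))) :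
    touchArc.wp W (fun k s' => k ≤ 50 ∧ CellsSound T M (n + 1) (s'.wa 11) (s'.ra 2) ∧
      CellsImprove (s.wa 11) (s.ra 2) (s'.wa 11) (s'.ra 2) ∧
      s'.wa 11 (s.wv 6) ≠ 0 ∧ s'.ra 2 (s.wv 6) ≤
          s.ra 201 (s.wa 100 (s.wv 4)) + s.ra 100 (s.wv 4) + s.ra 101 (s.wa 101 (s.wv 4))) s := by
  simp only [touchArc, Program.wp]
  simp [h5]
  refine Program.wp_mono (wp_improveCell (T := T) (M := M) (w := n + 1) (by simpa using hs)
    (by simpa using ha) ?_ hM) ?_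
  · intro I hI
    simp at hI ⊢
    rw [covers_of_lt (by omega)] at hI
    rwa [hI]
  rintro k₁ s₁ ⟨i₁, i₂, i₃, i₄, i₅⟩
  simp at i₃ i₄ i₅
  exact ⟨by omega, i₂, i₃, i₄, i₅⟩

theorem wp_enterSpan {W n M : ℕ} {T : ℕ → ℕ → ℝ → Prop} {s : State} (hok : TableOk n M s) (hn : 1 ≤ n)
    (hs : CellsSound T M (n + 1) (s.wa 11) (s.ra 2)) (ha : s.wv 4 < M) (hM : M ≤ W)
    (hW : n * (n + 1) ≤ W) (h5 : s.wv 5 = s.wa 100 (s.wv 4)) (h67 : s.wv 6 < s.wv 7)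
    (h7 : s.wv 7 ≤ n)
    (hT : ∀ I, s.wv 6 < I → I < s.wv 7 →
      T (s.wv 4) I (s.ra 101 (s.wa 100 (s.wv 4)) + s.ra 100 (s.wv 4) + s.ra 101 (s.wa 101 (s.wv 4)))) :
    enterSpan.wp W (fun k s' => k ≤ 100 ∧ CellsSound T M (n + 1) (s'.wa 11) (s'.ra 2) ∧
      CellsImprove (s.wa 11) (s.ra 2) (s'.wa 11) (s'.ra 2) ∧
      ∀ I, s.wv 6 < I → I < s.wv 7 → ∃ q < (Nat.log 2 n + 1) * (n + 1), Covers (n + 1) q I ∧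
        s'.wa 11 q ≠ 0 ∧ s'.ra 2 q ≤
          s.ra 101 (s.wa 100 (s.wv 4)) + s.ra 100 (s.wv 4) + s.ra 101 (s.wa 101 (s.wv 4))) s := by
  have hrow := row_le (j := 0) hn (Nat.zero_le _)
  refine ⟨by simp; omega, fun hb => ?_, fun hb => ?_⟩
  · simp at hb
    refine Program.wp_mono (wp_spanArc hok hn hs ha hM hW h5 hb h7 hT) ?_
    rintro k s' ⟨h₁, h₂⟩
    exact ⟨by simp; omega, h₂⟩
  · simp at hb
    exact ⟨by simp, hs, CellsImprove.refl _ _, fun I h₁ h₂ => by omega⟩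

theorem wp_enterTouch {W n M : ℕ} {T : ℕ → ℕ → ℝ → Prop} {s : State}
    (hs : CellsSound T M (n + 1) (s.wa 11) (s.ra 2)) (ha : s.wv 4 < M) (hM : M ≤ W)
    (h5 : s.wv 5 = s.wa 100 (s.wv 4)) (h6 : s.wv 6 ≤ n)
    (hT : s.wa 10 (s.wv 5) = 0 → s.wa 6 (s.wv 5) ≠ 0 → T (s.wv 4) (s.wv 6)
      (s.ra 201 (s.wa 100 (s.wv 4)) + s.ra 100 (s.wv 4) + s.ra 101 (s.wa 101 (s.wv 4)))) :
    enterTouch.wp W (fun k s' => k ≤ 70 ∧ CellsSound T M (n + 1) (s'.wa 11) (s'.ra 2) ∧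
      CellsImprove (s.wa 11) (s.ra 2) (s'.wa 11) (s'.ra 2) ∧
      (s.wa 10 (s.wv 5) = 0 → s.wa 6 (s.wv 5) ≠ 0 → s'.wa 11 (s.wv 6) ≠ 0 ∧ s'.ra 2 (s.wv 6) ≤
          s.ra 201 (s.wa 100 (s.wv 4)) + s.ra 100 (s.wv 4) + s.ra 101 (s.wa 101 (s.wv 4)))) s := by
  refine ⟨by simp, fun hb => ?_, fun hb => ?_⟩
  · simp at hb
    refine Program.wp_mono (wp_touchArc hs ha hM h5 h6 (hT hb.1 hb.2)) ?_
    rintro k s' ⟨h₁, h₂, h₃, h₄⟩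
    exact ⟨by simp; omega, h₂, h₃, fun _ _ => h₄⟩
  · simp at hb
    exact ⟨by simp, hs, CellsImprove.refl _ _, fun h₁ h₂ => absurd (hb h₁) h₂⟩

/-- An arc crosses the levels strictly between its ends with the tree distance of its origin, at a
cost that does not depend on the level. It also crosses the level of its origin, with the label of
the detour to the origin. -/
theorem wp_enterArc {W n M : ℕ} {T : ℕ → ℕ → ℝ → Prop} {s : State} (hok : TableOk n M s)
    (hn : 1 ≤ n) (hT : s.crossArc = T) (hs : CellsSound T M (n + 1) (s.wa 11) (s.ra 2))
    (hc : CellsComplete T (n + 1) (s.wv 4) ((Nat.log 2 n + 1) * (n + 1)) (s.wa 11) (s.ra 2))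
    (ha : s.wv 4 < M) (hM : M ≤ W) (hW : n * (n + 1) ≤ W) :
    enterArc.wp W (fun k s' => k ≤ 300 ∧ CellsSound T M (n + 1) (s'.wa 11) (s'.ra 2) ∧
      CellsComplete T (n + 1) (s.wv 4 + 1) ((Nat.log 2 n + 1) * (n + 1)) (s'.wa 11) (s'.ra 2)) s := by
  obtain ⟨a, haa⟩ : ∃ a, s.wv 4 = a := ⟨_, rfl⟩
  obtain ⟨u, hu⟩ : ∃ u, s.wa 100 a = u := ⟨_, rfl⟩
  obtain ⟨v, hv⟩ : ∃ v, s.wa 101 a = v := ⟨_, rfl⟩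
  have hrow := row_le (j := 0) hn (Nat.zero_le _)
  have hTa : ∀ I κ, T a I κ ↔ ∃ k, I < s.wa 3 v ∧ Launch (s.ra 101) (s.wa 3) (s.wa 10) (s.wa 6)
      (s.ra 201) I u k ∧ κ = k + s.ra 100 a + s.ra 101 v := by
    intro I κ
    rw [← hT, ← hu, ← hv]
    rfl
  have hlvv := hok.lv_le v
  rw [haa] at hc ha ⊢
  refine ⟨by simp, by simp, by simp, ?_⟩
  obtain ⟨s₀, hs₀⟩ : ∃ s₀, ((s.setW 5 u).setW 6 (s.wa 3 u)).setW 7 (s.wa 3 v) = s₀ := ⟨_, rfl⟩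
  simp only [Program.wp, WExp.eval, State.setW_wv, State.setW_wa, haa, hu, hv, Nat.reduceEqDiff,
    if_false, hs₀]
  have v0 : s₀.wv 0 = n := by rw [← hs₀]; simp [hok.n_eq]
  have v4 : s₀.wv 4 = a := by rw [← hs₀]; simp [haa]
  have v5 : s₀.wv 5 = u := by rw [← hs₀]; simp
  have v6 : s₀.wv 6 = s.wa 3 u := by rw [← hs₀]; simp
  have v7 : s₀.wv 7 = s.wa 3 v := by rw [← hs₀]; simp
  have va : s₀.wa = s.wa := by rw [← hs₀]; simp
  have vr : s₀.ra = s.ra := by rw [← hs₀]; simp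
  refine ⟨by simp, fun hb => ?_, fun hb => ?_⟩
  · simp [v6, v7] at hb
    refine Program.wp_mono (Program.wp_frame (wp_enterSpan (n := n) (M := M) (T := T)
      ⟨v0, by rw [va]; exact hok.log, by rw [va]; exact hok.pow, by rw [va]; exact hok.lv_le⟩ hn
      (by rwa [va, vr]) (by rwa [v4]) hM hW (by rw [v5, va, v4, hu]) (by rw [v6, v7]; exact hb.2)
      (by rwa [v7]) ?_)) ?_
    · intro I h₁ h₂
      rw [v6] at h₁
      rw [v7] at h₂
      rw [v4, va, vr, hu, hv]
      exact (hTa I _).2 ⟨_, h₂, ⟨hb.1, Or.inl ⟨h₁, rfl⟩⟩, rfl⟩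
    rintro k₁ s₁ ⟨⟨i₁, i₂, i₃, i₄⟩, hF₁⟩
    have w4 : s₁.wv 4 = a := (hF₁.wv 4 (by decide)).trans v4
    have w5 : s₁.wv 5 = u := (hF₁.wv 5 (by decide)).trans v5
    have w6 : s₁.wv 6 = s.wa 3 u := (hF₁.wv 6 (by decide)).trans v6
    have a100 : s₁.wa 100 = s.wa 100 := (hF₁.wa 100 (by decide)).trans (by rw [va])
    have a101 : s₁.wa 101 = s.wa 101 := (hF₁.wa 101 (by decide)).trans (by rw [va])
    have a10 : s₁.wa 10 = s.wa 10 := (hF₁.wa 10 (by decide)).trans (by rw [va])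
    have a6 : s₁.wa 6 = s.wa 6 := (hF₁.wa 6 (by decide)).trans (by rw [va])
    have r100 : s₁.ra 100 = s.ra 100 := (hF₁.ra 100 (by decide)).trans (by rw [vr])
    have r101 : s₁.ra 101 = s.ra 101 := (hF₁.ra 101 (by decide)).trans (by rw [vr])
    have r201 : s₁.ra 201 = s.ra 201 := (hF₁.ra 201 (by decide)).trans (by rw [vr])
    rw [va, vr] at i₃
    rw [va, vr, v4, v6, v7, hu, hv] at i₄
    refine Program.wp_mono (wp_enterTouch (n := n) i₂ (by rwa [w4]) hM (by rw [w5, w4, a100, hu])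
      (by rw [w6]; exact hok.lv_le u) ?_) ?_
    · rw [a10, a6, w4, w5, w6, a100, a101, r100, r101, r201, hu, hv]
      intro h₁ h₂
      exact (hTa _ _).2 ⟨_, hb.2, ⟨hb.1, Or.inr ⟨rfl, h₁, h₂, rfl⟩⟩, rfl⟩
    rintro k₂ s₂ ⟨j₁, j₂, j₃, j₄⟩
    rw [a10, a6, w4, w5, w6, a100, a101, r100, r101, r201, hu, hv] at j₄
    refine ⟨by simp; omega, j₂, (hc.improve (i₃.trans j₃)).succ ?_⟩
    intro I κ hTI
    obtain ⟨k, h₁, ⟨h₂, h₃⟩, rfl⟩ := (hTa I κ).1 hTI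
    rcases h₃ with ⟨h₃, rfl⟩ | ⟨rfl, h₃, h₄, rfl⟩
    · obtain ⟨q, hq, g₁, g₂, g₃⟩ := i₄ I h₃ h₁
      obtain ⟨g₄, g₅⟩ := j₃ q g₂
      exact ⟨q, hq, g₁, g₄, g₅.trans g₃⟩
    · obtain ⟨g₁, g₂⟩ := j₄ h₃ h₄
      have hlu := hok.lv_le u
      refine ⟨s.wa 3 u, ?_, (covers_of_lt (by omega)).2 rfl, g₁, g₂⟩
      rw [Nat.succ_mul]
      omega
  · simp [v6, v7] at hb
    rw [va, vr]
    refine ⟨by simp, hs, hc.succ ?_⟩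
    intro I κ hTI
    obtain ⟨k, h₁, ⟨h₂, h₃⟩, -⟩ := (hTa I κ).1 hTI
    have := hb h₂
    rcases h₃ with h₃ | h₃ <;> omega

/-- Enters all arcs into the table. -/
def enterArcs : Program :=
  .seq (.wset 4 (.const 0)) <|
  .loop (.wlt (.var 4) (.var 101)) <|
    .seq enterArc (.wset 4 (.add (.var 4) (.const 1)))

theorem wp_enterArcs {W n M : ℕ} {T : ℕ → ℕ → ℝ → Prop} {s : State} (hok : TableOk n M s)
    (hn : 1 ≤ n) (hT : s.crossArc = T) (hcell : ∀ q, s.wa 11 q = 0) (hM' : s.wv 101 = M) (hM : M ≤ W)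
    (hW : n * (n + 1) ≤ W) :
    enterArcs.wp W (fun k s' => k ≤ 400 * (M + 1) ∧ CellsSound T M (n + 1) (s'.wa 11) (s'.ra 2) ∧
      CellsComplete T (n + 1) M ((Nat.log 2 n + 1) * (n + 1)) (s'.wa 11) (s'.ra 2)) s := by
  refine ⟨Nat.zero_le _, ?_⟩
  refine Program.wp_loop (fun t => t.wv 4 ≤ M ∧ CellsSound T M (n + 1) (t.wa 11) (t.ra 2) ∧
      CellsComplete T (n + 1) (t.wv 4) ((Nat.log 2 n + 1) * (n + 1)) (t.wa 11) (t.ra 2))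
    (fun t => 400 * (M - t.wv 4)) ?_ ?_ ?_ ?_
  · refine ⟨by simp, fun q I hq => ?_, fun a ha => ?_⟩
    · simp [hcell] at hq
    · simp at ha
  · intros; simp
  · rintro t hF - ⟨h₁, h₂, h₃⟩ hb
    have e101 : t.wv 101 = M := (hF.wv 101 (by decide)).trans (by simp [hM'])
    simp [e101] at hb
    have a12 : t.wa 12 = s.wa 12 := (hF.wa 12 (by decide)).trans (by simp)
    have a13 : t.wa 13 = s.wa 13 := (hF.wa 13 (by decide)).trans (by simp)
    have a3 : t.wa 3 = s.wa 3 := (hF.wa 3 (by decide)).trans (by simp)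
    have hTt : t.crossArc = T := by
      rw [← hT, State.crossArc, State.crossArc, a3, hF.wa 100 (by decide), hF.wa 101 (by decide),
        hF.ra 100 (by decide), hF.ra 101 (by decide), hF.wa 10 (by decide), hF.wa 6 (by decide),
        hF.ra 201 (by decide)]
      simp
    refine Program.wp_seq (Program.wp_mono (Program.wp_frame (wp_enterArc (n := n) (M := M) (T := T)
      ⟨(hF.wv 0 (by decide)).trans (by simp [hok.n_eq]), by rw [a12]; exact hok.log,
        by rw [a13]; exact hok.pow, by rw [a3]; exact hok.lv_le⟩ hn hTt h₂ h₃ hb hM hW)) ?_)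
    rintro k₁ s₁ ⟨⟨i₁, i₂, i₃⟩, hF₁⟩
    have w4 : s₁.wv 4 = t.wv 4 := hF₁.wv 4 (by decide)
    simp [Program.wp, w4]
    exact ⟨by omega, ⟨by omega, i₂, i₃⟩, by omega⟩
  · rintro k t hF - ⟨h₁, h₂, h₃⟩ hb hk
    have e101 : t.wv 101 = M := (hF.wv 101 (by decide)).trans (by simp [hM'])
    simp [e101] at hb hk
    have : t.wv 4 = M := by omega
    rw [this] at h₃
    refine ⟨by simp; omega, h₂, h₃⟩

/-- Pushes the contents of the rows of the table down to the first row. -/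
def pushCells : Program :=
  .seq (.wset 5 (.mul (.add (.arr 12 (.var 0)) (.const 1)) (.add (.var 0) (.const 1)))) <|
  .loop (.wlt (.add (.var 0) (.const 1)) (.var 5)) <|
    .seq (.wset 5 (.sub (.var 5) (.const 1))) <|
    .ite (.weq (.arr 11 (.var 5)) (.const 0)) .skip <|
      .seq (.wset 4 (.sub (.arr 11 (.var 5)) (.const 1))) <|
      .seq (.rset 0 (.arr 2 (.var 5))) <|
      .seq (.wset 9 (.sub (.var 5) (.add (.var 0) (.const 1)))) <|
      .seq improveCell <|
      .seq (.wset 9 (.add (.var 9)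
        (.arr 13 (.sub (.div (.var 5) (.add (.var 0) (.const 1))) (.const 1)))))
      improveCell

/-- An interval of length `2 ^ (j + 1)` is the union of two of length `2 ^ j`, so a cell can hand
its arc to two cells of the row below. Going from the last cell to the first, a cell is final when
it is pushed; the cells before it suffice from then on. -/
theorem wp_pushCells {W n M : ℕ} {T : ℕ → ℕ → ℝ → Prop} {s : State} (hok : TableOk n M s)
    (hn : 1 ≤ n) (hTn : ∀ a I κ, T a I κ → I ≤ n)
    (hs : CellsSound T M (n + 1) (s.wa 11) (s.ra 2))
    (hc : CellsComplete T (n + 1) M ((Nat.log 2 n + 1) * (n + 1)) (s.wa 11) (s.ra 2))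
    (hM : M ≤ W) (hW : n * (n + 1) ≤ W) :
    pushCells.wp W (fun k s' => k ≤ 200 * ((Nat.log 2 n + 1) * (n + 1)) ∧
      CellsSound T M (n + 1) (s'.wa 11) (s'.ra 2) ∧
      CellsComplete T (n + 1) M (n + 1) (s'.wa 11) (s'.ra 2)) s := by
  have hrow := row_le hn le_rfl
  have hn1 := row_le hn (Nat.zero_le _)
  have h12 : s.wa 12 n = Nat.log 2 n := hok.log n hn le_rfl
  have hlog : Nat.log 2 n < n := Nat.log_lt_self 2 (by omega)
  obtain ⟨Q₀, hQ₀⟩ : ∃ Q, (Nat.log 2 n + 1) * (n + 1) = Q := ⟨_, rfl⟩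
  have hQ₀' : Q₀ = Nat.log 2 n * (n + 1) + n + 1 := by rw [← hQ₀]; ring
  refine Program.wp_seq ⟨by simp [hok.n_eq, h12]; refine ⟨by omega, by omega, by rw [hQ₀]; omega⟩, ?_⟩
  have hev : WExp.eval s (.mul (.add (.arr 12 (.var 0)) (.const 1)) (.add (.var 0) (.const 1))) = Q₀ := by
    simp [hok.n_eq, h12, hQ₀]
  rw [hev]
  rw [hQ₀] at hc ⊢
  refine Program.wp_loop (fun t => n + 1 ≤ t.wv 5 ∧ t.wv 5 ≤ Q₀ ∧
      CellsSound T M (n + 1) (t.wa 11) (t.ra 2) ∧ CellsComplete T (n + 1) M (t.wv 5) (t.wa 11) (t.ra 2))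
    (fun t => 150 * (t.wv 5 - (n + 1))) ?_ ?_ ?_ ?_
  · refine ⟨by simp; omega, by simp, by simpa using hs, by simpa using hc⟩
  · intro t hF _ _
    have e0 : t.wv 0 = n := (hF.wv 0 (by decide)).trans (by simp [hok.n_eq])
    simp [e0]
    omega
  · rintro t hF - ⟨h₁, h₂, h₃, h₄⟩ hb
    have e0 : t.wv 0 = n := (hF.wv 0 (by decide)).trans (by simp [hok.n_eq])
    have a13 : t.wa 13 = s.wa 13 := (hF.wa 13 (by decide)).trans (by simp)
    simp [e0] at hb
    obtain ⟨q, hq⟩ : ∃ q, t.wv 5 = q + 1 := ⟨t.wv 5 - 1, by omega⟩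
    rw [hq] at hb h₂ h₄
    refine ⟨by simp; omega, ?_⟩
    have hev' : WExp.eval t (.sub (.var 5) (.const 1)) = q := by simp [hq]
    rw [hev']
    refine ⟨by simp, fun hz => ?_, fun hz => ?_⟩
    · have hz' : t.wa 11 q = 0 := by simpa using hz
      refine ⟨⟨by simp; omega, by simp; omega, by simpa using h₃, ?_⟩, by simp [hq]; omega⟩
      intro a ha I κ hT
      obtain ⟨q', hq', g₁, g₂, g₃⟩ := h₄ a ha I κ hT
      have : q' ≠ q := by rintro rfl; exact g₂ hz'
      exact ⟨q', by simp; omega, g₁, g₂, g₃⟩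
    · have hz' : t.wa 11 q ≠ 0 := by simpa using hz
      obtain ⟨j, hj⟩ : ∃ j, q / (n + 1) = j + 1 :=
        ⟨q / (n + 1) - 1, by have := Nat.div_pos (show n + 1 ≤ q by omega) (by omega); omega⟩
      obtain ⟨p, hp⟩ : ∃ p, q % (n + 1) = p := ⟨_, rfl⟩
      have hpn : p < n + 1 := by rw [← hp]; exact Nat.mod_lt _ (by omega)
      have hqe : q = (j + 1) * (n + 1) + p := by
        have := Nat.div_add_mod q (n + 1)
        rw [hj, hp] at this
        rw [← this, mul_comm]
      have hqe' : q = j * (n + 1) + (n + 1) + p := by rw [hqe, Nat.succ_mul]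
      have hjn : j + 1 ≤ Nat.log 2 n := by
        have : q / (n + 1) < Nat.log 2 n + 1 := Nat.div_lt_of_lt_mul (by rw [mul_comm, hQ₀]; omega)
        omega
      have hcov : ∀ I, Covers (n + 1) q I ↔ p ≤ I ∧ I < p + 2 ^ (j + 1) := by
        intro I
        rw [hqe]
        exact covers_iff hpn
      have hpow2 : 2 ^ (j + 1) = 2 ^ j + 2 ^ j := by rw [pow_succ]; ring
      have hpos : 0 < 2 ^ j := by positivity
      have hsq := fun I hI => h₃ q I hz' ((hcov I).2 hI)
      -- The arc in the cell crosses the last level of its interval, which is therefore at most `n`;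
      -- so the column of the second half stays in the row.
      have hlast : p + 2 ^ (j + 1) ≤ n + 1 := by
        have := hTn _ _ _ (hsq (p + 2 ^ (j + 1) - 1) ⟨by omega, by omega⟩).2
        omega
      have hcell : t.wa 11 q - 1 < M := (hsq p ⟨le_rfl, by omega⟩).1
      have h13 : t.wa 13 j = 2 ^ j := by rw [a13]; exact hok.pow j (by omega)
      have hc₁ : ∀ I, Covers (n + 1) (j * (n + 1) + p) I ↔ p ≤ I ∧ I < p + 2 ^ j :=
        fun I => covers_iff hpn
      have hc₂ : ∀ I, Covers (n + 1) (j * (n + 1) + (p + 2 ^ j)) I ↔ p + 2 ^ j ≤ I ∧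
          I < p + 2 ^ j + 2 ^ j := fun I => covers_iff (by omega)
      simp only [Program.wp]
      simp [e0]
      have hq₁ : q - (n + 1) = j * (n + 1) + p := by omega
      rw [hq₁]
      refine ⟨by omega, ⟨by omega, by omega⟩, ?_⟩
      refine Program.wp_mono (Program.wp_frame (wp_improveCell (T := T) (M := M) (w := n + 1)
        (by simpa using h₃) (by simpa using hcell) ?_ hM)) ?_
      · intro I hI
        simp [hc₁] at hI
        simpa using (hsq I ⟨by omega, by omega⟩).2
      rintro k₁ s₁ ⟨⟨i₁, i₂, i₃, i₄, i₅⟩, hF₁⟩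
      have w0 : s₁.wv 0 = n := (hF₁.wv 0 (by decide)).trans (by simp [e0])
      have w4 : s₁.wv 4 = t.wa 11 q - 1 := (hF₁.wv 4 (by decide)).trans (by simp)
      have w5 : s₁.wv 5 = q := (hF₁.wv 5 (by decide)).trans (by simp)
      have w9 : s₁.wv 9 = j * (n + 1) + p := (hF₁.wv 9 (by decide)).trans (by simp)
      have b13 : s₁.wa 13 = t.wa 13 := (hF₁.wa 13 (by decide)).trans (by simp)
      have r0 : s₁.rv 0 = t.ra 2 q := (hF₁.rv 0 (by decide)).trans (by simp)
      simp at i₃ i₄ i₅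
      simp [w0, w5, w9, b13, hj, h13]
      rw [add_assoc (j * (n + 1)) p (2 ^ j)]
      refine ⟨⟨by omega, by omega⟩, ?_⟩
      refine Program.wp_mono (Program.wp_frame (wp_improveCell (T := T) (M := M) (w := n + 1)
        (by simpa using i₂) (by simpa [w4] using hcell) ?_ hM)) ?_
      · intro I hI
        simp [hc₂] at hI
        simpa [w4, r0] using (hsq I ⟨by omega, by omega⟩).2
      rintro k₂ s₂ ⟨⟨j₁, j₂, j₃, j₄, j₅⟩, hF₂⟩
      have x5 : s₂.wv 5 = q := (hF₂.wv 5 (by decide)).trans (by simp [w5])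
      simp [r0] at j₃ j₄ j₅
      have himp := CellsImprove.trans i₃ j₃
      refine ⟨⟨by omega, by omega, j₂, ?_⟩, by omega⟩
      intro a ha I κ hT
      obtain ⟨q', hq', g₁, g₂, g₃⟩ := h₄ a ha I κ hT
      rw [x5]
      by_cases hqq : q' = q
      · rw [hqq] at g₁ g₃
        obtain ⟨g₄, g₅⟩ := (hcov I).1 g₁
        by_cases hI : I < p + 2 ^ j
        · obtain ⟨g₆, g₇⟩ := j₃ _ i₄
          exact ⟨j * (n + 1) + p, by omega, (hc₁ I).2 ⟨g₄, hI⟩, g₆, (g₇.trans i₅).trans g₃⟩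
        · exact ⟨j * (n + 1) + (p + 2 ^ j), by omega, (hc₂ I).2 ⟨by omega, by omega⟩, j₄, j₅.trans g₃⟩
      · obtain ⟨g₄, g₅⟩ := himp q' g₂
        exact ⟨q', by omega, g₁, g₄, g₅.trans g₃⟩
  · rintro k t hF - ⟨h₁, h₂, h₃, h₄⟩ hb hk
    have e0 : t.wv 0 = n := (hF.wv 0 (by decide)).trans (by simp [hok.n_eq])
    simp [e0] at hb hk
    have : t.wv 5 = n + 1 := by omega
    rw [this] at h₄
    refine ⟨by simp; omega, h₃, h₄⟩

end RealRAM

/-! ### The steps of the preprocessing -/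

theorem PathMarked.step {n i : ℕ} {P onP par : ℕ → ℕ} (h : PathMarked n P i onP par)
    (hi : ∀ j < i, P j ≠ P i) :
    PathMarked n P (i + 1) (Function.update onP (P i) (i + 1))
      (Function.update par (P i) (if i = 0 then n + 1 else P (i - 1) + 1)) := by
  refine ⟨fun j hj => ?_, fun v hv => ?_⟩
  · rcases Nat.lt_succ_iff_lt_or_eq.1 hj with hj | rfl
    · simp only [Function.update_of_ne (hi j hj)]
      exact h.mark j hj
    · simp
  · rw [Function.update_of_ne (hv i (Nat.lt_succ_self i)).symm]
    exact h.rest v fun j hj => hv j (by omega)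

/-! ### Programs for the arcs, the tree and the ends of the cells. -/

namespace RealRAM

/-- Lists both orientations of every edge. -/
def makeArcs : Program :=
  .seq (.wset 4 (.const 0)) <|
  .seq (.loop (.wlt (.var 4) (.var 1)) <|
    .seq (.wstore 100 (.var 4) (.arr 0 (.var 4))) <|
    .seq (.wstore 101 (.var 4) (.arr 1 (.var 4))) <|
    .seq (.rstore 100 (.var 4) (.arr 0 (.var 4))) <|
    .seq (.wstore 100 (.add (.var 1) (.var 4)) (.arr 1 (.var 4))) <|
    .seq (.wstore 101 (.add (.var 1) (.var 4)) (.arr 0 (.var 4))) <|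
    .seq (.rstore 100 (.add (.var 1) (.var 4)) (.arr 0 (.var 4))) <|
    .wset 4 (.add (.var 4) (.const 1))) <|
  .seq (.wset 100 (.var 0)) <|
  .seq (.wset 101 (.add (.var 1) (.var 1))) <|
  .wset 102 (.var 2)

theorem wp_makeArcs {W : ℕ} {s : State} (hW : 2 * s.wv 1 + 2 ≤ W) :
    makeArcs.wp W (fun k s' => k ≤ 100 * (s.wv 1 + 1) ∧ s'.wv 100 = s.wv 0 ∧
      s'.wv 101 = 2 * s.wv 1 ∧ s'.wv 102 = s.wv 2 ∧
      ∀ e < s.wv 1, s'.wa 100 e = s.wa 0 e ∧ s'.wa 101 e = s.wa 1 e ∧ s'.ra 100 e = s.ra 0 e ∧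
        s'.wa 100 (s.wv 1 + e) = s.wa 1 e ∧ s'.wa 101 (s.wv 1 + e) = s.wa 0 e ∧
        s'.ra 100 (s.wv 1 + e) = s.ra 0 e) s := by
  refine ⟨Nat.zero_le _, Program.wp_seq ?_⟩
  refine Program.wp_loop (fun t => t.wv 4 ≤ s.wv 1 ∧
      ∀ e < t.wv 4, t.wa 100 e = s.wa 0 e ∧ t.wa 101 e = s.wa 1 e ∧ t.ra 100 e = s.ra 0 e ∧
        t.wa 100 (s.wv 1 + e) = s.wa 1 e ∧ t.wa 101 (s.wv 1 + e) = s.wa 0 e ∧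
        t.ra 100 (s.wv 1 + e) = s.ra 0 e)
    (fun t => 60 * (s.wv 1 - t.wv 4)) (by simp) ?_ ?_ ?_
  · intros; simp
  · rintro t hF - ⟨h₁, h₂⟩ hb
    have e1 : t.wv 1 = s.wv 1 := (hF.wv 1 (by decide)).trans (by simp)
    have a0 : t.wa 0 = s.wa 0 := (hF.wa 0 (by decide)).trans (by simp)
    have a1 : t.wa 1 = s.wa 1 := (hF.wa 1 (by decide)).trans (by simp)
    have r0 : t.ra 0 = s.ra 0 := (hF.ra 0 (by decide)).trans (by simp)
    simp [e1] at hb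
    simp [Program.wp, e1, a0, a1, r0]
    refine ⟨by omega, by omega, ⟨by omega, fun e he => ?_⟩, by omega⟩
    by_cases het : e = t.wv 4
    · subst het
      have : t.wv 4 ≠ s.wv 1 + t.wv 4 := by omega
      simp [Function.update_of_ne this]
    · have g₁ : e ≠ s.wv 1 + t.wv 4 := by omega
      have g₂ : s.wv 1 + e ≠ t.wv 4 := by omega
      have g₃ : s.wv 1 + e ≠ s.wv 1 + t.wv 4 := by omega
      simp only [Function.update_of_ne het, Function.update_of_ne g₁, Function.update_of_ne g₂,
        Function.update_of_ne g₃]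
      exact h₂ e (by omega)
  · rintro k t hF - ⟨h₁, h₂⟩ hb hk
    have e0 : t.wv 0 = s.wv 0 := (hF.wv 0 (by decide)).trans (by simp)
    have e1 : t.wv 1 = s.wv 1 := (hF.wv 1 (by decide)).trans (by simp)
    have e2 : t.wv 2 = s.wv 2 := (hF.wv 2 (by decide)).trans (by simp)
    simp [e1] at hb hk
    have : t.wv 4 = s.wv 1 := by omega
    rw [this] at h₂
    simp [Program.wp, e0, e1, e2]
    exact ⟨by omega, by omega, by omega, h₂⟩

/-- Marks the vertices of the path and sets their parents. -/
def markPath : Program :=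
  .seq (.wset 4 (.const 0)) <|
  .seq (.wset 5 (.add (.var 0) (.const 1))) <|
  .loop (.wlt (.var 4) (.var 3)) <|
    .seq (.wset 6 (.arr 2 (.var 4))) <|
    .seq (.wstore 10 (.var 6) (.add (.var 4) (.const 1))) <|
    .seq (.wstore 4 (.var 6) (.var 5)) <|
    .seq (.wset 5 (.add (.var 6) (.const 1))) <|
    .wset 4 (.add (.var 4) (.const 1))

theorem wp_markPath {W : ℕ} {s : State} (h0 : ∀ v, s.wa 10 v = 0)
    (hinj : ∀ i < s.wv 3, ∀ j < s.wv 3, s.wa 2 i = s.wa 2 j → i = j)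
    (hlt : ∀ i < s.wv 3, s.wa 2 i < W) (hW : s.wv 0 < W) (hW' : s.wv 3 < W) :
    markPath.wp W (fun k s' => k ≤ 50 * (s.wv 3 + 1) ∧
      PathMarked (s.wv 0) (s.wa 2) (s.wv 3) (s'.wa 10) (s'.wa 4)) s := by
  refine ⟨Nat.zero_le _, by simp; omega, ?_⟩
  refine Program.wp_loop (fun t => t.wv 4 ≤ s.wv 3 ∧
      PathMarked (s.wv 0) (s.wa 2) (t.wv 4) (t.wa 10) (t.wa 4) ∧
      t.wv 5 = if t.wv 4 = 0 then s.wv 0 + 1 else s.wa 2 (t.wv 4 - 1) + 1)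
    (fun t => 40 * (s.wv 3 - t.wv 4)) ?_ ?_ ?_ ?_
  · refine ⟨by simp, ⟨by simp, by simpa using h0⟩, by simp⟩
  · intros; simp
  · rintro t hF - ⟨h₁, h₂, h₃⟩ hb
    have e3 : t.wv 3 = s.wv 3 := (hF.wv 3 (by decide)).trans (by simp)
    have a2 : t.wa 2 = s.wa 2 := (hF.wa 2 (by decide)).trans (by simp)
    simp [e3] at hb
    have := hlt _ hb
    have hstep := h₂.step fun j hj he => hj.ne (hinj j (by omega) _ hb he)
    rw [← h₃] at hstep
    simp [Program.wp, a2]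
    exact ⟨by omega, by omega, by omega, ⟨by omega, hstep⟩, by omega⟩
  · rintro k t hF - ⟨h₁, h₂, h₃⟩ hb hk
    have e3 : t.wv 3 = s.wv 3 := (hF.wv 3 (by decide)).trans (by simp)
    simp [e3] at hb hk
    have : t.wv 4 = s.wv 3 := by omega
    rw [this] at h₂
    exact ⟨by simp; omega, h₂⟩

/-- Computes parents, levels and depths in the order of the distances. -/
def makeLevels : Program :=
  .seq (.wset 4 (.const 0)) <|
  .loop (.wlt (.var 4) (.var 107)) <|
    .seq (.wset 6 (.arr 107 (.var 4))) <|
    .seq (.ite (.weq (.arr 10 (.var 6)) (.const 0))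
      (.seq (.wstore 4 (.var 6) (.add (.arr 100 (.sub (.arr 106 (.var 6)) (.const 1))) (.const 1)))
        (.wstore 3 (.var 6) (.arr 3 (.sub (.arr 4 (.var 6)) (.const 1)))))
      (.wstore 3 (.var 6) (.arr 10 (.var 6)))) <|
    .seq (.wstore 5 (.var 6) (.add (.arr 5 (.sub (.arr 4 (.var 6)) (.const 1))) (.const 1))) <|
    .wset 4 (.add (.var 4) (.const 1))

theorem wp_makeLevels {W : ℕ} {π : ℕ → ℕ} {s : State}
    (hπ : treeParent (s.wa 10) (s.wa 4) (s.wa 100) (s.wa 106) = π)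
    (h3 : ∀ v, s.wa 3 v = 0) (h5 : ∀ v, s.wa 5 v = 0) (hle : ∀ j < s.wv 107, π (s.wa 107 j) ≤ W)
    (hprev : ∀ j < s.wv 107, (∀ j' < s.wv 107, s.wa 107 j' ≠ π (s.wa 107 j) - 1) ∨
      ∃ j' < j, s.wa 107 j' = π (s.wa 107 j) - 1) (hW : s.wv 107 < W) :
    makeLevels.wp W (fun k s' => k ≤ 70 * (s.wv 107 + 1) ∧
      Levelled π (s.wa 10) (s.wa 107) (s.wv 107) (s.wa 4) (s'.wa 4) (s'.wa 3) (s'.wa 5)) s := by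
  refine ⟨Nat.zero_le _, ?_⟩
  refine Program.wp_loop (fun t => t.wv 4 ≤ s.wv 107 ∧
      Levelled π (s.wa 10) (s.wa 107) (t.wv 4) (s.wa 4) (t.wa 4) (t.wa 3) (t.wa 5) ∧
      ∀ v, t.wa 5 v ≤ t.wv 4)
    (fun t => 60 * (s.wv 107 - t.wv 4)) ?_ ?_ ?_ ?_
  · refine ⟨by simp, ⟨by simp, ?_⟩, by simp [h5]⟩
    simp [h3, h5]
  · intros; simp
  · rintro t hF - ⟨h₁, h₂, h₃⟩ hb
    have e107 : t.wv 107 = s.wv 107 := (hF.wv 107 (by decide)).trans (by simp)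
    have a10 : t.wa 10 = s.wa 10 := (hF.wa 10 (by decide)).trans (by simp)
    have a100 : t.wa 100 = s.wa 100 := (hF.wa 100 (by decide)).trans (by simp)
    have a106 : t.wa 106 = s.wa 106 := (hF.wa 106 (by decide)).trans (by simp)
    have a107 : t.wa 107 = s.wa 107 := (hF.wa 107 (by decide)).trans (by simp)
    simp [e107] at hb
    obtain ⟨x, hx⟩ : ∃ x, s.wa 107 (t.wv 4) = x := ⟨_, rfl⟩
    have hπx := hle _ hb
    rw [hx] at hπx
    have hstep := h₂.step hx fun j hj => by
      rcases hprev j (by omega) with h | h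
      · exact Or.inl fun j' hj' => h j' (by omega)
      · exact Or.inr h
    have hdep := h₃ (π x - 1)
    have hdep' : ∀ v, Function.update (t.wa 5) x (t.wa 5 (π x - 1) + 1) v ≤ t.wv 4 + 1 := by
      intro v
      rw [Function.update_apply]
      split_ifs
      · omega
      · have := h₃ v; omega
    simp [Program.wp, a10, a100, a106, a107, hx]
    refine ⟨fun hx0 => ?_, fun hx0 => ?_⟩
    · have hp : s.wa 100 (s.wa 106 x - 1) + 1 = π x := by rw [← hπ]; simp [treeParent, hx0]
      rw [if_pos hx0] at hstep
      have hp' : s.wa 100 (s.wa 106 x - 1) = π x - 1 := by omega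
      rw [hp, hp']
      exact ⟨by omega, by omega, by omega, by omega, ⟨by omega, hstep, hdep'⟩, by omega⟩
    -- A vertex of the path got its parent when the path was marked, and that parent is the one
    -- prescribed by `π`.
    · have hp : t.wa 4 x = π x := by
        by_cases hold : ∃ j < t.wv 4, s.wa 107 j = x
        · obtain ⟨j, hj, hjx⟩ := hold
          have := (h₂.done j hj).1
          rwa [hjx] at this
        · push Not at hold
          rw [(h₂.rest x hold).1, ← hπ]
          simp [treeParent, hx0]
      rw [if_neg hx0, ← hp, Function.update_eq_self, hp] at hstep
      rw [hp]
      exact ⟨by omega, by omega, ⟨by omega, hstep, hdep'⟩, by omega⟩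
  · rintro k t hF - ⟨h₁, h₂, h₃⟩ hb hk
    have e107 : t.wv 107 = s.wv 107 := (hF.wv 107 (by decide)).trans (by simp)
    simp [e107] at hb hk
    have : t.wv 4 = s.wv 107 := by omega
    rw [this] at h₂
    exact ⟨by simp; omega, h₂⟩

/-- The ends of the arcs in the cells. -/
def cellEnds : Program :=
  .seq (.wset 4 (.const 0)) <|
  .loop (.wlt (.var 4) (.add (.var 0) (.const 1))) <|
    .seq (.ite (.weq (.arr 11 (.var 4)) (.const 0)) .skip
      (.seq (.wstore 8 (.var 4) (.add (.arr 100 (.sub (.arr 11 (.var 4)) (.const 1))) (.const 1)))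
        (.wstore 9 (.var 4) (.add (.arr 101 (.sub (.arr 11 (.var 4)) (.const 1))) (.const 1))))) <|
    .wset 4 (.add (.var 4) (.const 1))

theorem wp_cellEnds {W : ℕ} {s : State} (h9 : ∀ I, s.wa 9 I = 0)
    (hlt : ∀ I ≤ s.wv 0, s.wa 11 I ≠ 0 → s.wa 100 (s.wa 11 I - 1) < W ∧ s.wa 101 (s.wa 11 I - 1) < W)
    (hW : s.wv 0 + 1 < W) :
    cellEnds.wp W (fun k s' => k ≤ 60 * (s.wv 0 + 2) ∧
      ∀ I, (I ≤ s.wv 0 ∧ s.wa 11 I ≠ 0 ∧ s'.wa 8 I = s.wa 100 (s.wa 11 I - 1) + 1 ∧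
        s'.wa 9 I = s.wa 101 (s.wa 11 I - 1) + 1) ∨
        ((I ≤ s.wv 0 → s.wa 11 I = 0) ∧ s'.wa 9 I = 0)) s := by
  refine ⟨Nat.zero_le _, ?_⟩
  refine Program.wp_loop (fun t => t.wv 4 ≤ s.wv 0 + 1 ∧
      ∀ I, (I < t.wv 4 ∧ s.wa 11 I ≠ 0 ∧ t.wa 8 I = s.wa 100 (s.wa 11 I - 1) + 1 ∧
        t.wa 9 I = s.wa 101 (s.wa 11 I - 1) + 1) ∨
        ((I < t.wv 4 → s.wa 11 I = 0) ∧ t.wa 9 I = 0))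
    (fun t => 50 * (s.wv 0 + 1 - t.wv 4)) ?_ ?_ ?_ ?_
  · simp [h9]
  · intro t hF _ _
    have e0 : t.wv 0 = s.wv 0 := (hF.wv 0 (by decide)).trans (by simp)
    simp [e0]
    omega
  · rintro t hF - ⟨h₁, h₂⟩ hb
    have e0 : t.wv 0 = s.wv 0 := (hF.wv 0 (by decide)).trans (by simp)
    have a11 : t.wa 11 = s.wa 11 := (hF.wa 11 (by decide)).trans (by simp)
    have a100 : t.wa 100 = s.wa 100 := (hF.wa 100 (by decide)).trans (by simp)
    have a101 : t.wa 101 = s.wa 101 := (hF.wa 101 (by decide)).trans (by simp)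
    simp [e0] at hb
    refine Program.wp_seq ⟨by simp, fun hz => ?_, fun hz => ?_⟩
    · have hz' : s.wa 11 (t.wv 4) = 0 := by simpa [a11] using hz
      refine ⟨by simp; omega, ⟨by simp; omega, ?_⟩, by simp; omega⟩
      intro I
      simp
      rcases h₂ I with h | h
      · exact Or.inl ⟨by omega, h.2⟩
      · refine Or.inr ⟨fun hI => ?_, h.2⟩
        by_cases hI' : I = t.wv 4
        · rw [hI']; exact hz'
        · exact h.1 (by omega)
    · have hz' : s.wa 11 (t.wv 4) ≠ 0 := by simpa [a11] using hz
      have := hlt (t.wv 4) (by omega) hz'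
      simp [Program.wp, a11, a100, a101]
      refine ⟨by omega, by omega, by omega, ⟨by omega, fun I => ?_⟩, by omega⟩
      by_cases hI' : I = t.wv 4
      · left
        rw [hI']
        simpa using hz'
      · simp only [Function.update_of_ne hI']
        rcases h₂ I with h | h
        · exact Or.inl ⟨by omega, h.2⟩
        · exact Or.inr ⟨fun hI => h.1 (by omega), h.2⟩
  · rintro k t hF - ⟨h₁, h₂⟩ hb hk
    have e0 : t.wv 0 = s.wv 0 := (hF.wv 0 (by decide)).trans (by simp)
    simp [e0] at hb hk
    have : t.wv 4 = s.wv 0 + 1 := by omega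
    rw [this] at h₂
    refine ⟨by simp; omega, fun I => ?_⟩
    rcases h₂ I with h | h
    · exact Or.inl ⟨by omega, h.2⟩
    · exact Or.inr ⟨fun hI => h.1 (by omega), h.2⟩

end RealRAM

/-! ### Programs for the detour graph. -/

namespace RealRAM

/-- Appends an arc from the vertex in variable 8, of the length in the real variable 0, to the target
of the arc in variable 4. -/
def emitArc (o : ℕ) : Program :=
  .seq (.wstore o (.var (o + 1)) (.var 8)) <|
  .seq (.wstore (o + 1) (.var (o + 1)) (.arr 101 (.var 4))) <|
  .seq (.rstore o (.var (o + 1)) (.var 0)) <|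
  .seq (.wstore (o + 14) (.var (o + 1)) (.arr 100 (.var 4))) <|
  .wset (o + 1) (.add (.var (o + 1)) (.const 1))

/-- The distance of the origin of the arc in variable 4 plus the length of the arc. -/
def arcCost : RExp := .add (.arr 101 (.arr 100 (.var 4))) (.arr 100 (.var 4))

/-- Appends what the arc in variable 4 contributes to the detour graph. -/
def emitStep (o : ℕ) : Program :=
  .seq (.wset 6 (.arr 3 (.arr 100 (.var 4)))) <|
  .seq (.wset 7 (.arr 3 (.arr 101 (.var 4)))) <|
  .seq (.wset 8 (.var 0)) <|
  .ite (.or (.weq (.var 6) (.const 0)) (.neg (.weq (.arr 10 (.arr 101 (.var 4))) (.const 0))))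
    .skip <|
  .ite (.wlt (.var 6) (.var 7)) (.seq (.rset 0 arcCost) (emitArc o)) <|
  .ite (.weq (.var 6) (.var 7))
    (.ite (.weq (.arr 10 (.arr 100 (.var 4))) (.const 0))
      (.seq (.wset 8 (.arr 100 (.var 4))) (.seq (.rset 0 (.arr 100 (.var 4))) (emitArc o)))
      .skip) <|
  .ite (.weq (.arr 9 (.var 7)) (.const 0)) .skip <|
    -- Levels count from 1 and positions on the path from 0, so array 2 holds at the index `lv v`
    -- the vertex of the path on level `lv v + 1`. Its distance is subtracted twice for want of a
    -- multiplication of reals.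
    .seq (.rset 0 (.add (.sub (.sub (.arr 2 (.var 7)) (.arr 101 (.arr 2 (.var 7))))
      (.arr 101 (.arr 2 (.var 7)))) arcCost)) (emitArc o)

/-- The detour graph, with the arrays at `o`. -/
def emit (o : ℕ) : Program :=
  .seq (.wset 4 (.const 0)) <|
  .seq (.wset (o + 1) (.const 0)) <|
  .seq (.loop (.wlt (.var 4) (.var 101)) <|
    .seq (emitStep o) (.wset 4 (.add (.var 4) (.const 1)))) <|
  .seq (.wset o (.add (.var 0) (.const 1))) <|
  .wset (o + 2) (.var 0)

/-- The arcs of the detour graph that an arc contributes, in a state. -/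
def State.detourArc (s : State) (a : ℕ) : ℕ → ℝ → Prop :=
  DetourArc (s.wv 0) (s.ra 101) (s.wa 3) (s.wa 10) (fun I => s.wa 2 (I - 1)) (s.wa 9) (s.ra 2)
    (s.wa 100 a) (s.wa 101 a) (s.ra 100 a)

/-- The arcs of the detour graph listed so far. -/
def State.Emits (s : State) (o : ℕ) (T : ℕ → ℕ → ℝ → Prop) (i : ℕ) : Prop :=
  Emitted T (s.wa 100) (s.wa 101) i (s.wa o) (s.wa (o + 1)) (s.wa (o + 14)) (s.ra o) (s.wv (o + 1))

theorem wp_emitArc {W o : ℕ} (ho : o = 200 ∨ o = 300) {s : State} {T : ℕ → ℕ → ℝ → Prop}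
    (hE : s.Emits o T (s.wv 4)) (hT : T (s.wv 4) (s.wv 8) (s.rv 0))
    (hT' : ∀ S c, T (s.wv 4) S c → S = s.wv 8 ∧ c = s.rv 0) (hW : s.wv 4 < W) :
    (emitArc o).wp W (fun k s' => k ≤ 20 ∧ s'.Emits o T (s.wv 4 + 1)) s := by
  have h := Emitted.push hE hT hT'
  have hle : s.wv (o + 1) ≤ s.wv 4 := hE.le
  rcases ho with rfl | rfl
  all_goals
    simp only [Nat.reduceAdd] at h hle
    simp [emitArc, Program.wp, State.Emits]
    exact ⟨by omega, h⟩

/-- The three kinds of detour arcs exclude each other by the order of the levels, so an arc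
contributes at most one; this is the uniqueness that `Emitted.push` requires. -/
theorem wp_emitStep {W o : ℕ} (ho : o = 200 ∨ o = 300) {s : State}
    (hE : s.Emits o s.detourArc (s.wv 4)) (hW : s.wv 4 < W) :
    (emitStep o).wp W (fun k s' => k ≤ 100 ∧ s'.Emits o s.detourArc (s.wv 4 + 1)) s := by
  obtain ⟨a, ha⟩ : ∃ a, s.wv 4 = a := ⟨_, rfl⟩
  obtain ⟨T, hT⟩ : ∃ T, s.detourArc = T := ⟨_, rfl⟩
  obtain ⟨u, hu⟩ : ∃ u, s.wa 100 a = u := ⟨_, rfl⟩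
  obtain ⟨v, hv⟩ : ∃ v, s.wa 101 a = v := ⟨_, rfl⟩
  have hTa : ∀ S c', T a S c' ↔ s.wa 3 u ≠ 0 ∧ s.wa 10 v = 0 ∧
    ((s.wa 3 u < s.wa 3 v ∧ S = s.wv 0 ∧ c' = s.ra 101 u + s.ra 100 a) ∨
      (s.wa 3 u = s.wa 3 v ∧ s.wa 10 u = 0 ∧ S = u ∧ c' = s.ra 100 a) ∨
      (s.wa 3 v < s.wa 3 u ∧ s.wa 9 (s.wa 3 v) ≠ 0 ∧ S = s.wv 0 ∧
        c' = s.ra 2 (s.wa 3 v) - s.ra 101 (s.wa 2 (s.wa 3 v)) - s.ra 101 (s.wa 2 (s.wa 3 v)) +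
          (s.ra 101 u + s.ra 100 a))) := by
    intro S c'
    rw [← hT, ← hu, ← hv]
    rfl
  rw [hT, ha] at hE ⊢
  rw [ha] at hW
  have hgo : ∀ (t : State) (S : ℕ) (c : ℝ) (K : ℕ), K ≤ 80 → t.wv 4 = a →
      t.Emits o T a → T a S c → t.wv 8 = S → t.rv 0 = c →
      (∀ S' c', T a S' c' → S' = S ∧ c' = c) →
      (emitArc o).wp W (fun k s' => K + k ≤ 100 ∧ s'.Emits o T (a + 1)) t := by
    rintro t S c K hK h4 hEt hTt rfl rfl huniq
    refine Program.wp_mono (wp_emitArc ho (T := T) (by rwa [h4]) (by rwa [h4]) (by rwa [h4])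
      (by omega)) ?_
    rintro k s' ⟨h₁, h₂⟩
    rw [h4] at h₂
    exact ⟨by omega, h₂⟩
  have hskip : ∀ t : State, t.Emits o T a → (∀ S c, ¬ T a S c) → t.Emits o T (a + 1) :=
    fun t h₁ h₂ => Emitted.skip h₁ h₂
  have hE' : ∀ x₆ x₇ x₈ : ℕ, (((s.setW 6 x₆).setW 7 x₇).setW 8 x₈).Emits o T a := by
    intro x₆ x₇ x₈
    rcases ho with rfl | rfl
    all_goals simpa [State.Emits] using hE
  have hE'' : ∀ (x₆ x₇ x₈ x₈' : ℕ) (c : ℝ),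
      (((((s.setW 6 x₆).setW 7 x₇).setW 8 x₈).setW 8 x₈').setR 0 c).Emits o T a := by
    intro x₆ x₇ x₈ x₈' c
    rcases ho with rfl | rfl
    all_goals simpa [State.Emits] using hE
  refine ⟨trivial, trivial, trivial, ?_⟩
  obtain ⟨t, ht⟩ : ∃ t, ((s.setW 6 (s.wa 3 u)).setW 7 (s.wa 3 v)).setW 8 (s.wv 0) = t := ⟨_, rfl⟩
  simp only [Program.wp, WExp.eval, State.setW_wv, State.setW_wa, ha, hu, hv, Nat.reduceEqDiff,
    if_false, ht]
  have v4 : t.wv 4 = a := by rw [← ht]; simp [ha]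
  have v6 : t.wv 6 = s.wa 3 u := by rw [← ht]; simp
  have v7 : t.wv 7 = s.wa 3 v := by rw [← ht]; simp
  have v8 : t.wv 8 = s.wv 0 := by rw [← ht]; simp
  have va : t.wa = s.wa := by rw [← ht]; simp
  have vr : t.ra = s.ra := by rw [← ht]; simp
  have hEt : t.Emits o T a := by rw [← ht]; exact hE' _ _ _
  have hEt' : ∀ c : ℝ, (t.setR 0 c).Emits o T a := by
    intro c
    have := hE'' (s.wa 3 u) (s.wa 3 v) (s.wv 0) (s.wv 0) c
    rcases ho with rfl | rfl
    all_goals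
      rw [← ht]
      simpa [State.Emits] using this
  have hEt'' : ∀ (x : ℕ) (c : ℝ), ((t.setW 8 x).setR 0 c).Emits o T a := by
    intro x c
    rw [← ht]
    exact hE'' _ _ _ _ _
  refine ⟨by simp, fun hb => ?_, fun hb => ?_⟩
  · simp [v6, v4, va, hv] at hb
    refine ⟨by simp, hskip t hEt fun S c hS => ?_⟩
    obtain ⟨h₁, h₂, -⟩ := (hTa S c).1 hS
    tauto
  simp [v6, v4, va, hv] at hb
  obtain ⟨hb₁, hb₂⟩ := hb
  refine ⟨by simp, fun hb => ?_, fun hb => ?_⟩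
  · simp [v6, v7] at hb
    refine ⟨by simp [arcCost], ?_⟩
    have hc : RExp.eval t arcCost = s.ra 101 u + s.ra 100 a := by simp [arcCost, v4, va, vr, hu]
    rw [hc]
    refine Program.wp_mono (hgo _ (s.wv 0) _ 50 (by norm_num) (by simpa using v4) (hEt' _)
      ((hTa _ _).2 ⟨hb₁, hb₂, Or.inl ⟨hb, rfl, rfl⟩⟩) (by simpa using v8) (by simp) ?_) ?_
    · intro S' c' hS
      obtain ⟨-, -, h | h | h⟩ := (hTa _ _).1 hS
      · exact h.2
      · omega
      · omega
    · rintro k s' ⟨h₁, h₂⟩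
      exact ⟨by simp [arcCost]; omega, h₂⟩
  simp [v6, v7] at hb
  refine ⟨by simp, fun hb' => ?_, fun hb' => ?_⟩
  · simp [v6, v7] at hb'
    refine ⟨by simp, fun hu0 => ?_, fun hu0 => ?_⟩
    · simp [v4, va, hu] at hu0
      refine ⟨by simp, by simp, ?_⟩
      have hc : t.wa 100 (t.wv 4) = u := by rw [v4, va, hu]
      rw [hc]
      refine Program.wp_mono (hgo _ u (s.ra 100 a) 60 (by norm_num) (by simpa using v4) (hEt'' _ _)
        ((hTa _ _).2 ⟨hb₁, hb₂, Or.inr (Or.inl ⟨hb', hu0, rfl, rfl⟩)⟩) (by simp)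
        (by simp [v4, vr]) ?_) ?_
      · intro S' c' hS
        obtain ⟨-, -, h | h | h⟩ := (hTa _ _).1 hS
        · omega
        · exact h.2.2
        · omega
      · rintro k s' ⟨h₁, h₂⟩
        exact ⟨by simp; omega, h₂⟩
    · simp [v4, va, hu] at hu0
      refine ⟨by simp, hskip t hEt fun S c hS => ?_⟩
      obtain ⟨-, -, h | h | h⟩ := (hTa _ _).1 hS
      · omega
      · exact hu0 h.2.1
      · omega
  simp [v6, v7] at hb'
  refine ⟨by simp, fun hz => ?_, fun hz => ?_⟩
  · simp [v7, va] at hz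
    refine ⟨by simp, hskip t hEt fun S c hS => ?_⟩
    obtain ⟨-, -, h | h | h⟩ := (hTa _ _).1 hS
    · omega
    · omega
    · exact h.2.1 hz
  · simp [v7, va] at hz
    refine ⟨by simp [arcCost], ?_⟩
    refine Program.wp_mono (hgo _ (s.wv 0) _ 70 (by norm_num) (by simpa using v4) (hEt' _)
      ((hTa _ _).2 ⟨hb₁, hb₂, Or.inr (Or.inr ⟨by omega, hz, rfl, rfl⟩)⟩) (by simpa using v8)
      (by simp [arcCost, v4, v7, va, vr, hu]) ?_) ?_
    · intro S' c' hS
      obtain ⟨-, -, h | h | h⟩ := (hTa _ _).1 hS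
      · omega
      · omega
      · exact h.2.2
    · rintro k s' ⟨h₁, h₂⟩
      exact ⟨by simp [arcCost]; omega, h₂⟩

theorem wp_emit {W o : ℕ} (ho : o = 200 ∨ o = 300) {s : State} (hM : s.wv 101 < W)
    (hW : s.wv 0 < W) :
    (emit o).wp W (fun k s' => k ≤ 150 * (s.wv 101 + 1) ∧ s'.wv o = s.wv 0 + 1 ∧
      s'.wv (o + 2) = s.wv 0 ∧ s'.Emits o s.detourArc (s.wv 101)) s := by
  obtain ⟨T, hT⟩ : ∃ T, s.detourArc = T := ⟨_, rfl⟩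
  rw [hT]
  refine ⟨Nat.zero_le _, Nat.zero_le _, Program.wp_seq ?_⟩
  refine Program.wp_loop (fun t => t.wv 4 ≤ s.wv 101 ∧ t.Emits o T (t.wv 4))
    (fun t => 120 * (s.wv 101 - t.wv 4)) ?_ ?_ ?_ ?_
  · rcases ho with rfl | rfl
    all_goals
      refine ⟨by simp, ⟨by simp, by simp, by simp⟩⟩
  · intros; simp
  · rintro t hF - ⟨h₁, h₂⟩ hb
    have hTt : t.detourArc = T ∧ t.wv 101 = s.wv 101 := by
      rw [← hT]
      rcases ho with rfl | rfl
      all_goals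
        unfold State.detourArc
        rw [hF.wv 0 (by decide), hF.ra 101 (by decide), hF.wa 3 (by decide), hF.wa 10 (by decide),
          hF.wa 2 (by decide), hF.wa 9 (by decide), hF.ra 2 (by decide), hF.wa 100 (by decide),
          hF.wa 101 (by decide), hF.ra 100 (by decide), hF.wv 101 (by decide)]
        simp
    simp [hTt.2] at hb
    refine Program.wp_seq (Program.wp_mono (Program.wp_frame (wp_emitStep ho
      (by rwa [hTt.1]) (by omega))) ?_)
    rintro k₁ s₁ ⟨⟨i₁, i₂⟩, hF₁⟩
    rw [hTt.1] at i₂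
    have w4 : s₁.wv 4 = t.wv 4 := by
      rcases ho with rfl | rfl
      all_goals exact hF₁.wv 4 (by decide)
    simp [Program.wp, w4]
    refine ⟨by omega, ⟨by omega, ?_⟩, by omega⟩
    rcases ho with rfl | rfl
    all_goals simpa [State.Emits] using i₂
  · rintro k t hF - ⟨h₁, h₂⟩ hb hk
    have hTt : t.wv 0 = s.wv 0 ∧ t.wv 101 = s.wv 101 := by
      rcases ho with rfl | rfl
      all_goals
        rw [hF.wv 0 (by decide), hF.wv 101 (by decide)]
        simp
    simp [hTt] at hb
    have h4 : t.wv 4 = s.wv 101 := by omega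
    rw [h4] at h₂
    rcases ho with rfl | rfl
    all_goals
      simp at hk
      simp [Program.wp, hTt]
      exact ⟨by omega, by omega, by simpa [State.Emits] using h₂⟩

/-- Stores the predecessors of the detours, shifted by one. -/
def copyPred (o b : ℕ) : Program :=
  .seq (.wset 4 (.const 0)) <|
  .loop (.wlt (.var 4) (.var 0)) <|
    .seq (.ite (.weq (.arr (o + 4) (.var 4)) (.const 0)) .skip
      (.wstore b (.var 4)
        (.add (.arr (o + 14) (.sub (.arr (o + 6) (.var 4)) (.const 1))) (.const 1)))) <|
    .wset 4 (.add (.var 4) (.const 1))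

theorem wp_copyPred {W o b : ℕ} (ho : (o = 200 ∧ b = 6) ∨ (o = 300 ∧ b = 7)) {s : State}
    (h0 : ∀ v, s.wa b v = 0)
    (hlt : ∀ v < s.wv 0, s.wa (o + 4) v ≠ 0 → s.wa (o + 14) (s.wa (o + 6) v - 1) < W)
    (hW : s.wv 0 < W) :
    (copyPred o b).wp W (fun k s' => k ≤ 60 * (s.wv 0 + 1) ∧
      (∀ v < s.wv 0, s'.wa b v =
        if s.wa (o + 4) v = 0 then 0 else s.wa (o + 14) (s.wa (o + 6) v - 1) + 1) ∧
      ∀ v, s.wv 0 ≤ v → s'.wa b v = 0) s := by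
  refine ⟨Nat.zero_le _, ?_⟩
  refine Program.wp_loop (fun t => t.wv 4 ≤ s.wv 0 ∧ (∀ v < t.wv 4, t.wa b v =
        if s.wa (o + 4) v = 0 then 0 else s.wa (o + 14) (s.wa (o + 6) v - 1) + 1) ∧
      ∀ v, t.wv 4 ≤ v → t.wa b v = 0)
    (fun t => 40 * (s.wv 0 - t.wv 4)) (by simpa using h0) ?_ ?_ ?_
  · intros; simp
  · rintro t hF - ⟨h₁, h₂, h₃⟩ hb
    have e0 : t.wv 0 = s.wv 0 ∧ t.wa (o + 4) = s.wa (o + 4) ∧ t.wa (o + 6) = s.wa (o + 6) ∧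
        t.wa (o + 14) = s.wa (o + 14) := by
      rcases ho with ⟨rfl, rfl⟩ | ⟨rfl, rfl⟩
      all_goals
        simp only [Nat.reduceAdd]
        rw [hF.wv 0 (by decide), hF.wa _ (by decide), hF.wa _ (by decide), hF.wa _ (by decide)]
        simp
    obtain ⟨e0, e4, e6, e14⟩ := e0
    simp [e0] at hb
    have hlt' := hlt _ hb
    refine Program.wp_seq ⟨by simp, fun hz => ?_, fun hz => ?_⟩
    · simp [e4] at hz
      refine ⟨by simp; omega, ⟨by simp; omega, ?_, ?_⟩, by simp; omega⟩
      · simp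
        intro v hv
        by_cases hvt : v = t.wv 4
        · rw [hvt, if_pos hz]
          exact h₃ _ le_rfl
        · exact h₂ v (by omega)
      · simp
        exact fun v hv => h₃ v (by omega)
    · simp [e4] at hz
      have := hlt' hz
      simp [Program.wp, e6, e14]
      refine ⟨by omega, by omega, ⟨by omega, fun v hv => ?_, fun v hv => ?_⟩, by omega⟩
      · by_cases hvt : v = t.wv 4
        · rw [hvt, if_neg hz]; simp
        · rw [Function.update_of_ne hvt]
          exact h₂ v (by omega)
      · rw [Function.update_of_ne (by omega)]
        exact h₃ v (by omega)
  · rintro k t hF - ⟨h₁, h₂, h₃⟩ hb hk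
    have e0 : t.wv 0 = s.wv 0 := by
      rcases ho with ⟨rfl, rfl⟩ | ⟨rfl, rfl⟩
      all_goals
        rw [hF.wv 0 (by decide)]
        simp
    simp [e0] at hb hk
    have : t.wv 4 = s.wv 0 := by omega
    rw [this] at h₂ h₃
    exact ⟨by simp; omega, h₂, h₃⟩

end RealRAM

/-! ### Signs of the detour arcs, and the cells from the table. -/

section

variable {n r M : ℕ} {src dst : ℕ → ℕ} {wt : ℕ → ℝ} {d : ℕ → ℝ} {lv par dep onP X : ℕ → ℕ}
  {zy zz p : ℕ → ℕ} {cv δ cv₁ : ℕ → ℝ}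

/-- Dijkstra's algorithm needs this in spite of the subtractions. The distance of `X (I + 1)` is at
most `d u` and, by `hz`, at most the cost of the cell, so both subtracted terms are covered. -/
theorem DetourArc.nonneg {E : ℕ → ℕ → ℝ → Prop} (h : LevelTree E n r d lv par dep onP X)
    (hE : IsArcs E n) (hz : ∀ I, zz I ≠ 0 → d (X (I + 1)) ≤ cv I) {u v S : ℕ} {c c' : ℝ}
    (hA : E u v c) (hT : DetourArc n d lv onP X zz cv u v c S c') : 0 ≤ c' := by
  have hc := hE.pos _ _ _ hA
  obtain ⟨hu, -, ⟨-, -, rfl⟩ | ⟨-, -, -, rfl⟩ | ⟨hlt, hzv, -, rfl⟩⟩ := hT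
  · linarith [h.dist_nonneg u hu]
  · exact hc.le
  · have h₁ := hz _ hzv
    have h₂ := h.top_le hE (J := lv v + 1) (by omega) (v := u) (by omega)
    linarith

/-- The arc of the cell ends in the subtree of `X (I + 1)`, and the rest of its cost is nonnegative.
-/
theorem Cells.top_le {E : ℕ → ℕ → ℝ → Prop} (h : LevelTree E n r d lv par dep onP X)
    (hE : IsArcs E n) (hD : Detours E d lv onP X (fun _ => 0) cv₁ p δ)
    (hC : Cells E d lv onP p δ zy zz cv) (I : ℕ) (hI : zz I ≠ 0) : d (X (I + 1)) ≤ cv I := by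
  obtain ⟨y, z, c, k, h₁, h₂, ⟨h₃, h₄⟩, -, -, h₅⟩ := hC.sound I hI
  have hc := hE.pos _ _ _ h₁
  have h₆ := h.top_le hE (J := I + 1) (by omega) (v := z) (by omega)
  have hk : 0 ≤ k := by
    rcases h₄ with ⟨-, rfl⟩ | ⟨-, -, h₇, rfl⟩
    · exact h.dist_nonneg y h₃
    · exact hD.nonneg y h₇
  linarith

/-- The cells that result from the first row of the table. -/
theorem Cells.of_table {cell : ℕ → ℕ} (hs : CellsSound (CrossArc src dst wt d lv onP p δ) M (n + 1) cell cv)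
    (hc : CellsComplete (CrossArc src dst wt d lv onP p δ) (n + 1) M (n + 1) cell cv)
    (hz : ∀ I, (I ≤ n ∧ cell I ≠ 0 ∧ zy I = src (cell I - 1) + 1 ∧ zz I = dst (cell I - 1) + 1) ∨
      ((I ≤ n → cell I = 0) ∧ zz I = 0)) :
    Cells (Arc M src dst wt) d lv onP p δ zy zz cv := by
  refine ⟨fun I hI => ?_, ?_⟩
  · obtain ⟨hIn, hcI, h₁, h₂⟩ | ⟨-, h₁⟩ := hz I
    · obtain ⟨h₃, k, h₄, h₅, h₆⟩ := hs I I hcI ((covers_of_lt (by omega)).2 rfl)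
      exact ⟨_, _, _, k, ⟨_, h₃, rfl, rfl, rfl⟩, h₄, h₅, h₁, h₂, h₆⟩
    · exact absurd h₁ hI
  · rintro I y z c k ⟨a, ha, rfl, rfl, rfl⟩ hlt hL
    obtain ⟨q, hq, hqI, h₁, h₂⟩ := hc a ha I _ ⟨k, hlt, hL, rfl⟩
    have hIq := (covers_of_lt hq).1 hqI
    subst hIq
    obtain ⟨-, -, -, h₃⟩ | ⟨h₃, -⟩ := hz I
    · exact ⟨by omega, h₂⟩
    · exact absurd (h₃ (by omega)) h₁

end

/-! ### Assembly of the preprocessing. -/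

namespace RealRAM

/-- The variables and arrays from `o` on have not been used. -/
structure Fresh (o : ℕ) (s : State) : Prop where
  wv : ∀ x < 100, s.wv (o + x) = 0
  wa : ∀ a < 100, ∀ i, s.wa (o + a) i = 0

theorem Fresh.frame {o : ℕ} {c : Program} {s s' : State} (h : Fresh o s) (hF : Frame c s s')
    (hv : ∀ x ∈ c.wordVars, x < o ∨ o + 100 ≤ x) (ha : ∀ a ∈ c.wordArrays, a < o ∨ o + 100 ≤ a) :
    Fresh o s' := by
  refine ⟨fun x hx => ?_, fun a hx i => ?_⟩
  · rw [hF.wv _ fun hm => by have := hv _ hm; omega]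
    exact h.wv x hx
  · rw [hF.wa _ fun hm => by have := ha _ hm; omega]
    exact h.wa a hx i

/-- Predecessors of detours are computed with the variables and arrays from `o` on, and stored in
the array `b`. -/
def detourSearch (o b : ℕ) : Program := .seq (emit o) (.seq (dijkstra.shift o) (copyPred o b))

theorem wp_dijkstra_shift {W B o : ℕ} {s : State}
    (hdst : ∀ a < s.wv (1 + o), s.wa (1 + o) a < s.wv (0 + o))
    (hwt : ∀ a < s.wv (1 + o), 0 ≤ s.ra (0 + o) a) (hS : s.wv (2 + o) < s.wv (0 + o))
    (hB : ∀ r, 2 ^ (r / 2) ≤ s.wv (1 + o) + 1 → r < B) (hBW : B ≤ W) (hW : s.wv (1 + o) + 1 < W)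
    (hNW : s.wv (0 + o) ≤ W)
    (zv : s.wv (4 + o) = 0 ∧ s.wv (5 + o) = 0 ∧ s.wv (6 + o) = 0 ∧ s.wv (7 + o) = 0)
    (za : ∀ i, s.wa (2 + o) i = 0 ∧ s.wa (4 + o) i = 0 ∧ s.wa (5 + o) i = 0 ∧ s.wa (12 + o) i = 0) :
    (dijkstra.shift o).wp W (fun k s' =>
      k ≤ 2000 * (s.wv (1 + o) + (B + 1) * (s.wv (0 + o) + 1)) ∧
      ShortestPaths (s.wv (0 + o)) (s.wv (1 + o)) (s.wv (2 + o)) (s.wa (0 + o)) (s.wa (1 + o))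
        (s.ra (0 + o)) (s'.wa (4 + o)) (s'.wa (6 + o)) (s'.wa (7 + o)) (s'.wv (7 + o))
        (s'.ra (1 + o))) s := by
  refine Program.wp_shift o (Program.wp_mono (wp_dijkstra (B := B) (s := s.window o) ⟨hdst, hwt⟩ hS
    hB hBW hW hNW zv.1 zv.2.1 zv.2.2.1 zv.2.2.2 (fun i => (za i).1) (fun i => (za i).2.1)
    (fun i => (za i).2.2.1) (fun i => (za i).2.2.2)) ?_)
  rintro k t h s' rfl
  exact h

/-- Used twice: while array 9 is zero it yields the detours that enter from above, and `hz` is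
vacuous; with the finished cells it yields all detours. -/
theorem wp_detourSearch {W B o b n r : ℕ} (ho : (o = 200 ∧ b = 6) ∨ (o = 300 ∧ b = 7)) {s : State}
    (h : LevelTree (Arc (s.wv 101) (s.wa 100) (s.wa 101) (s.ra 100)) n r (s.ra 101) (s.wa 3)
      (s.wa 4) (s.wa 5) (s.wa 10) (fun I => s.wa 2 (I - 1)))
    (hE : IsArcs (Arc (s.wv 101) (s.wa 100) (s.wa 101) (s.ra 100)) n) (hn : s.wv 0 = n)
    (hz : ∀ I, s.wa 9 I ≠ 0 → s.ra 101 (s.wa 2 (I + 1 - 1)) ≤ s.ra 2 I)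
    (hf : Fresh o s) (hb : ∀ v, s.wa b v = 0)
    (hB : ∀ r, 2 ^ (r / 2) ≤ s.wv 101 + 1 → r < B) (hBW : B ≤ W) (hW : s.wv 101 + 1 < W)
    (hnW : n + 1 < W) :
    (detourSearch o b).wp W (fun k s' => k ≤ 2500 * (s.wv 101 + (B + 1) * (n + 2)) ∧
      Detours (Arc (s.wv 101) (s.wa 100) (s.wa 101) (s.ra 100)) (s.ra 101) (s.wa 3) (s.wa 10)
        (fun I => s.wa 2 (I - 1)) (s.wa 9) (s.ra 2) (s'.wa b) (s'.ra (o + 1))) s := by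
  have ho' : o = 200 ∨ o = 300 := by omega
  have hArc : ∀ a < s.wv 101, Arc (s.wv 101) (s.wa 100) (s.wa 101) (s.ra 100) (s.wa 100 a)
    (s.wa 101 a) (s.ra 100 a) := fun a ha => ⟨a, ha, rfl, rfl, rfl⟩
  refine Program.wp_seq (Program.wp_mono (Program.wp_frame (wp_emit ho' (by omega) (by omega))) ?_)
  rintro k₁ s₁ ⟨⟨hk₁, v0, v2, hem⟩, hF₁⟩
  have hle := hem.le
  have hdst : ∀ j < s₁.wv (o + 1), s₁.wa (o + 1) j < n := by
    intro j hj
    obtain ⟨a, ha, -, h₁, -⟩ := hem.sound j hj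
    have : s₁.wa 101 = s.wa 101 := by
      rcases ho' with rfl | rfl
      all_goals exact hF₁.wa 101 (by decide)
    rw [h₁, this]
    exact hE.lt _ _ _ (hE.symm _ _ _ (hArc a ha))
  have hfrm : ∀ j < s₁.wv (o + 1), s₁.wa (o + 14) j < n := by
    intro j hj
    obtain ⟨a, ha, -, -, h₁⟩ := hem.sound j hj
    have : s₁.wa 100 = s.wa 100 := by
      rcases ho' with rfl | rfl
      all_goals exact hF₁.wa 100 (by decide)
    rw [h₁, this]
    exact hE.lt _ _ _ (hArc a ha)
  have hwt : ∀ j < s₁.wv (o + 1), 0 ≤ s₁.ra o j := by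
    intro j hj
    obtain ⟨a, ha, h₁, -⟩ := hem.sound j hj
    rw [State.detourArc, hn] at h₁
    exact DetourArc.nonneg h hE hz (hArc a ha) h₁
  have zv : s₁.wv (4 + o) = 0 ∧ s₁.wv (5 + o) = 0 ∧ s₁.wv (6 + o) = 0 ∧ s₁.wv (7 + o) = 0 := by
    rcases ho' with rfl | rfl
    all_goals
      simp only [Nat.reduceAdd]
      rw [hF₁.wv _ (by decide), hF₁.wv _ (by decide), hF₁.wv _ (by decide), hF₁.wv _ (by decide)]
      exact ⟨hf.wv 4 (by norm_num), hf.wv 5 (by norm_num), hf.wv 6 (by norm_num),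
        hf.wv 7 (by norm_num)⟩
  have za : ∀ i, s₁.wa (2 + o) i = 0 ∧ s₁.wa (4 + o) i = 0 ∧ s₁.wa (5 + o) i = 0 ∧
      s₁.wa (12 + o) i = 0 := by
    intro i
    rcases ho' with rfl | rfl
    all_goals
      simp only [Nat.reduceAdd]
      rw [hF₁.wa _ (by decide), hF₁.wa _ (by decide), hF₁.wa _ (by decide), hF₁.wa _ (by decide)]
      exact ⟨hf.wa 2 (by norm_num) i, hf.wa 4 (by norm_num) i, hf.wa 5 (by norm_num) i,
        hf.wa 12 (by norm_num) i⟩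
  have c1 : 1 + o = o + 1 := add_comm _ _
  have c2 : 2 + o = o + 2 := add_comm _ _
  have c0 : 0 + o = o := Nat.zero_add o
  rw [hn] at v0 v2
  refine Program.wp_seq (Program.wp_mono (Program.wp_frame (wp_dijkstra_shift (B := B) ?_ ?_ ?_ ?_
    hBW ?_ ?_ zv za)) ?_)
  · rw [c1, c0, v0]
    exact fun a ha => (hdst a ha).trans n.lt_succ_self
  · rwa [c1, c0]
  · rw [c2, c0, v0, v2]
    exact n.lt_succ_self
  · rw [c1]
    exact fun r hr => hB r (by omega)
  · rw [c1]
    omega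
  · rw [c0, v0]
    omega
  rw [c0, c1, c2, v0, v2, add_comm 4 o, add_comm 6 o, add_comm 7 o]
  rintro k₂ s₂ ⟨⟨hk₂, hS⟩, hF₂⟩
  have f14 : s₂.wa (o + 14) = s₁.wa (o + 14) := by
    rcases ho' with rfl | rfl
    all_goals exact hF₂.wa _ (by decide)
  have f0 : s₂.wv 0 = n := by
    rw [← hn]
    rcases ho' with rfl | rfl
    all_goals exact (hF₂.wv 0 (by decide)).trans (hF₁.wv 0 (by decide))
  have fb : s₂.wa b = s.wa b := by
    rcases ho with ⟨rfl, rfl⟩ | ⟨rfl, rfl⟩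
    all_goals exact (hF₂.wa _ (by decide)).trans (hF₁.wa _ (by decide))
  have hnW' : s₂.wv 0 < W := by omega
  refine Program.wp_mono (Program.wp_frame (wp_copyPred ho (by rwa [fb]) ?_ hnW')) ?_
  · intro v hv hdone
    obtain ⟨a, ha, h₁, -⟩ := hS.pred v hdone (by omega)
    rw [h₁, f14, Nat.add_sub_cancel]
    exact (hfrm a ha).trans (by omega)
  rw [f0, f14]
  rintro k₃ s₃ ⟨⟨hk₃, hp, hp'⟩, hF₃⟩
  have fδ : s₃.ra (o + 1) = s₂.ra (o + 1) := by
    rcases ho with ⟨rfl, rfl⟩ | ⟨rfl, rfl⟩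
    all_goals exact hF₃.ra _ (by decide)
  refine ⟨?_, ?_⟩
  · have h₁ : 1 * (n + 2) ≤ (B + 1) * (n + 2) := Nat.mul_le_mul_right _ (by omega)
    have e : n + 1 + 1 = n + 2 := rfl
    rw [e] at hk₂
    omega
  · rw [fδ]
    refine ShortestPaths.detours h (k := s₁.wv (o + 1)) (wt' := s₁.ra o) (src' := s₁.wa o) (dst' := s₁.wa (o + 1))
      (frm := s₁.wa (o + 14)) ?_ hS hp hp'
    have hem' := hem
    unfold State.Emits State.detourArc at hem'
    rw [hn] at hem'
    have g₁ : s₁.wa 100 = s.wa 100 ∧ s₁.wa 101 = s.wa 101 := by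
      rcases ho' with rfl | rfl
      all_goals exact ⟨hF₁.wa 100 (by decide), hF₁.wa 101 (by decide)⟩
    rwa [g₁.1, g₁.2] at hem'

end RealRAM

namespace RealRAM

/-- The arcs of the graph in an input state. -/
def State.edgeArc (s : State) (u v : ℕ) (c : ℝ) : Prop :=
  ∃ e < s.wv 1, ((s.wa 0 e = u ∧ s.wa 1 e = v) ∨ (s.wa 0 e = v ∧ s.wa 1 e = u)) ∧ s.ra 0 e = c

/-- An admissible input with the arcs `E`, `n` vertices, `m` edges and the source `r`. -/
structure InputOk (E : ℕ → ℕ → ℝ → Prop) (n m r : ℕ) (s : State) : Prop where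
  n_eq : s.wv 0 = n
  m_eq : s.wv 1 = m
  r_eq : s.wv 2 = r
  lt : r < n
  wv : ∀ x, 4 ≤ x → s.wv x = 0
  wa : ∀ a, 3 ≤ a → ∀ i, s.wa a i = 0
  arc : s.edgeArc = E
  arcs : IsArcs E n
  path : ∀ M src dst wt done pred ord c d, Arc M src dst wt = E →
    ShortestPaths n M r src dst wt done pred ord c d → TightPath E n r d (s.wa 2) (s.wv 3)

/-- The shortest-path tree with the levels of its vertices. -/
def makeTree : Program :=
  .seq makeArcs (.seq (dijkstra.shift 100) (.seq markPath makeLevels))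

/-- The shortest-path tree has been computed. -/
structure TreeOk (E : ℕ → ℕ → ℝ → Prop) (n m r : ℕ) (s : State) : Prop where
  n_eq : s.wv 0 = n
  m_eq : s.wv 101 = 2 * m
  arc : Arc (s.wv 101) (s.wa 100) (s.wa 101) (s.ra 100) = E
  tree : LevelTree E n r (s.ra 101) (s.wa 3) (s.wa 4) (s.wa 5) (s.wa 10) (fun I => s.wa 2 (I - 1))
  path : ∀ j < s.wv 3, s.wa 10 (s.wa 2 j) ≠ 0 ∧ s.wa 3 (s.wa 2 j) ≠ 0

theorem wp_makeTree {W B n m r : ℕ} {E : ℕ → ℕ → ℝ → Prop} {s : State} (h : InputOk E n m r s)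
    (hB : ∀ r, 2 ^ (r / 2) ≤ 2 * m + 1 → r < B) (hBW : B ≤ W) (hW : 2 * m + 1 < W)
    (hnW : n + 1 < W) :
    makeTree.wp W (fun k s' => k ≤ 5000 * (m + (B + 1) * (n + 2)) ∧ TreeOk E n m r s') s := by
  refine Program.wp_seq (Program.wp_mono (Program.wp_frame (wp_makeArcs
    (by rw [h.m_eq]; omega))) ?_)
  rw [h.n_eq, h.m_eq, h.r_eq]
  rintro k₁ s₁ ⟨⟨hk₁, N₁, M₁, S₁, he⟩, hF₁⟩
  have hArc : Arc (2 * m) (s₁.wa 100) (s₁.wa 101) (s₁.ra 100) = E := by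
    rw [← h.arc]
    ext u v c
    unfold State.edgeArc
    rw [h.m_eq]
    constructor
    · rintro ⟨a, ha, rfl, rfl, rfl⟩
      by_cases ham : a < m
      · obtain ⟨e₁, e₂, e₃, -⟩ := he a ham
        exact ⟨a, ham, Or.inl ⟨e₁.symm, e₂.symm⟩, e₃.symm⟩
      · obtain ⟨b, rfl⟩ : ∃ b, a = m + b := ⟨a - m, by omega⟩
        obtain ⟨-, -, -, e₁, e₂, e₃⟩ := he b (by omega)
        exact ⟨b, by omega, Or.inr ⟨e₂.symm, e₁.symm⟩, e₃.symm⟩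
    · rintro ⟨e, hem, ⟨rfl, rfl⟩ | ⟨rfl, rfl⟩, rfl⟩
      · obtain ⟨e₁, e₂, e₃, -⟩ := he e hem
        exact ⟨e, by omega, e₁, e₂, e₃⟩
      · obtain ⟨-, -, -, e₁, e₂, e₃⟩ := he e hem
        exact ⟨m + e, by omega, e₁, e₂, e₃⟩
  have hA : IsArcs (Arc (2 * m) (s₁.wa 100) (s₁.wa 101) (s₁.ra 100)) n := by
    rw [hArc]
    exact h.arcs
  have hdj := wp_dijkstra_shift (W := W) (B := B) (o := 100) (s := s₁)
  simp only [Nat.reduceAdd, N₁, M₁, S₁] at hdj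
  refine Program.wp_seq (Program.wp_mono (Program.wp_frame (hdj
    (fun a ha => hA.lt _ _ _ (hA.symm _ _ _ ⟨a, ha, rfl, rfl, rfl⟩))
    (fun a ha => (hA.pos _ _ _ ⟨a, ha, rfl, rfl, rfl⟩).le) h.lt hB hBW hW (by omega) ?_ ?_)) ?_)
  · rw [hF₁.wv _ (by decide), hF₁.wv _ (by decide), hF₁.wv _ (by decide), hF₁.wv _ (by decide)]
    exact ⟨h.wv _ (by norm_num), h.wv _ (by norm_num), h.wv _ (by norm_num), h.wv _ (by norm_num)⟩
  · intro i
    rw [hF₁.wa _ (by decide), hF₁.wa _ (by decide), hF₁.wa _ (by decide), hF₁.wa _ (by decide)]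
    exact ⟨h.wa _ (by norm_num) _, h.wa _ (by norm_num) _, h.wa _ (by norm_num) _,
      h.wa _ (by norm_num) _⟩
  rintro k₂ s₂ ⟨⟨hk₂, hS⟩, hF₂⟩
  have hP := h.path _ _ _ _ _ _ _ _ _ hArc hS
  have p2 : s₂.wa 2 = s.wa 2 := (hF₂.wa 2 (by decide)).trans (hF₁.wa 2 (by decide))
  have p3 : s₂.wv 3 = s.wv 3 := (hF₂.wv 3 (by decide)).trans (hF₁.wv 3 (by decide))
  have p0 : s₂.wv 0 = n := (hF₂.wv 0 (by decide)).trans ((hF₁.wv 0 (by decide)).trans h.n_eq)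
  have p10 : s₂.wa 10 = s.wa 10 := (hF₂.wa 10 (by decide)).trans (hF₁.wa 10 (by decide))
  have hle := hP.le
  refine Program.wp_seq (Program.wp_mono (Program.wp_frame (wp_markPath ?_ ?_ ?_ ?_ ?_)) ?_)
  · rw [p10]
    exact h.wa 10 (by norm_num)
  · rw [p2, p3]
    exact hP.inj
  · rw [p2, p3]
    exact fun i hi => (hP.lt i hi).trans (by omega)
  · omega
  · omega
  rw [p2, p3, p0]
  rintro k₃ s₃ ⟨⟨hk₃, hm⟩, hF₃⟩
  rw [← hArc] at hP
  have q : s₃.wa 100 = s₁.wa 100 ∧ s₃.wa 101 = s₁.wa 101 ∧ s₃.ra 100 = s₁.ra 100 ∧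
      s₃.wv 101 = 2 * m :=
    ⟨(hF₃.wa _ (by decide)).trans (hF₂.wa _ (by decide)),
      (hF₃.wa _ (by decide)).trans (hF₂.wa _ (by decide)),
      (hF₃.ra _ (by decide)).trans (hF₂.ra _ (by decide)),
      ((hF₃.wv _ (by decide)).trans (hF₂.wv _ (by decide))).trans M₁⟩
  have q' : s₃.wa 104 = s₂.wa 104 ∧ s₃.wa 106 = s₂.wa 106 ∧ s₃.wa 107 = s₂.wa 107 ∧
      s₃.wv 107 = s₂.wv 107 ∧ s₃.ra 101 = s₂.ra 101 :=
    ⟨hF₃.wa _ (by decide), hF₃.wa _ (by decide), hF₃.wa _ (by decide), hF₃.wv _ (by decide),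
      hF₃.ra _ (by decide)⟩
  obtain ⟨q₁, q₂, q₃, q₄⟩ := q
  obtain ⟨q₅, q₆, q₇, q₈, q₉⟩ := q'
  rw [← q₁, ← q₂, ← q₃, ← q₅, ← q₆, ← q₇, ← q₈, ← q₉] at hS
  rw [← q₁, ← q₂, ← q₃, ← q₉] at hP
  rw [← q₁, ← q₂, ← q₃] at hA
  have hcn := hS.count_le
  refine Program.wp_mono (Program.wp_frame (wp_makeLevels rfl ?_ ?_ ?_ ?_ (by omega))) ?_
  · intro v
    rw [hF₃.wa _ (by decide), hF₂.wa _ (by decide), hF₁.wa _ (by decide)]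
    exact h.wa _ (by norm_num) _
  · intro v
    rw [hF₃.wa _ (by decide), hF₂.wa _ (by decide), hF₁.wa _ (by decide)]
    exact h.wa _ (by norm_num) _
  · intro j hj
    rcases treeParent_spec hA hS hP hm (hS.ord_done j hj) with ⟨-, e, -⟩ | ⟨-, u, c, e, -, -, -, hu, -⟩
    · omega
    · have := hS.lt u hu
      omega
  · exact fun j hj => treeParent_earlier hA hS hP hm hj
  rintro k₄ s₄ ⟨⟨hk₄, hL⟩, hF₄⟩
  have hT := hS.levelTree hA hP hm hL
  have t0 : s₄.wv 0 = n := (hF₄.wv 0 (by decide)).trans ((hF₃.wv 0 (by decide)).trans p0)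
  have t1 : s₄.wv 101 = 2 * m := (hF₄.wv _ (by decide)).trans q₄
  have t2 : s₄.wa 2 = s.wa 2 := (hF₄.wa _ (by decide)).trans ((hF₃.wa _ (by decide)).trans p2)
  have t3 : s₄.wv 3 = s.wv 3 := (hF₄.wv _ (by decide)).trans ((hF₃.wv _ (by decide)).trans p3)
  have t10 : s₄.wa 10 = s₃.wa 10 := hF₄.wa _ (by decide)
  have hArc' : Arc (2 * m) (s₃.wa 100) (s₃.wa 101) (s₃.ra 100) = E := by rw [q₁, q₂, q₃, hArc]
  refine ⟨?_, t0, t1, ?_, ?_, ?_⟩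
  · have h₁ : 1 * (n + 2) ≤ (B + 1) * (n + 2) := Nat.mul_le_mul_right _ (by omega)
    have h₂ : (B + 1) * (n + 1) ≤ (B + 1) * (n + 2) := Nat.mul_le_mul_left _ (by omega)
    omega
  · rw [t1, hF₄.wa 100 (by decide), hF₄.wa 101 (by decide), hF₄.ra 100 (by decide), hArc']
  · rw [t2, t10, hF₄.ra 101 (by decide), ← hArc']
    exact hT
  · rw [t2, t3, t10]
    intro j hj
    have h₁ := (hm.mark j hj).1
    obtain ⟨i, hi, h₂⟩ := hS.ord_surj _ (hP.done_ne hS j hj)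
    have h₃ := (hL.done i hi).2.1
    rw [h₂, if_neg (by omega)] at h₃
    omega

/-- The cheapest arcs across the levels. -/
def makeCells : Program :=
  .seq buildLogs (.seq enterArcs (.seq pushCells cellEnds))

/-- Filling the table takes O(m) steps and pushing it down O(n log n). The table itself is scratch;
only the ends of the arcs in its first row are kept. -/
theorem wp_makeCells {W n m r : ℕ} {E : ℕ → ℕ → ℝ → Prop} {s : State} (h : TreeOk E n m r s)
    (hE : IsArcs E n) (hn : 1 ≤ n) (h9 : ∀ I, s.wa 9 I = 0) (h11 : ∀ q, s.wa 11 q = 0)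
    (h12 : s.wa 12 1 = 0) (hM : 2 * m ≤ W) (hW : n * (n + 1) ≤ W) (hW' : n + 2 ≤ W) :
    makeCells.wp W (fun k s' => k ≤ 1000 * (m + (Nat.log 2 n + 1) * (n + 2)) ∧
      Cells E (s.ra 101) (s.wa 3) (s.wa 10) (s.wa 6) (s.ra 201) (s'.wa 8) (s'.wa 9) (s'.ra 2) ∧
      ∀ I, s'.wa 9 I ≠ 0 → I ≤ n) s := by
  obtain ⟨T, hT⟩ : ∃ T, s.crossArc = T := ⟨_, rfl⟩
  have hTn : ∀ a I κ, T a I κ → I ≤ n := by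
    rw [← hT]
    rintro a I κ ⟨k, h₁, -⟩
    exact h₁.le.trans (h.tree.lv_le _)
  have hends : ∀ a < 2 * m, s.wa 100 a < n ∧ s.wa 101 a < n := by
    intro a ha
    have : E (s.wa 100 a) (s.wa 101 a) (s.ra 100 a) := by
      rw [← h.arc, h.m_eq]
      exact ⟨a, ha, rfl, rfl, rfl⟩
    exact ⟨hE.lt _ _ _ this, hE.lt _ _ _ (hE.symm _ _ _ this)⟩
  refine Program.wp_seq (Program.wp_mono (Program.wp_frame (wp_buildLogs h12
    (by rwa [h.n_eq]) (by rw [h.n_eq]; omega))) ?_)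
  rw [h.n_eq]
  rintro k₁ s₁ ⟨⟨hk₁, hl, hp⟩, hF₁⟩
  have hok₁ : TableOk n (2 * m) s₁ := by
    refine ⟨(hF₁.wv 0 (by decide)).trans h.n_eq, hl, hp, ?_⟩
    rw [hF₁.wa 3 (by decide)]
    exact h.tree.lv_le
  have hT₁ : s₁.crossArc = T := by
    rw [← hT]
    unfold State.crossArc
    rw [hF₁.wa 100 (by decide), hF₁.wa 101 (by decide), hF₁.ra 100 (by decide),
      hF₁.ra 101 (by decide), hF₁.wa 3 (by decide), hF₁.wa 10 (by decide), hF₁.wa 6 (by decide),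
      hF₁.ra 201 (by decide)]
  refine Program.wp_seq (Program.wp_mono (Program.wp_frame (wp_enterArcs hok₁ hn hT₁
    (by rwa [hF₁.wa 11 (by decide)]) ((hF₁.wv 101 (by decide)).trans h.m_eq) hM hW)) ?_)
  rintro k₂ s₂ ⟨⟨hk₂, hs₂, hc₂⟩, hF₂⟩
  have hok₂ : TableOk n (2 * m) s₂ := by
    refine ⟨(hF₂.wv 0 (by decide)).trans hok₁.n_eq, ?_, ?_, ?_⟩
    · rw [hF₂.wa 12 (by decide)]
      exact hl
    · rw [hF₂.wa 13 (by decide)]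
      exact hp
    · rw [hF₂.wa 3 (by decide)]
      exact hok₁.lv_le
  refine Program.wp_seq (Program.wp_mono (Program.wp_frame (wp_pushCells hok₂ hn hTn hs₂ hc₂ hM
    hW)) ?_)
  rintro k₃ s₃ ⟨⟨hk₃, hs₃, hc₃⟩, hF₃⟩
  have e0 : s₃.wv 0 = n := (hF₃.wv 0 (by decide)).trans hok₂.n_eq
  have e9 : s₃.wa 9 = s.wa 9 := (hF₃.wa _ (by decide)).trans ((hF₂.wa _ (by decide)).trans
    (hF₁.wa _ (by decide)))
  have e100 : s₃.wa 100 = s.wa 100 := (hF₃.wa _ (by decide)).trans ((hF₂.wa _ (by decide)).trans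
    (hF₁.wa _ (by decide)))
  have e101 : s₃.wa 101 = s.wa 101 := (hF₃.wa _ (by decide)).trans ((hF₂.wa _ (by decide)).trans
    (hF₁.wa _ (by decide)))
  refine Program.wp_mono (Program.wp_frame (wp_cellEnds (by rwa [e9]) ?_ (by omega))) ?_
  · rw [e0, e100, e101]
    intro I hI hcell
    have := hends _ (hs₃ I I hcell ((covers_of_lt (by omega)).2 rfl)).1
    omega
  rw [e0, e100, e101]
  rintro k₄ s₄ ⟨⟨hk₄, hz⟩, hF₄⟩
  refine ⟨?_, ?_, fun I hI => ?_⟩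
  · have h₁ : 1 * (n + 2) ≤ (Nat.log 2 n + 1) * (n + 2) := Nat.mul_le_mul_right _ (by omega)
    have h₂ : (Nat.log 2 n + 1) * (n + 1) ≤ (Nat.log 2 n + 1) * (n + 2) :=
      Nat.mul_le_mul_left _ (by omega)
    omega
  · rw [← h.arc, h.m_eq, hF₄.ra 2 (by decide)]
    rw [← hT] at hs₃ hc₃
    exact Cells.of_table hs₃ hc₃ hz
  · rcases hz I with h₁ | h₁
    · exact h₁.1
    · exact absurd h₁.2 hI

/-- The preprocessing. -/
def preprocess : Program :=
  .seq makeTree (.seq (detourSearch 200 6) (.seq makeCells (detourSearch 300 7)))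

/-- The arrays 3 to 9 answer the queries for vertices of `P`. -/
def Prepared (E : ℕ → ℕ → ℝ → Prop) (n r : ℕ) (P : ℕ → ℕ) (k : ℕ) (wa : ℕ → ℕ → ℕ) : Prop :=
  ∃ (d δ₁ δ₃ cv cv₁ : ℕ → ℝ) (onP X : ℕ → ℕ),
    LevelTree E n r d (wa 3) (wa 4) (wa 5) onP X ∧
    Detours E d (wa 3) onP X (fun _ => 0) cv₁ (wa 6) δ₁ ∧
    Cells E d (wa 3) onP (wa 6) δ₁ (wa 8) (wa 9) cv ∧
    Detours E d (wa 3) onP X (wa 9) cv (wa 7) δ₃ ∧ (∀ I, wa 9 I ≠ 0 → I ≤ n) ∧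
    ∀ j < k, onP (P j) ≠ 0 ∧ wa 3 (P j) ≠ 0

/-- The cells need the detours from above, and the final detours need the cells; hence two searches
with the cells in between. The searches use the blocks from 200 and from 300, which are still zero
as Dijkstra's algorithm expects. -/
theorem wp_preprocess {W B n m r : ℕ} {E : ℕ → ℕ → ℝ → Prop} {s : State} (h : InputOk E n m r s)
    (hB : ∀ r, 2 ^ (r / 2) ≤ 2 * m + 1 → r < B) (hlB : Nat.log 2 n ≤ B) (hBW : B ≤ W)
    (hW : 2 * m + 1 < W) (hnW : n + 2 ≤ W) (hnW' : n * (n + 1) ≤ W) :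
    preprocess.wp W (fun k s' => k ≤ 20000 * (m + (B + 1) * (n + 2)) ∧
      Prepared E n r (s.wa 2) (s.wv 3) s'.wa) s := by
  have hf : ∀ o, 4 ≤ o → Fresh o s := fun o ho =>
    ⟨fun x _ => h.wv _ (by omega), fun a _ => h.wa _ (by omega)⟩
  refine Program.wp_seq (Program.wp_mono (Program.wp_frame (wp_makeTree h hB hBW hW (by omega))) ?_)
  rintro k₁ s₁ ⟨⟨hk₁, h₁⟩, hF₁⟩
  have z : ∀ a, 6 ≤ a → a ≠ 10 → a < 100 → ∀ i, s₁.wa a i = 0 := by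
    intro a h6 h10 h100 i
    have : ∀ a' ∈ makeTree.wordArrays, a' < 6 ∨ a' = 10 ∨ 100 ≤ a' := by decide
    rw [hF₁.wa a fun ha => by have := this a ha; omega]
    exact h.wa a (by omega) i
  have hArcs : IsArcs (Arc (s₁.wv 101) (s₁.wa 100) (s₁.wa 101) (s₁.ra 100)) n := by
    rw [h₁.arc]
    exact h.arcs
  refine Program.wp_seq (Program.wp_mono (Program.wp_frame (wp_detourSearch (Or.inl ⟨rfl, rfl⟩)
    (n := n) (r := r) (B := B) (by rw [h₁.arc]; exact h₁.tree) hArcs h₁.n_eq ?_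
    ((hf 200 (by norm_num)).frame hF₁ (by decide) (by decide)) (z 6 (by norm_num) (by norm_num) (by norm_num))
    (by rwa [h₁.m_eq]) hBW (by rwa [h₁.m_eq]) (by omega))) ?_)
  · intro I hI
    exact absurd (z 9 (by norm_num) (by norm_num) (by norm_num) I) hI
  rw [h₁.m_eq]
  rintro k₂ s₂ ⟨⟨hk₂, hD₁⟩, hF₂⟩
  have z9 : s₁.wa 9 = fun _ => 0 := funext (z 9 (by norm_num) (by norm_num) (by norm_num))
  rw [← h₁.m_eq, h₁.arc, z9] at hD₁
  have h₂ : TreeOk E n m r s₂ := by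
    obtain ⟨i₁, i₂, i₃, i₄, i₅⟩ := h₁
    refine ⟨?_, ?_, ?_, ?_, ?_⟩
    · rwa [hF₂.wv _ (by decide)]
    · rwa [hF₂.wv _ (by decide)]
    · rwa [hF₂.wv _ (by decide), hF₂.wa _ (by decide), hF₂.wa _ (by decide), hF₂.ra _ (by decide)]
    · rwa [hF₂.ra 101 (by decide), hF₂.wa 3 (by decide), hF₂.wa 4 (by decide), hF₂.wa 5 (by decide),
        hF₂.wa 10 (by decide), hF₂.wa 2 (by decide)]
    · rwa [hF₂.wv _ (by decide), hF₂.wa 3 (by decide), hF₂.wa 10 (by decide), hF₂.wa 2 (by decide)]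
  have hn : 1 ≤ n := Nat.one_le_of_lt h.lt
  refine Program.wp_seq (Program.wp_mono (Program.wp_frame (wp_makeCells h₂ h.arcs hn ?_ ?_ ?_
    (by omega) hnW' hnW)) ?_)
  · rw [hF₂.wa 9 (by decide)]
    exact z 9 (by norm_num) (by norm_num) (by norm_num)
  · rw [hF₂.wa 11 (by decide)]
    exact z 11 (by norm_num) (by norm_num) (by norm_num)
  · rw [hF₂.wa 12 (by decide)]
    exact z 12 (by norm_num) (by norm_num) (by norm_num) _
  rintro k₃ s₃ ⟨⟨hk₃, hC, hIn⟩, hF₃⟩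
  have h₃ : TreeOk E n m r s₃ := by
    obtain ⟨i₁, i₂, i₃, i₄, i₅⟩ := h₂
    refine ⟨?_, ?_, ?_, ?_, ?_⟩
    · rwa [hF₃.wv _ (by decide)]
    · rwa [hF₃.wv _ (by decide)]
    · rwa [hF₃.wv _ (by decide), hF₃.wa _ (by decide), hF₃.wa _ (by decide), hF₃.ra _ (by decide)]
    · rwa [hF₃.ra 101 (by decide), hF₃.wa 3 (by decide), hF₃.wa 4 (by decide), hF₃.wa 5 (by decide),
        hF₃.wa 10 (by decide), hF₃.wa 2 (by decide)]
    · rwa [hF₃.wv _ (by decide), hF₃.wa 3 (by decide), hF₃.wa 10 (by decide), hF₃.wa 2 (by decide)]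
  have e : s₃.ra 101 = s₁.ra 101 ∧ s₃.wa 3 = s₁.wa 3 ∧ s₃.wa 10 = s₁.wa 10 ∧ s₃.wa 2 = s₁.wa 2 ∧
      s₃.wa 6 = s₂.wa 6 ∧ s₃.wa 7 = s₁.wa 7 := by
    rw [hF₃.ra _ (by decide), hF₃.wa _ (by decide), hF₃.wa _ (by decide), hF₃.wa _ (by decide),
      hF₃.wa _ (by decide), hF₃.wa _ (by decide)]
    exact ⟨hF₂.ra _ (by decide), hF₂.wa _ (by decide), hF₂.wa _ (by decide), hF₂.wa _ (by decide),
      rfl, hF₂.wa _ (by decide)⟩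
  obtain ⟨e₁, e₂, e₃, e₄, e₅, e₆⟩ := e
  rw [← e₁, ← e₂, ← e₃, ← e₄, ← e₅] at hD₁
  rw [hF₂.ra 101 (by decide), hF₂.wa 3 (by decide), hF₂.wa 10 (by decide), ← e₁, ← e₂, ← e₃,
    ← e₅] at hC
  refine Program.wp_mono (Program.wp_frame (wp_detourSearch (Or.inr ⟨rfl, rfl⟩)
    (n := n) (r := r) (B := B) (by rw [h₃.arc]; exact h₃.tree) (by rw [h₃.arc]; exact h.arcs)
    h₃.n_eq (hC.top_le h₃.tree h.arcs hD₁)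
    ((((hf 300 (by norm_num)).frame hF₁ (by decide) (by decide)).frame hF₂ (by decide)
      (by decide)).frame hF₃ (by decide) (by decide))
    (by rw [e₆]; exact z 7 (by norm_num) (by norm_num) (by norm_num))
    (by rwa [h₃.m_eq]) hBW (by rwa [h₃.m_eq]) (by omega))) ?_
  rintro k₄ s₄ ⟨⟨hk₄, hD₃⟩, hF₄⟩
  rw [h₃.m_eq] at hk₄
  rw [h₃.arc] at hD₃
  refine ⟨?_, s₃.ra 101, s₂.ra 201, s₄.ra 301, s₃.ra 2, s₁.ra 2, s₃.wa 10, fun I => s₃.wa 2 (I - 1), ?_⟩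
  · have h₅ : (Nat.log 2 n + 1) * (n + 2) ≤ (B + 1) * (n + 2) := Nat.mul_le_mul_right _ (by omega)
    omega
  · rw [hF₄.wa 3 (by decide), hF₄.wa 4 (by decide), hF₄.wa 5 (by decide), hF₄.wa 6 (by decide),
      hF₄.wa 8 (by decide), hF₄.wa 9 (by decide)]
    refine ⟨h₃.tree, hD₁, hC, hD₃, hIn, ?_⟩
    have := h₃.path
    rwa [e₄, hF₃.wv 3 (by decide), hF₂.wv 3 (by decide), hF₁.wv 3 (by decide),
      hF₁.wa 2 (by decide)] at this

end RealRAM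

/-! ### Truncation to linear size, and the query on the result. -/

section

variable {E : ℕ → ℕ → ℝ → Prop} {n r : ℕ} {d : ℕ → ℝ} {lv par dep onP X : ℕ → ℕ}

/-- Parents and depths matter only for vertices below `n`, so their arrays may be cut off or differ
beyond. -/
theorem LevelTree.congr {par' dep' : ℕ → ℕ} (h : LevelTree E n r d lv par dep onP X)
    (hE : IsArcs E n) (hp : ∀ v < n, par' v = par v) (hd : ∀ v < n, dep' v = dep v) :
    LevelTree E n r d lv par' dep' onP X where
  lv_root := h.lv_root
  onP_root := h.onP_root
  par_root := by rw [hp r (h.lt r (by rw [h.lv_root]; exact one_ne_zero)), h.par_root]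
  dist_root := h.dist_root
  lv_top := h.lv_top
  reach := h.reach
  parent v hv hr := by
    obtain ⟨u, c, h₁, h₂, h₃, h₄, h₅⟩ := h.parent v hv hr
    have hvn := h.lt v hv
    exact ⟨u, c, by rw [hp v hvn, h₁], h₂, h₃, by rw [hd v hvn, hd u (hE.lt _ _ _ h₂), h₄], h₅⟩
  onP_eq := h.onP_eq
  lt := h.lt
  lv_le := h.lv_le
  dist_nonneg := h.dist_nonneg

end

namespace RealRAM

variable {E : ℕ → ℕ → ℝ → Prop} {n r k : ℕ} {P : ℕ → ℕ}

/-- The first `2 * n` cells of the arrays suffice. -/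
theorem Prepared.truncate {wa wa' : ℕ → ℕ → ℕ} (h : Prepared E n r P k wa) (hE : IsArcs E n)
    (hn : 1 ≤ n) (h₁ : ∀ a < 10, ∀ i < 2 * n, wa' a i = wa a i)
    (h₂ : ∀ a, ∀ i, 2 * n ≤ i → wa' a i = 0) : Prepared E n r P k wa' := by
  obtain ⟨d, δ₁, δ₃, cv, cv₁, onP, X, hT, hD₁, hC, hD₃, hz, hP⟩ := h
  -- Levels, both kinds of predecessors and `zz` vanish beyond the index `n < 2 * n`, so truncation
  -- does not change them. Parents, depths and `zy` need to agree only where they are read.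
  have H : ∀ a < 10, (∀ i, wa a i ≠ 0 → i ≤ n) → wa' a = wa a := by
    intro a ha hi
    funext i
    by_cases hin : i < 2 * n
    · exact h₁ a ha i hin
    · rw [h₂ a i (by omega)]
      by_contra hne
      have := hi i (Ne.symm hne)
      omega
  have e3 := H 3 (by norm_num) fun i hi => (hT.lt i hi).le
  have e6 := H 6 (by norm_num) fun i hi => (hT.lt i (hD₁.pred i hi).2.1).le
  have e7 := H 7 (by norm_num) fun i hi => (hT.lt i (hD₃.pred i hi).2.1).le
  have e9 := H 9 (by norm_num) hz
  refine ⟨d, δ₁, δ₃, cv, cv₁, onP, X, ?_⟩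
  rw [e3, e6, e7, e9]
  refine ⟨hT.congr hE (fun v hv => h₁ 4 (by norm_num) v (by omega))
    (fun v hv => h₁ 5 (by norm_num) v (by omega)), hD₁, ⟨fun I hI => ?_, hC.complete⟩, hD₃, hz, hP⟩
  rw [h₁ 8 (by norm_num) I (by have := hz I hI; omega)]
  exact hC.sound I hI

/-- If the query reports failure, `Avoids.bounds` rules out every walk. Otherwise the answer is a
list without repetitions of vertices below `n`; so its length fits into a word. -/
theorem Prepared.wp_query {W : ℕ} {s : State} (h : Prepared E n r P k s.wa) (hE : IsArcs E n)
    (hx : ∃ j < k, P j = s.wv 1) (hW : n < W) :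
    query.wp W (fun c s' => c ≤ 1000 * (s'.report.length + 1) ∧
      ((s'.report = [] ∧ ∀ W', ¬ Avoids E (s.wv 1) r (s.wv 0) W') ∨
        ∃ ℓ, Route E r s'.report (s.wv 0) ℓ ∧ s'.report.Nodup ∧ s.wv 1 ∉ s'.report ∧
          ∀ W', Avoids E (s.wv 1) r (s.wv 0) W' → ℓ ≤ 3 * W')) s := by
  obtain ⟨d, δ₁, δ₃, cv, cv₁, onP, X, hT, hD₁, hC, hD₃, -, hP⟩ := h
  obtain ⟨j, hj, hjx⟩ := hx
  have hxP := hP j hj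
  rw [hjx] at hxP
  by_cases hf : QueryFails (s.wa 3) (s.wa 7) (s.wa 9) (s.wa 3 (s.wv 1)) (s.wv 0)
  · refine Program.wp_mono (wp_query_of_fails hf (by omega)) ?_
    rintro c s' ⟨h₁, h₂⟩
    refine ⟨by omega, Or.inl ⟨h₁, fun W' hW' => ?_⟩⟩
    obtain ⟨b₁, b₂, -, -, -, b₃, b₄⟩ := hW'.bounds hT hE hD₁ hC hD₃ hxP.1 rfl hxP.2
    rcases hf with h | h | ⟨h, h'⟩ | ⟨h, h'⟩
    · exact b₂ h
    · exact b₁ h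
    · exact (b₄ h).2.1 h'
    · exact (b₃ h).1 h'
  · have hf' := hf
    simp only [QueryFails, not_or, not_and] at hf'
    obtain ⟨f₁, -, f₂, f₃⟩ := hf'
    obtain ⟨out, ℓ, a₁, a₂, a₃, a₄, a₅, a₆⟩ :=
      exists_answer hT hE hD₁ hC hD₃ hxP.1 rfl hxP.2 f₁ f₃ f₂
    have hlen : out.length ≤ n := by
      have := (a₃.subperm (l₂ := List.range n) fun q hq =>
        List.mem_range.2 (hT.lt q (a₅ q hq))).length_le
      rwa [List.length_range] at this
    refine Program.wp_mono (RealRAM.wp_query hf a₁ (by omega)) ?_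
    rintro c s' ⟨h₁, h₂⟩
    rw [h₁, List.length_reverse, List.nodup_reverse, List.mem_reverse]
    exact ⟨h₂, Or.inr ⟨ℓ, a₂.reverse hE.symm, a₃, a₄, a₆⟩⟩

end RealRAM

/-! ### From the weighted graph to arcs and back. -/

section

variable {n : ℕ} (G : SimpleGraph (Fin n)) (w : Sym2 (Fin n) → ℝ)

/-- The arcs of a weighted graph. -/
def GraphArc (u v : ℕ) (c : ℝ) : Prop :=
  ∃ a b : Fin n, (a : ℕ) = u ∧ (b : ℕ) = v ∧ G.Adj a b ∧ w s(a, b) = c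

variable {G w}

theorem isArcs_graphArc (hw : ∀ e ∈ G.edgeSet, 0 < w e) : IsArcs (GraphArc G w) n where
  symm := by
    rintro _ _ _ ⟨a, b, rfl, rfl, h, rfl⟩
    exact ⟨b, a, rfl, rfl, h.symm, by rw [Sym2.eq_swap]⟩
  pos := by
    rintro _ _ _ ⟨a, b, rfl, rfl, h, rfl⟩
    exact hw _ h
  lt := by
    rintro _ _ _ ⟨a, b, rfl, rfl, h, rfl⟩
    exact a.2

@[simp] theorem walkWeight_nil {V : Type*} {G : SimpleGraph V} (w : Sym2 V → ℝ) (u : V) :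
    walkWeight w (SimpleGraph.Walk.nil : G.Walk u u) = 0 := by simp [walkWeight]

@[simp] theorem walkWeight_cons {V : Type*} {G : SimpleGraph V} (w : Sym2 V → ℝ) {u v t : V}
    (h : G.Adj u v) (p : G.Walk v t) :
    walkWeight w (SimpleGraph.Walk.cons h p) = w s(u, v) + walkWeight w p := by simp [walkWeight]

theorem walkWeight_concat {V : Type*} {G : SimpleGraph V} (w : Sym2 V → ℝ) {u v t : V}
    (p : G.Walk u v) (h : G.Adj v t) :
    walkWeight w (p.concat h) = walkWeight w p + w s(v, t) := by
  simp [walkWeight, SimpleGraph.Walk.edges_concat]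

theorem Route.exists_walk {a b : ℕ} {l : List ℕ} {W : ℝ} (h : Route (GraphArc G w) a l b W) :
    ∀ u v : Fin n, (u : ℕ) = a → (v : ℕ) = b →
      ∃ p : G.Walk u v, p.support.map Fin.val = l ∧ walkWeight w p = W := by
  induction h with
  | single a =>
    rintro u v rfl hv
    obtain rfl := Fin.ext hv
    exact ⟨.nil, by simp, by simp⟩
  | cons h _ ih =>
    rintro u v rfl rfl
    obtain ⟨a, b, ha, rfl, hab, rfl⟩ := h
    obtain rfl := Fin.ext ha
    obtain ⟨p, h₁, h₂⟩ := ih b v rfl rfl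
    exact ⟨.cons hab p, by simp [h₁], by simp [h₂]⟩

theorem Avoids.append_walk {x r : ℕ} {u v : Fin n} (p : G.Walk u v) :
    ∀ {W : ℝ}, Avoids (GraphArc G w) x r u W → (∀ y ∈ p.support, (y : ℕ) ≠ x) →
      Avoids (GraphArc G w) x r v (W + walkWeight w p) := by
  induction p with
  | nil => exact fun h _ => by simpa using h
  | cons h p ih =>
    intro W hW hx
    rw [walkWeight_cons, ← add_assoc]
    exact ih (hW.step ⟨_, _, rfl, rfl, h, rfl⟩ (hx _ (by simp))) fun y hy => hx y (by simp [hy])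

theorem Avoids.of_walk {r v x : Fin n} (p : G.Walk r v) (hx : x ∉ p.support) :
    Avoids (GraphArc G w) x r v (walkWeight w p) := by
  have hne : ∀ y ∈ p.support, (y : ℕ) ≠ x := fun y hy h => hx (Fin.ext h ▸ hy)
  simpa using Avoids.append_walk p (.base (hne r (by simp))) hne

variable {M S c : ℕ} {src dst done pred ord : ℕ → ℕ} {wt d : ℕ → ℝ} {r : Fin n}

theorem ShortestPaths.le_walk (hS : ShortestPaths n M r src dst wt done pred ord c d)
    (hA : Arc M src dst wt = GraphArc G w) {u v : Fin n} (p : G.Walk u v) :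
    done u ≠ 0 → done v ≠ 0 ∧ d v ≤ d u + walkWeight w p := by
  induction p with
  | nil => exact fun h => ⟨h, by simp⟩
  | @cons u v _ h p ih =>
    intro hu
    obtain ⟨a, ha, h₁, h₂, h₃⟩ : Arc M src dst wt u v (w s(u, v)) := by
      rw [hA]
      exact ⟨u, v, rfl, rfl, h, rfl⟩
    have := hS.relaxed a ha (by rwa [h₁])
    rw [h₁, h₂, h₃] at this
    obtain ⟨i₁, i₂⟩ := ih this.1
    exact ⟨i₁, by rw [walkWeight_cons]; linarith⟩

/-- Follow the predecessors; positive weights make the distance drop, so induction on it applies. -/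
theorem ShortestPaths.exists_walk (hw : ∀ e ∈ G.edgeSet, 0 < w e)
    (hS : ShortestPaths n M r src dst wt done pred ord c d)
    (hA : Arc M src dst wt = GraphArc G w) {v : Fin n} (hv : done v ≠ 0) :
    ∃ p : G.Walk r v, walkWeight w p = d v := by
  suffices H : ∀ x < n, done x ≠ 0 → ∀ v : Fin n, (v : ℕ) = x →
      ∃ p : G.Walk r v, walkWeight w p = d v from H v v.2 hv v rfl
  refine induction_on_real d fun x _ ih hx v hvx => ?_
  subst hvx
  by_cases hvr : (v : ℕ) = r
  · obtain rfl := Fin.ext hvr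
    exact ⟨.nil, by rw [walkWeight_nil, hS.source.2]⟩
  obtain ⟨a, ha, -, h₂, h₃, h₄⟩ := hS.pred v hx hvr
  obtain ⟨u, v', hu, hv', hadj, hwt⟩ : GraphArc G w (src a) (dst a) (wt a) :=
    hA ▸ ⟨a, ha, rfl, rfl, rfl⟩
  obtain rfl : v' = v := Fin.ext (hv'.trans h₂)
  rw [← hu] at h₃ h₄
  have := hw s(u, v') hadj
  obtain ⟨p, hp⟩ := ih u u.2 (by linarith) h₃ u rfl
  exact ⟨p.concat hadj, by rw [walkWeight_concat, hp, h₄, hwt]⟩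

theorem wordArray_support {T : SimpleGraph (Fin n)} {u v : Fin n} (p : T.Walk u v) {i : ℕ}
    (hi : i ≤ p.length) : RealRAM.wordArray p.support i = p.getVert i := by
  have h : i < p.support.length := by rw [SimpleGraph.Walk.length_support]; omega
  rw [RealRAM.wordArray, List.getD_eq_getElem _ _ (by simpa using h), List.getElem_map,
    SimpleGraph.Walk.support_getElem_eq_getVert]

/-- Every prefix of `P` is a path of `T` from the root, so its length is the distance of its end.
Two successive prefixes differ by one edge. It holds for any outcome of Dijkstra's algorithm, since
the distances are only known after the run. -/
theorem ShortestPaths.tightPath {T : SimpleGraph (Fin n)} (hw : ∀ e ∈ G.edgeSet, 0 < w e)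
    (hT : IsShortestPathTree G w r T) {t : Fin n} {P : T.Walk r t} (hP : P.IsPath)
    (hS : ShortestPaths n M r src dst wt done pred ord c d)
    (hA : Arc M src dst wt = GraphArc G w) :
    TightPath (GraphArc G w) n r d (RealRAM.wordArray P.support) P.support.length := by
  have hdist : ∀ {v : Fin n} (p : T.Walk r v), p.IsPath → d v = walkWeight w p := by
    intro v p hp
    have h₁ := hS.le_walk hA (p.mapLe hT.le) hS.source.1
    have h₂ : walkWeight w (p.mapLe hT.le) = walkWeight w p := by simp [walkWeight]
    obtain ⟨q, hq⟩ := hS.exists_walk hw hA h₁.1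
    rw [hS.source.2, zero_add, h₂] at h₁
    exact le_antisymm h₁.2 (hq ▸ hT.shortest v p hp q)
  have hlen := P.length_support
  have hc := hP.length_lt
  rw [Fintype.card_fin] at hc
  refine ⟨?_, by omega, by omega, ?_, ?_, ?_⟩
  · rw [wordArray_support P (Nat.zero_le _), P.getVert_zero]
  · intro i hi j hj hij
    rw [wordArray_support P (by omega), wordArray_support P (by omega)] at hij
    exact hP.getVert_injOn (by simp; omega) (by simp; omega) (Fin.ext hij)
  · intro i hi
    rw [wordArray_support P (by omega)]
    exact Fin.is_lt _
  · intro i hi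
    have hi' : i < P.length := by omega
    rw [wordArray_support P (by omega), wordArray_support P (by omega)]
    refine ⟨_, ⟨_, _, rfl, rfl, hT.le (P.adj_getVert_succ hi'), rfl⟩, ?_⟩
    rw [hdist _ (hP.take i), hdist _ (hP.take (i + 1))]
    have he : i < P.edges.length := by simpa using hi'
    have : P.edges[i] = s(P.getVert i, P.getVert (i + 1)) := by
      simp [SimpleGraph.Walk.edges, SimpleGraph.Walk.darts_getElem_eq_getVert]
    simp only [walkWeight, SimpleGraph.Walk.edges_take, List.map_take]
    rw [List.sum_take_succ _ _ (by simpa using hi')]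
    simp [this]

variable {L : List (Fin n × Fin n)}

theorem edgeArc_inputState (hL : IsEdgeList G L) (r : Fin n) (P : List (Fin n)) :
    (RealRAM.inputState w L r P).edgeArc = GraphArc G w := by
  have h1 : ∀ e, ∀ h : e < L.length, (RealRAM.inputState w L r P).wa 0 e = (L[e].1 : ℕ) ∧
      (RealRAM.inputState w L r P).wa 1 e = (L[e].2 : ℕ) ∧
      (RealRAM.inputState w L r P).ra 0 e = w s(L[e].1, L[e].2) := by
    intro e h
    simp [RealRAM.inputState, RealRAM.wordArray, h]
  have hm : (RealRAM.inputState w L r P).wv 1 = L.length := rfl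
  ext u v c
  constructor
  · rintro ⟨e, he, h₁, rfl⟩
    rw [hm] at he
    obtain ⟨e₁, e₂, e₃⟩ := h1 e he
    rw [e₁, e₂] at h₁
    have hadj : G.Adj L[e].1 L[e].2 :=
      (hL.2 _).1 (List.mem_map.2 ⟨L[e], List.getElem_mem he, rfl⟩)
    rcases h₁ with ⟨h₁, h₂⟩ | ⟨h₁, h₂⟩
    · exact ⟨_, _, h₁, h₂, hadj, e₃.symm⟩
    · exact ⟨_, _, h₂, h₁, hadj.symm, by rw [e₃, Sym2.eq_swap]⟩
  · rintro ⟨a, b, rfl, rfl, hadj, rfl⟩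
    obtain ⟨e, he, heq⟩ := List.mem_map.1 ((hL.2 s(a, b)).2 hadj)
    obtain ⟨i, hi, rfl⟩ := List.mem_iff_getElem.1 he
    obtain ⟨e₁, e₂, e₃⟩ := h1 i hi
    refine ⟨i, hi, ?_, by rw [e₃, heq]⟩
    rw [e₁, e₂]
    rcases Sym2.eq_iff.1 heq with ⟨h₁, h₂⟩ | ⟨h₁, h₂⟩
    · exact Or.inl ⟨by rw [h₁], by rw [h₂]⟩
    · exact Or.inr ⟨by rw [h₁], by rw [h₂]⟩

theorem IsEdgeList.length_eq (hL : IsEdgeList G L) : L.length = G.edgeSet.ncard := by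
  classical
  have : G.edgeSet = ((L.map fun e => s(e.1, e.2)).toFinset : Set (Sym2 (Fin n))) := by
    ext e
    simp only [List.coe_toFinset, Set.mem_ofPred_eq]
    exact (hL.2 e).symm
  rw [this, Set.ncard_coe_finset, List.toFinset_card_of_nodup hL.1, List.length_map]

theorem IsEdgeList.length_le (hL : IsEdgeList G L) : L.length ≤ n * n := by
  have := (List.Nodup.of_map _ hL.1).length_le_card
  simpa using this

theorem inputOk_inputState {T : SimpleGraph (Fin n)} (hw : ∀ e ∈ G.edgeSet, 0 < w e)
    (hT : IsShortestPathTree G w r T) {t : Fin n} {P : T.Walk r t} (hP : P.IsPath)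
    (hL : IsEdgeList G L) : RealRAM.InputOk (GraphArc G w) n L.length r
      (RealRAM.inputState w L r P.support) where
  n_eq := rfl
  m_eq := rfl
  r_eq := rfl
  lt := r.2
  wv x hx := by
    simpa [RealRAM.inputState] using
      congrArg (·.getD 0) (List.getElem?_eq_none (l := [n, L.length, (r : ℕ), P.support.length]) hx)
  wa a ha i := by
    match a, ha with
    | a + 3, _ => rfl
  arc := edgeArc_inputState hL r _
  arcs := isArcs_graphArc hw
  path _ _ _ _ _ _ _ _ _ hA hS := hS.tightPath hw hT hP hA

end

/-! ### Word bounds, constants and the main theorem. -/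

namespace RealRAM

theorem wordArray_le {n : ℕ} (l : List (Fin n)) (j : ℕ) : wordArray l j ≤ n := by
  rw [wordArray, List.getD_eq_getElem?_getD, List.getElem?_map]
  cases l[j]? with
  | none => simp
  | some a => simp

theorem bounded_inputState {n W : ℕ} {w : Sym2 (Fin n) → ℝ} {L : List (Fin n × Fin n)} {r : Fin n}
    {P : List (Fin n)} (hn : n ≤ W) (hL : L.length ≤ W) (hP : P.length ≤ W) :
    Bounded W (inputState w L r P) := by
  refine ⟨fun x => ?_, fun a i => ?_⟩
  · match x with
    | 0 => exact hn
    | 1 => exact hL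
    | 2 => exact r.2.le.trans hn
    | 3 => exact hP
    | x + 4 => simp [inputState]
  · match a with
    | 0 => exact (wordArray_le _ _).trans hn
    | 1 => exact (wordArray_le _ _).trans hn
    | 2 => exact (wordArray_le _ _).trans hn
    | a + 3 => exact Nat.zero_le _

theorem bounded_queryState {A S W v x : ℕ} {s : State} (h : Bounded W s) (hv : v ≤ W)
    (hx : x ≤ W) : Bounded W (queryState (s.dataStructure A S) v x) := by
  refine ⟨fun y => ?_, fun a i => ?_⟩
  · match y with
    | 0 => exact hv
    | 1 => exact hx
    | y + 2 => simp [queryState]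
  · simp only [queryState]
    split_ifs
    · exact h.wa _ _
    · exact Nat.zero_le _

theorem isCorrectReport_of_route {n : ℕ} {G : SimpleGraph (Fin n)} {w : Sym2 (Fin n) → ℝ}
    {r v x : Fin n} {out : List ℕ} {ℓ : ℝ} (h : Route (GraphArc G w) r out v ℓ) (hnd : out.Nodup)
    (hx : (x : ℕ) ∉ out) (hmin : ∀ W, Avoids (GraphArc G w) x r v W → ℓ ≤ 3 * W) :
    IsCorrectReport 3 G w r v x out := by
  obtain ⟨p, rfl, rfl⟩ := h.exists_walk r v rfl rfl
  exact Or.inl ⟨p, ⟨.mk' (List.Nodup.of_map _ hnd), fun hp => hx (List.mem_map_of_mem hp),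
    fun q hq => hmin _ (.of_walk q hq)⟩, rfl⟩

/-- Bounds on the words and the number of steps of the preprocessing. -/
theorem preprocess_bounds {n m : ℕ} (hn : 1 ≤ n) (hm : m ≤ n * n) :
    (∀ r, 2 ^ (r / 2) ≤ 2 * m + 1 → r < 4 * Nat.log 2 (n + 1) + 6) ∧
      Nat.log 2 n ≤ 4 * Nat.log 2 (n + 1) + 6 ∧
      4 * Nat.log 2 (n + 1) + 6 ≤ (n + 2) ^ 4 ∧ 2 * m + 1 < (n + 2) ^ 4 ∧ n + 2 ≤ (n + 2) ^ 4 ∧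
      n * (n + 1) ≤ (n + 2) ^ 4 ∧
      20000 * (m + (4 * Nat.log 2 (n + 1) + 6 + 1) * (n + 2)) ≤
        660000 * (m + n * Nat.log 2 (n + 1)) := by
  obtain ⟨l, hl⟩ : ∃ l, Nat.log 2 (n + 1) = l := ⟨_, rfl⟩
  have h₁ : n + 1 < 2 ^ (l + 1) := hl ▸ Nat.lt_pow_succ_log_self one_lt_two _
  have h₂ : l < n + 1 := hl ▸ Nat.log_lt_self 2 (by omega)
  have h₃ : 1 ≤ l := hl ▸ Nat.log_pos one_lt_two (by omega)
  have h₄ : 4 * (n * n + 4 * n + 4) ≤ (n + 2) ^ 4 := by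
    have : (n + 2) ^ 4 = (n * n + 4 * n + 4) * (n * n + 4 * n + 4) := by ring
    rw [this]
    exact Nat.mul_le_mul_right _ (by omega)
  rw [hl]
  refine ⟨fun r hr => ?_, ?_, by omega, by omega, by omega, ?_, ?_⟩
  -- As `n + 1 < 2 ^ (l + 1)`, the number `2 * m + 1` of nodes is at most `2 * n * n + 1 < 2 ^ (2 *
  -- l + 3)`, hence `r / 2 < 2 * l + 3`.
  · have h₅ : 2 ^ (r / 2) < 2 ^ (2 * l + 3) := by
      have h₆ : 2 ^ (2 * l + 3) = 2 * (2 ^ (l + 1) * 2 ^ (l + 1)) := by ring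
      have h₇ : (n + 1) * (n + 1) ≤ 2 ^ (l + 1) * 2 ^ (l + 1) := Nat.mul_le_mul h₁.le h₁.le
      have h₈ : (n + 1) * (n + 1) = n * n + 2 * n + 1 := by ring
      omega
    have := (Nat.pow_lt_pow_iff_right one_lt_two).1 h₅
    omega
  · have : Nat.log 2 n ≤ l := hl ▸ Nat.log_mono_right (Nat.le_succ n)
    omega
  · rw [mul_add]
    omega
  -- Both `n` and `l` are at least 1, so the additive constants are absorbed, and `660000 = 20000 *
  -- 33`.
  · have h₅ : (4 * l + 6 + 1) * (n + 2) ≤ (11 * l) * (3 * n) := Nat.mul_le_mul (by omega) (by omega)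
    have h₆ : 11 * l * (3 * n) = 33 * (n * l) := by ring
    omega

end RealRAM

open RealRAM in
theorem mainTheorem1 :
    ∃ (preprocess query : RealRAM.Program) (A B C K : ℕ),
      ∀ (n : ℕ) (G : SimpleGraph (Fin n)) (w : Sym2 (Fin n) → ℝ),
        (∀ e ∈ G.edgeSet, 0 < w e) →
      ∀ (r : Fin n) (T : SimpleGraph (Fin n)), IsShortestPathTree G w r T →
      ∀ (t : Fin n) (P : T.Walk r t), P.IsPath →
      ∀ L : List (Fin n × Fin n), IsEdgeList G L →
        ∃ (k : ℕ) (s : RealRAM.State),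
          RealRAM.Exec ((n + 2) ^ K) preprocess (RealRAM.inputState w L r P.support) k s ∧
          k ≤ C * (G.edgeSet.ncard + n * Nat.log 2 (n + 1)) ∧
          ∀ x ∈ P.support, ∀ v : Fin n,
            ∃ (k' : ℕ) (s' : RealRAM.State),
              RealRAM.Exec ((n + 2) ^ K) query
                (RealRAM.queryState (s.dataStructure A (B * n)) v x) k' s' ∧
              k' ≤ C * (s'.report.length + 1) ∧
              RealRAM.IsCorrectReport 3 G w r v x s'.report := by
  -- The query reads only the arrays 3 to 9, which are among the first 10, and needs indices up to
  -- `n`, covered by `2 * n` cells. The words are bounded by the fourth power of `n + 2`, and 660000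
  -- also exceeds the factor 1000 of the query.
  refine ⟨RealRAM.preprocess, RealRAM.query, 10, 2, 660000, 4, ?_⟩
  intro n G w hw r T hT t P hP L hL
  have hn : 1 ≤ n := Nat.one_le_of_lt r.2
  obtain ⟨b₁, b₂, b₃, b₄, b₅, b₆, b₇⟩ := preprocess_bounds hn hL.length_le
  have hE := isArcs_graphArc hw
  have hlen : P.support.length ≤ n := by
    have := hP.length_lt
    rw [Fintype.card_fin] at this
    rw [SimpleGraph.Walk.length_support]
    exact this
  have hB₀ : Bounded ((n + 2) ^ 4) (inputState w L r P.support) :=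
    bounded_inputState (by omega) (by omega) (by omega)
  obtain ⟨k, s, hexec, hk, hs⟩ := Program.exists_exec_of_wp
    (wp_preprocess (inputOk_inputState hw hT hP hL) b₁ b₂ b₃ b₄ b₅ b₆) hB₀
  refine ⟨k, s, hexec, hL.length_eq ▸ hk.trans b₇, fun x hx v => ?_⟩
  have hq : Prepared (GraphArc G w) n r (wordArray P.support) P.support.length
      (queryState (s.dataStructure 10 (2 * n)) v x).wa := by
    refine Prepared.truncate hs hE hn (fun a ha i hi => ?_) fun a i hi => ?_
    · simp only [queryState]
      exact dif_pos ⟨ha, hi⟩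
    · simp only [queryState]
      exact dif_neg fun h => by omega
  have hxP : ∃ j < P.support.length, wordArray P.support j = x := by
    obtain ⟨j, hj, rfl⟩ := List.mem_iff_getElem.1 hx
    exact ⟨j, hj, by
      rw [wordArray, List.getD_eq_getElem _ _ (by simpa using hj), List.getElem_map]⟩
  obtain ⟨k', s', hexec', hk', hs'⟩ := Program.exists_exec_of_wp
    (hq.wp_query hE hxP (by omega : n < (n + 2) ^ 4))
    (bounded_queryState (hexec.bounded hB₀) (by omega) (by omega))
  refine ⟨k', s', hexec', by omega, ?_⟩
  rcases hs' with ⟨h₁, h₂⟩ | ⟨ℓ, h₁, h₂, h₃, h₄⟩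
  · rw [h₁]
    refine Or.inr ⟨fun q => ?_, rfl⟩
    by_contra hxq
    exact h₂ _ (.of_walk q hxq)
  · exact isCorrectReport_of_route h₁ h₂ h₃ h₄
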